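/- Let $\mathbb F$ be $\mathbb R$ or $\mathbb C$. For integers $r\ge 1$ and $n_1,n_2>r$ put $V=\mathbb F^{n_1\times n_2}$, $X_r=\{M\in V:\operatorname{rank}M\le r\}$, $d=r+1$, let $f_1,\dots,f_p$ with $p=\binom{n_1}{r+1}\binom{n_2}{r+1}$ be the $(r+1)\times(r+1)$ minors, and $$B(n_1,n_2,r)=\frac{\binom{n_1}{r+1}\binom{n_2}{r+1}}{(r+1)!\,\binom{n_1n_2+r}{r+1}}\,(n_1n_2+r).$$ **Algorithm 1** takes a basis $u_1,\dots,u_R$ of a subspace $U\subseteq V$ and the polynomials $f_1,\dots,f_p\in S^d(V^*)$. With $I_d=\operatorname{span}\{f_j\}$, it computes a basis $P_1,\dots,P_m$ of $S^d(U)\cap I_d^{\perp}\subseteq S^d(V)$. If $m=0$ it outputs "$U$ trivially intersects $X_r$". If $m>R$ it outputs "Fail". Otherwise it runs simultaneous diagonalization on $T=\sum_i e_i\otimes P_i\in\mathbb F^m\otimes V\otimes V^{\otimes(d-1)}$. That subroutine first draws random functionals $f,g$ on $\mathbb F^m$, with independent standard Gaussian coordinates. It then finds the non-zero eigenvalues $\lambda_a$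 of $T(f)T(g)^+$ with eigenvectors $v_a$ ($T(\cdot)$ being the contraction in the first mode and ${}^+$ the Moore–Penrose inverse), and fails unless these eigenvalues are distinct and $\operatorname{rank}(T(f)T(g)^+)$ in number. Next it finds eigenvectors $w_a$ of $(T(f)^+T(g))^{\mathsf T}$ for the eigenvalues $\lambda_a^{-1}$, and fails unless these are its only non-zero eigenvalues, as many as its rank. Finally it sets $u_a=T(h_a)$ for functionals $h_a$ dual to the $v_b\otimes w_b$, fails if some $u_a\in\operatorname{span}\{u_b\}$ with $a\ne b$, and otherwise returns the terms $u_a\otimes v_a\otimes w_a$. If these are a decomposition of $T$ of the form $\{z_i\otimes x_i^{\otimes d}\}_{i=1}^m$ with $z_1,\dots,z_m$ linearly independent and $x_1,\dots,x_m$ linearly independent, Algorithm 1 outputs "the only elements of $U\cap X_r$ are $x_1,\dots,x_m$ (up to scale)"; in all other cases it outputs "Fail". The following hold. 1. *Running time.* For each $\mathbb F$ there are absolute constants $C,c$ and one program for a random access machine over $\mathbb F$ (unit-cost field operations including conjugation, tests for zero, a random tape, index arithmetic charged by the size of the numbers, and an oracle that diagonalizes diagonalizable matrices) that carries out Algorithm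 1 for all $r\ge1$, all $n_1,n_2>r$ and every basis $u_1,\dots,u_R$ of every subspace of $V$ (the basis $P$ not depending on the random tape), in at most $(n_1n_2)^{Cr}$ steps, with at most $c$ oracle calls. So the time is $(n_1n_2)^{O(r)}$, which is $(n_1n_2)^{O(1)}$ for fixed $r$. 2. *Certification.* On every basis of every subspace $U$, an output of Algorithm 1 other than "Fail" is correct: if it outputs "$U$ trivially intersects $X_r$", then $U\cap X_r=\{0\}$ ($U$ is $r$-entangled); if it outputs $x_1,\dots,x_m$, then $U\cap X_r=\bigcup_i\mathbb F x_i$. 3. *Generic subspaces.* Let $r\ge 1$, $n_1,n_2>r$, and let $0\le s\le R$ be integers with $R\le B(n_1,n_2,r)$. There is a Zariski open dense subset $G$ of $X_r^{\times s}\times V^{\times(R-s)}$ such that for every $(v_1,\dots,v_R)\in G$, with $U=\operatorname{span}\{v_1,\dots,v_R\}$: the $v_i$ are linearly independent, so $\dim U=R$; $U\cap X_r=\{0\}\cup\bigcup_{i\le s}\mathbb F v_i$; and for every basis of $U$ (and every basis $P$ computed in the first step) Algorithm 1, with probability one over its random functionals, outputs "$U$ trivially intersects $X_r$" if $s=0$,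 and outputs precisely $v_1,\dots,v_s$, up to order and non-zero scalar multiples, if $s>0$. 4. For every fixed $r\ge 1$, $B(n_1,n_2,r)=\Omega_r(n_1n_2)$: there is $\kappa_r>0$ with $B(n_1,n_2,r)\ge\kappa_r\,n_1n_2$ for all $n_1,n_2>r$. -/

import Mathlib

open scoped Nat Matrix
open MeasureTheory ProbabilityTheory

/-! ## Zariski topology on affine space, genericity -/

/-- Algebraic subsets of the affine space `F^σ`. -/
def IsZariskiClosed {F σ : Type*} [Field F] (Z : Set (σ → F)) : Prop :=
  ∃ I : Ideal (MvPolynomial σ F), Z = MvPolynomial.zeroLocus F I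

/-- `A` is an open dense subset of `Y`, in the topology that `Y` inherits from the Zariski
topology of `F^σ`. -/
def IsZariskiOpenDenseIn {F σ : Type*} [Field F] (A Y : Set (σ → F)) : Prop :=
  (∃ Z : Set (σ → F), IsZariskiClosed Z ∧ A = Y \ Z) ∧
    ∀ Z : Set (σ → F), IsZariskiClosed Z → A ⊆ Z → Y ⊆ Z

/-! ## Matrices of bounded rank

An `n₁ × n₂` matrix is treated as a vector whose coordinates are indexed by pairs. -/

/-- The determinantal variety of all `n₁ × n₂` matrices of rank at most `r`. -/
def rankVariety (F : Type*) [Field F] (n₁ n₂ r : ℕ) : Set (Fin n₁ × Fin n₂ → F) :=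
  {w | (Matrix.of fun i j => w (i, j)).rank ≤ r}

/-- All `R`-tuples of `n₁ × n₂` matrices whose first `s` members have rank at most `r`. -/
def plantedVariety (F : Type*) [Field F] (n₁ n₂ r R s : ℕ) :
    Set (Fin R × (Fin n₁ × Fin n₂) → F) :=
  {x | ∀ i : Fin R, (i : ℕ) < s → (fun q => x (i, q)) ∈ rankVariety F n₁ n₂ r}

/-- The `(r+1) × (r+1)` minors of the generic `n₁ × n₂` matrix, listed in the order given by an
enumeration `e` of the pairs (choice of rows, choice of columns). -/
noncomputable def minors (F : Type*) [Field F] {n₁ n₂ r p : ℕ}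
    (e : Fin p ≃ (Fin (r + 1) ↪o Fin n₁) × (Fin (r + 1) ↪o Fin n₂)) (j : Fin p) :
    MvPolynomial (Fin n₁ × Fin n₂) F :=
  Matrix.det (Matrix.of fun a b => MvPolynomial.X ((e j).1 a, (e j).2 b))

/-- The upper bound on the dimension of the subspace. -/
noncomputable def dimBound (n₁ n₂ r : ℕ) : ℝ :=
  ((n₁.choose (r + 1) : ℝ) * (n₂.choose (r + 1) : ℝ)) /
    (((r + 1)! : ℝ) * ((n₁ * n₂ + r).choose (r + 1) : ℝ)) * ((n₁ : ℝ) * (n₂ : ℝ) + (r : ℝ))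

/-! ## Symmetric tensors -/

/-- Tensors of order `d` over `F^ι`, in coordinates. -/
abbrev Tensor (d : ℕ) (ι F : Type*) := (Fin d → ι) → F

/-- The `d`-th tensor power of the vector `v`. -/
def tensorPower {ι F : Type*} [Field F] (d : ℕ) (v : ι → F) : Tensor d ι F :=
  fun a => ∏ t, v (a t)

/-- Tensors that are invariant under permutation of the factors. -/
def symTensors (d : ℕ) (ι F : Type*) [Field F] : Submodule F (Tensor d ι F) where
  carrier := {T | ∀ (π : Equiv.Perm (Fin d)) (a : Fin d → ι), T (a ∘ π) = T a}
  add_mem' := by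
    intro S T hS hT π a
    simp [hS π a, hT π a]
  zero_mem' := by
    intro π a
    simp
  smul_mem' := by
    intro c T hT π a
    simp [hT π a]

/-- The symmetric power of the subspace `U`: the symmetric tensors in the `d`-th tensor power
of `U`. -/
def symPower {ι F : Type*} [Field F] (d : ℕ) (U : Submodule F (ι → F)) :
    Submodule F (Tensor d ι F) :=
  Submodule.span F {T | ∃ w : Fin d → ι → F, (∀ t, w t ∈ U) ∧ T = fun a => ∏ t, w t (a t)} ⊓
    symTensors d ι F

/-- The exponent vector of the monomial `x_{a 0} x_{a 1} ⋯ x_{a (d-1)}`. -/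
noncomputable def content {ι : Type*} {d : ℕ} (a : Fin d → ι) : ι →₀ ℕ :=
  ∑ t, Finsupp.single (a t) 1

/-- The symmetric tensor of a homogeneous polynomial `f` of degree `d`, so that
`f v = ∑ a, polarization d f a * tensorPower d v a`. -/
noncomputable def polarization {ι F : Type*} [Fintype ι] [Field F] (d : ℕ)
    (f : MvPolynomial ι F) : Tensor d ι F :=
  fun a => MvPolynomial.coeff (content a) f * ((∏ i, ((content a i)! : F)) / (d ! : F))

/-- The tensors of order `d` that are orthogonal to all the polynomials `f j`, homogeneous of
degree `d`. -/
def annihilator {ι F : Type*} [Fintype ι] [Field F] {p : ℕ} (d : ℕ)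
    (f : Fin p → MvPolynomial ι F) : Submodule F (Tensor d ι F) where
  carrier := {T | ∀ j, ∑ a, polarization d (f j) a * T a = 0}
  add_mem' := by
    intro S T hS hT j
    simp [mul_add, Finset.sum_add_distrib, hS j, hT j]
  zero_mem' := by
    intro j
    simp
  smul_mem' := by
    intro c T hT j
    have h : ∑ a, polarization d (f j) a * (c • T) a
        = c * ∑ a, polarization d (f j) a * T a := by
      rw [Finset.mul_sum]
      refine Finset.sum_congr rfl fun a _ => ?_
      simp only [Pi.smul_apply, smul_eq_mul]
      ring
    rw [h, hT j, mul_zero]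

/-! ## The simultaneous diagonalization algorithm -/

/-- `B` is the Moore-Penrose pseudoinverse of `A`. -/
def IsMoorePenrose {β γ F : Type*} [Fintype β] [Fintype γ] [RCLike F]
    (A : Matrix β γ F) (B : Matrix γ β F) : Prop :=
  A * B * A = A ∧ B * A * B = B ∧ (A * B).IsHermitian ∧ (B * A).IsHermitian

/-- The contraction `T(f)` of a three-mode tensor with a functional on its first mode. -/
def contract {α β γ F : Type*} [Fintype α] [Field F] (T : α → β → γ → F) (f : α → F) :
    Matrix β γ F :=
  Matrix.of fun y z => ∑ x, f x * T x y z

/-- `T(f) T(g)⁺` has as many distinct non-zero eigenvalues as its rank `L`; they are `lam a`,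
with eigenvectors `v a`. -/
def FirstEigen {α β γ F : Type*} [Fintype α] [Fintype β] [Fintype γ] [RCLike F]
    (T : α → β → γ → F) (f g : α → F) (L : ℕ) (lam : Fin L → F) (v : Fin L → β → F) : Prop :=
  ∃ B : Matrix γ β F, IsMoorePenrose (contract T g) B ∧
    (contract T f * B).rank = L ∧ Function.Injective lam ∧
    ∀ a, lam a ≠ 0 ∧ v a ≠ 0 ∧ (contract T f * B) *ᵥ v a = lam a • v a

/-- The non-zero eigenvalues of `T(f)⁺ T(g)` are the inverses of the `lam a`, each of them simple.
This map acts on the dual of the third mode, so its eigenvectors in the third mode itself are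
those of its transpose; they are the `w a`. -/
def SecondEigen {α β γ F : Type*} [Fintype α] [Fintype β] [Fintype γ] [RCLike F]
    (T : α → β → γ → F) (f g : α → F) (L : ℕ) (lam : Fin L → F) (w : Fin L → γ → F) : Prop :=
  ∃ B : Matrix γ β F, IsMoorePenrose (contract T f) B ∧
    (B * contract T g).rank = L ∧
    ∀ a, w a ≠ 0 ∧ (B * contract T g)ᵀ *ᵥ w a = (lam a)⁻¹ • w a

/-- The vectors `u a = T(h a)`, for functionals `h a` dual to the `v b ⊗ w b`. -/
def DualContraction {α β γ F : Type*} [Fintype β] [Fintype γ] [Field F]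
    (T : α → β → γ → F) (L : ℕ) (u : Fin L → α → F) (v : Fin L → β → F) (w : Fin L → γ → F) :
    Prop :=
  ∃ h : Fin L → β → γ → F,
    (∀ a b, ∑ y, ∑ z, h a y z * (v b y * w b z) = if a = b then 1 else 0) ∧
    ∀ a x, u a x = ∑ y, ∑ z, h a y z * T x y z

/-- Outputs of the simultaneous diagonalization algorithm: the terms of a rank decomposition, or
"Fail". -/
inductive SimDiagOutput (α β γ F : Type*) where
  | fail : SimDiagOutput α β γ F
  | decomposition (L : ℕ) (u : Fin L → α → F) (v : Fin L → β → F) (w : Fin L → γ → F) :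
      SimDiagOutput α β γ F

/-- The outputs that the simultaneous diagonalization algorithm may give on the tensor `T` when
it has drawn the functionals `f` and `g`. (The order and the scaling of the eigenvectors, and the
dual functionals, are left open by the algorithm.) -/
inductive SimDiag {α β γ F : Type*} [Fintype α] [Fintype β] [Fintype γ] [RCLike F]
    (T : α → β → γ → F) (f g : α → F) : SimDiagOutput α β γ F → Prop where
  | repeated (h : ¬ ∃ L lam v, FirstEigen T f g L lam v) : SimDiag T f g .fail
  | mismatch (L : ℕ) (lam : Fin L → F) (v : Fin L → β → F) (hv : FirstEigen T f g L lam v)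
      (h : ¬ ∃ w, SecondEigen T f g L lam w) : SimDiag T f g .fail
  | parallel (L : ℕ) (lam : Fin L → F) (u : Fin L → α → F) (v : Fin L → β → F)
      (w : Fin L → γ → F) (hv : FirstEigen T f g L lam v) (hw : SecondEigen T f g L lam w)
      (hu : DualContraction T L u v w)
      (h : ∃ a b, a ≠ b ∧ u a ∈ Submodule.span F {u b}) : SimDiag T f g .fail
  | success (L : ℕ) (lam : Fin L → F) (u : Fin L → α → F) (v : Fin L → β → F)
      (w : Fin L → γ → F) (hv : FirstEigen T f g L lam v) (hw : SecondEigen T f g L lam w)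
      (hu : DualContraction T L u v w)
      (h : ∀ a b, a ≠ b → u a ∉ Submodule.span F {u b}) :
      SimDiag T f g (.decomposition L u v w)

/-! ## Algorithm 1 -/

/-- Outputs of Algorithm 1: "`U` trivially intersects `X`", "the only elements of the intersection
are the listed ones (up to scale)", or "Fail". -/
inductive Output (ι F : Type*) where
  | trivial : Output ι F
  | only (xs : List (ι → F)) : Output ι F
  | fail : Output ι F

/-- `P` is a basis of the space of those tensors in the `d`-th symmetric power of the span of `u`
that are orthogonal to the polynomials `f j`. -/
def IsIntersectionBasis {ι F : Type*} [Fintype ι] [Field F] {p R m : ℕ} (d : ℕ)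
    (f : Fin p → MvPolynomial ι F) (u : Fin R → ι → F) (P : Fin m → Tensor d ι F) : Prop :=
  LinearIndependent F P ∧
    Submodule.span F (Set.range P) =
      symPower d (Submodule.span F (Set.range u)) ⊓ annihilator d f

/-- The tensor `∑ i, e_i ⊗ P_i` with modes `F^m`, `V` and the tensors of order `k` over `V`. -/
def stack {ι F : Type*} {k m : ℕ} (P : Fin m → Tensor (k + 1) ι F) :
    Fin m → ι → (Fin k → ι) → F :=
  fun i y q => P i (Fin.cons y q)

/-- The terms `a t ⊗ b t ⊗ c t` form a decomposition of `∑ i, e_i ⊗ P_i` into `m` terms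
`z t ⊗ (x t)^{⊗(k+1)}` with both `z` and `x` linearly independent. -/
def IsPowerDecomposition {ι F : Type*} [Field F] {k m : ℕ} (P : Fin m → Tensor (k + 1) ι F)
    (L : ℕ) (a : Fin L → Fin m → F) (b : Fin L → ι → F) (c : Fin L → (Fin k → ι) → F)
    (z : Fin L → Fin m → F) (x : Fin L → ι → F) : Prop :=
  L = m ∧ LinearIndependent F z ∧ LinearIndependent F x ∧
    (∀ t i y q, a t i * b t y * c t q = z t i * tensorPower (k + 1) (x t) (Fin.cons y q)) ∧
    ∀ i q, P i q = ∑ t, z t i * tensorPower (k + 1) (x t) q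

/-- The outputs that Algorithm 1 may give once the basis `P` is computed, for random functionals
whose coordinates are the first `m` entries of `θ` and of `η`. -/
inductive Algorithm1Run {ι F : Type*} [Fintype ι] [RCLike F] {k R m : ℕ}
    (P : Fin m → Tensor (k + 1) ι F) (θ η : Fin R → F) : Output ι F → Prop where
  | trivial (h : m = 0) : Algorithm1Run P θ η .trivial
  | tooMany (h : R < m) : Algorithm1Run P θ η .fail
  | noDecomposition (hm : 0 < m) (hR : m ≤ R)
      (h : SimDiag (stack P) (θ ∘ Fin.castLE hR) (η ∘ Fin.castLE hR) .fail) :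
      Algorithm1Run P θ η .fail
  | notPowers (hm : 0 < m) (hR : m ≤ R) (L : ℕ) (a : Fin L → Fin m → F) (b : Fin L → ι → F)
      (c : Fin L → (Fin k → ι) → F)
      (h : SimDiag (stack P) (θ ∘ Fin.castLE hR) (η ∘ Fin.castLE hR) (.decomposition L a b c))
      (hzx : ¬ ∃ z x, IsPowerDecomposition P L a b c z x) : Algorithm1Run P θ η .fail
  | found (hm : 0 < m) (hR : m ≤ R) (L : ℕ) (a : Fin L → Fin m → F) (b : Fin L → ι → F)
      (c : Fin L → (Fin k → ι) → F)
      (h : SimDiag (stack P) (θ ∘ Fin.castLE hR) (η ∘ Fin.castLE hR) (.decomposition L a b c))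
      (z : Fin L → Fin m → F) (x : Fin L → ι → F)
      (hzx : IsPowerDecomposition P L a b c z x) : Algorithm1Run P θ η (.only (List.ofFn x))

/-- Algorithm 1, on homogeneous polynomials `f j` of degree `k + 1` and a basis `u`, may compute
the basis `P` of the intersection in its first step and end with the output `out`, when the random
functionals of its second step are given by `θ` and `η`. -/
def Algorithm1 {ι F : Type*} [Fintype ι] [RCLike F] {k p R m : ℕ}
    (f : Fin p → MvPolynomial ι F) (u : Fin R → ι → F) (P : Fin m → Tensor (k + 1) ι F)
    (θ η : Fin R → F) (out : Output ι F) : Prop :=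
  IsIntersectionBasis (k + 1) f u P ∧ Algorithm1Run P θ η out

/-! ## Random functionals -/

/-- `R` independent standard Gaussian pairs (real part, imaginary part). -/
noncomputable def gaussianTape (R : ℕ) : Measure (Fin R → ℝ × ℝ) :=
  Measure.pi fun _ => (gaussianReal 0 1).prod (gaussianReal 0 1)

/-- The scalars with the given real and imaginary parts (over the reals, `RCLike.I = 0` and the
second entries have no effect). -/
noncomputable def toScalars (F : Type*) [RCLike F] {R : ℕ} (ξ : Fin R → ℝ × ℝ) : Fin R → F :=
  fun i => ((ξ i).1 : F) + ((ξ i).2 : F) * RCLike.I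

/-! ## A uniform random access machine over the field `F`, with a diagonalization oracle

A store has natural-number registers, used for indices, and named two-dimensional arrays of field
elements. Programs are finite, contain no field constants besides `0` and `1`, and do not depend on
the size of the input. -/

/-- An oracle that diagonalizes diagonalizable matrices; its answer on any other matrix is
arbitrary. -/
structure DiagOracle (F : Type*) [Field F] where
  vecs : ∀ k : ℕ, Matrix (Fin k) (Fin k) F → Matrix (Fin k) (Fin k) F
  vals : ∀ k : ℕ, Matrix (Fin k) (Fin k) F → Fin k → F
  spec : ∀ (k : ℕ) (A : Matrix (Fin k) (Fin k) F),
    (∃ (Q : Matrix (Fin k) (Fin k) F) (D : Fin k → F),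
      IsUnit Q.det ∧ A * Q = Q * Matrix.diagonal D) →
    IsUnit (vecs k A).det ∧ A * vecs k A = vecs k A * Matrix.diagonal (vals k A)

/-- Memory of the machine, with the number of steps and of oracle calls made so far. -/
structure Store (F : Type*) where
  reg : ℕ → ℕ
  cell : ℕ → ℕ → ℕ → F
  steps : ℕ
  calls : ℕ

/-- Index expressions. -/
inductive NExp where
  | lit (c : ℕ)
  | reg (i : ℕ)
  | add (a b : NExp)
  | sub (a b : NExp)
  | mul (a b : NExp)
  | div (a b : NExp)
  | mod (a b : NExp)

/-- Expressions with values in the field; `cell a i j` is the entry `(i, j)` of the array `a`. -/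
inductive FExp where
  | zero
  | one
  | cell (a : ℕ) (i j : NExp)
  | add (x y : FExp)
  | sub (x y : FExp)
  | mul (x y : FExp)
  | inv (x : FExp)
  | conj (x : FExp)

/-- Programs. `loop i e body` runs `body` with register `i` set to `0, 1, …, e - 1` in turn.
`diag e src dst ev` hands the leading `e × e` block of the array `src` to the oracle, and writes the
eigenvectors to the array `dst` (as columns) and the eigenvalues to row `0` of the array `ev`. -/
inductive Program where
  | skip
  | setReg (i : ℕ) (e : NExp)
  | setCell (a : ℕ) (i j : NExp) (x : FExp)
  | seq (c₁ c₂ : Program)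
  | ifZero (x : FExp) (c₁ c₂ : Program)
  | ifLt (e₁ e₂ : NExp) (c₁ c₂ : Program)
  | loop (i : ℕ) (e : NExp) (body : Program)
  | diag (e : NExp) (src dst ev : ℕ)

namespace NExp

def eval (ρ : ℕ → ℕ) : NExp → ℕ
  | lit c => c
  | reg i => ρ i
  | add a b => eval ρ a + eval ρ b
  | sub a b => eval ρ a - eval ρ b
  | mul a b => eval ρ a * eval ρ b
  | div a b => eval ρ a / eval ρ b
  | mod a b => eval ρ a % eval ρ b

/-- Every operation on indices is charged one more than the number it produces, so that large
integers cannot be made cheaply. -/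
def cost (ρ : ℕ → ℕ) : NExp → ℕ
  | lit c => c + 1
  | reg i => ρ i + 1
  | add a b => cost ρ a + cost ρ b + (eval ρ a + eval ρ b) + 1
  | sub a b => cost ρ a + cost ρ b + (eval ρ a - eval ρ b) + 1
  | mul a b => cost ρ a + cost ρ b + eval ρ a * eval ρ b + 1
  | div a b => cost ρ a + cost ρ b + eval ρ a / eval ρ b + 1
  | mod a b => cost ρ a + cost ρ b + eval ρ a % eval ρ b + 1

end NExp

namespace FExp

def eval {F : Type*} [RCLike F] (σ : Store F) : FExp → F
  | zero => 0
  | one => 1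
  | cell a i j => σ.cell a (i.eval σ.reg) (j.eval σ.reg)
  | add x y => eval σ x + eval σ y
  | sub x y => eval σ x - eval σ y
  | mul x y => eval σ x * eval σ y
  | inv x => (eval σ x)⁻¹
  | conj x => star (eval σ x)

/-- One step for each field operation and each memory access, besides the cost of the indices. -/
def cost {F : Type*} (σ : Store F) : FExp → ℕ
  | zero => 1
  | one => 1
  | cell _ i j => i.cost σ.reg + j.cost σ.reg + 1
  | add x y => cost σ x + cost σ y + 1
  | sub x y => cost σ x + cost σ y + 1
  | mul x y => cost σ x + cost σ y + 1
  | inv x => cost σ x + 1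
  | conj x => cost σ x + 1

end FExp

namespace Store

def tick {F : Type*} (σ : Store F) (t : ℕ) : Store F := { σ with steps := σ.steps + t }

def setReg {F : Type*} (σ : Store F) (i x : ℕ) : Store F :=
  { σ with reg := fun j => if j = i then x else σ.reg j }

def setCell {F : Type*} (σ : Store F) (a i j : ℕ) (x : F) : Store F :=
  { σ with cell := fun a₁ i₁ j₁ => if a₁ = a ∧ i₁ = i ∧ j₁ = j then x else σ.cell a₁ i₁ j₁ }

/-- Write the matrix `Q` to the leading block of the array `a`. -/
def setBlock {F : Type*} (σ : Store F) (a k l : ℕ) (Q : Matrix (Fin k) (Fin l) F) : Store F :=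
  { σ with cell := fun a₁ i j =>
      if h : a₁ = a ∧ i < k ∧ j < l then Q ⟨i, h.2.1⟩ ⟨j, h.2.2⟩ else σ.cell a₁ i j }

end Store

namespace Program

/-- Execution of a program, with its steps and oracle calls added to the counters. -/
noncomputable def run {F : Type*} [RCLike F] (O : DiagOracle F) : Program → Store F → Store F
  | skip, σ => σ.tick 1
  | setReg i e, σ => (σ.setReg i (e.eval σ.reg)).tick (e.cost σ.reg + 1)
  | setCell a i j x, σ =>
      (σ.setCell a (i.eval σ.reg) (j.eval σ.reg) (x.eval σ)).tick
        (i.cost σ.reg + j.cost σ.reg + x.cost σ + 1)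
  | seq c₁ c₂, σ => run O c₂ (run O c₁ σ)
  | ifZero x c₁ c₂, σ =>
      open Classical in
      if x.eval σ = 0 then run O c₁ (σ.tick (x.cost σ + 1))
      else run O c₂ (σ.tick (x.cost σ + 1))
  | ifLt e₁ e₂ c₁ c₂, σ =>
      if e₁.eval σ.reg < e₂.eval σ.reg
      then run O c₁ (σ.tick (e₁.cost σ.reg + e₂.cost σ.reg + 1))
      else run O c₂ (σ.tick (e₁.cost σ.reg + e₂.cost σ.reg + 1))
  | loop i e body, σ =>
      (List.range (e.eval σ.reg)).foldl
        (fun τ t => run O body ((τ.setReg i t).tick (t + 1))) (σ.tick (e.cost σ.reg + 1))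
  | diag e src dst ev, σ =>
      let k := e.eval σ.reg
      let A : Matrix (Fin k) (Fin k) F := Matrix.of fun i j => σ.cell src i j
      let τ := (σ.setBlock dst k k (O.vecs k A)).setBlock ev 1 k
        (Matrix.of fun _ j => O.vals k A j)
      { τ with steps := τ.steps + (e.cost σ.reg + k * k + 1), calls := τ.calls + 1 }

end Program

/-- The initial store for Algorithm 1 on polynomials `f j` of degree `d` in `n` variables and the
vectors `u i`: registers `0, 1, 2, 3` hold `n, d, R, p`; array `0` holds the vectors; row `j` of
array `1` holds the coefficients of `f j`, the coefficient of `x_{a 0} ⋯ x_{a (d-1)}` standing at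
the position whose base-`n` digits are `a`; rows `0` and `1` of array `2` are the random tape. -/
noncomputable def initialStore {ι F : Type*} [RCLike F] {n p R : ℕ} (d : ℕ) (ν : ι ≃ Fin n)
    (f : Fin p → MvPolynomial ι F) (u : Fin R → ι → F) (θ η : Fin R → F) : Store F where
  reg i := if i = 0 then n else if i = 1 then d else if i = 2 then R else if i = 3 then p else 0
  cell a i j :=
    if a = 0 then (if h : i < R ∧ j < n then u ⟨i, h.1⟩ (ν.symm ⟨j, h.2⟩) else 0)
    else if a = 1 then
      (if h : i < p ∧ j < n ^ d then
        MvPolynomial.coeff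
          (content fun t => ν.symm (finFunctionFinEquiv.symm (⟨j, h.2⟩ : Fin (n ^ d)) t))
          (f ⟨i, h.1⟩)
      else 0)
    else if a = 2 then
      (if h : j < R then (if i = 0 then θ ⟨j, h⟩ else if i = 1 then η ⟨j, h⟩ else 0) else 0)
    else 0
  steps := 0
  calls := 0

/-- The output that a final store stands for: register `0` tells which of the three messages,
register `1` the number of listed vectors, which are the first rows of array `0`. -/
def readOutput {ι F : Type*} {n : ℕ} (ν : ι ≃ Fin n) (σ : Store F) : Output ι F :=
  if σ.reg 0 = 0 then .trivial
  else if σ.reg 0 = 1 then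
    .only (List.ofFn fun (t : Fin (σ.reg 1)) (q : ι) => σ.cell 0 t (ν q))
  else .fail

/-! ## Contents of index tuples -/

section Content

variable {ι : Type*} {d : ℕ}

/-! The rank condition is linearized by tensor powers. Pairing the polarization of a minor with the
power `w^{⊗(r+1)}` evaluates the minor at `w`, so `w` lies in `U` and has rank at most `r` exactly
when its power lies in `W = S^{r+1}(U) ∩ I^⊥` (`tensorPower_mem_annihilator_iff`,
`tensorPower_mem_symPower`, `mem_of_tensorPower_mem_symPower`). If `W = 0`, the intersection is
trivial. If `W` is spanned by the powers of linearly independent vectors `x t`, the only powers in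
`W` are multiples of these (`exists_eq_smul_of_tensorPower_eq_sum`), so the intersection is the
union of the lines through the `x t`. This is the certification; it needs no genericity.

Suppose `W` has such a basis of powers. Then the stacked tensor is `∑ z t ⊗ x t ⊗ (x t)^{⊗r}`, and
its contraction with `f` factors as `X diag(f(z t)) Yᵀ`, where `X` and `Y` have independent columns.
For every generalized inverse `G` of `T(g)` this gives `T(f) G X = X diag(f(z t) / g(z t))`. If the
ratios are non-zero and distinct (`GenericDecomposition`), the eigenvectors for non-zero eigenvalues
are the `x t` up to scale, so the subroutine can only return the terms of this decomposition
(`GenericDecomposition.simDiag`). Gaussian functionals are almost surely in this position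
(`ae_genericDecomposition`).

It remains to see that generically `W` is spanned by the planted powers. Expressed in the vectors `v
i`, this says that no non-zero form of degree `r+1` in the linear forms of the `v i`, free of the
planted pure powers, is killed by all minors regarded as functionals. With `N = n₁ n₂` and `p`
independent minors, the inequality `R N^r ≤ p` suffices, and it follows from `R ≤ B`, because `B = p
/ (N (N+1) ⋯ (N+r-1))`. One good tuple is built by induction on `R`
(`exists_vectors_no_vanishing_form`). A generic first vector, with linear form `l₀`, is chosen so
that contraction with `l₀^j` divides dimensions by at most `N^j`; the subspace killed by one further
`l₀` still satisfies the inequality for `R` replaced by `R - 1`, and the part of a form of lowest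
order in the first variable is treated by induction. Vectors of rank at most `r` are enough here,
because they include all vectors with at most `r` non-zero entries, and powers of order `j ≤ r` of
those span all forms of degree `j`. The power of order `r+1` is not covered, and it is just the one
excluded for planted vectors. Goodness is the non-vanishing of a polynomial, and the planted variety
is the image of an affine space, hence irreducible, so good tuples form an open dense set.

For the running time, an explicit program computes `W` as the kernel of a Hermitian Gram matrix, a
generalized inverse of `T(g)` from the eigenvalues of another Gram matrix, and the eigenvectors of
`T(f) G`: three oracle calls. Explicit tests decide whether the result comes from a decomposition in
general position. If so, its vectors are a legal output (`GenericDecomposition.algorithm1Run`); if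
no such decomposition exists, "Fail" is legal (`algorithm1Run_fail`). Costs are polynomial in a
common bound `(n₁ n₂)^{r+1}` of the registers (`Program.exists_cost_le`). -/

theorem content_apply [DecidableEq ι] (a : Fin d → ι) (i : ι) :
    content a i = Fintype.card {t // a t = i} := by
  simp only [content, Finsupp.finsetSum_apply, Finsupp.single_apply, Fintype.card_subtype,
    Finset.card_filter]

theorem content_comp_perm (a : Fin d → ι) (π : Equiv.Perm (Fin d)) :
    content (a ∘ π) = content a := by
  simp only [content, Function.comp_apply]
  exact Equiv.sum_comp π fun t => Finsupp.single (a t) 1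

/-- Equal multiplicities mean that the fibres over each value have equal size; bijections between
the fibres glue to a permutation of the positions. -/
theorem content_eq_iff (a b : Fin d → ι) :
    content a = content b ↔ ∃ π : Equiv.Perm (Fin d), a = b ∘ π := by
  classical
  constructor
  · intro h
    have h1 : ∀ i, Nonempty ({t // a t = i} ≃ {t // b t = i}) := fun i => by
      rw [← Fintype.card_eq, ← content_apply a, ← content_apply b, h]
    refine ⟨Equiv.ofFiberEquiv fun i => (h1 i).some, ?_⟩
    exact funext fun t => (Equiv.ofFiberEquiv_map _ t).symm
  · rintro ⟨π, rfl⟩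
    exact content_comp_perm b π

theorem content_injective_le_one {a : Fin d → ι} (ha : Function.Injective a) (i : ι) :
    content a i ≤ 1 := by
  classical
  rw [content_apply, Fintype.card_le_one_iff]
  rintro ⟨s, hs⟩ ⟨t, ht⟩
  exact Subtype.ext (ha (hs.trans ht.symm))

theorem monomial_content {F : Type*} [CommSemiring F] (a : Fin d → ι) :
    ∏ t, (MvPolynomial.X (a t) : MvPolynomial ι F) = MvPolynomial.monomial (content a) 1 := by
  rw [content, MvPolynomial.monomial_sum_one]
  rfl

end Content

/-! ## Minors and rank -/

section Rank

variable {F : Type*} [Field F]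

/-- Order embeddings, instead of injections, match the indexing of the minors. A basis of the row
space is extracted from the rows and cut down to `k` of them, listed increasingly. -/
theorem exists_orderEmbedding_linearIndependent_rows {β : Type*} [Fintype β] {n k : ℕ}
    (M : Matrix (Fin n) β F) (h : k ≤ M.rank) :
    ∃ f : Fin k ↪o Fin n, LinearIndependent F fun i => M (f i) := by
  classical
  obtain ⟨κ, a, ha, hspan, hli⟩ := exists_linearIndependent' F M
  have : Finite κ := Finite.of_injective a ha
  have := Fintype.ofFinite κ
  have hcard : k ≤ Fintype.card κ := by
    rw [← finrank_span_eq_card hli, hspan]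
    rwa [Matrix.rank_eq_finrank_span_row] at h
  obtain ⟨t, hts, htc⟩ := Finset.exists_subset_card_eq
    (s := Finset.univ.image a) (n := k) (by rwa [Finset.card_image_of_injective _ ha])
  refine ⟨t.orderEmbOfFin htc, ?_⟩
  have hmem : ∀ i, ∃ x, a x = t.orderEmbOfFin htc i := fun i => by
    have := hts (t.orderEmbOfFin_mem htc i)
    simpa using this
  choose g hg using hmem
  have hginj : Function.Injective g := fun i j hij => by
    have := hg i
    rw [hij, hg j] at this
    exact ((t.orderEmbOfFin htc).injective this).symm
  have := hli.comp g hginj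
  rw [show (fun i => M (t.orderEmbOfFin htc i)) = (M ∘ a) ∘ g from
    funext fun i => congrArg M (hg i).symm]
  exact this

/-- A matrix of larger rank has `r+1` independent rows; the submatrix on these has rank `r+1`, so
its transpose again has `r+1` independent rows, and these positions carry a non-zero minor. -/
theorem rank_le_iff_minors {n₁ n₂ r : ℕ} (M : Matrix (Fin n₁) (Fin n₂) F) :
    M.rank ≤ r ↔ ∀ (f : Fin (r + 1) ↪o Fin n₁) (g : Fin (r + 1) ↪o Fin n₂),
      (M.submatrix f g).det = 0 := by
  constructor
  · intro h f g
    by_contra hdet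
    have h1 := Matrix.rank_of_det_ne_zero hdet
    have h2 := Matrix.rank_submatrix_le M f g
    simp at h1
    omega
  · intro h
    by_contra! hr
    obtain ⟨f, hf⟩ := exists_orderEmbedding_linearIndependent_rows M hr
    have h1 : (M.submatrix f id).rank = r + 1 := by
      rw [Matrix.rank_eq_finrank_span_row]
      exact (finrank_span_eq_card hf).trans (by simp)
    rw [← Matrix.rank_transpose] at h1
    obtain ⟨g, hg⟩ := exists_orderEmbedding_linearIndependent_rows _ h1.ge
    have h2 := Matrix.linearIndependent_rows_iff_isUnit (A := (M.submatrix f g)ᵀ) |>.1 hg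
    rw [Matrix.isUnit_iff_isUnit_det, Matrix.det_transpose, h f g] at h2
    simp at h2

end Rank

/-! ### Minors as linear forms on symmetric tensors -/

section MinorForm

variable {F : Type*} [Field F] {n₁ n₂ r p : ℕ}

/-- The positions of the entries of a minor that occur in the term given by `σ`. -/
def minorPositions (fg : (Fin (r + 1) ↪o Fin n₁) × (Fin (r + 1) ↪o Fin n₂))
    (σ : Equiv.Perm (Fin (r + 1))) (b : Fin (r + 1)) : Fin n₁ × Fin n₂ :=
  (fg.1 (σ b), fg.2 b)

theorem minorPositions_injective (fg : (Fin (r + 1) ↪o Fin n₁) × (Fin (r + 1) ↪o Fin n₂))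
    (σ : Equiv.Perm (Fin (r + 1))) : Function.Injective (minorPositions fg σ) := by
  intro a b h
  exact fg.2.injective (congrArg Prod.snd h)

/-- The value of the polarized minor at a symmetric tensor. -/
def minorForm (fg : (Fin (r + 1) ↪o Fin n₁) × (Fin (r + 1) ↪o Fin n₂))
    (T : Tensor (r + 1) (Fin n₁ × Fin n₂) F) : F :=
  ∑ σ : Equiv.Perm (Fin (r + 1)), ((Equiv.Perm.sign σ : ℤ) : F) * T (minorPositions fg σ)

theorem coeff_minors (e : Fin p ≃ (Fin (r + 1) ↪o Fin n₁) × (Fin (r + 1) ↪o Fin n₂)) (j : Fin p)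
    (m : Fin n₁ × Fin n₂ →₀ ℕ) [DecidableEq (Fin n₁ × Fin n₂ →₀ ℕ)] :
    MvPolynomial.coeff m (minors F e j) = ∑ σ : Equiv.Perm (Fin (r + 1)),
      ((Equiv.Perm.sign σ : ℤ) : F) *
        if content (minorPositions (e j) σ) = m then 1 else 0 := by
  rw [minors, Matrix.det_apply, MvPolynomial.coeff_sum]
  refine Finset.sum_congr rfl fun σ _ => ?_
  have h := monomial_content (F := F) (minorPositions (e j) σ)
  simp only [minorPositions] at h
  simp only [Matrix.of_apply, h, Units.smul_def, zsmul_eq_mul]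
  rw [← map_intCast (MvPolynomial.C (R := F) (σ := Fin n₁ × Fin n₂)), MvPolynomial.coeff_C_mul,
    MvPolynomial.coeff_monomial]
  congr

theorem coeff_minors_ne_zero
    (e : Fin p ≃ (Fin (r + 1) ↪o Fin n₁) × (Fin (r + 1) ↪o Fin n₂)) (j : Fin p)
    {m : Fin n₁ × Fin n₂ →₀ ℕ} (h : MvPolynomial.coeff m (minors F e j) ≠ 0) (i) : m i ≤ 1 := by
  classical
  rw [coeff_minors] at h
  obtain ⟨σ, -, hσ⟩ := Finset.exists_ne_zero_of_sum_ne_zero h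
  have : content (minorPositions (e j) σ) = m := by
    by_contra hne
    simp [hne] at hσ
  rw [← this]
  exact content_injective_le_one (minorPositions_injective _ _) i

/-- Every monomial of a minor is squarefree, so the factorials of the exponents are all `1`. -/
theorem polarization_minors
    (e : Fin p ≃ (Fin (r + 1) ↪o Fin n₁) × (Fin (r + 1) ↪o Fin n₂)) (j : Fin p)
    (a : Fin (r + 1) → Fin n₁ × Fin n₂) :
    polarization (r + 1) (minors F e j) a =
      MvPolynomial.coeff (content a) (minors F e j) * ((r + 1)! : F)⁻¹ := by
  rw [polarization]
  by_cases h : MvPolynomial.coeff (content a) (minors F e j) = 0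
  · simp [h]
  · have h1 : ∀ i, ((content a i)! : F) = 1 := fun i => by
      have := coeff_minors_ne_zero e j h i
      interval_cases content a i <;> simp
    simp [h1]

/-- Each term of the minor belongs to a tuple of distinct positions, which has `(r+1)!`
rearrangements, and a symmetric tensor takes the same value at all of them. -/
theorem sum_coeff_minors_mul
    (e : Fin p ≃ (Fin (r + 1) ↪o Fin n₁) × (Fin (r + 1) ↪o Fin n₂)) (j : Fin p)
    {T : Tensor (r + 1) (Fin n₁ × Fin n₂) F} (hT : T ∈ symTensors (r + 1) _ F) :
    ∑ a, MvPolynomial.coeff (content a) (minors F e j) * T a =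
      ((r + 1)! : F) * minorForm (e j) T := by
  classical
  have key : ∀ σ : Equiv.Perm (Fin (r + 1)),
      ∑ a, (if content (minorPositions (e j) σ) = content a then T a else 0) =
        ((r + 1)! : F) * T (minorPositions (e j) σ) := by
    intro σ
    set b := minorPositions (e j) σ
    have hb : Function.Injective b := minorPositions_injective _ _
    have h1 : Finset.univ.filter (fun a => content b = content a) =
        Finset.univ.image fun π : Equiv.Perm (Fin (r + 1)) => b ∘ π := by
      ext a
      simp only [Finset.mem_filter, Finset.mem_univ, true_and, Finset.mem_image]
      rw [eq_comm, content_eq_iff]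
      exact ⟨fun ⟨π, h⟩ => ⟨π, h.symm⟩, fun ⟨π, h⟩ => ⟨π, h.symm⟩⟩
    rw [← Finset.sum_filter, h1, Finset.sum_image]
    · have h2 : ∀ π : Equiv.Perm (Fin (r + 1)), T (b ∘ π) = T b := fun π => hT π b
      simp [h2, Fintype.card_perm]
    · intro π _ π' _ h
      ext t
      exact congrArg _ (hb (congrFun h t))
  simp only [coeff_minors, Finset.sum_mul, minorForm, Finset.mul_sum]
  rw [Finset.sum_comm]
  refine Finset.sum_congr rfl fun σ _ => ?_
  rw [← mul_left_comm, ← key σ, Finset.mul_sum]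
  refine Finset.sum_congr rfl fun a _ => ?_
  split_ifs <;> simp

/-- On symmetric tensors the condition no longer involves the factorials or the enumeration `e`;
hence different enumerations give the same intersection. -/
theorem mem_annihilator_minors_iff [CharZero F]
    (e : Fin p ≃ (Fin (r + 1) ↪o Fin n₁) × (Fin (r + 1) ↪o Fin n₂))
    {T : Tensor (r + 1) (Fin n₁ × Fin n₂) F} (hT : T ∈ symTensors (r + 1) _ F) :
    T ∈ annihilator (r + 1) (minors F e) ↔ ∀ fg, minorForm fg T = 0 := by
  have hf : ((r + 1)! : F) ≠ 0 := by exact_mod_cast Nat.factorial_ne_zero _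
  have h1 : T ∈ annihilator (r + 1) (minors F e) ↔
      ∀ j, ∑ a, polarization (r + 1) (minors F e j) a * T a = 0 := Iff.rfl
  rw [h1, ← e.forall_congr_right (q := fun fg => minorForm fg T = 0)]
  refine forall_congr' fun j => ?_
  have h2 : ∑ a, polarization (r + 1) (minors F e j) a * T a = minorForm (e j) T := by
    rw [← mul_right_inj' hf, ← sum_coeff_minors_mul e j hT, Finset.mul_sum]
    refine Finset.sum_congr rfl fun a _ => ?_
    rw [polarization_minors]
    field_simp
  rw [h2]

theorem minorForm_tensorPower (fg : (Fin (r + 1) ↪o Fin n₁) × (Fin (r + 1) ↪o Fin n₂))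
    (w : Fin n₁ × Fin n₂ → F) :
    minorForm fg (tensorPower (r + 1) w) =
      ((Matrix.of fun i j => w (i, j)).submatrix fg.1 fg.2).det := by
  simp [minorForm, tensorPower, minorPositions, Matrix.det_apply']

theorem tensorPower_mem_symTensors {ι : Type*} (d : ℕ) (v : ι → F) :
    tensorPower d v ∈ symTensors d ι F := fun π a =>
  Equiv.prod_comp π fun t => v (a t)

/-- The bridge between the variety and linear algebra: on a power, the polarized minors are the
minors themselves. -/
theorem tensorPower_mem_annihilator_iff [CharZero F]
    (e : Fin p ≃ (Fin (r + 1) ↪o Fin n₁) × (Fin (r + 1) ↪o Fin n₂)) (w : Fin n₁ × Fin n₂ → F) :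
    tensorPower (r + 1) w ∈ annihilator (r + 1) (minors F e) ↔ w ∈ rankVariety F n₁ n₂ r := by
  rw [mem_annihilator_minors_iff e (tensorPower_mem_symTensors _ w)]
  simp only [minorForm_tensorPower, rankVariety, Set.mem_ofPred_eq, rank_le_iff_minors]
  exact ⟨fun h f g => h (f, g), fun h fg => h fg.1 fg.2⟩

end MinorForm

/-! ## Tensor powers and symmetric powers -/

section Tensors

variable {ι F : Type*} [Field F]

theorem sum_prod_mul_prod [Fintype ι] {d : ℕ} (χ v : Fin d → ι → F) :
    ∑ q : Fin d → ι, (∏ t, χ t (q t)) * ∏ t, v t (q t) = ∏ t, ∑ y, χ t y * v t y := by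
  classical
  rw [Finset.prod_univ_sum, Fintype.piFinset_univ]
  exact Finset.sum_congr rfl fun q _ => Finset.prod_mul_distrib.symm

theorem tensorPower_cons {k : ℕ} (v : ι → F) (y : ι) (q : Fin k → ι) :
    tensorPower (k + 1) v (Fin.cons y q) = v y * tensorPower k v q := by
  simp [tensorPower, Fin.prod_univ_succ]

theorem tensorPower_smul {d : ℕ} (c : F) (v : ι → F) :
    tensorPower d (c • v) = c ^ d • tensorPower d v := by
  ext q
  simp [tensorPower, Finset.prod_mul_distrib]

theorem linearMap_pi_apply [Fintype ι] [DecidableEq ι] {M : Type*} [AddCommMonoid M] [Module F M]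
    (f : (ι → F) →ₗ[F] M) (x : ι → F) : f x = ∑ y, x y • f (Pi.single y 1) := by
  conv_lhs => rw [pi_eq_sum_univ' x]
  simp only [map_sum, map_smul]

theorem exists_dual_family [Fintype ι] {κ : Type*} [Fintype κ] [DecidableEq κ] {x : κ → ι → F}
    (hx : LinearIndependent F x) :
    ∃ χ : κ → ι → F, ∀ s t, ∑ y, χ s y * x t y = if s = t then 1 else 0 := by
  classical
  obtain ⟨f, hf⟩ := LinearMap.exists_leftInverse_of_injective (Fintype.linearCombination F x)
    (LinearMap.ker_eq_bot.2 hx.fintypeLinearCombination_injective)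
  refine ⟨fun s y => f (Pi.single y 1) s, fun s t => ?_⟩
  have h1 : f (x t) = Pi.single t 1 := by
    have := LinearMap.congr_fun hf (Pi.single t 1)
    simpa [Fintype.linearCombination_apply_single] using this
  have h2 := congrFun (linearMap_pi_apply f (x t)) s
  rw [h1] at h2
  simp only [Finset.sum_apply, Pi.smul_apply, smul_eq_mul] at h2
  rw [Pi.single_apply] at h2
  rw [h2]
  exact Finset.sum_congr rfl fun y _ => mul_comm _ _

theorem sum_tensorPower_mul [Fintype ι] {d : ℕ} (χ : Fin d → ι → F) (v : ι → F) :
    ∑ q, (∏ t, χ t (q t)) * tensorPower d v q = ∏ t, ∑ y, χ t y * v y :=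
  sum_prod_mul_prod χ fun _ => v

/-- Powers of a dual family are dual to the powers. The exponent must be positive, since `0 ^ 0 = 1`
would spoil the vanishing of the mixed pairings. -/
theorem linearIndependent_tensorPower [Fintype ι] {κ : Type*} [Fintype κ] {d : ℕ} (hd : d ≠ 0)
    {x : κ → ι → F} (hx : LinearIndependent F x) :
    LinearIndependent F fun t => tensorPower d (x t) := by
  classical
  obtain ⟨χ, hχ⟩ := exists_dual_family hx
  rw [Fintype.linearIndependent_iff]
  intro g hg s
  have h1 : ∑ q, (∏ t : Fin d, χ s (q t)) * (∑ t, g t • tensorPower d (x t)) q = 0 := by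
    rw [hg]; simp
  simp only [Finset.sum_apply, Pi.smul_apply, smul_eq_mul, Finset.mul_sum] at h1
  rw [Finset.sum_comm] at h1
  have h2 : ∀ t, ∑ q, (∏ k : Fin d, χ s (q k)) * (g t * tensorPower d (x t) q) =
      g t * if s = t then 1 else 0 := fun t => by
    have := sum_tensorPower_mul (d := d) (fun _ => χ s) (x t)
    rw [hχ, Finset.prod_const, Finset.card_univ, Fintype.card_fin] at this
    rw [show (if s = t then 1 else 0 : F) = (if s = t then 1 else 0) ^ d by
      split_ifs <;> simp [hd], ← this, Finset.mul_sum]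
    exact Finset.sum_congr rfl fun q _ => by ring
  simpa [h2] using h1

/-- A power in the span of powers of independent vectors is proportional to one of them. -/
theorem exists_eq_smul_of_tensorPower_eq_sum [Fintype ι] {κ : Type*} [Fintype κ] {k : ℕ}
    (hk : k ≠ 0) {x : κ → ι → F} (hx : LinearIndependent F x) {w : ι → F} {a : κ → F}
    (h : tensorPower (k + 1) w = ∑ t, a t • tensorPower (k + 1) (x t)) :
    w = 0 ∨ ∃ t, a t ≠ 0 ∧ ∃ c : F, w = c • x t := by
  classical
  by_cases hw : w = 0
  · exact Or.inl hw
  right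
  obtain ⟨y₀, hy₀⟩ := Function.ne_iff.1 hw
  obtain ⟨χ, hχ⟩ := exists_dual_family hx
  have hy₀' : w y₀ ^ k ≠ 0 := pow_ne_zero _ hy₀
  -- Fixing the last `k` indices at `y₀`, where `w` does not vanish, turns the identity of tensors
  -- into one of vectors.
  have hspan : w = ∑ t, ((w y₀ ^ k)⁻¹ * (a t * x t y₀ ^ k)) • x t := by
    ext y
    have := congrFun h (Fin.cons y fun _ => y₀)
    simp only [tensorPower_cons, Finset.sum_apply, Pi.smul_apply, smul_eq_mul] at this
    simp only [tensorPower, Finset.prod_const, Finset.card_univ, Fintype.card_fin] at this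
    simp only [Finset.sum_apply, Pi.smul_apply, smul_eq_mul]
    rw [← mul_right_inj' hy₀', mul_comm, this, Finset.mul_sum]
    refine Finset.sum_congr rfl fun t _ => ?_
    field_simp
  obtain ⟨c, hc⟩ : ∃ c : κ → F, c = fun t => (w y₀ ^ k)⁻¹ * (a t * x t y₀ ^ k) := ⟨_, rfl⟩
  replace hspan : w = ∑ t, c t • x t := by rw [hc]; exact hspan
  have hχw : ∀ s, ∑ y, χ s y * w y = c s := fun s => by
    conv_lhs => rw [hspan]
    simp only [Finset.sum_apply, Pi.smul_apply, smul_eq_mul, Finset.mul_sum]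
    rw [Finset.sum_comm]
    have : ∀ t, ∑ y, χ s y * (c t * x t y) = c t * if s = t then 1 else 0 := fun t => by
      rw [← hχ, Finset.mul_sum]
      exact Finset.sum_congr rfl fun y _ => by ring
    simp [this]
  obtain ⟨s, hs⟩ : ∃ s, c s ≠ 0 := by
    by_contra! hall
    exact hw (by rw [hspan]; simp [hall])
  -- Pair the identity with `χ t ⊗ (χ s)^{⊗k}`. Each `x u` is killed by `χ t` or by `χ s`, because
  -- `t ≠ s` and `k ≠ 0`, so the right side vanishes; the left side is `c t * c s ^ k` with `c s ≠
  -- 0`.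
  have hzero : ∀ t, t ≠ s → c t = 0 := fun t hts => by
    have h1 := sum_tensorPower_mul (d := k + 1) (Fin.cons (χ t) fun _ => χ s) w
    rw [h] at h1
    have h2 : ∑ q, (∏ i, (Fin.cons (χ t) (fun _ => χ s) : Fin (k + 1) → ι → F) i (q i)) *
        (∑ u, a u • tensorPower (k + 1) (x u)) q = 0 := by
      simp only [Finset.sum_apply, Pi.smul_apply, smul_eq_mul, Finset.mul_sum]
      rw [Finset.sum_comm]
      refine Finset.sum_eq_zero fun u _ => ?_
      have h3 := sum_tensorPower_mul (d := k + 1) (Fin.cons (χ t) fun _ => χ s) (x u)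
      have h4 : ∏ i, ∑ y, (Fin.cons (χ t) (fun _ => χ s) : Fin (k + 1) → ι → F) i y * x u y =
          0 := by
        rw [Fin.prod_univ_succ]
        simp only [Fin.cons_zero, Fin.cons_succ, hχ, Finset.prod_const, Finset.card_univ,
          Fintype.card_fin]
        by_cases hu : t = u
        · subst hu
          simp [hts.symm, hk]
        · simp [hu]
      rw [h4] at h3
      rw [← mul_zero (a u), ← h3, Finset.mul_sum]
      exact Finset.sum_congr rfl fun q _ => by ring
    rw [h2, Fin.prod_univ_succ] at h1
    simp only [Fin.cons_zero, Fin.cons_succ, hχw, Finset.prod_const, Finset.card_univ,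
      Fintype.card_fin] at h1
    exact (mul_eq_zero.1 h1.symm).resolve_right (pow_ne_zero _ hs)
  refine ⟨s, fun ha => hs (by simp [hc, ha]), c s, ?_⟩
  conv_lhs => rw [hspan]
  exact Fintype.sum_eq_single s fun t ht => by
    change c t • x t = 0
    rw [hzero t ht, zero_smul]

theorem tensorPower_mem_symPower {d : ℕ} {U : Submodule F (ι → F)} {w : ι → F} (hw : w ∈ U) :
    tensorPower d w ∈ symPower d U :=
  ⟨Submodule.subset_span ⟨fun _ => w, fun _ => hw, rfl⟩, tensorPower_mem_symTensors d w⟩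

theorem slice_mem_of_mem_symPower {k : ℕ} {U : Submodule F (ι → F)} {T : Tensor (k + 1) ι F}
    (hT : T ∈ symPower (k + 1) U) (q : Fin k → ι) : (fun y => T (Fin.cons y q)) ∈ U := by
  let L : Tensor (k + 1) ι F →ₗ[F] ι → F :=
    { toFun := fun T y => T (Fin.cons y q)
      map_add' := fun _ _ => rfl
      map_smul' := fun _ _ => rfl }
  suffices h : Submodule.span F {T : Tensor (k + 1) ι F |
      ∃ w : Fin (k + 1) → ι → F, (∀ t, w t ∈ U) ∧ T = fun a => ∏ t, w t (a t)} ≤ U.comap L from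
    h hT.1
  rw [Submodule.span_le]
  rintro _ ⟨w, hw, rfl⟩
  have : (fun y => ∏ t, w t ((Fin.cons y q : Fin (k + 1) → ι) t)) =
      (∏ t : Fin k, w t.succ (q t)) • w 0 := by
    ext y
    simp [Fin.prod_univ_succ, mul_comm]
  change (fun y => ∏ t, w t ((Fin.cons y q : Fin (k + 1) → ι) t)) ∈ U
  rw [this]
  exact U.smul_mem _ (hw 0)

theorem mem_of_tensorPower_mem_symPower {k : ℕ} {U : Submodule F (ι → F)} {w : ι → F}
    (h : tensorPower (k + 1) w ∈ symPower (k + 1) U) : w ∈ U := by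
  by_cases hw : w = 0
  · rw [hw]; exact U.zero_mem
  obtain ⟨y₀, hy₀⟩ := Function.ne_iff.1 hw
  have h1 := slice_mem_of_mem_symPower h fun _ => y₀
  simp only [tensorPower_cons] at h1
  have h2 := U.smul_mem (tensorPower k w fun _ => y₀)⁻¹ h1
  have h3 : tensorPower k w (fun _ => y₀) ≠ 0 := by
    simpa [tensorPower] using pow_ne_zero _ hy₀
  convert h2 using 1
  ext y
  simp only [Pi.smul_apply, smul_eq_mul]
  field_simp

/-- A tensor whose slices in every direction lie in `U` belongs to the tensor power of `U`. A
projection `π` onto `U` fixes the slices in the first slot, so `T` is the sum over `z` of `π e_z ⊗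
T(z, ·)`, and the second factors are treated by induction. -/
theorem mem_span_of_slices [Finite ι] (U : Submodule F (ι → F)) :
    ∀ (d : ℕ) (T : Tensor d ι F),
      (∀ t q, (fun y => T (Function.update q t y)) ∈ U) →
      T ∈ Submodule.span F {T : Tensor d ι F |
        ∃ w : Fin d → ι → F, (∀ t, w t ∈ U) ∧ T = fun a => ∏ t, w t (a t)} := by
  classical
  have := Fintype.ofFinite ι
  obtain ⟨π, hπ⟩ := LinearMap.exists_leftInverse_of_injective U.subtype U.ker_subtype
  intro d
  induction d with
  | zero =>
    intro T _
    have : T = T (fun i => i.elim0) • fun a => ∏ t : Fin 0, (0 : ι → F) (a t) := by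
      ext q
      simp [Subsingleton.elim q fun i => i.elim0]
    rw [this]
    exact Submodule.smul_mem _ _ (Submodule.subset_span ⟨fun _ => 0, fun t => t.elim0, rfl⟩)
  | succ k ih =>
    intro T hT
    have hsum : T = ∑ z : ι, fun q : Fin (k + 1) → ι =>
        (π (Pi.single z 1) : ι → F) (q 0) * T (Fin.cons z (Fin.tail q)) := by
      ext q
      have h0 := hT 0 q
      have h1 := LinearMap.congr_fun hπ ⟨_, h0⟩
      have h2 := congrArg (fun u : U => (u : ι → F) (q 0)) h1
      simp only [LinearMap.comp_apply, Submodule.subtype_apply, LinearMap.id_apply,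
        Function.update_eq_self] at h2
      rw [← h2, linearMap_pi_apply π]
      simp only [Submodule.coe_sum, Submodule.coe_smul, Finset.sum_apply, Pi.smul_apply,
        smul_eq_mul]
      refine Finset.sum_congr rfl fun z _ => ?_
      rw [mul_comm]
      congr 2
      ext i
      refine Fin.cases ?_ (fun j => ?_) i
      · simp
      · simp [Fin.tail]
    rw [hsum]
    refine Submodule.sum_mem _ fun z _ => ?_
    have hz := ih (fun q => T (Fin.cons z q)) fun t q => by
      have := hT t.succ (Fin.cons z q)
      simpa [Fin.cons_update] using this
    let L : Tensor k ι F →ₗ[F] Tensor (k + 1) ι F :=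
      { toFun := fun S q => (π (Pi.single z 1) : ι → F) (q 0) * S (Fin.tail q)
        map_add' := fun S S' => by ext q; simp [mul_add]
        map_smul' := fun c S => by ext q; simp [mul_left_comm] }
    have hL : (fun q : Fin (k + 1) → ι =>
        (π (Pi.single z 1) : ι → F) (q 0) * T (Fin.cons z (Fin.tail q))) =
        L fun q => T (Fin.cons z q) := rfl
    rw [hL]
    have := Submodule.mem_map_of_mem (f := L) hz
    rw [Submodule.map_span] at this
    refine Submodule.span_mono ?_ this
    rintro _ ⟨_, ⟨w, hw, rfl⟩, rfl⟩
    refine ⟨Fin.cons (π (Pi.single z 1) : ι → F) w, fun t => ?_, ?_⟩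
    · refine Fin.cases ?_ (fun j => ?_) t
      · simp
      · simpa using hw j
    · ext q
      simp [L, Fin.prod_univ_succ, Fin.tail]

/-- Symmetry carries the condition on the slices of one slot to all slots. This is the description
of the symmetric power that the program translates into linear equations. -/
theorem mem_symPower_succ_iff [Finite ι] {k : ℕ} {U : Submodule F (ι → F)}
    {T : Tensor (k + 1) ι F} : T ∈ symPower (k + 1) U ↔
      T ∈ symTensors (k + 1) ι F ∧ ∀ q : Fin k → ι, (fun y => T (Fin.cons y q)) ∈ U := by
  refine ⟨fun h => ⟨h.2, slice_mem_of_mem_symPower h⟩, fun ⟨hT, h⟩ => ⟨?_, hT⟩⟩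
  refine mem_span_of_slices U _ T fun t q => ?_
  have h1 := h (Fin.tail (q ∘ Equiv.swap 0 t))
  convert h1 using 2 with y
  rw [← hT (Equiv.swap 0 t)]
  congr 1
  ext i
  refine Fin.cases ?_ (fun j => ?_) i
  · simp
  · simp only [Function.comp_apply, Fin.cons_succ, Fin.tail]
    rw [Function.update_of_ne]
    intro hj
    rw [Equiv.swap_apply_eq_iff, Equiv.swap_apply_right] at hj
    exact Fin.succ_ne_zero _ hj

end Tensors

/-! ## Generalized inverses -/

section GeneralizedInverse

/-- Compose a projection onto the range of `A` with a linear section of `A` over its range. -/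
theorem exists_generalized_inverse {β γ F : Type*} [Fintype β] [Fintype γ] [Field F]
    (A : Matrix β γ F) : ∃ G : Matrix γ β F, A * G * A = A := by
  classical
  set f := Matrix.toLin' A with hf
  obtain ⟨s, hs⟩ := LinearMap.exists_rightInverse_of_surjective f.rangeRestrict
    f.range_rangeRestrict
  obtain ⟨p, hp⟩ := LinearMap.exists_leftInverse_of_injective (LinearMap.range f).subtype
    (LinearMap.range f).ker_subtype
  refine ⟨LinearMap.toMatrix' (s ∘ₗ p), ?_⟩
  apply Matrix.toLin'.injective
  rw [Matrix.toLin'_mul, Matrix.toLin'_mul, Matrix.toLin'_toMatrix', ← hf]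
  refine LinearMap.ext fun v => ?_
  have h1 : p (f v) = f.rangeRestrict v := LinearMap.congr_fun hp (f.rangeRestrict v)
  have h2 := LinearMap.congr_fun hs (f.rangeRestrict v)
  simp only [LinearMap.comp_apply, h1]
  exact congrArg Subtype.val h2

variable {β γ F : Type*} [Fintype β] [Fintype γ] [RCLike F]

open scoped ComplexOrder in
-- `Aᴴ A X = 0` implies `A X = 0`, so the left factor `Aᴴ` can be cancelled from the hypothesis.
-- Hermitian symmetry follows by comparing `A G Aᴴ` with its adjoint through the adjoint of the
-- identity just obtained.
theorem mul_generalized_inverse_gram (A : Matrix β γ F) {G : Matrix γ γ F}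
    (hG : Aᴴ * A * G * (Aᴴ * A) = Aᴴ * A) :
    A * (G * Aᴴ) * A = A ∧ (A * (G * Aᴴ)).IsHermitian := by
  classical
  have h1 : A * (G * Aᴴ) * A = A := by
    have : Aᴴ * A * (G * (Aᴴ * A) - 1) = 0 := by
      rw [Matrix.mul_sub, Matrix.mul_one, ← Matrix.mul_assoc, hG, sub_self]
    rw [Matrix.conjTranspose_mul_self_mul_eq_zero, Matrix.mul_sub, Matrix.mul_one,
      sub_eq_zero] at this
    simpa only [Matrix.mul_assoc] using this
  refine ⟨h1, ?_⟩
  have h2 : Aᴴ * (A * (Gᴴ * Aᴴ)) = Aᴴ := by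
    have := congrArg Matrix.conjTranspose h1
    simpa only [Matrix.conjTranspose_mul, Matrix.conjTranspose_conjTranspose,
      Matrix.mul_assoc] using this
  have h3 : A * (G * Aᴴ) = A * (Gᴴ * Aᴴ) := by
    calc A * (G * Aᴴ) = A * (G * (Aᴴ * (A * (Gᴴ * Aᴴ)))) := by rw [h2]
      _ = A * (G * Aᴴ) * A * (Gᴴ * Aᴴ) := by simp only [Matrix.mul_assoc]
      _ = A * (Gᴴ * Aᴴ) := by rw [h1]
  rw [Matrix.IsHermitian, Matrix.conjTranspose_mul, Matrix.conjTranspose_mul,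
    Matrix.conjTranspose_conjTranspose, h3, Matrix.mul_assoc]

/-- If `X` and `Y` are generalized inverses with `A X` and `Y A` Hermitian, then `Y A X` has all
four properties. They come from the Gram matrices of `A` and of its adjoint. -/
theorem exists_isMoorePenrose (A : Matrix β γ F) : ∃ B : Matrix γ β F, IsMoorePenrose A B := by
  obtain ⟨G, hG⟩ := exists_generalized_inverse (Aᴴ * A)
  obtain ⟨G', hG'⟩ := exists_generalized_inverse (Aᴴᴴ * Aᴴ)
  obtain ⟨X, h1, h2⟩ : ∃ X : Matrix γ β F, A * X * A = A ∧ (A * X).IsHermitian :=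
    ⟨_, mul_generalized_inverse_gram A hG⟩
  obtain ⟨Y, h5, h6⟩ : ∃ Y : Matrix γ β F, A * Y * A = A ∧ (Y * A).IsHermitian := by
    obtain ⟨h3, h4⟩ := mul_generalized_inverse_gram Aᴴ hG'
    refine ⟨(G' * Aᴴᴴ)ᴴ, ?_, ?_⟩
    · have := congrArg Matrix.conjTranspose h3
      simpa only [Matrix.conjTranspose_mul, Matrix.conjTranspose_conjTranspose,
        Matrix.mul_assoc] using this
    · have : ((Aᴴ * (G' * Aᴴᴴ))ᴴ).IsHermitian := by rw [h4]; exact h4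
      simpa only [Matrix.conjTranspose_mul, Matrix.conjTranspose_conjTranspose] using this
  have hl : A * (Y * A * X) = A * X := by
    rw [← Matrix.mul_assoc, ← Matrix.mul_assoc, h5]
  have hr : Y * A * X * A = Y * A := by
    rw [Matrix.mul_assoc, Matrix.mul_assoc, ← Matrix.mul_assoc A, h1]
  refine ⟨Y * A * X, ?_, ?_, ?_, ?_⟩
  · rw [hl, h1]
  · rw [hr, ← Matrix.mul_assoc, ← Matrix.mul_assoc, Matrix.mul_assoc Y A Y,
      Matrix.mul_assoc Y, h5]
  · rw [hl]; exact h2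
  · rw [hr]; exact h6

end GeneralizedInverse

/-! ## Matrices of the form `A * diagonal _ * B` -/

section Factored

variable {β γ τ F : Type*} [Fintype β] [Fintype γ] [Fintype τ] [DecidableEq τ] [Field F]

/-- The one-sided inverses of `A` and `B` reduce the generalized-inverse equation to `D (B G A) D =
D`, so `B G A` is the inverse of the diagonal matrix `D`. Only this equation on `G` is used, so the
program may replace the Moore-Penrose inverse by a cheaper one. -/
theorem factored_mul_generalized_inverse_mul {A : Matrix β τ F} {A' : Matrix τ β F}
    (hA : A' * A = 1) {B : Matrix τ γ F} {B' : Matrix γ τ F} (hB : B * B' = 1) {f g : τ → F}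
    (hg : ∀ t, g t ≠ 0) {G : Matrix γ β F}
    (hG : A * Matrix.diagonal g * B * G * (A * Matrix.diagonal g * B) =
      A * Matrix.diagonal g * B) :
    A * Matrix.diagonal f * B * G * A = A * Matrix.diagonal fun t => f t / g t := by
  set D := Matrix.diagonal g
  set E := Matrix.diagonal fun t => (g t)⁻¹
  have hED : E * D = 1 := by
    rw [Matrix.diagonal_mul_diagonal, ← Matrix.diagonal_one]
    congr 1; ext t; exact inv_mul_cancel₀ (hg t)
  have hDE : D * E = 1 := by
    rw [Matrix.diagonal_mul_diagonal, ← Matrix.diagonal_one]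
    congr 1; ext t; exact mul_inv_cancel₀ (hg t)
  have h1 : D * (B * G * A) * D = D := by
    calc D * (B * G * A) * D
        = (A' * A) * D * (B * G * A) * D * (B * B') := by rw [hA, hB]; simp
      _ = A' * (A * D * B * G * (A * D * B)) * B' := by simp only [Matrix.mul_assoc]
      _ = A' * (A * D * B) * B' := by rw [hG]
      _ = (A' * A) * D * (B * B') := by simp only [Matrix.mul_assoc]
      _ = D := by rw [hA, hB]; simp
  have h2 : B * G * A = E := by
    calc B * G * A = (E * D) * (B * G * A) * (D * E) := by rw [hED, hDE]; simp
      _ = E * (D * (B * G * A) * D) * E := by simp only [Matrix.mul_assoc]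
      _ = E * (D * E) := by rw [h1, Matrix.mul_assoc]
      _ = E := by rw [hDE, Matrix.mul_one]
  calc A * Matrix.diagonal f * B * G * A = A * (Matrix.diagonal f * (B * G * A)) := by
        simp only [Matrix.mul_assoc]
    _ = _ := by simp only [h2, E, Matrix.diagonal_mul_diagonal, div_eq_mul_inv]

variable {M : Matrix β β F} {A : Matrix β τ F} {A' : Matrix τ β F} {N : Matrix τ β F} {ρ : τ → F}

/-- An eigenvector for a non-zero eigenvalue lies in the range of `M`, hence in that of `A`;
cancelling `A` leaves an eigenvector of the diagonal matrix. -/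
theorem exists_eigenvector_coordinates (hM : M = A * N) (hA : A' * A = 1)
    (hMA : M * A = A * Matrix.diagonal ρ) {v : β → F} (hv : v ≠ 0) {l : F} (hl : l ≠ 0)
    (h : M *ᵥ v = l • v) : ∃ y : τ → F, v = A *ᵥ y ∧ y ≠ 0 ∧ ∀ t, ρ t * y t = l * y t := by
  refine ⟨l⁻¹ • (N *ᵥ v), ?_, ?_, ?_⟩
  · rw [Matrix.mulVec_smul, Matrix.mulVec_mulVec, ← hM, h, smul_smul, inv_mul_cancel₀ hl, one_smul]
  · intro h0
    apply hv
    have : v = A *ᵥ (l⁻¹ • (N *ᵥ v)) := by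
      rw [Matrix.mulVec_smul, Matrix.mulVec_mulVec, ← hM, h, smul_smul, inv_mul_cancel₀ hl,
        one_smul]
    rw [this, h0, Matrix.mulVec_zero]
  · set y := l⁻¹ • (N *ᵥ v) with hy
    have h1 : v = A *ᵥ y := by
      rw [hy, Matrix.mulVec_smul, Matrix.mulVec_mulVec, ← hM, h, smul_smul, inv_mul_cancel₀ hl,
        one_smul]
    have h2 : A *ᵥ (Matrix.diagonal ρ *ᵥ y) = A *ᵥ (l • y) := by
      rw [Matrix.mulVec_mulVec, ← hMA, ← Matrix.mulVec_mulVec, ← h1, h, Matrix.mulVec_smul, ← h1]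
    have h3 := congrArg (A' *ᵥ ·) h2
    simp only [Matrix.mulVec_mulVec, ← Matrix.mul_assoc, hA, Matrix.one_mul,
      Matrix.one_mulVec] at h3
    intro t
    have := congrFun h3 t
    simpa [Matrix.mulVec_diagonal] using this

theorem eigenvector_eq_smul_col (hM : M = A * N) (hA : A' * A = 1)
    (hMA : M * A = A * Matrix.diagonal ρ) (hρ : Function.Injective ρ) {v : β → F} (hv : v ≠ 0)
    {l : F} (hl : l ≠ 0) (h : M *ᵥ v = l • v) :
    ∃ t, l = ρ t ∧ ∃ c : F, c ≠ 0 ∧ v = c • fun y => A y t := by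
  obtain ⟨y, hvy, hy, hρy⟩ := exists_eigenvector_coordinates hM hA hMA hv hl h
  obtain ⟨t, ht⟩ := Function.ne_iff.1 hy
  have hlt : l = ρ t := (mul_right_cancel₀ ht (hρy t)).symm
  refine ⟨t, hlt, y t, ht, ?_⟩
  have hy' : y = Pi.single t (y t) := by
    ext s
    by_cases hs : s = t
    · subst hs; simp
    · rw [Pi.single_eq_of_ne hs]
      by_contra hne
      exact hs (hρ ((mul_right_cancel₀ hne (hρy s)).trans hlt))
  rw [hvy]
  conv_lhs => rw [hy']
  ext b
  simp [Matrix.mulVec_single, mul_comm]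

theorem rank_eq_card_of_factored (hM : M = A * N) (hA : A' * A = 1)
    (hMA : M * A = A * Matrix.diagonal ρ) (hρ : ∀ t, ρ t ≠ 0) : M.rank = Fintype.card τ := by
  apply le_antisymm
  · rw [hM]
    exact (Matrix.rank_mul_le_left _ _).trans (Matrix.rank_le_card_width _)
  · have h1 : (Matrix.diagonal ρ).rank = Fintype.card τ := by
      classical
      rw [Matrix.rank_diagonal]
      simp [hρ]
    rw [← h1, ← Matrix.one_mul (Matrix.diagonal ρ), ← hA, Matrix.mul_assoc, ← hMA]
    exact (Matrix.rank_mul_le_right _ _).trans (Matrix.rank_mul_le_left _ _)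

end Factored

/-! ## Decompositions into independent powers -/

section GenericDecomposition

variable {ι F : Type*} {k m : ℕ}

/-- The value at `f` of the functional with coordinates `z`. -/
def weight [Field F] (f z : Fin m → F) : F := ∑ i, f i * z i

/-- The tensor `∑ i, e_i ⊗ P_i` is a sum of `m` terms `z t ⊗ (x t)^{⊗(k+1)}` with both `z` and `x`
linearly independent, on which the functionals `f` and `g` are in general position. -/
structure GenericDecomposition [Field F] (P : Fin m → Tensor (k + 1) ι F) (f g : Fin m → F)
    (z : Fin m → Fin m → F) (x : Fin m → ι → F) : Prop where
  left_li : LinearIndependent F z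
  right_li : LinearIndependent F x
  eq : ∀ i q, P i q = ∑ t, z t i * tensorPower (k + 1) (x t) q
  left_ne : ∀ t, weight f (z t) ≠ 0
  right_ne : ∀ t, weight g (z t) ≠ 0
  ratio_injective : Function.Injective fun t => weight f (z t) / weight g (z t)

/-- The matrix with columns `x t`. -/
def colMatrix {κ : Type*} (x : κ → ι → F) : Matrix ι κ F := Matrix.of fun y t => x t y

theorem exists_colMatrix_left_inverse [Field F] [Fintype ι] {κ : Type*} [Fintype κ]
    [DecidableEq κ] {x : κ → ι → F} (hx : LinearIndependent F x) :
    ∃ A' : Matrix κ ι F, A' * colMatrix x = 1 := by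
  obtain ⟨χ, hχ⟩ := exists_dual_family hx
  exact ⟨Matrix.of χ, by ext s t; simp [Matrix.mul_apply, colMatrix, hχ, Matrix.one_apply]⟩

/-- The two outer factors do not depend on `f`: all contractions are diagonalized simultaneously. -/
theorem contract_stack_eq [Field F] {P : Fin m → Tensor (k + 1) ι F} {z : Fin m → Fin m → F}
    {x : Fin m → ι → F} (h : ∀ i q, P i q = ∑ t, z t i * tensorPower (k + 1) (x t) q)
    (f : Fin m → F) :
    contract (stack P) f = colMatrix x * Matrix.diagonal (fun t => weight f (z t)) *
      (colMatrix fun t => tensorPower k (x t))ᵀ := by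
  ext y q
  rw [Matrix.mul_apply]
  simp only [contract, stack, Matrix.of_apply, h, Matrix.mul_diagonal, colMatrix,
    Matrix.transpose_apply, tensorPower_cons, weight, Finset.mul_sum, Finset.sum_mul]
  rw [Finset.sum_comm]
  exact Finset.sum_congr rfl fun t _ => Finset.sum_congr rfl fun i _ => by ring

variable [RCLike F] [Fintype ι] {P : Fin m → Tensor (k + 1) ι F} {f g : Fin m → F}
  {z : Fin m → Fin m → F} {x : Fin m → ι → F}

theorem GenericDecomposition.first_mul (H : GenericDecomposition P f g z x) (hk : k ≠ 0)
    {G : Matrix (Fin k → ι) ι F}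
    (hG : contract (stack P) g * G * contract (stack P) g = contract (stack P) g) :
    contract (stack P) f * G * colMatrix x =
      colMatrix x * Matrix.diagonal fun t => weight f (z t) / weight g (z t) := by
  classical
  obtain ⟨A', hA⟩ := exists_colMatrix_left_inverse H.right_li
  obtain ⟨B', hB⟩ := exists_colMatrix_left_inverse (linearIndependent_tensorPower hk H.right_li)
  have hB' := congrArg Matrix.transpose hB
  rw [Matrix.transpose_mul, Matrix.transpose_one] at hB'
  rw [contract_stack_eq H.eq g] at hG
  rw [contract_stack_eq H.eq f]
  exact factored_mul_generalized_inverse_mul hA hB' H.right_ne hG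

/-- Transposition exchanges the roles of the `x t` and of their powers, and of `f` and `g`. -/
theorem GenericDecomposition.second_mul (H : GenericDecomposition P f g z x) (hk : k ≠ 0)
    {G : Matrix (Fin k → ι) ι F} (hG : IsMoorePenrose (contract (stack P) f) G) :
    (G * contract (stack P) g)ᵀ * (colMatrix fun t => tensorPower k (x t)) =
      (colMatrix fun t => tensorPower k (x t)) *
        Matrix.diagonal fun t => weight g (z t) / weight f (z t) := by
  classical
  obtain ⟨A', hA⟩ := exists_colMatrix_left_inverse H.right_li
  obtain ⟨B', hB⟩ := exists_colMatrix_left_inverse (linearIndependent_tensorPower hk H.right_li)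
  have hA' := congrArg Matrix.transpose hA
  rw [Matrix.transpose_mul, Matrix.transpose_one] at hA'
  have h1 := congrArg Matrix.transpose hG.1
  have ht : ∀ D : Fin m → F, (colMatrix x * Matrix.diagonal D *
      (colMatrix fun t => tensorPower k (x t))ᵀ)ᵀ =
      (colMatrix fun t => tensorPower k (x t)) * Matrix.diagonal D * (colMatrix x)ᵀ := fun D => by
    simp only [Matrix.transpose_mul, Matrix.transpose_transpose, Matrix.diagonal_transpose,
      Matrix.mul_assoc]
  rw [Matrix.transpose_mul, Matrix.transpose_mul, ← Matrix.mul_assoc, contract_stack_eq H.eq f,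
    ht] at h1
  rw [Matrix.transpose_mul, contract_stack_eq H.eq g, ht]
  exact factored_mul_generalized_inverse_mul hB hA' H.left_ne h1

theorem GenericDecomposition.rank_first (H : GenericDecomposition P f g z x) (hk : k ≠ 0)
    {G : Matrix (Fin k → ι) ι F} (hG : IsMoorePenrose (contract (stack P) g) G) :
    (contract (stack P) f * G).rank = m := by
  classical
  obtain ⟨A', hA⟩ := exists_colMatrix_left_inverse H.right_li
  refine (rank_eq_card_of_factored (A := colMatrix x)
    (N := Matrix.diagonal (fun t => weight f (z t)) *
      (colMatrix fun t => tensorPower k (x t))ᵀ * G) ?_ hA (H.first_mul hk hG.1)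
    fun t => div_ne_zero (H.left_ne t) (H.right_ne t)).trans (Fintype.card_fin m)
  rw [contract_stack_eq H.eq f]; simp only [Matrix.mul_assoc]

theorem GenericDecomposition.rank_second (H : GenericDecomposition P f g z x) (hk : k ≠ 0)
    {G : Matrix (Fin k → ι) ι F} (hG : IsMoorePenrose (contract (stack P) f) G) :
    (G * contract (stack P) g).rank = m := by
  classical
  obtain ⟨B', hB⟩ := exists_colMatrix_left_inverse (linearIndependent_tensorPower hk H.right_li)
  rw [← Matrix.rank_transpose]
  refine (rank_eq_card_of_factored (A := colMatrix fun t => tensorPower k (x t))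
    (N := (G * colMatrix x * Matrix.diagonal (fun t => weight g (z t)))ᵀ) ?_ hB
    (H.second_mul hk hG) fun t => div_ne_zero (H.right_ne t) (H.left_ne t)).trans
    (Fintype.card_fin m)
  rw [contract_stack_eq H.eq g]
  simp only [Matrix.transpose_mul, Matrix.transpose_transpose, Matrix.mul_assoc]

theorem mul_colMatrix_col {κ β : Type*} [Fintype κ] [Fintype β] [DecidableEq κ]
    {M : Matrix β β F} {v : κ → β → F}
    {ρ : κ → F} (h : M * colMatrix v = colMatrix v * Matrix.diagonal ρ) (t : κ) :
    M *ᵥ v t = ρ t • v t := by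
  ext y
  have := congrFun (congrFun h y) t
  rw [Matrix.mul_diagonal] at this
  simpa [Matrix.mul_apply, colMatrix, Matrix.mulVec, dotProduct, mul_comm] using this

theorem GenericDecomposition.firstEigen (H : GenericDecomposition P f g z x) (hk : k ≠ 0) :
    FirstEigen (stack P) f g m (fun t => weight f (z t) / weight g (z t)) x := by
  classical
  obtain ⟨G, hG⟩ := exists_isMoorePenrose (contract (stack P) g)
  exact ⟨G, hG, H.rank_first hk hG, H.ratio_injective, fun t =>
    ⟨div_ne_zero (H.left_ne t) (H.right_ne t), H.right_li.ne_zero t,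
      mul_colMatrix_col (H.first_mul hk hG.1) t⟩⟩

/-- The number of eigenvectors is the rank, that is `m`; each non-zero eigenvalue is one of the
distinct ratios, so its eigenvector is a multiple of one `x t`. The injection `s` records which. -/
theorem GenericDecomposition.firstEigen_eq (H : GenericDecomposition P f g z x) (hk : k ≠ 0)
    {L : ℕ} {lam : Fin L → F} {v : Fin L → ι → F} (h : FirstEigen (stack P) f g L lam v) :
    L = m ∧ ∃ s : Fin L → Fin m, Function.Injective s ∧
      (∀ a, lam a = weight f (z (s a)) / weight g (z (s a))) ∧
      ∀ a, ∃ c : F, c ≠ 0 ∧ v a = c • x (s a) := by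
  classical
  obtain ⟨G, hG, hL, hlam, hv⟩ := h
  obtain ⟨A', hA⟩ := exists_colMatrix_left_inverse H.right_li
  refine ⟨hL.symm.trans (H.rank_first hk hG), ?_⟩
  have h1 : ∀ a, ∃ t, lam a = weight f (z t) / weight g (z t) ∧
      ∃ c : F, c ≠ 0 ∧ v a = c • x t := fun a =>
    eigenvector_eq_smul_col (A := colMatrix x)
      (N := Matrix.diagonal (fun t => weight f (z t)) *
        (colMatrix fun t => tensorPower k (x t))ᵀ * G)
      (by rw [contract_stack_eq H.eq f]; simp only [Matrix.mul_assoc])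
      hA (H.first_mul hk hG.1) H.ratio_injective (hv a).2.1 (hv a).1 (hv a).2.2
  choose s hs hc using h1
  refine ⟨s, fun a b hab => hlam ?_, hs, hc⟩
  rw [hs, hs, hab]

theorem GenericDecomposition.secondEigen_eq (H : GenericDecomposition P f g z x) (hk : k ≠ 0)
    {L : ℕ} {lam : Fin L → F} {s : Fin L → Fin m}
    (hs : ∀ a, lam a = weight f (z (s a)) / weight g (z (s a))) {w : Fin L → (Fin k → ι) → F}
    (h : SecondEigen (stack P) f g L lam w) (a : Fin L) :
    ∃ c : F, c ≠ 0 ∧ w a = c • tensorPower k (x (s a)) := by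
  classical
  obtain ⟨G, hG, -, hw⟩ := h
  obtain ⟨B', hB⟩ := exists_colMatrix_left_inverse (linearIndependent_tensorPower hk H.right_li)
  have hinj : Function.Injective fun t => weight g (z t) / weight f (z t) := fun t u htu => by
    apply H.ratio_injective
    have := congrArg Inv.inv htu
    simpa only [inv_div] using this
  have hla : (lam a)⁻¹ = weight g (z (s a)) / weight f (z (s a)) := by rw [hs, inv_div]
  obtain ⟨t, ht, c, hc, hwc⟩ := eigenvector_eq_smul_col
    (A := colMatrix fun t => tensorPower k (x t))
    (N := (G * colMatrix x * Matrix.diagonal (fun t => weight g (z t)))ᵀ)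
    (by
      rw [contract_stack_eq H.eq g]
      simp only [Matrix.transpose_mul, Matrix.transpose_transpose, Matrix.mul_assoc]) hB
      (H.second_mul hk hG) hinj (hw a).1
    (by rw [hla]; exact div_ne_zero (H.right_ne _) (H.left_ne _)) (hw a).2
  have : t = s a := hinj (ht.symm.trans hla)
  subst this
  exact ⟨c, hc, hwc⟩

theorem GenericDecomposition.secondEigen (H : GenericDecomposition P f g z x) (hk : k ≠ 0)
    {lam : Fin m → F} {s : Fin m → Fin m}
    (hs : ∀ a, lam a = weight f (z (s a)) / weight g (z (s a))) :
    SecondEigen (stack P) f g m lam fun a => tensorPower k (x (s a)) := by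
  obtain ⟨G, hG⟩ := exists_isMoorePenrose (contract (stack P) f)
  refine ⟨G, hG, H.rank_second hk hG, fun a =>
    ⟨(linearIndependent_tensorPower hk H.right_li).ne_zero _, ?_⟩⟩
  rw [hs, inv_div]
  exact mul_colMatrix_col (H.second_mul hk hG) (s a)

/-- On a tensor with a decomposition in general position, the simultaneous diagonalization
algorithm returns the terms of this decomposition. -/
theorem GenericDecomposition.simDiag (H : GenericDecomposition P f g z x) (hk : k ≠ 0)
    {out : SimDiagOutput (Fin m) ι (Fin k → ι) F} (h : SimDiag (stack P) f g out) :
    ∃ (s : Equiv.Perm (Fin m)) (a : Fin m → Fin m → F) (b : Fin m → ι → F)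
      (c : Fin m → (Fin k → ι) → F), out = .decomposition m a b c ∧
      ∀ t i y q, a t i * b t y * c t q =
        z (s t) i * tensorPower (k + 1) (x (s t)) (Fin.cons y q) := by
  classical
  have dual : ∀ {L : ℕ} {lam : Fin L → F} {u : Fin L → Fin m → F} {v : Fin L → ι → F}
      {w : Fin L → (Fin k → ι) → F}, FirstEigen (stack P) f g L lam v →
      SecondEigen (stack P) f g L lam w → DualContraction (stack P) L u v w →
      L = m ∧ ∃ s : Fin L → Fin m, Function.Injective s ∧
        (∀ a, ∃ c : F, c ≠ 0 ∧ u a = c • z (s a)) ∧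
        ∀ t i y q, u t i * v t y * w t q =
          z (s t) i * tensorPower (k + 1) (x (s t)) (Fin.cons y q) := by
    intro L lam u v w hv hw hu
    obtain ⟨rfl, s, hsinj, hs, hvs⟩ := H.firstEigen_eq hk hv
    have hws := H.secondEigen_eq hk hs hw
    choose c hc hvc using hvs
    choose c' hc' hwc using hws
    obtain ⟨h, hh, hu⟩ := hu
    have hsurj := Finite.surjective_of_injective hsinj
    -- The functionals are dual to `c b • x ⊗ c' b • x^{⊗k}`, so on the unscaled products they give
    -- the reciprocals. The scalars then reappear in `u` and cancel in `u ⊗ v ⊗ w`.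
    have hval : ∀ a b, ∑ y, ∑ q, h a y q * (x (s b) y * tensorPower k (x (s b)) q) =
        if a = b then (c b * c' b)⁻¹ else 0 := fun a b => by
      have h1 := hh a b
      rw [hvc, hwc] at h1
      have h2 : c b * c' b ≠ 0 := mul_ne_zero (hc b) (hc' b)
      rw [← mul_right_inj' h2, Finset.mul_sum]
      simp only [Finset.mul_sum]
      rw [mul_ite, mul_inv_cancel₀ h2, mul_zero, ← h1]
      refine Finset.sum_congr rfl fun y _ => Finset.sum_congr rfl fun q _ => ?_
      simp only [Pi.smul_apply, smul_eq_mul]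
      ring
    have huz : ∀ a, u a = (c a * c' a)⁻¹ • z (s a) := fun a => by
      ext i
      rw [hu]
      have h3 : ∀ y q, h a y q * stack P i y q =
          ∑ b, z (s b) i * (h a y q * (x (s b) y * tensorPower k (x (s b)) q)) := fun y q => by
        rw [stack, H.eq, Finset.mul_sum,
          ← (Equiv.ofBijective s ⟨hsinj, hsurj⟩).sum_comp]
        refine Finset.sum_congr rfl fun b _ => ?_
        rw [tensorPower_cons]
        change h a y q * (z (s b) i * (x (s b) y * tensorPower k (x (s b)) q)) = _
        ring
      simp only [h3]
      have h4 : ∑ y, ∑ q, ∑ b, z (s b) i * (h a y q * (x (s b) y * tensorPower k (x (s b)) q)) =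
          ∑ b, z (s b) i * ∑ y, ∑ q, h a y q * (x (s b) y * tensorPower k (x (s b)) q) := by
        simp only [Finset.mul_sum]
        rw [Finset.sum_comm' (t' := Finset.univ) (s' := fun _ => Finset.univ) (by simp)]
        rw [Finset.sum_comm]
        conv_rhs => rw [Finset.sum_comm]
        refine Finset.sum_congr rfl fun y _ => ?_
        rw [Finset.sum_comm]
      rw [h4]
      simp [hval, mul_comm]
    refine ⟨rfl, s, hsinj, fun a => ⟨_, inv_ne_zero (mul_ne_zero (hc a) (hc' a)), huz a⟩, ?_⟩
    intro t i y q
    rw [huz, hvc, hwc, tensorPower_cons]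
    simp only [Pi.smul_apply, smul_eq_mul]
    have := hc t
    have := hc' t
    field_simp
  cases h with
  | repeated h => exact absurd ⟨_, _, _, H.firstEigen hk⟩ h
  | mismatch L lam v hv h =>
    obtain ⟨rfl, s, -, hs, -⟩ := H.firstEigen_eq hk hv
    exact absurd ⟨_, H.secondEigen hk hs⟩ h
  | parallel L lam u v w hv hw hu h =>
    obtain ⟨rfl, s, hsinj, huz, -⟩ := dual hv hw hu
    obtain ⟨a, b, hab, hspan⟩ := h
    obtain ⟨c, hc, ha⟩ := huz a
    obtain ⟨c', hc', hb⟩ := huz b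
    have h1 : z (s a) ∈ Submodule.span F (z '' {s b}) := by
      rw [Set.image_singleton]
      rw [ha, hb] at hspan
      rw [Submodule.mem_span_singleton] at hspan ⊢
      obtain ⟨t, ht⟩ := hspan
      refine ⟨c⁻¹ * (t * c'), ?_⟩
      rw [mul_smul, mul_smul, ht, smul_smul, inv_mul_cancel₀ hc, one_smul]
    exact absurd h1 (H.left_li.notMem_span_image fun h => hab (hsinj h))
  | success L lam u v w hv hw hu h =>
    obtain ⟨rfl, s, hsinj, -, hterm⟩ := dual hv hw hu
    exact ⟨Equiv.ofBijective s ⟨hsinj, Finite.surjective_of_injective hsinj⟩, u, v, w, rfl, hterm⟩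

/-- The Moore-Penrose inverse does not raise the rank. -/
theorem IsMoorePenrose.rank_le {β γ : Type*} [Fintype β] [Fintype γ] {A : Matrix β γ F}
    {B : Matrix γ β F} (h : IsMoorePenrose A B) : B.rank ≤ A.rank := by
  rw [← h.2.1]
  exact (Matrix.rank_mul_le_left _ _).trans (Matrix.rank_mul_le_right _ _)

theorem ne_zero_of_card_le_rank_diagonal {w : Fin m → F} (h : m ≤ (Matrix.diagonal w).rank)
    (t : Fin m) : w t ≠ 0 := by
  classical
  rw [Matrix.rank_diagonal] at h
  intro ht
  have := Fintype.card_subtype_lt (p := fun i => w i ≠ 0) (x := t) (by simp [ht])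
  rw [Fintype.card_fin] at this
  omega

/-- A converse to the uniqueness result: a successful run on such a decomposition proves that the
functionals were in general position. The rank `m` of `T(f) T(g)⁺` bounds the ranks of both diagonal
factors from below, so no weight vanishes; and `m` distinct eigenvalues found among `m` ratios
exhaust them. -/
theorem SimDiag.genericDecomposition {L : ℕ} {a : Fin L → Fin m → F} {b : Fin L → ι → F}
    {c : Fin L → (Fin k → ι) → F} (h : SimDiag (stack P) f g (.decomposition L a b c))
    {z : Fin L → Fin m → F} {x : Fin L → ι → F} (hzx : IsPowerDecomposition P L a b c z x)
    (hk : k ≠ 0) : ∃ hL : L = m, GenericDecomposition P f g (z ∘ Fin.cast hL.symm)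
      (x ∘ Fin.cast hL.symm) := by
  classical
  obtain ⟨rfl, hz, hx, -, hP⟩ := hzx
  refine ⟨rfl, ?_⟩
  change GenericDecomposition P f g z x
  cases h with
  | success _ lam _ _ _ hv =>
  obtain ⟨G, hG, hrank, hlam, hv⟩ := hv
  obtain ⟨A', hA⟩ := exists_colMatrix_left_inverse hx
  obtain ⟨B', hB⟩ := exists_colMatrix_left_inverse (linearIndependent_tensorPower hk hx)
  have hB' := congrArg Matrix.transpose hB
  rw [Matrix.transpose_mul, Matrix.transpose_one] at hB'
  have hf : ∀ t, weight f (z t) ≠ 0 := ne_zero_of_card_le_rank_diagonal <| by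
    conv_lhs => rw [← hrank, contract_stack_eq hP]
    exact ((Matrix.rank_mul_le_left _ _).trans (Matrix.rank_mul_le_left _ _)).trans
      (Matrix.rank_mul_le_right _ _)
  have hg : ∀ t, weight g (z t) ≠ 0 := ne_zero_of_card_le_rank_diagonal <| by
    conv_lhs => rw [← hrank]
    refine ((Matrix.rank_mul_le_right _ _).trans hG.rank_le).trans ?_
    rw [contract_stack_eq hP]
    exact (Matrix.rank_mul_le_left _ _).trans (Matrix.rank_mul_le_right _ _)
  have h1 := hG.1
  rw [contract_stack_eq hP] at h1
  have hMA := factored_mul_generalized_inverse_mul (f := fun t => weight f (z t)) hA hB' hg h1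
  rw [← contract_stack_eq hP] at hMA
  have hex : ∀ a, ∃ t, weight f (z t) / weight g (z t) = lam a := fun a => by
    obtain ⟨y, -, hy, hρ⟩ := exists_eigenvector_coordinates (A := colMatrix x)
      (N := Matrix.diagonal (fun t => weight f (z t)) *
        (colMatrix fun t => tensorPower k (x t))ᵀ * G)
      (by rw [contract_stack_eq hP]; simp only [Matrix.mul_assoc]) hA hMA (hv a).2.1 (hv a).1
      (hv a).2.2
    obtain ⟨t, ht⟩ := Function.ne_iff.1 hy
    exact ⟨t, mul_right_cancel₀ ht (hρ t)⟩
  choose s hs using hex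
  have hsinj : Function.Injective s := fun a b hab => hlam (by rw [← hs, ← hs, hab])
  refine ⟨hz, hx, hP, hf, hg, fun t u htu => ?_⟩
  obtain ⟨a, rfl⟩ := Finite.surjective_of_injective hsinj t
  obtain ⟨b, rfl⟩ := Finite.surjective_of_injective hsinj u
  simp only [hs] at htu
  rw [hlam htu]

theorem FirstEigen.linearIndependent {α β γ : Type*} [Fintype α] [Fintype β] [Fintype γ]
    {T : α → β → γ → F} {f g : α → F} {L : ℕ} {lam : Fin L → F} {v : Fin L → β → F}
    (h : FirstEigen T f g L lam v) : LinearIndependent F v := by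
  classical
  obtain ⟨B, -, -, hlam, hv⟩ := h
  refine Module.End.eigenvectors_linearIndependent' (Matrix.toLin' (contract T f * B)) lam hlam v
    fun a => ⟨?_, (hv a).2.1⟩
  rw [Module.End.mem_eigenspace_iff, Matrix.toLin'_apply]
  exact (hv a).2.2

/-- Independence of the `v a` alone suffices: take `χ a` from a dual family of `v`, tensored with a
multiple of a coordinate at which `w a` does not vanish. Thus the last stage of the subroutine can
always be carried out. -/
theorem exists_dualContraction {α β γ : Type*} [Fintype β] [Fintype γ]
    (T : α → β → γ → F) {L : ℕ} {v : Fin L → β → F} (hv : LinearIndependent F v)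
    {w : Fin L → γ → F} (hw : ∀ a, w a ≠ 0) : ∃ u, DualContraction T L u v w := by
  classical
  obtain ⟨χ, hχ⟩ := exists_dual_family hv
  choose z₀ hz₀ using fun a => Function.ne_iff.1 (hw a)
  refine ⟨_, fun a y z => χ a y * Pi.single (M := fun _ => F) (z₀ a) (w a (z₀ a))⁻¹ z, ?_,
    fun _ _ => rfl⟩
  intro a b
  have h1 : ∑ y, ∑ z, χ a y * Pi.single (M := fun _ => F) (z₀ a) (w a (z₀ a))⁻¹ z *
      (v b y * w b z) = (∑ y, χ a y * v b y) *
        ∑ z, Pi.single (M := fun _ => F) (z₀ a) (w a (z₀ a))⁻¹ z * w b z := by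
    rw [Finset.sum_mul_sum]
    exact Finset.sum_congr rfl fun y _ => Finset.sum_congr rfl fun z _ => by ring
  rw [h1, hχ, Finset.sum_eq_single (z₀ a) (fun z _ hz => by simp [Pi.single_eq_of_ne hz])
    (by simp)]
  split_ifs with hab
  · subst hab
    simpa using inv_mul_cancel₀ (hz₀ a)
  · simp

/-- The relation between runs and outputs allows many orders and scalings; for the program, the list
with exactly these representatives in this order must be among them. The branch of parallel vectors
is impossible by uniqueness. -/
theorem GenericDecomposition.algorithm1Run {R : ℕ} {θ η : Fin R → F} (hm : 0 < m) (hR : m ≤ R)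
    (H : GenericDecomposition P (θ ∘ Fin.castLE hR) (η ∘ Fin.castLE hR) z x) (hk : k ≠ 0) :
    Algorithm1Run P θ η (.only (List.ofFn x)) := by
  classical
  have hv := H.firstEigen hk
  have hw := H.secondEigen (s := id) hk fun _ => rfl
  obtain ⟨u, hu⟩ := exists_dualContraction (stack P) H.right_li
    (linearIndependent_tensorPower hk H.right_li).ne_zero
  have hout : SimDiag (stack P) (θ ∘ Fin.castLE hR) (η ∘ Fin.castLE hR)
      (.decomposition m u x fun t => tensorPower k (x t)) := by
    refine .success m _ u x _ hv hw hu ?_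
    by_contra! h
    obtain ⟨s, a, b, c, hfail, -⟩ := H.simDiag hk (.parallel m _ u x _ hv hw hu h)
    cases hfail
  obtain ⟨s, a, b, c, heq, hterm⟩ := H.simDiag hk hout
  cases heq
  -- The terms were built from `x t` itself; a term equal to that of another index would make two of
  -- the independent powers proportional.
  have hs : ∀ t, s t = t := fun t => by
    by_contra hne
    obtain ⟨i, hi⟩ := Function.ne_iff.1 (H.left_li.ne_zero (s t))
    have hX := linearIndependent_tensorPower k.succ_ne_zero H.right_li
    refine hX.notMem_span_image (s := {t}) (x := s t) (by simpa using hne) ?_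
    rw [Set.image_singleton, Submodule.mem_span_singleton]
    refine ⟨(z (s t) i)⁻¹ * u t i, ?_⟩
    ext q
    have := hterm t i (q 0) (Fin.tail q)
    rw [Fin.cons_self_tail, mul_assoc, ← tensorPower_cons, Fin.cons_self_tail] at this
    simp only [Pi.smul_apply, smul_eq_mul]
    rw [mul_assoc, this, inv_mul_cancel_left₀ hi]
  simp only [hs] at hterm
  exact .found hm hR m u x _ hout z x ⟨rfl, H.left_li, H.right_li, hterm, H.eq⟩

/-- Follow the algorithm until a test fails. If the subroutine succeeds, its terms cannot form a
decomposition into independent powers, because this would put the functionals in general position.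
-/
theorem algorithm1Run_fail {R : ℕ} {θ η : Fin R → F} (hm : 0 < m) (hR : m ≤ R) (hk : k ≠ 0)
    (h : ¬ ∃ z x, GenericDecomposition P (θ ∘ Fin.castLE hR) (η ∘ Fin.castLE hR) z x) :
    Algorithm1Run P θ η .fail := by
  classical
  by_cases h1 : ∃ L lam v, FirstEigen (stack P) (θ ∘ Fin.castLE hR) (η ∘ Fin.castLE hR) L lam v
  swap
  · exact .noDecomposition hm hR (.repeated h1)
  obtain ⟨L, lam, v, hv⟩ := h1
  by_cases h2 : ∃ w, SecondEigen (stack P) (θ ∘ Fin.castLE hR) (η ∘ Fin.castLE hR) L lam w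
  swap
  · exact .noDecomposition hm hR (.mismatch L lam v hv h2)
  obtain ⟨w, hw⟩ := h2
  obtain ⟨u, hu⟩ := exists_dualContraction (stack P) hv.linearIndependent
    (w := w) (by obtain ⟨B, -, -, hB⟩ := hw; exact fun a => (hB a).1)
  by_cases h3 : ∃ a b, a ≠ b ∧ u a ∈ Submodule.span F {u b}
  · exact .noDecomposition hm hR (.parallel L lam u v w hv hw hu h3)
  push Not at h3
  have hs := SimDiag.success L lam u v w hv hw hu h3
  refine .notPowers hm hR L u v w hs ?_
  rintro ⟨z, x, hzx⟩
  obtain ⟨hL, H⟩ := hs.genericDecomposition hzx hk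
  exact h ⟨_, _, H⟩

/-- On a tensor with a decomposition in general position, Algorithm 1 lists the vectors of this
decomposition. -/
theorem GenericDecomposition.output_eq {R : ℕ} {θ η : Fin R → F} (hm : 0 < m) (hR : m ≤ R)
    (H : GenericDecomposition P (θ ∘ Fin.castLE hR) (η ∘ Fin.castLE hR) z x) (hk : k ≠ 0)
    {out : Output ι F} (h : Algorithm1Run P θ η out) :
    ∃ (s : Equiv.Perm (Fin m)) (c : Fin m → F), (∀ t, c t ≠ 0) ∧
      out = .only (List.ofFn fun t => c t • x (s t)) := by
  classical
  cases h with
  | trivial h => omega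
  | tooMany h => omega
  | noDecomposition _ _ h =>
    obtain ⟨s, a, b, c, hfail, -⟩ := H.simDiag hk h
    cases hfail
  | notPowers _ _ L a b c h hzx =>
    obtain ⟨s, a, b, c, heq, hterm⟩ := H.simDiag hk h
    cases heq
    refine absurd ⟨z ∘ s, x ∘ s, rfl, H.left_li.comp _ s.injective, H.right_li.comp _ s.injective,
      hterm, fun i q => ?_⟩ hzx
    rw [H.eq]
    exact (Equiv.sum_comp s fun t => z t i * tensorPower (k + 1) (x t) q).symm
  | found _ _ L a b c h z' x' hzx =>
    obtain ⟨s, a, b, c, heq, hterm⟩ := H.simDiag hk h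
    cases heq
    obtain ⟨-, hz', hx', hterm', -⟩ := hzx
    have hc : ∀ t, ∃ c : F, c ≠ 0 ∧ x' t = c • x (s t) := fun t => by
      obtain ⟨i, hi⟩ := Function.ne_iff.1 (hz'.ne_zero t)
      have h1 : tensorPower (k + 1) (x' t) =
          ∑ u, Pi.single (M := fun _ => F) (s t) ((z' t i)⁻¹ * z (s t) i) u •
            tensorPower (k + 1) (x u) := by
        rw [Finset.sum_eq_single (s t) (fun u _ hu => by simp [Pi.single_eq_of_ne hu]) (by simp)]
        ext q
        have := hterm' t i (q 0) (Fin.tail q)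
        rw [hterm, Fin.cons_self_tail] at this
        simp only [Pi.single_eq_same, Pi.smul_apply, smul_eq_mul]
        rw [mul_assoc, this, inv_mul_cancel_left₀ hi]
      rcases exists_eq_smul_of_tensorPower_eq_sum hk H.right_li h1 with h0 | ⟨u, hu, c, hc⟩
      · exact absurd h0 (hx'.ne_zero t)
      · have hus : u = s t := by
          by_contra hne
          exact hu (by simp [Pi.single_eq_of_ne hne])
        subst hus
        refine ⟨c, fun h0 => hx'.ne_zero t ?_, hc⟩
        rw [hc, h0, zero_smul]
    choose c hc hxc using hc
    exact ⟨s, c, hc, congrArg _ (congrArg _ (funext hxc))⟩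

end GenericDecomposition

/-! ## Correctness of the messages of Algorithm 1 -/

section Certification

variable {F : Type*} [RCLike F] {r n₁ n₂ R p m : ℕ}

theorem algorithm1_trivial_correct
    (e : Fin p ≃ (Fin (r + 1) ↪o Fin n₁) × (Fin (r + 1) ↪o Fin n₂))
    {u : Fin R → Fin n₁ × Fin n₂ → F} {P : Fin m → Tensor (r + 1) (Fin n₁ × Fin n₂) F}
    {θ η : Fin R → F} (h : Algorithm1 (minors F e) u P θ η .trivial) {w : Fin n₁ × Fin n₂ → F}
    (hw : w ∈ Submodule.span F (Set.range u)) (hwr : w ∈ rankVariety F n₁ n₂ r) : w = 0 := by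
  obtain ⟨⟨-, hspan⟩, hrun⟩ := h
  have hm : m = 0 := by cases hrun; assumption
  subst hm
  have h1 : tensorPower (r + 1) w ∈ Submodule.span F (Set.range P) :=
    hspan ▸ ⟨tensorPower_mem_symPower hw, (tensorPower_mem_annihilator_iff e w).2 hwr⟩
  rw [Set.range_eq_empty, Submodule.span_empty, Submodule.mem_bot] at h1
  ext q
  have := congrFun h1 fun _ => q
  simpa [tensorPower] using this

/-- The coefficient matrix is square with independent rows, so the relation between `P` and `X` can
be inverted. -/
theorem span_eq_span_of_decomposition {τ : Type*} {P : Fin m → τ → F}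
    {z : Fin m → Fin m → F} (hz : LinearIndependent F z) {X : Fin m → τ → F}
    (hP : ∀ i q, P i q = ∑ t, z t i * X t q) :
    Submodule.span F (Set.range P) = Submodule.span F (Set.range X) := by
  classical
  apply le_antisymm
  · rw [Submodule.span_le]
    rintro _ ⟨i, rfl⟩
    have : P i = ∑ t, z t i • X t := by
      ext q
      simp [hP]
    rw [this]
    exact Submodule.sum_mem _ fun t _ => Submodule.smul_mem _ _ (Submodule.subset_span ⟨t, rfl⟩)
  · obtain ⟨χ, hχ⟩ := exists_dual_family hz
    rw [Submodule.span_le]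
    rintro _ ⟨s, rfl⟩
    have : X s = ∑ i, χ s i • P i := by
      ext q
      simp only [Finset.sum_apply, Pi.smul_apply, smul_eq_mul, hP, Finset.mul_sum]
      rw [Finset.sum_comm]
      have h1 : ∀ t, ∑ i, χ s i * (z t i * X t q) = (if s = t then 1 else 0) * X t q := fun t => by
        rw [← hχ, Finset.sum_mul]
        exact Finset.sum_congr rfl fun i _ => by ring
      simp [h1]
    rw [this]
    exact Submodule.sum_mem _ fun t _ => Submodule.smul_mem _ _ (Submodule.subset_span ⟨t, rfl⟩)

/-- A subspace whose symmetric power meets the annihilator of the minors in the span of powers of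
independent vectors meets the determinantal variety in the lines spanned by these vectors. -/
theorem mem_inter_rankVariety_iff {κ : Type*} [Fintype κ] (hr : r ≠ 0)
    (e : Fin p ≃ (Fin (r + 1) ↪o Fin n₁) × (Fin (r + 1) ↪o Fin n₂))
    {U : Submodule F (Fin n₁ × Fin n₂ → F)} {x : κ → Fin n₁ × Fin n₂ → F}
    (hx : LinearIndependent F x)
    (h : symPower (r + 1) U ⊓ annihilator (r + 1) (minors F e) =
      Submodule.span F (Set.range fun t => tensorPower (r + 1) (x t)))
    (w : Fin n₁ × Fin n₂ → F) :
    (w ∈ U ∧ w ∈ rankVariety F n₁ n₂ r) ↔ w = 0 ∨ ∃ (t : κ) (c : F), w = c • x t := by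
  constructor
  · rintro ⟨hw, hwr⟩
    have h1 : tensorPower (r + 1) w ∈
        Submodule.span F (Set.range fun t => tensorPower (r + 1) (x t)) :=
      h ▸ ⟨tensorPower_mem_symPower hw, (tensorPower_mem_annihilator_iff e w).2 hwr⟩
    rw [Submodule.mem_span_range_iff_exists_fun] at h1
    obtain ⟨a, ha⟩ := h1
    rcases exists_eq_smul_of_tensorPower_eq_sum hr hx ha.symm with h0 | ⟨t, -, c, hc⟩
    · exact Or.inl h0
    · exact Or.inr ⟨t, c, hc⟩
  · have hmem : ∀ t, tensorPower (r + 1) (x t) ∈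
        symPower (r + 1) U ⊓ annihilator (r + 1) (minors F e) := fun t =>
      h ▸ Submodule.subset_span ⟨t, rfl⟩
    have hsmul : ∀ t (c : F), c • x t ∈ U ∧ c • x t ∈ rankVariety F n₁ n₂ r := fun t c => by
      refine ⟨U.smul_mem _ (mem_of_tensorPower_mem_symPower (hmem t).1), ?_⟩
      rw [← tensorPower_mem_annihilator_iff e, tensorPower_smul]
      exact Submodule.smul_mem _ _ (hmem t).2
    rintro (rfl | ⟨t, c, rfl⟩)
    · refine ⟨U.zero_mem, ?_⟩
      rw [← tensorPower_mem_annihilator_iff e]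
      have : tensorPower (r + 1) (0 : Fin n₁ × Fin n₂ → F) = 0 := by
        ext q; simp [tensorPower]
      rw [this]
      exact Submodule.zero_mem _
    · exact hsmul t c

theorem algorithm1_only_correct (hr : r ≠ 0)
    (e : Fin p ≃ (Fin (r + 1) ↪o Fin n₁) × (Fin (r + 1) ↪o Fin n₂))
    {u : Fin R → Fin n₁ × Fin n₂ → F} {P : Fin m → Tensor (r + 1) (Fin n₁ × Fin n₂) F}
    {θ η : Fin R → F} {xs : List (Fin n₁ × Fin n₂ → F)}
    (h : Algorithm1 (minors F e) u P θ η (.only xs)) (w : Fin n₁ × Fin n₂ → F) :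
    (w ∈ Submodule.span F (Set.range u) ∧ w ∈ rankVariety F n₁ n₂ r) ↔
      w = 0 ∨ ∃ x ∈ xs, ∃ t : F, w = t • x := by
  obtain ⟨⟨-, hspan⟩, hrun⟩ := h
  cases hrun with
  | found hm hR L a b c h z x hzx =>
    obtain ⟨rfl, hz, hx, -, hP⟩ := hzx
    rw [mem_inter_rankVariety_iff hr e hx
      (hspan.symm.trans
        (span_eq_span_of_decomposition (X := fun t => tensorPower (r + 1) (x t)) hz hP))]
    simp [List.mem_ofFn]

end Certification

/-! ## Homogeneous functionals on a polynomial ring -/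

section HomogeneousFunctionals

open MvPolynomial Module

variable {ι F : Type*} [Field F]

theorem exists_content_eq {e : ℕ} (m : ι →₀ ℕ) (hm : m.degree = e) :
    ∃ q : Fin e → ι, content q = m := by
  classical
  induction e generalizing m with
  | zero =>
    rw [Finsupp.degree_eq_zero_iff] at hm
    exact ⟨fun i => i.elim0, by simp [content, hm]⟩
  | succ e ih =>
    obtain ⟨y, hy⟩ : ∃ y, m y ≠ 0 := by
      by_contra! h
      have : m = 0 := Finsupp.ext h
      rw [this] at hm
      simp at hm
    have hle : Finsupp.single y 1 ≤ m := by
      rw [Finsupp.single_le_iff]; omega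
    obtain ⟨m', rfl⟩ := exists_add_of_le hle
    rw [map_add, Finsupp.degree_single] at hm
    obtain ⟨q, hq⟩ := ih m' (by omega)
    exact ⟨Fin.cons y q, by rw [← hq]; simp [content, Fin.sum_univ_succ]⟩

theorem prod_X_isHomogeneous {e : ℕ} (q : Fin e → ι) :
    (∏ t, (X (q t) : MvPolynomial ι F)).IsHomogeneous e := by
  have := IsHomogeneous.prod Finset.univ (fun t => (X (q t) : MvPolynomial ι F)) (fun _ => 1)
    fun t _ => isHomogeneous_X F (q t)
  simpa using this

/-- The linear form with coefficients `v`. -/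
noncomputable def linearForm [Fintype ι] (v : ι → F) : MvPolynomial ι F := ∑ y, C (v y) * X y

theorem linearForm_isHomogeneous [Fintype ι] (v : ι → F) : (linearForm v).IsHomogeneous 1 :=
  IsHomogeneous.sum _ _ _ fun y _ => isHomogeneous_C_mul_X (v y) y

theorem prod_linearForm [Fintype ι] {j : ℕ} (v : Fin j → ι → F) :
    ∏ t, linearForm (v t) = ∑ q : Fin j → ι, C (∏ t, v t (q t)) * ∏ t, X (q t) := by
  classical
  simp only [linearForm, Finset.prod_univ_sum, Fintype.piFinset_univ, Finset.prod_mul_distrib,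
    map_prod]

theorem linearForm_pow [Fintype ι] (v : ι → F) (j : ℕ) :
    linearForm v ^ j = ∑ q : Fin j → ι, C (∏ t, v (q t)) * ∏ t, X (q t) := by
  rw [← prod_linearForm fun _ => v]
  simp

/-- Linear functionals on polynomials that vanish outside degree `e`. -/
def homogeneousFunctionals (ι F : Type*) [Field F] (e : ℕ) :
    Submodule F (MvPolynomial ι F →ₗ[F] F) where
  carrier := {f | ∀ m : ι →₀ ℕ, m.degree ≠ e → f (monomial m 1) = 0}
  add_mem' := fun {f g} hf hg m hm => by rw [LinearMap.add_apply, hf m hm, hg m hm, add_zero]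
  zero_mem' := fun m _ => rfl
  smul_mem' := fun c f hf m hm => by rw [LinearMap.smul_apply, hf m hm, smul_zero]

theorem apply_eq_zero_of_isHomogeneous {e d : ℕ} {f : (MvPolynomial ι F →ₗ[F] F)}
    (hf : f ∈ homogeneousFunctionals ι F e) {p : MvPolynomial ι F} (hp : p.IsHomogeneous d)
    (hd : d ≠ e) : f p = 0 := by
  rw [p.as_sum, map_sum]
  refine Finset.sum_eq_zero fun m hm => ?_
  have h1 : m.degree = d := by
    by_contra hne
    exact mem_support_iff.1 hm (hp.coeff_eq_zero hne)
  have h2 : monomial m (coeff m p) = coeff m p • monomial m (1 : F) := by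
    rw [smul_monomial, smul_eq_mul, mul_one]
  rw [h2, map_smul, hf m (by omega), smul_zero]

instance (K : Submodule F (MvPolynomial ι F →ₗ[F] F)) : Module.Free F K :=
  Module.Free.of_divisionRing F K

/-- Contraction of functionals with the polynomial `p`. -/
noncomputable def contraction (p : MvPolynomial ι F) :
    (MvPolynomial ι F →ₗ[F] F) →ₗ[F] (MvPolynomial ι F →ₗ[F] F) :=
  LinearMap.lcomp F F (LinearMap.mulLeft F p)

theorem contraction_apply (p q : MvPolynomial ι F) (f : (MvPolynomial ι F →ₗ[F] F)) :
    contraction p f q = f (p * q) := rfl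

theorem contraction_mem {e j : ℕ} {f : (MvPolynomial ι F →ₗ[F] F)}
    (hf : f ∈ homogeneousFunctionals ι F e) {p : MvPolynomial ι F} (hp : p.IsHomogeneous j)
    (hj : j ≤ e) : contraction p f ∈ homogeneousFunctionals ι F (e - j) := fun m hm => by
  rw [contraction_apply]
  exact apply_eq_zero_of_isHomogeneous hf (hp.mul (isHomogeneous_monomial 1 rfl)) (by omega)

theorem contraction_eq_zero {e d : ℕ} {f : MvPolynomial ι F →ₗ[F] F}
    (hf : f ∈ homogeneousFunctionals ι F e) {p : MvPolynomial ι F} (hp : p.IsHomogeneous d)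
    (hd : e < d) : contraction p f = 0 := by
  refine MvPolynomial.basisMonomials ι F |>.ext fun m => ?_
  rw [coe_basisMonomials, LinearMap.zero_apply, contraction_apply]
  exact apply_eq_zero_of_isHomogeneous hf (hp.mul (isHomogeneous_monomial 1 rfl)) (by omega)

theorem functional_ext {e : ℕ} {f : (MvPolynomial ι F →ₗ[F] F)}
    (hf : f ∈ homogeneousFunctionals ι F e) (h : ∀ q : Fin e → ι, f (∏ t, X (q t)) = 0) :
    f = 0 := by
  refine MvPolynomial.basisMonomials ι F |>.ext fun m => ?_
  rw [coe_basisMonomials, LinearMap.zero_apply]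
  by_cases hm : m.degree = e
  · obtain ⟨q, rfl⟩ := exists_content_eq m hm
    change f (monomial (content q) 1) = 0
    rw [← monomial_content]
    exact h q
  · exact hf m hm

/-- Restriction of a functional to products of `e` variables. -/
noncomputable def evalProducts (ι F : Type*) [Field F] (e : ℕ) :
    (MvPolynomial ι F →ₗ[F] F) →ₗ[F] (Fin e → ι) → F :=
  LinearMap.pi fun q => LinearMap.applyₗ (∏ t, X (q t))

theorem evalProducts_injOn (e : ℕ) :
    Function.Injective ((evalProducts ι F e).domRestrict (homogeneousFunctionals ι F e)) := by
  refine (injective_iff_map_eq_zero _).2 ?_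
  rintro ⟨f, hf⟩ h
  exact Subtype.ext (functional_ext hf fun q => congrFun h q)

variable [Fintype ι]

instance (e : ℕ) : FiniteDimensional F (homogeneousFunctionals ι F e) :=
  Module.Finite.of_injective _ (evalProducts_injOn e)

theorem finrank_homogeneousFunctionals_le (e : ℕ) :
    finrank F (homogeneousFunctionals ι F e) ≤ Fintype.card ι ^ e := by
  refine (LinearMap.finrank_le_finrank_of_injective (evalProducts_injOn (ι := ι) (F := F) e)).trans
    ?_
  simp

theorem finiteDimensional_of_le_homogeneousFunctionals {e : ℕ}
    {K : Submodule F (MvPolynomial ι F →ₗ[F] F)} (hK : K ≤ homogeneousFunctionals ι F e) :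
    FiniteDimensional F K :=
  Submodule.finiteDimensional_of_le hK

/-! ### Polarization -/

/-- Expanded in `c`, the hypothesis says that a polynomial vanishes at all points of an infinite
field, so its coefficients vanish. The coefficient of the product of all variables is a positive
integer multiple of the value at `∏ a t`. -/
theorem apply_prod_eq_zero_of_pow [CharZero F] {A : Type*} [CommRing A] [Algebra F A] {j : ℕ}
    (f : A →ₗ[F] F) (a : Fin j → A) (h : ∀ c : Fin j → F, f ((∑ t, c t • a t) ^ j) = 0) :
    f (∏ t, a t) = 0 := by
  classical
  set G : MvPolynomial (Fin j) F :=
    ∑ π : Fin j → Fin j, monomial (content π) (f (∏ i, a (π i))) with hG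
  have hG0 : G = 0 := by
    refine MvPolynomial.funext fun c => ?_
    rw [map_zero, ← h c]
    have h1 : (∑ t, c t • a t) ^ j = ∑ π : Fin j → Fin j, (∏ i, c (π i)) • ∏ i, a (π i) := by
      have := Finset.prod_univ_sum (fun _ : Fin j => (Finset.univ : Finset (Fin j)))
        fun _ t => c t • a t
      rw [Finset.prod_const, Finset.card_univ, Fintype.card_fin, Fintype.piFinset_univ] at this
      rw [this]
      exact Finset.sum_congr rfl fun π _ => Finset.prod_smul _ _ _
    rw [h1, hG, map_sum, map_sum]
    refine Finset.sum_congr rfl fun π _ => ?_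
    have h2 : monomial (content π) (f (∏ i, a (π i))) =
        C (f (∏ i, a (π i))) * ∏ i, (X (π i) : MvPolynomial (Fin j) F) := by
      rw [monomial_content, C_mul_monomial, mul_one]
    rw [h2, map_smul, smul_eq_mul, map_mul, eval_C, map_prod (eval c), mul_comm]
    simp
  have h3 : coeff (content (id : Fin j → Fin j)) G = 0 := by rw [hG0, coeff_zero]
  rw [hG, coeff_sum] at h3
  simp only [coeff_monomial] at h3
  rw [← Finset.sum_filter] at h3
  have h4 : ∀ π ∈ Finset.univ.filter
      (fun π : Fin j → Fin j => content π = content (id : Fin j → Fin j)),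
      f (∏ i, a (π i)) = f (∏ i, a i) := fun π hπ => by
    obtain ⟨σ, rfl⟩ := (content_eq_iff _ _).1 (Finset.mem_filter.1 hπ).2
    congr 1
    exact Equiv.prod_comp σ a
  rw [Finset.sum_congr rfl h4, Finset.sum_const, nsmul_eq_mul] at h3
  refine (mul_eq_zero.1 h3).resolve_left ?_
  refine Nat.cast_ne_zero.2 (Finset.card_ne_zero.2 ?_)
  exact ⟨id, by simp⟩

/-- The set `S` contains all vectors with at most `j` non-zero entries. -/
def ContainsSparse (j : ℕ) (S : Set (ι → F)) : Prop :=
  ∀ v : ι → F, (Function.support v).ncard ≤ j → v ∈ S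

omit [Fintype ι] in
theorem ContainsSparse.mono {i j : ℕ} (hij : i ≤ j) {S : Set (ι → F)} (h : ContainsSparse j S) :
    ContainsSparse i S := fun v hv => h v (hv.trans hij)

theorem sum_smul_X_eq_linearForm {j : ℕ} (c : Fin j → F) (q : Fin j → ι) [DecidableEq ι] :
    ∑ t, c t • (X (q t) : MvPolynomial ι F) = linearForm (∑ t, Pi.single (q t) (c t)) := by
  simp only [linearForm, Finset.sum_apply, map_sum, Finset.sum_mul]
  rw [Finset.sum_comm]
  refine Finset.sum_congr rfl fun t _ => ?_
  rw [Finset.sum_eq_single (q t) (fun y _ hy => by simp [Pi.single_eq_of_ne hy]) (by simp),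
    Pi.single_eq_same, smul_eq_C_mul]

omit [Fintype ι] in
theorem ncard_support_sum_single_le {j : ℕ} (c : Fin j → F) (q : Fin j → ι) [DecidableEq ι] :
    (Function.support (∑ t, Pi.single (M := fun _ => F) (q t) (c t))).ncard ≤ j := by
  have h : Function.support (∑ t, Pi.single (M := fun _ => F) (q t) (c t)) ⊆ Set.range q := by
    intro y hy
    by_contra hne
    apply hy
    rw [Finset.sum_apply]
    refine Finset.sum_eq_zero fun t _ => Pi.single_eq_of_ne ?_ _
    rintro rfl
    exact hne ⟨t, rfl⟩
  refine (Set.ncard_le_ncard h (Set.toFinite _)).trans ?_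
  rw [← Set.image_univ]
  refine (Set.ncard_image_le (Set.toFinite _)).trans ?_
  simp

/-- Polarizing a product of `j` variables involves only powers of combinations of these variables,
that is, of vectors with at most `j` non-zero entries. This is why sparse vectors matter. -/
theorem functional_eq_zero_of_contraction_pow [CharZero F] {e j : ℕ} (hj : j ≤ e)
    {S : Set (ι → F)} (hS : ContainsSparse j S) {f : (MvPolynomial ι F →ₗ[F] F)}
    (hf : f ∈ homogeneousFunctionals ι F e)
    (h : ∀ v ∈ S, contraction (linearForm v ^ j) f = 0) : f = 0 := by
  classical
  obtain ⟨i, rfl⟩ := Nat.exists_eq_add_of_le hj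
  refine functional_ext hf fun q => ?_
  rw [Fin.prod_univ_add]
  set rest : MvPolynomial ι F := ∏ t : Fin i, X (q (Fin.natAdd j t))
  refine apply_prod_eq_zero_of_pow (f ∘ₗ LinearMap.mulRight F rest) _ fun c => ?_
  rw [sum_smul_X_eq_linearForm]
  have h1 := h _ (hS _ (ncard_support_sum_single_le c fun t => q (Fin.castAdd i t)))
  exact LinearMap.congr_fun h1 rest

theorem span_linearForm_pow_le (j : ℕ) (S : Set (ι → F)) :
    Submodule.span F ((fun v => linearForm v ^ j) '' S) ≤
      Submodule.span F (Set.range fun q : Fin j → ι => ∏ t, (X (q t) : MvPolynomial ι F)) := by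
  rw [Submodule.span_le]
  rintro _ ⟨v, -, rfl⟩
  simp only [linearForm_pow, ← smul_eq_C_mul]
  exact Submodule.sum_mem _ fun q _ => Submodule.smul_mem _ _ (Submodule.subset_span ⟨q, rfl⟩)

theorem finiteDimensional_span_linearForm_pow (j : ℕ) (S : Set (ι → F)) :
    FiniteDimensional F (Submodule.span F ((fun v => linearForm v ^ j) '' S)) := by
  have := FiniteDimensional.span_of_finite F
    (Set.finite_range fun q : Fin j → ι => ∏ t, (X (q t) : MvPolynomial ι F))
  exact Submodule.finiteDimensional_of_le (span_linearForm_pow_le j S)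

theorem finrank_span_linearForm_pow_le (j : ℕ) (S : Set (ι → F)) :
    finrank F (Submodule.span F ((fun v => linearForm v ^ j) '' S)) ≤ Fintype.card ι ^ j := by
  have := FiniteDimensional.span_of_finite F
    (Set.finite_range fun q : Fin j → ι => ∏ t, (X (q t) : MvPolynomial ι F))
  refine (Submodule.finrank_mono (span_linearForm_pow_le j S)).trans
    ((finrank_range_le_card _).trans ?_)
  simp

/-- Contraction with the `j`-th power of some member of `S` decreases the dimension at most by the
factor `(card ι) ^ j`. -/
theorem exists_finrank_le_mul_finrank_contraction [CharZero F] {e j : ℕ} (hj : j ≤ e)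
    {S : Set (ι → F)} (hS : ContainsSparse j S) {K : Submodule F (MvPolynomial ι F →ₗ[F] F)}
    (hK : K ≤ homogeneousFunctionals ι F e) :
    ∃ v ∈ S, finrank F K ≤
      Fintype.card ι ^ j * finrank F (K.map (contraction (linearForm v ^ j))) := by
  have := finiteDimensional_of_le_homogeneousFunctionals hK
  -- Finitely many powers span all the powers in question; their number is bounded by the number of
  -- products of `j` variables.
  obtain ⟨M, hM, v, hv, hspan⟩ : ∃ M ≤ Fintype.card ι ^ j, ∃ v : Fin M → ι → F,
      (∀ i, v i ∈ S) ∧ ∀ w ∈ S, linearForm w ^ j ∈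
        Submodule.span F (Set.range fun i => linearForm (v i) ^ j) := by
    have := finiteDimensional_span_linearForm_pow (F := F) j S
    obtain ⟨b, hb, hspan, -⟩ := Submodule.exists_fun_fin_finrank_span_eq F
      ((fun v => linearForm v ^ j) '' S)
    choose v hv hvb using hb
    refine ⟨_, finrank_span_linearForm_pow_le j S, v, hv, fun w hw => ?_⟩
    rw [show (fun i => linearForm (v i) ^ j) = b from funext hvb, hspan]
    exact Submodule.subset_span ⟨w, hw, rfl⟩
  by_contra! hlt
  -- Contracting with all spanning powers at once is injective, so the dimensions of the images add
  -- up to at least that of `K`, and one of them reaches the average.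
  let Φ : K →ₗ[F] ∀ i : Fin M, K.map (contraction (linearForm (v i) ^ j)) :=
    LinearMap.pi fun i => (contraction (linearForm (v i) ^ j)).submoduleMap K
  have hΦ : Function.Injective Φ := by
    refine (injective_iff_map_eq_zero _).2 ?_
    rintro ⟨f, hf⟩ h
    refine Subtype.ext (functional_eq_zero_of_contraction_pow hj hS (hK hf) fun w hw => ?_)
    have hmem := hspan w hw
    rw [Submodule.mem_span_range_iff_exists_fun] at hmem
    obtain ⟨a, ha⟩ := hmem
    refine LinearMap.ext fun p => ?_
    rw [contraction_apply, ← ha, Finset.sum_mul, map_sum]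
    refine Finset.sum_eq_zero fun i _ => ?_
    have h1 : contraction (linearForm (v i) ^ j) f = 0 := congrArg Subtype.val (congrFun h i)
    rw [smul_mul_assoc, map_smul, ← contraction_apply, h1, LinearMap.zero_apply, smul_zero]
  have h1 := LinearMap.finrank_le_finrank_of_injective hΦ
  rw [Module.finrank_pi_fintype] at h1
  have h2 : Fintype.card ι ^ j * finrank F K ≤ ∑ i : Fin M,
      Fintype.card ι ^ j * finrank F (K.map (contraction (linearForm (v i) ^ j))) := by
    rw [← Finset.mul_sum]
    exact Nat.mul_le_mul_left _ h1
  have h0 : 0 < finrank F K :=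
    Nat.zero_lt_of_lt (hlt 0 (hS 0 (by simp)))
  rcases Nat.eq_zero_or_pos M with hM0 | hM0
  · have : IsEmpty (Fin M) := by rw [hM0]; infer_instance
    rw [Finset.univ_eq_empty, Finset.sum_empty] at h1
    omega
  · have : Nonempty (Fin M) := ⟨⟨0, hM0⟩⟩
    have h3 : ∑ i : Fin M,
        Fintype.card ι ^ j * finrank F (K.map (contraction (linearForm (v i) ^ j))) <
        ∑ _i : Fin M, finrank F K :=
      Finset.sum_lt_sum_of_nonempty Finset.univ_nonempty fun i _ => hlt (v i) (hv i)
    rw [Finset.sum_const, Finset.card_univ, Fintype.card_fin, smul_eq_mul] at h3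
    exact absurd ((Nat.mul_le_mul_right (finrank F K) hM).trans h2) (not_le.2 h3)

/-! ### Generic members of irreducible sets -/

/-- The product of two polynomials that do not vanish identically on `S` does not vanish
identically on `S`. -/
def PolyIrreducible {σ F : Type*} [Field F] (S : Set (σ → F)) : Prop :=
  S.Nonempty ∧ ∀ h₁ h₂ : MvPolynomial σ F, (∃ x ∈ S, eval x h₁ ≠ 0) → (∃ x ∈ S, eval x h₂ ≠ 0) →
    ∃ x ∈ S, eval x (h₁ * h₂) ≠ 0

omit [Fintype ι] in
theorem PolyIrreducible.exists_prod_ne_zero {S : Set (ι → F)} (hS : PolyIrreducible S)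
    {κ : Type*} (s : Finset κ) (h : κ → MvPolynomial ι F)
    (hh : ∀ i ∈ s, ∃ x ∈ S, eval x (h i) ≠ 0) : ∃ x ∈ S, eval x (∏ i ∈ s, h i) ≠ 0 := by
  classical
  induction s using Finset.induction_on with
  | empty =>
    obtain ⟨x, hx⟩ := hS.1
    exact ⟨x, hx, by simp⟩
  | insert i s hi ih =>
    rw [Finset.prod_insert hi]
    exact hS.2 _ _ (hh i (by simp)) (ih fun i hi => hh i (by simp [hi]))

/-- Pull back along the parametrization: the polynomial ring of the parameters is a domain, and over
an infinite field a non-zero polynomial has a non-zero value. -/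
theorem polyIrreducible_range {σ τ F : Type*} [Field F] [Infinite F]
    (p : σ → MvPolynomial τ F) : PolyIrreducible (Set.range fun y i => eval y (p i)) := by
  refine ⟨⟨_, 0, rfl⟩, ?_⟩
  have key : ∀ (h : MvPolynomial σ F) (y : τ → F),
      eval (fun i => eval y (p i)) h = eval y (bind₁ p h) := fun h y => by
    rw [eval, eval, eval₂Hom_bind₁]
  rintro h₁ h₂ ⟨_, ⟨y₁, rfl⟩, h1⟩ ⟨_, ⟨y₂, rfl⟩, h2⟩
  simp only [key] at h1 h2
  have h3 : bind₁ p h₁ * bind₁ p h₂ ≠ 0 := by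
    apply mul_ne_zero
    · intro h0; simp [h0] at h1
    · intro h0; simp [h0] at h2
  by_contra! hall
  apply h3
  refine MvPolynomial.funext fun y => ?_
  rw [← map_mul, ← key, map_zero]
  exact hall _ ⟨y, rfl⟩

/-- Independence of finitely many functionals means that the dual of `M → F^κ` is injective, so the
map itself is onto; `M` may have infinite dimension. -/
theorem exists_dual_vectors {M κ : Type*} [AddCommGroup M] [Module F M] [Fintype κ]
    [DecidableEq κ] {g : κ → Dual F M} (hg : LinearIndependent F g) :
    ∃ T : κ → M, ∀ b c, g b (T c) = if b = c then 1 else 0 := by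
  have h1 : Function.Surjective (LinearMap.pi g) := by
    rw [← LinearMap.dualMap_injective_iff]
    refine (injective_iff_map_eq_zero _).2 fun ψ hψ => ?_
    rw [Fintype.linearIndependent_iff] at hg
    refine LinearMap.pi_ext' fun b => LinearMap.ext_ring ?_
    refine hg (fun b => ψ (Pi.single b 1)) (LinearMap.ext fun x => ?_) b
    have h2 := LinearMap.congr_fun hψ x
    rw [LinearMap.dualMap_apply, linearMap_pi_apply] at h2
    simpa [mul_comm] using h2
  choose T hT using h1
  refine ⟨fun c => T (Pi.single c 1), fun b c => ?_⟩
  have := congrFun (hT (Pi.single c 1)) b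
  rw [LinearMap.pi_apply] at this
  rw [this, Pi.single_apply]

theorem exists_linearIndependent_map {M M' : Type*} [AddCommGroup M] [Module F M]
    [AddCommGroup M'] [Module F M'] (c : M →ₗ[F] M') (K : Submodule F M) [FiniteDimensional F K] :
    ∃ f : Fin (finrank F (K.map c)) → M, (∀ b, f b ∈ K) ∧ LinearIndependent F fun b => c (f b) := by
  have hb := (finBasis F (K.map c)).linearIndependent.map' _ (Submodule.ker_subtype _)
  have hex : ∀ i, ∃ f ∈ K, c f = (finBasis F (K.map c) i : M') :=
    fun i => Submodule.mem_map.1 (finBasis F (K.map c) i).2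
  choose f hfK hf using hex
  refine ⟨f, hfK, ?_⟩
  simp only [hf]
  exact hb

/-- Maximality of the dimension of a contraction is an open condition. -/
theorem exists_polynomial_finrank_contraction {e : ℕ} (j : ℕ)
    {K : Submodule F (MvPolynomial ι F →ₗ[F] F)} (hK : K ≤ homogeneousFunctionals ι F e)
    (v₀ : ι → F) : ∃ h : MvPolynomial ι F, eval v₀ h ≠ 0 ∧ ∀ v, eval v h ≠ 0 →
      finrank F (K.map (contraction (linearForm v₀ ^ j))) ≤
        finrank F (K.map (contraction (linearForm v ^ j))) := by
  classical
  have := finiteDimensional_of_le_homogeneousFunctionals hK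
  obtain ⟨f, hfK, hf⟩ := exists_linearIndependent_map (contraction (linearForm v₀ ^ j)) K
  obtain ⟨T, hT⟩ := exists_dual_vectors hf
  generalize finrank F (K.map (contraction (linearForm v₀ ^ j))) = ρ at *
  -- The pairings of the contracted functionals with the dual polynomials `T c`, as polynomials in
  -- the coordinates of `v`. The matrix is the identity at `v₀`, and wherever its determinant is not
  -- zero the contractions remain independent.
  let A : Matrix (Fin ρ) (Fin ρ) (MvPolynomial ι F) := Matrix.of fun b c =>
    ∑ q : Fin j → ι, C (f b ((∏ t, X (q t)) * T c)) * ∏ t, X (q t)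
  have hA : ∀ v b c, eval v (A b c) = f b (linearForm v ^ j * T c) := fun v b c => by
    rw [linearForm_pow, Finset.sum_mul, map_sum]
    simp only [A, Matrix.of_apply, map_sum, map_mul, eval_C, map_prod (eval v), eval_X]
    refine Finset.sum_congr rfl fun q _ => ?_
    rw [← smul_eq_C_mul, smul_mul_assoc, map_smul, smul_eq_mul, mul_comm]
  have hdet : ∀ v, eval v A.det = (Matrix.of fun b c => f b (linearForm v ^ j * T c)).det :=
    fun v => by
      rw [RingHom.map_det]
      congr 1
      ext b c
      exact hA v b c
  refine ⟨A.det, ?_, fun v hv => ?_⟩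
  · rw [hdet]
    have : (Matrix.of fun b c => f b (linearForm v₀ ^ j * T c)) = 1 := by
      ext b c
      rw [Matrix.of_apply, Matrix.one_apply]
      exact hT b c
    rw [this, Matrix.det_one]
    exact one_ne_zero
  · rw [hdet] at hv
    have hli : LinearIndependent F fun b : Fin ρ => contraction (linearForm v ^ j) (f b) := by
      rw [Fintype.linearIndependent_iff]
      intro c hc
      have h1 : Matrix.vecMul c (Matrix.of fun b c => f b (linearForm v ^ j * T c)) = 0 := by
        ext t
        have h2 := LinearMap.congr_fun hc (T t)
        simpa [Matrix.vecMul, dotProduct, contraction_apply] using h2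
      exact fun i => congrFun (Matrix.eq_zero_of_vecMul_eq_zero hv h1) i
    calc ρ = finrank F (Submodule.span F (Set.range fun b : Fin ρ =>
          contraction (linearForm v ^ j) (f b))) := by
          rw [finrank_span_eq_card hli, Fintype.card_fin]
      _ ≤ _ := Submodule.finrank_mono <| Submodule.span_le.2 <| by
          rintro _ ⟨b, rfl⟩
          exact Submodule.mem_map_of_mem (hfK b)

theorem finrank_le_finrank_inf_ker {M M' : Type*} [AddCommGroup M] [Module F M]
    [AddCommGroup M'] [Module F M'] (c : M →ₗ[F] M') (K : Submodule F M) [FiniteDimensional F K]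
    (W : Submodule F M') [FiniteDimensional F W] (h : ∀ x ∈ K, c x ∈ W) :
    finrank F K ≤ finrank F ↥(K ⊓ LinearMap.ker c) + finrank F W := by
  have h1 := LinearMap.finrank_range_add_finrank_ker (c.domRestrict K)
  have h2 : LinearMap.range (c.domRestrict K) ≤ W := by
    rintro _ ⟨f, rfl⟩
    exact h f f.2
  have h3 := Submodule.finrank_mono h2
  have h4 : LinearMap.ker (c.domRestrict K) = (LinearMap.ker c).comap K.subtype := rfl
  have h5 := Submodule.finrank_map_subtype_eq K ((LinearMap.ker c).comap K.subtype)
  rw [Submodule.map_comap_subtype] at h5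
  rw [h4, ← h5] at h1
  omega

/-- The dimension of the part of a space of functionals that is killed by a linear form. -/
theorem finrank_le_finrank_inf_ker_contraction {e : ℕ}
    {K : Submodule F (MvPolynomial ι F →ₗ[F] F)} (hK : K ≤ homogeneousFunctionals ι F (e + 1))
    (v : ι → F) : finrank F K ≤
      finrank F ↥(K ⊓ LinearMap.ker (contraction (linearForm v))) + Fintype.card ι ^ e := by
  have := finiteDimensional_of_le_homogeneousFunctionals hK
  refine (finrank_le_finrank_inf_ker (contraction (linearForm v)) K
    (homogeneousFunctionals ι F e) fun f hf => ?_).trans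
    (Nat.add_le_add_left (finrank_homogeneousFunctionals_le e) _)
  exact contraction_mem (hK hf) (linearForm_isHomogeneous v) (by omega)

/-- There are finitely many conditions, one for each `k` and each `j ≤ e k`. Each is the
non-vanishing of a polynomial that is not identically zero on `S`, and by irreducibility they hold
together at one point. For `j > g` nothing is claimed and the polynomial `1` serves. -/
theorem exists_generic_contraction [CharZero F] {κ : Type} [Fintype κ] {e : κ → ℕ}
    {K : κ → Submodule F (MvPolynomial ι F →ₗ[F] F)}
    (hK : ∀ k, K k ≤ homogeneousFunctionals ι F (e k)) {S : Set (ι → F)} (hS : PolyIrreducible S)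
    {g : ℕ} (hg : ContainsSparse g S) :
    ∃ v ∈ S, ∀ k j, j ≤ e k → j ≤ g → finrank F (K k) ≤
      Fintype.card ι ^ j * finrank F ((K k).map (contraction (linearForm v ^ j))) := by
  classical
  have h1 : ∀ x : Σ k, Fin (e k + 1), ∃ h : MvPolynomial ι F, (∃ v ∈ S, eval v h ≠ 0) ∧
      ((x.2 : ℕ) ≤ g → ∀ v, eval v h ≠ 0 → finrank F (K x.1) ≤
        Fintype.card ι ^ (x.2 : ℕ) *
          finrank F ((K x.1).map (contraction (linearForm v ^ (x.2 : ℕ))))) := by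
    rintro ⟨k, j⟩
    by_cases hj : (j : ℕ) ≤ g
    · obtain ⟨v₀, hv₀, hle⟩ := exists_finrank_le_mul_finrank_contraction
        (Nat.lt_succ_iff.1 j.2) (hg.mono hj) (hK k)
      obtain ⟨h, hh, hv⟩ := exists_polynomial_finrank_contraction j (hK k) v₀
      exact ⟨h, ⟨v₀, hv₀, hh⟩, fun _ v hne => hle.trans (Nat.mul_le_mul_left _ (hv v hne))⟩
    · obtain ⟨v, hv⟩ := hS.1
      exact ⟨1, ⟨v, hv, by simp⟩, fun h => absurd h hj⟩
  choose h hne hfin using h1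
  obtain ⟨v, hv, hprod⟩ := hS.exists_prod_ne_zero Finset.univ h fun x _ => hne x
  refine ⟨v, hv, fun k j hj hjg => hfin ⟨k, ⟨j, by omega⟩⟩ hjg v ?_⟩
  rw [map_prod, Finset.prod_ne_zero_iff] at hprod
  exact hprod _ (Finset.mem_univ _)

/-! ### The dimension theorem -/

/-- Grouping a form by the powers of its first variable isolates the part of lowest order, on which
the induction below works. -/
theorem aeval_fin_cons {A : Type*} [CommRing A] [Algebra F A] {R : ℕ} (l₀ : A) (l : Fin R → A)
    (T : MvPolynomial (Fin (R + 1)) F) :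
    aeval (Fin.cons l₀ l : Fin (R + 1) → A) T =
      (finSuccEquiv F R T).sum fun i c => l₀ ^ i * aeval l c := by
  have h : aeval (Fin.cons l₀ l : Fin (R + 1) → A) T =
      Polynomial.eval₂ (aeval l : MvPolynomial (Fin R) F →ₐ[F] A).toRingHom l₀
        (finSuccEquiv F R T) := by
    induction T using MvPolynomial.induction_on with
    | C a =>
      have := (finSuccEquiv F R).commutes a
      rw [MvPolynomial.algebraMap_eq] at this
      rw [this, Polynomial.algebraMap_apply, MvPolynomial.algebraMap_eq, Polynomial.eval₂_C]
      simp
    | add p q hp hq => simp [hp, hq, Polynomial.eval₂_add]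
    | mul_X p i hp =>
      rw [map_mul, map_mul, Polynomial.eval₂_mul, hp, aeval_X]
      congr 1
      refine Fin.cases ?_ (fun j => ?_) i
      · simp [finSuccEquiv_X_zero]
      · simp [finSuccEquiv_X_succ]
  rw [h, Polynomial.eval₂_eq_sum]
  exact Finset.sum_congr rfl fun i _ => mul_comm _ _

/-- If the spaces of functionals `K k`, homogeneous of degree `e k`, have dimension at least
`R (card ι) ^ (e k - 1)`, there are `R` vectors in the given irreducible sets such that no non-zero
form of degree `e k` in these vectors is killed by `K k`, apart from forms that involve excluded
pure powers. -/
theorem exists_vectors_no_vanishing_form [CharZero F] [Nonempty ι] {R : ℕ} {κ : Type} [Fintype κ]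
    {e : κ → ℕ} (he : ∀ k, 0 < e k) {K : κ → Submodule F (MvPolynomial ι F →ₗ[F] F)}
    (hK : ∀ k, K k ≤ homogeneousFunctionals ι F (e k))
    (hdim : ∀ k, R * Fintype.card ι ^ (e k - 1) ≤ finrank F (K k)) {S : Fin R → Set (ι → F)}
    (hS : ∀ i, PolyIrreducible (S i)) {g : Fin R → ℕ} (hg : ∀ i, ContainsSparse (g i) (S i))
    (heg : ∀ k i, e k ≤ g i + 1) :
    ∃ v : Fin R → ι → F, (∀ i, v i ∈ S i) ∧ ∀ k, ∀ T : MvPolynomial (Fin R) F,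
      T.IsHomogeneous (e k) → (∀ i, g i < e k → coeff (Finsupp.single i (e k)) T = 0) →
      (∀ f ∈ K k, f (aeval (fun i => linearForm (v i)) T) = 0) → T = 0 := by
  induction R generalizing κ with
  | zero =>
    refine ⟨fun i => i.elim0, fun i => i.elim0, fun k T hT _ _ => ?_⟩
    ext m
    rw [coeff_zero]
    refine hT.coeff_eq_zero ?_
    have : m = 0 := Subsingleton.elim _ _
    rw [this, map_zero]
    exact (he k).ne
  | succ R ih =>
    have hN : 0 < Fintype.card ι := Fintype.card_pos
    obtain ⟨v₀, hv₀, hgen⟩ := exists_generic_contraction hK (hS 0) (hg 0)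
    set l₀ := linearForm v₀
    -- The loss `N ^ j` in dimension is matched by the lower degree: the inequality is inherited
    -- with `e k - j` in place of `e k`. The hypothesis `heg` ensures that every `j < e k` is within
    -- reach of sparse vectors.
    have hdim' : ∀ k j, j < e k → (R + 1) * Fintype.card ι ^ (e k - j - 1) ≤
        finrank F ((K k).map (contraction (l₀ ^ j))) := fun k j hj => by
      have h1 := (hdim k).trans (hgen k j hj.le (by have := heg k 0; omega))
      rw [show e k - 1 = j + (e k - j - 1) by omega, pow_add, mul_left_comm] at h1
      exact Nat.le_of_mul_le_mul_left h1 (pow_pos hN j)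
    have hmem : ∀ k j, j ≤ e k → (K k).map (contraction (l₀ ^ j)) ≤
        homogeneousFunctionals ι F (e k - j) := fun k j hj => by
      rintro _ ⟨f, hf, rfl⟩
      refine contraction_mem (hK k hf) ?_ hj
      simpa using (linearForm_isHomogeneous v₀).pow j
    -- The induction is applied to all contractions with `l₀^j`, restricted to the part that one
    -- more factor `l₀` kills. That restriction costs at most the dimension `N ^ (e k - j - 1)` of
    -- the target, exactly the share of one vector.
    obtain ⟨v, hv, hvT⟩ := ih (κ := Σ k, Fin (e k)) (e := fun x => e x.1 - x.2)
      (fun x => by have := x.2.2; omega)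
      (K := fun x => (K x.1).map (contraction (l₀ ^ (x.2 : ℕ))) ⊓ LinearMap.ker (contraction l₀))
      (fun x => inf_le_left.trans (hmem x.1 x.2 x.2.2.le))
      (fun x => by
        have h1 := hdim' x.1 x.2 x.2.2
        have h2 := finrank_le_finrank_inf_ker_contraction (e := e x.1 - x.2 - 1)
          (K := (K x.1).map (contraction (l₀ ^ (x.2 : ℕ))))
          (by
            have := hmem x.1 x.2 x.2.2.le
            rwa [show e x.1 - (x.2 : ℕ) - 1 + 1 = e x.1 - x.2 by have := x.2.2; omega]) v₀
        rw [add_mul, one_mul] at h1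
        exact Nat.le_of_add_le_add_right (h1.trans h2))
      (S := fun i => S i.succ) (fun i => hS i.succ) (g := fun i => g i.succ)
      (fun i => hg i.succ) (fun x i => by have := heg x.1 i.succ; omega)
    refine ⟨Fin.cons v₀ v, fun i => Fin.cases hv₀ hv i, fun k T hT hexc hf => ?_⟩
    by_contra hT0
    set Q := finSuccEquiv F R T with hQ
    have hQ0 : Q ≠ 0 := by
      rw [hQ]
      exact fun h => hT0 ((finSuccEquiv F R).injective (h.trans (map_zero _).symm))
    -- The lowest power of the first variable that occurs in `T`.
    set j := Q.natTrailingDegree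
    have hj0 : Q.coeff j ≠ 0 := by
      rw [← Polynomial.trailingCoeff]
      exact mt Polynomial.trailingCoeff_eq_zero.1 hQ0
    have hje : j ≤ e k := by
      obtain ⟨m, hm⟩ := ne_zero_iff.1 hj0
      rw [finSuccEquiv_coeff_coeff] at hm
      by_contra hlt
      refine hm (hT.coeff_eq_zero ?_)
      rw [Finsupp.degree_eq_sum, Fin.sum_univ_succ, Finsupp.cons_zero]
      omega
    have hcons : (fun i => linearForm ((Fin.cons v₀ v : Fin (R + 1) → ι → F) i)) =
        Fin.cons l₀ fun i => linearForm (v i) := by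
      ext i
      refine Fin.cases rfl (fun _ => rfl) i
    -- Functionals killed by `l₀^(j+1)` see only the lowest-order part of `T`.
    have hkey : ∀ f ∈ K k, contraction (l₀ ^ (j + 1)) f = 0 →
        f (l₀ ^ j * aeval (fun i => linearForm (v i)) (Q.coeff j)) = 0 := fun f hfK hf0 => by
      have h1 := hf f hfK
      rw [hcons, aeval_fin_cons, ← hQ, Polynomial.sum, map_sum] at h1
      rwa [Finset.sum_eq_single j] at h1
      · intro i hi hij
        have hji : j < i := lt_of_le_of_ne
          (Polynomial.natTrailingDegree_le_of_mem_supp i hi) (Ne.symm hij)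
        obtain ⟨t, rfl⟩ := Nat.exists_eq_add_of_lt hji
        rw [show j + t + 1 = (j + 1) + t by omega, pow_add, mul_assoc]
        exact LinearMap.congr_fun hf0 _
      · intro hj
        simp [Polynomial.notMem_support_iff.1 hj]
    have hhom : (Q.coeff j).IsHomogeneous (e k - j) :=
      hT.finSuccEquiv_coeff_isHomogeneous j (e k - j) (by omega)
    rcases hje.lt_or_eq with hlt | heq
    · refine hj0 (hvT ⟨k, ⟨j, hlt⟩⟩ _ hhom (fun i hi => ?_) ?_)
      · have h1 := heg k i.succ
        simp only at hi
        -- An excluded pure power in the lower degree can occur only for `j = 0`, where it is a pure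
        -- power of `T` itself and so is excluded by hypothesis.
        have hj : j = 0 := by omega
        rw [hQ, finSuccEquiv_coeff_coeff, ← hexc i.succ (by omega)]
        congr 1
        ext t
        refine Fin.cases ?_ (fun t => ?_) t
        · simp [hj]
        · simp [hj, Finsupp.single_apply]
      · rintro _ ⟨⟨f, hfK, rfl⟩, hker⟩
        refine hkey f hfK ?_
        refine LinearMap.ext fun p => ?_
        have h2 := LinearMap.congr_fun (LinearMap.mem_ker.1 hker) p
        rw [contraction_apply, contraction_apply] at h2
        rw [contraction_apply, pow_succ, mul_assoc]
        exact h2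
    -- Here `T` is a multiple of the pure power of the first variable: either this power is
    -- excluded, or some functional of `K k` does not vanish on `l₀ ^ e k`.
    · have hC : Q.coeff j = C (coeff 0 (Q.coeff j)) := by
        rw [heq, Nat.sub_self] at hhom
        rw [heq]
        exact (totalDegree_eq_zero_iff_eq_C).1 (Nat.le_zero.1 hhom.totalDegree_le)
      rcases lt_or_ge (g 0) (e k) with hlt | hge
      · apply hj0
        rw [hC, hQ, finSuccEquiv_coeff_coeff, ← C_0, ← hexc 0 hlt]
        congr 2
        ext t
        refine Fin.cases ?_ (fun t => ?_) t
        · simp [heq]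
        · simp
      · have h1 := hgen k (e k) le_rfl hge
        have h2 : 0 < finrank F (K k) :=
          lt_of_lt_of_le (Nat.mul_pos R.succ_pos (pow_pos hN _)) (hdim k)
        obtain ⟨f, hfK, hf0⟩ : ∃ f ∈ K k, contraction (l₀ ^ e k) f ≠ 0 := by
          by_contra! hall
          have : (K k).map (contraction (l₀ ^ e k)) = ⊥ := by
            rw [eq_bot_iff]
            rintro _ ⟨f, hf, rfl⟩
            exact hall f hf
          rw [this, finrank_bot] at h1
          omega
        have hpow : ∀ i, (l₀ ^ i).IsHomogeneous i := fun i => by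
          simpa using (linearForm_isHomogeneous v₀).pow i
        have h3 := hkey f hfK (contraction_eq_zero (hK k hfK) (hpow (j + 1)) (by omega))
        have h4 : f (l₀ ^ e k) ≠ 0 := fun h5 => by
          apply hf0
          have h6 := contraction_mem (hK k hfK) (hpow (e k)) le_rfl
          rw [Nat.sub_self] at h6
          refine functional_ext h6 fun q => ?_
          rw [contraction_apply, Finset.univ_eq_empty, Finset.prod_empty, mul_one, h5]
        rw [hC, aeval_C, MvPolynomial.algebraMap_eq, mul_comm, ← smul_eq_C_mul, map_smul,
          smul_eq_mul, heq] at h3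
        apply hj0
        rw [hC, heq, (mul_eq_zero.1 h3).resolve_right h4, C_0]

end HomogeneousFunctionals

/-! ## Planted tuples -/

section Planted

open MvPolynomial Module

variable {F : Type*} [Field F] {n₁ n₂ r R s p : ℕ}

theorem exists_mul_eq_of_rank_le {M : Matrix (Fin n₁) (Fin n₂) F} (h : M.rank ≤ r) :
    ∃ (A : Matrix (Fin n₁) (Fin r) F) (B : Matrix (Fin r) (Fin n₂) F), M = A * B := by
  set W := Submodule.span F (Set.range M.col) with hW
  have hk : finrank F W ≤ r := by rwa [hW, ← Matrix.rank_eq_finrank_span_cols]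
  have hcol : ∀ c, M.col c ∈ W := fun c => Submodule.subset_span ⟨c, rfl⟩
  let b := finBasis F W
  -- Pads a factorization through the column space, of dimension possibly smaller than `r`, to inner
  -- dimension exactly `r`.
  let E : Matrix (Fin (finrank F W)) (Fin r) F :=
    Matrix.of fun i j => if Fin.castLE hk i = j then 1 else 0
  let A₀ : Matrix (Fin n₁) (Fin (finrank F W)) F := Matrix.of fun i j => (b j : Fin n₁ → F) i
  let B₀ : Matrix (Fin (finrank F W)) (Fin n₂) F := Matrix.of fun j c => b.repr ⟨_, hcol c⟩ j
  have hE : E * Eᵀ = 1 := by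
    ext i j
    simp only [E, Matrix.mul_apply, Matrix.transpose_apply, Matrix.of_apply, ite_mul, one_mul,
      zero_mul, Finset.sum_ite_eq, Finset.mem_univ, if_true]
    simp [Matrix.one_apply, Fin.ext_iff, eq_comm]
  refine ⟨A₀ * E, Eᵀ * B₀, ?_⟩
  rw [Matrix.mul_assoc, ← Matrix.mul_assoc E, hE, Matrix.one_mul]
  ext i c
  have h1 := congrArg (fun w : W => (w : Fin n₁ → F) i) (b.sum_repr ⟨_, hcol c⟩)
  simp only [AddSubmonoidClass.coe_finsetSum, Finset.sum_apply, SetLike.val_smul, Pi.smul_apply,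
    smul_eq_mul] at h1
  rw [Matrix.mul_apply]
  refine h1.symm.trans (Finset.sum_congr rfl fun j _ => mul_comm _ _)

theorem mem_rankVariety_iff {w : Fin n₁ × Fin n₂ → F} : w ∈ rankVariety F n₁ n₂ r ↔
    ∃ (A : Fin n₁ × Fin r → F) (B : Fin r × Fin n₂ → F),
      w = fun q => ∑ k, A (q.1, k) * B (k, q.2) := by
  constructor
  · intro h
    obtain ⟨A, B, hAB⟩ := exists_mul_eq_of_rank_le h
    refine ⟨fun q => A q.1 q.2, fun q => B q.1 q.2, funext fun q => ?_⟩
    exact congrFun (congrFun hAB q.1) q.2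
  · rintro ⟨A, B, rfl⟩
    have : (Matrix.of fun i j => ∑ k, A (i, k) * B (k, j)) =
        (Matrix.of fun i k => A (i, k)) * (Matrix.of fun k j => B (k, j)) := by
      ext i j
      simp [Matrix.mul_apply]
    rw [rankVariety, Set.mem_ofPred_eq, this]
    refine (Matrix.rank_mul_le_left _ _).trans ((Matrix.rank_le_card_width _).trans ?_)
    simp

/-- At most `r` non-zero entries occupy at most `r` rows. -/
theorem containsSparse_rankVariety : ContainsSparse r (rankVariety F n₁ n₂ r) := by
  classical
  intro v hv
  have h := Matrix.rank_le_card_of_support_subset (Matrix.of fun i j => v (i, j))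
    ((Function.support v).toFinset.image Prod.fst) (fun i hi => by
      obtain ⟨j, hj⟩ := Function.ne_iff.1 hi
      simp only [Finset.coe_image, Set.coe_toFinset, Set.mem_image]
      exact ⟨(i, j), hj, rfl⟩)
  refine h.trans (Finset.card_image_le.trans ?_)
  rwa [Set.ncard_eq_toFinset_card'] at hv

/-- The values allowed for the `i`-th member of a planted tuple. -/
def plantedFactor (F : Type*) [Field F] (n₁ n₂ r s i : ℕ) : Set (Fin n₁ × Fin n₂ → F) :=
  {w | i < s → w ∈ rankVariety F n₁ n₂ r}

theorem containsSparse_plantedFactor (i : ℕ) :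
    ContainsSparse (if i < s then r else r + 1) (plantedFactor F n₁ n₂ r s i) := by
  intro v hv hi
  rw [if_pos hi] at hv
  exact containsSparse_rankVariety v hv

/-- Coordinates of a planted tuple as polynomials in the entries of factorizations. -/
noncomputable def plantedParametrization (F : Type*) [Field F] (n₁ n₂ r s : ℕ) {κ : Type*}
    (idx : κ → ℕ) (y : κ × (Fin n₁ × Fin n₂)) :
    MvPolynomial (κ × ((Fin n₁ × Fin r) ⊕ (Fin r × Fin n₂) ⊕ (Fin n₁ × Fin n₂))) F :=
  if idx y.1 < s then ∑ k, X (y.1, .inl (y.2.1, k)) * X (y.1, .inr (.inl (k, y.2.2)))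
  else X (y.1, .inr (.inr y.2))

theorem range_plantedParametrization {κ : Type*} (idx : κ → ℕ) :
    Set.range (fun y i => eval y (plantedParametrization F n₁ n₂ r s idx i)) =
      {x | ∀ i : κ, (fun q => x (i, q)) ∈ plantedFactor F n₁ n₂ r s (idx i)} := by
  ext x
  constructor
  · rintro ⟨y, rfl⟩ i hi
    rw [mem_rankVariety_iff]
    refine ⟨fun a => y (i, .inl a), fun b => y (i, .inr (.inl b)), funext fun q => ?_⟩
    simp [plantedParametrization, hi]
  · intro h
    have h1 : ∀ i, idx i < s → ∃ AB : (Fin n₁ × Fin r → F) × (Fin r × Fin n₂ → F),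
        ∀ q, x (i, q) = ∑ k, AB.1 (q.1, k) * AB.2 (k, q.2) := fun i hi => by
      obtain ⟨A, B, hAB⟩ := mem_rankVariety_iff.1 (h i hi)
      exact ⟨(A, B), congrFun hAB⟩
    choose! AB hAB using h1
    refine ⟨fun y => Sum.elim (AB y.1).1 (Sum.elim (AB y.1).2 fun q => x (y.1, q)) y.2,
      funext fun y => ?_⟩
    by_cases hi : idx y.1 < s
    · simp [plantedParametrization, hi, ← hAB y.1 hi y.2]
    · simp [plantedParametrization, hi]

theorem polyIrreducible_plantedVariety [Infinite F] :
    PolyIrreducible (plantedVariety F n₁ n₂ r R s) := by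
  have := polyIrreducible_range (plantedParametrization F n₁ n₂ r s fun i : Fin R => (i : ℕ))
  rwa [range_plantedParametrization] at this

theorem polyIrreducible_plantedFactor [Infinite F] (i : ℕ) :
    PolyIrreducible (plantedFactor F n₁ n₂ r s i) := by
  have h1 := Set.ext_iff.1 (range_plantedParametrization (F := F) (n₁ := n₁) (n₂ := n₂) (r := r)
    (s := s) fun _ : Unit => i)
  have h2 : plantedFactor F n₁ n₂ r s i = Set.range fun y (q : Fin n₁ × Fin n₂) =>
      eval y (plantedParametrization F n₁ n₂ r s (fun _ : Unit => i) ((), q)) := by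
    ext w
    constructor
    · intro hw
      obtain ⟨y, hy⟩ := (h1 fun y => w y.2).2 fun _ => hw
      exact ⟨y, funext fun q => congrFun hy ((), q)⟩
    · rintro ⟨y, rfl⟩
      exact (h1 _).1 ⟨y, rfl⟩ ()
  rw [h2]
  exact polyIrreducible_range _

/-- The complement of a hypersurface in an irreducible set. -/
theorem isZariskiOpenDenseIn_of_polyIrreducible {σ : Type*} {Y : Set (σ → F)}
    (hY : PolyIrreducible Y) {h : MvPolynomial σ F} (hh : ∃ x ∈ Y, eval x h ≠ 0) :
    IsZariskiOpenDenseIn {x ∈ Y | eval x h ≠ 0} Y := by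
  refine ⟨⟨zeroLocus F (Ideal.span {h}), ⟨_, rfl⟩, ?_⟩, ?_⟩
  · ext x
    simp only [Set.mem_ofPred_eq, Set.mem_sdiff, mem_zeroLocus_iff, and_congr_right_iff]
    refine fun _ => not_congr ⟨fun h0 q hq => ?_, fun h0 => ?_⟩
    · obtain ⟨c, rfl⟩ := Ideal.mem_span_singleton'.1 hq
      simp [aeval_eq_eval, h0]
    · simpa [aeval_eq_eval] using h0 h (Ideal.subset_span rfl)
  · rintro Z ⟨I, rfl⟩ hAZ y hy q hq
    by_contra hne
    -- If an equation `q` of `Z` failed somewhere on `Y`, irreducibility would give a point where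
    -- neither `q` nor `h` vanishes, contradicting that `Z` contains the open set.
    obtain ⟨x, hx, hne'⟩ := hY.2 q h ⟨y, hy, by simpa [aeval_eq_eval] using hne⟩ hh
    rw [map_mul] at hne'
    have := hAZ ⟨hx, right_ne_zero_of_mul hne'⟩ q hq
    rw [aeval_eq_eval] at this
    exact left_ne_zero_of_mul hne' this

/-- Injectivity of a matrix with polynomial entries is an open condition. -/
theorem exists_polynomial_of_mulVec_injective {σ α β : Type*} [Fintype α] [Fintype β]
    [DecidableEq β] (A : Matrix α β (MvPolynomial σ F)) {x₀ : σ → F}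
    (h : ∀ c : β → F, A.map (eval x₀) *ᵥ c = 0 → c = 0) :
    ∃ h : MvPolynomial σ F, eval x₀ h ≠ 0 ∧ ∀ x, eval x h ≠ 0 →
      ∀ c : β → F, A.map (eval x) *ᵥ c = 0 → c = 0 := by
  classical
  obtain ⟨L, hL⟩ := LinearMap.exists_leftInverse_of_injective (A.map (eval x₀)).mulVecLin
    (LinearMap.ker_eq_bot'.2 h)
  have hL' : LinearMap.toMatrix' L * A.map (eval x₀) = 1 := by
    have := congrArg LinearMap.toMatrix' hL
    rwa [LinearMap.toMatrix'_comp, ← Matrix.toLin'_apply', LinearMap.toMatrix'_toLin',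
      LinearMap.toMatrix'_id] at this
  let L' : Matrix β α (MvPolynomial σ F) := (LinearMap.toMatrix' L).map C
  have key : ∀ x, eval x (L' * A).det = (LinearMap.toMatrix' L * A.map (eval x)).det := fun x => by
    rw [RingHom.map_det]
    congr 1
    ext i j
    simp [L', Matrix.mul_apply]
  refine ⟨(L' * A).det, ?_, fun x hx c hc => ?_⟩
  · rw [key, hL', Matrix.det_one]
    exact one_ne_zero
  · rw [key] at hx
    refine Matrix.eq_zero_of_mulVec_eq_zero hx ?_
    rw [← Matrix.mulVec_mulVec, hc, Matrix.mulVec_zero]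

end Planted

/-! ## The functionals given by the minors -/

section MinorFunctional

open MvPolynomial Module

variable {F : Type*} [Field F] {n₁ n₂ r R s p : ℕ}
  (e : Fin p ≃ (Fin (r + 1) ↪o Fin n₁) × (Fin (r + 1) ↪o Fin n₂))

theorem degree_content {ι : Type*} {d : ℕ} (a : Fin d → ι) : (content a).degree = d := by
  simp [content, map_sum]

/-- The pairing of polynomials with a minor, monomials being orthonormal. -/
noncomputable def minorFunctional (j : Fin p) : MvPolynomial (Fin n₁ × Fin n₂) F →ₗ[F] F :=
  (basisMonomials _ F).constr F fun m => coeff m (minors F e j)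

theorem minorFunctional_monomial (j : Fin p) (m : Fin n₁ × Fin n₂ →₀ ℕ) :
    minorFunctional e j (monomial m (1 : F)) = coeff m (minors F e j) := by
  have := (basisMonomials (Fin n₁ × Fin n₂) F).constr_basis F (fun m => coeff m (minors F e j)) m
  rwa [coe_basisMonomials] at this

theorem minorFunctional_mem (j : Fin p) :
    minorFunctional (F := F) e j ∈ homogeneousFunctionals (Fin n₁ × Fin n₂) F (r + 1) := by
  classical
  intro m hm
  rw [minorFunctional_monomial, coeff_minors]
  refine Finset.sum_eq_zero fun σ _ => ?_
  rw [if_neg, mul_zero]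
  rintro rfl
  exact hm (degree_content _)

theorem minorFunctional_sum (j : Fin p) {T : Tensor (r + 1) (Fin n₁ × Fin n₂) F}
    (hT : T ∈ symTensors (r + 1) _ F) :
    minorFunctional e j (∑ q, C (T q) * ∏ t, X (q t)) = ((r + 1)! : F) * minorForm (e j) T := by
  rw [map_sum, ← sum_coeff_minors_mul e j hT]
  refine Finset.sum_congr rfl fun q _ => ?_
  rw [← smul_eq_C_mul, map_smul, monomial_content, minorFunctional_monomial, smul_eq_mul, mul_comm]

/-- The diagonal monomial of a minor determines its rows and columns as sets, hence as increasing
sequences, and then the permutation. So it occurs in no other minor and in no other term, which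
makes the minors linearly independent. -/
theorem minorPositions_content_eq {fg fg' : (Fin (r + 1) ↪o Fin n₁) × (Fin (r + 1) ↪o Fin n₂)}
    {σ : Equiv.Perm (Fin (r + 1))}
    (h : content (minorPositions fg' σ) = content (minorPositions fg 1)) : fg' = fg ∧ σ = 1 := by
  obtain ⟨π, hπ⟩ := (content_eq_iff _ _).1 h
  have h1 : ∀ b, fg'.1 (σ b) = fg.1 (π b) := fun b => congrArg Prod.fst (congrFun hπ b)
  have h2 : ∀ b, fg'.2 b = fg.2 (π b) := fun b => congrArg Prod.snd (congrFun hπ b)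
  have h3 : fg'.1 = fg.1 := by
    rw [← OrderEmbedding.range_inj]
    ext y
    constructor
    · rintro ⟨b, rfl⟩
      exact ⟨π (σ.symm b), by rw [← h1, Equiv.apply_symm_apply]⟩
    · rintro ⟨b, rfl⟩
      exact ⟨σ (π.symm b), by rw [h1, Equiv.apply_symm_apply]⟩
  have h4 : fg'.2 = fg.2 := by
    rw [← OrderEmbedding.range_inj]
    ext y
    constructor
    · rintro ⟨b, rfl⟩
      exact ⟨π b, by rw [h2]⟩
    · rintro ⟨b, rfl⟩
      exact ⟨π.symm b, by rw [h2, Equiv.apply_symm_apply]⟩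
  refine ⟨Prod.ext h3 h4, Equiv.ext fun b => ?_⟩
  have h5 : π b = b := fg.2.injective (by rw [← h2, h4])
  have h6 := h1 b
  rw [h3, h5] at h6
  exact fg.1.injective h6

theorem minorFunctional_linearIndependent :
    LinearIndependent F (minorFunctional (F := F) e) := by
  classical
  rw [Fintype.linearIndependent_iff]
  intro g hg j
  have h1 := LinearMap.congr_fun hg (monomial (content (minorPositions (e j) 1)) 1)
  rw [LinearMap.sum_apply, Finset.sum_eq_single j] at h1
  · rw [LinearMap.smul_apply, minorFunctional_monomial, coeff_minors, Finset.sum_eq_single 1] at h1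
    · simpa using h1
    · intro σ _ hσ
      rw [if_neg fun h => hσ (minorPositions_content_eq h).2, mul_zero]
    · simp
  · intro j' _ hj
    rw [LinearMap.smul_apply, minorFunctional_monomial, coeff_minors, Finset.sum_eq_zero,
      smul_zero]
    intro σ _
    rw [if_neg fun h => hj (e.injective (minorPositions_content_eq h).1), mul_zero]
  · simp

/-- Order embeddings of `Fin k` correspond to the subsets with `k` elements. -/
noncomputable def orderEmbeddingEquivPowersetCard (k n : ℕ) :
    (Fin k ↪o Fin n) ≃ Finset.powersetCard k (Finset.univ : Finset (Fin n)) where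
  toFun f := ⟨Finset.univ.map f.toEmbedding, by simp [Finset.mem_powersetCard]⟩
  invFun S := (S : Finset (Fin n)).orderEmbOfFin (Finset.mem_powersetCard.1 S.2).2
  left_inv f := (Finset.orderEmbOfFin_unique' _ fun x => by simp).symm
  right_inv S := by
    apply Subtype.ext
    apply Finset.coe_injective
    simp

theorem card_orderEmbedding (k n : ℕ) : Nat.card (Fin k ↪o Fin n) = n.choose k := by
  rw [Nat.card_congr (orderEmbeddingEquivPowersetCard k n), Nat.card_eq_fintype_card,
    Fintype.card_coe, Finset.card_powersetCard, Finset.card_univ, Fintype.card_fin]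

theorem card_minors (e : Fin p ≃ (Fin (r + 1) ↪o Fin n₁) × (Fin (r + 1) ↪o Fin n₂)) :
    p = n₁.choose (r + 1) * n₂.choose (r + 1) := by
  rw [← card_orderEmbedding, ← card_orderEmbedding, ← Nat.card_prod, ← Nat.card_congr e,
    Nat.card_eq_fintype_card, Fintype.card_fin]

theorem factorial_mul_choose_add (N r : ℕ) (hN : 0 < N) :
    (r + 1)! * (N + r).choose (r + 1) = (N + r) * (N + r - 1).descFactorial r := by
  rw [← Nat.descFactorial_eq_factorial_mul_choose]
  obtain ⟨M, hM⟩ : ∃ M, N + r = M + 1 := ⟨N + r - 1, by omega⟩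
  rw [hM, Nat.succ_descFactorial_succ, Nat.add_sub_cancel]

theorem dimBound_eq (hN : 0 < n₁ * n₂) : dimBound n₁ n₂ r =
    ((n₁.choose (r + 1) * n₂.choose (r + 1) : ℕ) : ℝ) /
      ((n₁ * n₂ + r - 1).descFactorial r : ℕ) := by
  have h2 : (n₁ * n₂ + r - 1).descFactorial r ≠ 0 := by
    rw [Ne, Nat.descFactorial_eq_zero_iff_lt]
    omega
  have h1 := factorial_mul_choose_add (n₁ * n₂) r hN
  have h3 : ((n₁ : ℝ) * n₂ + r) ≠ 0 := by
    have : n₁ * n₂ + r ≠ 0 := by omega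
    exact_mod_cast this
  rw [dimBound, ← Nat.cast_mul ((r + 1)!), h1]
  push_cast
  have h4 : ((n₁ * n₂ + r - 1).descFactorial r : ℝ) ≠ 0 := by exact_mod_cast h2
  field_simp

/-- After cancellation the denominator of the bound is `N (N+1) ⋯ (N+r-1)` with `N = n₁ n₂`, which
is at least `N ^ r`. Only this weaker inequality enters the dimension argument. -/
theorem mul_pow_le_of_le_dimBound (hN : 0 < n₁ * n₂) (h : (R : ℝ) ≤ dimBound n₁ n₂ r) :
    R * (n₁ * n₂) ^ r ≤ n₁.choose (r + 1) * n₂.choose (r + 1) := by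
  have h2 : 0 < (n₁ * n₂ + r - 1).descFactorial r := by
    rw [Nat.pos_iff_ne_zero, Ne, Nat.descFactorial_eq_zero_iff_lt]
    omega
  rw [dimBound_eq hN, le_div_iff₀ (by exact_mod_cast h2)] at h
  have h3 : R * (n₁ * n₂ + r - 1).descFactorial r ≤ n₁.choose (r + 1) * n₂.choose (r + 1) := by
    exact_mod_cast h
  refine le_trans (Nat.mul_le_mul_left _ ?_) h3
  have := Nat.pow_sub_le_descFactorial (n₁ * n₂ + r - 1) r
  rwa [show n₁ * n₂ + r - 1 + 1 - r = n₁ * n₂ by omega] at this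

theorem finrank_span_minorFunctional :
    finrank F (Submodule.span F (Set.range (minorFunctional (F := F) e))) =
      n₁.choose (r + 1) * n₂.choose (r + 1) := by
  rw [finrank_span_eq_card (minorFunctional_linearIndependent e), Fintype.card_fin, ← card_minors e]

/-- No form of degree `r + 1` in the linear forms given by `v` is killed by the minors, if it does
not contain the pure powers of the first `s` linear forms. -/
def NoVanishingForm (s : ℕ) (v : Fin R → Fin n₁ × Fin n₂ → F) : Prop :=
  ∀ T : MvPolynomial (Fin R) F, T.IsHomogeneous (r + 1) →
    (∀ i : Fin R, (i : ℕ) < s → coeff (Finsupp.single i (r + 1)) T = 0) →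
    (∀ j, minorFunctional e j (aeval (fun i => linearForm (v i)) T) = 0) → T = 0

/-- The dimension theorem with the single space spanned by the minors. A planted vector controls
contractions up to order `r` only, so its power of order `r + 1` is the excluded one; an
unrestricted vector controls order `r + 1` too. -/
theorem exists_noVanishingForm [CharZero F] (hN : 0 < n₁ * n₂)
    (h : R * (n₁ * n₂) ^ r ≤ n₁.choose (r + 1) * n₂.choose (r + 1)) :
    ∃ x ∈ plantedVariety F n₁ n₂ r R s, NoVanishingForm e s fun i q => x (i, q) := by
  have : Nonempty (Fin n₁ × Fin n₂) := by
    rw [← Fintype.card_pos_iff]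
    simpa using hN
  obtain ⟨v, hv, hT⟩ := exists_vectors_no_vanishing_form (F := F) (ι := Fin n₁ × Fin n₂) (R := R)
    (κ := Unit) (e := fun _ => r + 1)
    (fun _ => r.succ_pos) (K := fun _ => Submodule.span F (Set.range (minorFunctional e)))
    (fun _ => Submodule.span_le.2 (by rintro _ ⟨j, rfl⟩; exact minorFunctional_mem e j))
    (fun _ => by simpa [finrank_span_minorFunctional] using h)
    (S := fun i => plantedFactor F n₁ n₂ r s i)
    (fun i => polyIrreducible_plantedFactor _)
    (g := fun i => if (i : ℕ) < s then r else r + 1)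
    (fun i => containsSparse_plantedFactor _)
    (fun _ i => by split_ifs <;> omega)
  refine ⟨fun y => v y.1 y.2, fun i => hv i, fun T hT1 hT2 hT3 => hT () T hT1 (fun i hi => ?_) ?_⟩
  · refine hT2 i ?_
    by_contra hne
    simp [hne] at hi
  · intro f hf
    induction hf using Submodule.span_induction with
    | mem f hf => obtain ⟨j, rfl⟩ := hf; exact hT3 j
    | zero => rfl
    | add f g _ _ h1 h2 => rw [LinearMap.add_apply, h1, h2, add_zero]
    | smul c f _ h1 => rw [LinearMap.smul_apply, h1, smul_zero]

/-- The minors are independent in a space of dimension at most `(n₁ n₂)^(r+1)`. The claim concerns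
integers, so the field may be taken to be `ℚ`. -/
theorem le_of_mul_pow_le (hN : 0 < n₁ * n₂)
    (h : R * (n₁ * n₂) ^ r ≤ n₁.choose (r + 1) * n₂.choose (r + 1)) : R ≤ n₁ * n₂ := by
  have e : Fin _ ≃ (Fin (r + 1) ↪o Fin n₁) × (Fin (r + 1) ↪o Fin n₂) :=
    (Fintype.equivFin _).symm
  have h1 := finrank_span_minorFunctional (F := ℚ) e
  have h2 : finrank ℚ (Submodule.span ℚ (Set.range (minorFunctional (F := ℚ) e))) ≤
      (n₁ * n₂) ^ (r + 1) := by
    refine (Submodule.finrank_mono (Submodule.span_le.2 ?_)).trans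
      ((finrank_homogeneousFunctionals_le (ι := Fin n₁ × Fin n₂) (F := ℚ) (r + 1)).trans (by simp))
    rintro _ ⟨j, rfl⟩
    exact minorFunctional_mem e j
  rw [h1, pow_succ'] at h2
  exact Nat.le_of_mul_le_mul_right (h.trans h2) (pow_pos hN r)

/-- The witness consists of distinct matrix units: they are independent, and as they have one
non-zero entry and `r ≠ 0` they are admissible in planted places. -/
theorem exists_polynomial_linearIndependent (hr : r ≠ 0) (hR : R ≤ n₁ * n₂) :
    ∃ h : MvPolynomial (Fin R × (Fin n₁ × Fin n₂)) F,
      (∃ x ∈ plantedVariety F n₁ n₂ r R s, eval x h ≠ 0) ∧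
      ∀ x, eval x h ≠ 0 → LinearIndependent F fun (i : Fin R) q => x (i, q) := by
  classical
  let A : Matrix (Fin n₁ × Fin n₂) (Fin R) (MvPolynomial (Fin R × (Fin n₁ × Fin n₂)) F) :=
    Matrix.of fun q i => X (i, q)
  have hA : ∀ x : Fin R × (Fin n₁ × Fin n₂) → F, (∀ c, A.map (eval x) *ᵥ c = 0 → c = 0) ↔
      LinearIndependent F fun (i : Fin R) q => x (i, q) := fun x => by
    rw [Fintype.linearIndependent_iff]
    refine forall_congr' fun c => ?_
    have : A.map (eval x) *ᵥ c = ∑ i, c i • fun q => x (i, q) := by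
      ext q
      simp [A, Matrix.mulVec, dotProduct, mul_comm]
    rw [this, funext_iff (f := c)]
    rfl
  let a : Fin R → Fin n₁ × Fin n₂ := fun i => finProdFinEquiv.symm (Fin.castLE hR i)
  have ha : Function.Injective a :=
    finProdFinEquiv.symm.injective.comp (Fin.castLE_injective hR)
  let x₀ : Fin R × (Fin n₁ × Fin n₂) → F := fun y => Pi.single (M := fun _ => F) (a y.1) 1 y.2
  have h0 : LinearIndependent F fun (i : Fin R) q => x₀ (i, q) :=
    (Pi.linearIndependent_single_one (Fin n₁ × Fin n₂) F).comp a ha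
  obtain ⟨h, h1, h2⟩ := exists_polynomial_of_mulVec_injective A ((hA x₀).2 h0)
  refine ⟨h, ⟨x₀, fun i _ => containsSparse_rankVariety _ ?_, h1⟩, fun x hx => (hA x).1 (h2 x hx)⟩
  refine le_trans (Set.ncard_le_ncard (t := {a i}) (fun q hq => ?_)) ?_
  · by_contra hne
    exact hq (Pi.single_eq_of_ne hne _)
  · rw [Set.ncard_singleton]
    omega

/-- For fixed vectors the condition is injectivity of a linear map on the coefficients of the
admissible monomials, and the entries of its matrix are polynomials in the vectors. -/
theorem exists_polynomial_noVanishingForm {x₀ : Fin R × (Fin n₁ × Fin n₂) → F}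
    (h₀ : NoVanishingForm e s fun i q => x₀ (i, q)) :
    ∃ h : MvPolynomial (Fin R × (Fin n₁ × Fin n₂)) F, eval x₀ h ≠ 0 ∧
      ∀ x, eval x h ≠ 0 → NoVanishingForm e s fun i q => x (i, q) := by
  classical
  -- The exponents of degree `r + 1` without the excluded pure powers.
  obtain ⟨M, hM⟩ : ∃ M : Finset (Fin R →₀ ℕ), ∀ m, m ∈ M ↔
      (∃ q : Fin (r + 1) → Fin R, content q = m) ∧
        ∀ i : Fin R, (i : ℕ) < s → m ≠ Finsupp.single i (r + 1) :=
    ⟨(Finset.univ.image (content : (Fin (r + 1) → Fin R) → _)).filter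
      fun m => ∀ i : Fin R, (i : ℕ) < s → m ≠ Finsupp.single i (r + 1), fun m => by simp⟩
  have hM0 : ∀ m : M, ∃ a : Fin (r + 1) → Fin R, content a = m.1 := fun m => ((hM _).1 m.2).1
  choose a ha using hM0
  let A : Matrix (Fin p) M (MvPolynomial (Fin R × (Fin n₁ × Fin n₂)) F) := Matrix.of fun j m =>
    ∑ q : Fin (r + 1) → Fin n₁ × Fin n₂, C (coeff (content q) (minors F e j)) * ∏ t, X (a m t, q t)
  let poly (c : M → F) : MvPolynomial (Fin R) F := ∑ m, c m • monomial m.1 1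
  have hpoly : ∀ c m', coeff m' (poly c) = if h : m' ∈ M then c ⟨m', h⟩ else 0 := fun c m' => by
    simp only [poly, coeff_sum, coeff_smul, coeff_monomial, smul_eq_mul, mul_ite, mul_one, mul_zero]
    split_ifs with h
    · rw [Finset.sum_eq_single ⟨m', h⟩ (fun m _ hm => if_neg fun h => hm (Subtype.ext h)) (by simp),
        if_pos rfl]
    · refine Finset.sum_eq_zero fun m _ => if_neg ?_
      rintro rfl
      exact h m.2
  have hA : ∀ (x : Fin R × (Fin n₁ × Fin n₂) → F) c j, (A.map (eval x) *ᵥ c) j =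
      minorFunctional e j (aeval (fun i => linearForm fun q => x (i, q)) (poly c)) := by
    intro x c j
    simp only [poly, map_sum, map_smul, Matrix.mulVec, dotProduct, Matrix.map_apply]
    refine Finset.sum_congr rfl fun m _ => ?_
    rw [mul_comm, smul_eq_mul, ← ha m, ← monomial_content, map_prod]
    simp only [aeval_X]
    rw [prod_linearForm, map_sum]
    simp only [A, Matrix.of_apply, map_sum, map_mul, eval_C, map_prod (eval x), eval_X]
    congr 1
    refine Finset.sum_congr rfl fun q _ => ?_
    rw [← smul_eq_C_mul, map_smul, monomial_content, minorFunctional_monomial, smul_eq_mul,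
      mul_comm]
  have hiff : ∀ x : Fin R × (Fin n₁ × Fin n₂) → F, (∀ c, A.map (eval x) *ᵥ c = 0 → c = 0) ↔
      NoVanishingForm e s fun i q => x (i, q) := by
    intro x
    constructor
    · intro h T hT1 hT2 hT3
      have h1 : poly (fun m => coeff m.1 T) = T := by
        ext m
        rw [hpoly]
        split_ifs with hm
        · rfl
        · by_contra hne
          apply hm
          rw [hM]
          obtain ⟨q, hq⟩ := exists_content_eq m (by
            by_contra hd
            exact hne (hT1.coeff_eq_zero hd).symm)
          refine ⟨⟨q, hq⟩, ?_⟩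
          rintro i hi rfl
          exact hne (hT2 i hi).symm
      have h2 := h (fun m => coeff m.1 T) (funext fun j => by rw [hA, h1]; exact hT3 j)
      rw [← h1, h2]
      simp [poly]
    · intro h c hc
      have h1 := h (poly c) (IsHomogeneous.sum _ _ _ fun m _ => by
          rw [smul_monomial]
          exact isHomogeneous_monomial _ (by rw [← ha m, degree_content])) (fun i hi => by
          rw [hpoly, dif_neg]
          intro hm
          exact ((hM _).1 hm).2 i hi rfl) (fun j => by rw [← hA, hc]; rfl)
      ext m
      have h2 := hpoly c m.1
      rw [dif_pos m.2, h1] at h2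
      exact h2.symm
  obtain ⟨h, h1, h2⟩ := exists_polynomial_of_mulVec_injective A ((hiff x₀).2 h₀)
  exact ⟨h, h1, fun x hx => (hiff x).1 (h2 x hx)⟩

end MinorFunctional

/-! ## Generic intersections -/

section GenericIntersection

open MvPolynomial Module

variable {F : Type*} [Field F] {n₁ n₂ r R s p m : ℕ}

theorem sum_pairing_smul_eq {ι κ : Type*} [Fintype ι] [Fintype κ] [DecidableEq κ]
    {v χ : κ → ι → F} (hχ : ∀ i j, ∑ y, χ i y * v j y = if i = j then 1 else 0) {w : ι → F}
    (hw : w ∈ Submodule.span F (Set.range v)) (y : ι) :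
    ∑ i, (∑ y, χ i y * w y) * v i y = w y := by
  obtain ⟨g, rfl⟩ := Submodule.mem_span_range_iff_exists_fun F |>.1 hw
  have h1 : ∀ i, ∑ y, χ i y * (∑ j, g j • v j) y = g i := fun i => by
    simp only [Finset.sum_apply, Pi.smul_apply, smul_eq_mul, Finset.mul_sum]
    rw [Finset.sum_comm, Finset.sum_eq_single i]
    · simp only [mul_left_comm (χ _ _)]
      rw [← Finset.mul_sum, hχ, if_pos rfl, mul_one]
    · intro j _ hj
      simp only [mul_left_comm (χ _ _)]
      rw [← Finset.mul_sum, hχ, if_neg hj.symm, mul_zero]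
    · simp
  simp only [h1]
  simp

/-- The coordinates of a tensor with respect to a family with dual family `χ`. -/
def tensorCoordinates {ι κ : Type*} [Fintype ι] {d : ℕ} (χ : κ → ι → F) :
    Tensor d ι F →ₗ[F] Tensor d κ F where
  toFun T a := ∑ q, (∏ t, χ (a t) (q t)) * T q
  map_add' S T := by
    ext a
    simp [mul_add, Finset.sum_add_distrib]
  map_smul' c T := by
    ext a
    simp [Finset.mul_sum, mul_left_comm]

theorem tensorCoordinates_apply {ι κ : Type*} [Fintype ι] {d : ℕ} (χ : κ → ι → F)
    (T : Tensor d ι F) (a : Fin d → κ) :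
    tensorCoordinates χ T a = ∑ q, (∏ t, χ (a t) (q t)) * T q := rfl

theorem sum_tensorCoordinates_mul {ι κ : Type*} [Fintype ι] [Fintype κ] [DecidableEq κ] {d : ℕ}
    {v χ : κ → ι → F} (hχ : ∀ i j, ∑ y, χ i y * v j y = if i = j then 1 else 0)
    {T : Tensor d ι F} (hT : T ∈ symPower d (Submodule.span F (Set.range v))) (q : Fin d → ι) :
    ∑ a, tensorCoordinates χ T a * ∏ t, v (a t) (q t) = T q := by
  classical
  have h1 := hT.1
  clear hT
  induction h1 using Submodule.span_induction with
  | mem T h =>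
    obtain ⟨w, hw, rfl⟩ := h
    simp only [tensorCoordinates_apply]
    have h2 : ∀ a : Fin d → κ, ∑ q : Fin d → ι, (∏ t, χ (a t) (q t)) * ∏ t, w t (q t) =
        ∏ t, ∑ y, χ (a t) y * w t y := fun a => sum_prod_mul_prod (fun t => χ (a t)) w
    simp only [h2]
    rw [← Finset.prod_congr rfl fun t _ => sum_pairing_smul_eq hχ (hw t) (q t),
      Finset.prod_univ_sum, Fintype.piFinset_univ]
    exact Finset.sum_congr rfl fun a _ => Finset.prod_mul_distrib.symm
  | zero => simp
  | add S T _ _ h1 h2 => simp only [map_add, Pi.add_apply, add_mul, Finset.sum_add_distrib, h1, h2]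
  | smul c T _ h1 =>
    simp only [map_smul, Pi.smul_apply, smul_eq_mul, mul_assoc, ← Finset.mul_sum, h1]

theorem tensorCoordinates_comp_perm {ι κ : Type*} [Fintype ι] {d : ℕ} (χ : κ → ι → F)
    {T : Tensor d ι F} (hT : T ∈ symTensors d ι F) (π : Equiv.Perm (Fin d)) (a : Fin d → κ) :
    tensorCoordinates χ T (a ∘ π) = tensorCoordinates χ T a := by
  rw [tensorCoordinates_apply, tensorCoordinates_apply,
    ← (Equiv.arrowCongr π.symm (Equiv.refl ι)).sum_comp]
  refine Finset.sum_congr rfl fun q _ => ?_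
  have h1 : (Equiv.arrowCongr π.symm (Equiv.refl ι)) q = q ∘ π := rfl
  rw [h1, hT]
  congr 1
  rw [← Equiv.prod_comp π fun t => χ (a t) (q t)]
  simp

theorem tensorCoordinates_tensorPower {ι κ : Type*} [Fintype ι] [DecidableEq κ] {d : ℕ}
    {v χ : κ → ι → F} (hχ : ∀ i j, ∑ y, χ i y * v j y = if i = j then 1 else 0)
    (i : κ) (a : Fin d → κ) :
    tensorCoordinates χ (tensorPower d (v i)) a = ∏ t, if a t = i then 1 else 0 := by
  rw [tensorCoordinates_apply, sum_tensorPower_mul fun t => χ (a t)]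
  simp only [hχ]

/-- In coordinates with respect to `v`, a symmetric tensor of `S^{r+1}(U)` becomes a form in `R`
variables, and substituting the linear forms of the `v i` gives back the polynomial of `T`. Each
coefficient is a positive integer times a coordinate, so in characteristic zero the form determines
the tensor. -/
theorem eq_zero_of_noVanishingForm [CharZero F]
    (e : Fin p ≃ (Fin (r + 1) ↪o Fin n₁) × (Fin (r + 1) ↪o Fin n₂))
    {v χ : Fin R → Fin n₁ × Fin n₂ → F}
    (hχ : ∀ i j, ∑ y, χ i y * v j y = if i = j then 1 else 0) (hv : NoVanishingForm e s v)
    {T : Tensor (r + 1) (Fin n₁ × Fin n₂) F}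
    (hT : T ∈ symPower (r + 1) (Submodule.span F (Set.range v)))
    (hT' : T ∈ annihilator (r + 1) (minors F e))
    (h : ∀ i : Fin R, (i : ℕ) < s → tensorCoordinates χ T (fun _ => i) = 0) : T = 0 := by
  classical
  set c := tensorCoordinates χ T with hc
  set G : MvPolynomial (Fin R) F := ∑ a : Fin (r + 1) → Fin R, C (c a) * ∏ t, X (a t) with hG
  have hcoeff : ∀ b : Fin (r + 1) → Fin R, ∃ N : ℕ, N ≠ 0 ∧ coeff (content b) G = N * c b := by
    intro b
    refine ⟨(Finset.univ.filter fun a : Fin (r + 1) → Fin R => content a = content b).card,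
      Finset.card_ne_zero_of_mem (a := b) (by simp), ?_⟩
    simp only [hG, coeff_sum, monomial_content, coeff_C_mul, coeff_monomial, mul_ite, mul_one,
      mul_zero]
    rw [← Finset.sum_filter, Finset.sum_congr rfl (g := fun _ => c b), Finset.sum_const,
      nsmul_eq_mul]
    intro a ha
    obtain ⟨π, rfl⟩ := (content_eq_iff _ _).1 (Finset.mem_filter.1 ha).2
    exact tensorCoordinates_comp_perm χ hT.2 π b
  have hG0 : G = 0 := by
    refine hv G (IsHomogeneous.sum _ _ _ fun a _ => ?_) (fun i hi => ?_) fun j => ?_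
    · simpa using (isHomogeneous_C (Fin R) (c a)).mul (prod_X_isHomogeneous a)
    · obtain ⟨N, -, hN⟩ := hcoeff fun _ => i
      rw [h i hi, mul_zero] at hN
      rw [← hN]
      congr 1
      simp [content]
    · have h1 : aeval (fun i => linearForm (v i)) G =
          ∑ q : Fin (r + 1) → Fin n₁ × Fin n₂, C (T q) * ∏ t, X (q t) := by
        simp only [hG, map_sum, map_mul, map_prod, aeval_X, aeval_C, MvPolynomial.algebraMap_eq,
          prod_linearForm, Finset.mul_sum]
        rw [Finset.sum_comm]
        refine Finset.sum_congr rfl fun q _ => ?_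
        rw [← sum_tensorCoordinates_mul hχ hT q, map_sum, Finset.sum_mul]
        refine Finset.sum_congr rfl fun a _ => ?_
        rw [map_mul, map_prod, mul_assoc]
      rw [h1, minorFunctional_sum e j hT.2, (mem_annihilator_minors_iff e hT.2).1 hT', mul_zero]
  ext q
  rw [← sum_tensorCoordinates_mul hχ hT q]
  refine Finset.sum_eq_zero fun a _ => ?_
  obtain ⟨N, hN, h1⟩ := hcoeff a
  rw [hG0, coeff_zero] at h1
  rw [← hc, (mul_eq_zero.1 h1.symm).resolve_left (by exact_mod_cast hN), zero_mul]

/-- Subtracting from `T` the combination of planted powers with the same diagonal coordinates leaves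
a tensor of the intersection without the excluded pure powers, hence zero. -/
theorem symPower_inf_annihilator_eq_span [CharZero F] (hs : s ≤ R)
    (e : Fin p ≃ (Fin (r + 1) ↪o Fin n₁) × (Fin (r + 1) ↪o Fin n₂))
    {v : Fin R → Fin n₁ × Fin n₂ → F} (hli : LinearIndependent F v) (hv : NoVanishingForm e s v)
    (hvr : ∀ i : Fin R, (i : ℕ) < s → v i ∈ rankVariety F n₁ n₂ r) :
    symPower (r + 1) (Submodule.span F (Set.range v)) ⊓ annihilator (r + 1) (minors F e) =
      Submodule.span F (Set.range fun i : Fin s => tensorPower (r + 1) (v (Fin.castLE hs i))) := by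
  classical
  have hmem : ∀ i : Fin s, tensorPower (r + 1) (v (Fin.castLE hs i)) ∈
      symPower (r + 1) (Submodule.span F (Set.range v)) ⊓ annihilator (r + 1) (minors F e) :=
    fun i => ⟨tensorPower_mem_symPower (Submodule.subset_span ⟨_, rfl⟩),
      (tensorPower_mem_annihilator_iff e _).2 (hvr _ i.2)⟩
  apply le_antisymm
  · intro T hT
    obtain ⟨χ, hχ⟩ := exists_dual_family hli
    set S : Tensor (r + 1) (Fin n₁ × Fin n₂) F :=
      ∑ i : Fin s, tensorCoordinates χ T (fun _ => Fin.castLE hs i) •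
        tensorPower (r + 1) (v (Fin.castLE hs i)) with hS
    have hSmem : S ∈ Submodule.span F
        (Set.range fun i : Fin s => tensorPower (r + 1) (v (Fin.castLE hs i))) :=
      Submodule.sum_mem _ fun i _ => Submodule.smul_mem _ _ (Submodule.subset_span ⟨i, rfl⟩)
    have hSmem' : S ∈ symPower (r + 1) (Submodule.span F (Set.range v)) ⊓
        annihilator (r + 1) (minors F e) :=
      Submodule.sum_mem _ fun i _ => Submodule.smul_mem _ _ (hmem i)
    have h0 : T - S = 0 := by
      have h1 := Submodule.sub_mem _ hT hSmem'
      refine eq_zero_of_noVanishingForm e hχ hv h1.1 h1.2 fun i hi => ?_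
      rw [map_sub, Pi.sub_apply, sub_eq_zero, hS, map_sum, Finset.sum_apply,
        Finset.sum_eq_single ⟨i, hi⟩]
      · rw [map_smul, Pi.smul_apply, tensorCoordinates_tensorPower hχ]
        simp
      · intro j _ hj
        rw [map_smul, Pi.smul_apply, tensorCoordinates_tensorPower hχ]
        have : i ≠ Fin.castLE hs j := by
          rintro rfl
          exact hj rfl
        simp [this]
      · simp
    rw [sub_eq_zero.1 h0]
    exact hSmem
  · rw [Submodule.span_le]
    rintro _ ⟨i, rfl⟩
    exact hmem i

/-- The rows of the transition matrix are independent because `P` is; as the matrix is square, so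
are its columns, which are the vectors `z t`. -/
theorem exists_coefficients_of_span_eq {τ : Type*} {P X : Fin m → τ → F}
    (hP : LinearIndependent F P)
    (h : Submodule.span F (Set.range P) = Submodule.span F (Set.range X)) :
    ∃ z : Fin m → Fin m → F, LinearIndependent F z ∧ ∀ i q, P i q = ∑ t, z t i * X t q := by
  classical
  have h1 : ∀ i, ∃ a : Fin m → F, ∑ t, a t • X t = P i := fun i =>
    (Submodule.mem_span_range_iff_exists_fun F).1 (h ▸ Submodule.subset_span ⟨i, rfl⟩)
  choose a ha using h1
  have h2 : LinearIndependent F a := by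
    rw [Fintype.linearIndependent_iff] at hP ⊢
    intro g hg
    refine hP g ?_
    have : ∑ i, g i • P i = ∑ t, (∑ i, g i • a i) t • X t := by
      simp only [← ha, Finset.smul_sum, smul_smul, Finset.sum_apply, Pi.smul_apply, smul_eq_mul,
        Finset.sum_smul]
      exact Finset.sum_comm
    rw [this, hg]
    simp
  refine ⟨fun t i => a i t, ?_, fun i q => ?_⟩
  · have h3 : IsUnit (Matrix.of a) := Matrix.linearIndependent_rows_iff_isUnit.1 h2
    exact Matrix.linearIndependent_cols_iff_isUnit.2 h3
  · rw [← ha]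
    simp

end GenericIntersection

/-! ## Random functionals -/

section Gaussian

variable {F : Type*} [RCLike F] {R m k : ℕ}

/-- The real part alone avoids its prescribed value almost surely; this covers both fields at once.
-/
theorem ae_gaussian_pair_ne (w : F) :
    ∀ᵐ ξ : ℝ × ℝ ∂((gaussianReal 0 1).prod (gaussianReal 0 1)),
      (ξ.1 : F) + (ξ.2 : F) * RCLike.I ≠ w := by
  have h1 : (gaussianReal 0 1) {RCLike.re w} = 0 := by
    have := nullSingletonClass_gaussianReal (μ := 0) (v := 1) one_ne_zero
    exact measure_singleton _
  have h2 : ((gaussianReal 0 1).prod (gaussianReal 0 1)) ({RCLike.re w} ×ˢ Set.univ) = 0 := by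
    rw [Measure.prod_prod, h1, zero_mul]
  refine measure_mono_null ?_ h2
  rintro ξ hξ
  simp only [Set.mem_compl_iff, Set.mem_ofPred_eq, not_not] at hξ
  refine ⟨?_, trivial⟩
  rw [Set.mem_singleton_iff, ← hξ]
  simp

theorem continuous_weight_toScalars (c : Fin R → F) :
    Continuous fun ξ : Fin R → ℝ × ℝ => weight (toScalars F ξ) c := by
  unfold weight toScalars
  fun_prop

instance (R : ℕ) : IsProbabilityMeasure (gaussianTape R) := by
  unfold gaussianTape
  infer_instance

/-- Fubini: with all coordinates fixed except one at which `c` does not vanish, a single value of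
the remaining scalar is bad. -/
theorem ae_weight_ne_zero {c : Fin R → F} (hc : c ≠ 0) :
    ∀ᵐ ξ ∂(gaussianTape R), weight (toScalars F ξ) c ≠ 0 := by
  cases R with
  | zero => exact absurd (Subsingleton.elim _ _) hc
  | succ R =>
    obtain ⟨j, hj⟩ := Function.ne_iff.1 hc
    have hmp := measurePreserving_piFinSuccAbove
      (fun _ : Fin (R + 1) => (gaussianReal 0 1).prod (gaussianReal 0 1)) j
    have hmeas : MeasurableSet {ξ : Fin (R + 1) → ℝ × ℝ | weight (toScalars F ξ) c ≠ 0} :=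
      ((continuous_weight_toScalars c).measurable (measurableSet_singleton 0)).compl
    have hmeas' : MeasurableSet {y : (ℝ × ℝ) × (Fin R → ℝ × ℝ) |
        weight (toScalars F (j.insertNth y.1 y.2 : Fin (R + 1) → ℝ × ℝ)) c ≠ 0} :=
      hmp.symm.measurable hmeas
    rw [gaussianTape, ← hmp.symm.map_eq, ae_map_iff hmp.symm.measurable.aemeasurable hmeas]
    refine (Measure.ae_prod_iff_ae_ae hmeas').2 ((Measure.ae_ae_comm hmeas').2 (ae_of_all _ ?_))
    intro y
    filter_upwards [ae_gaussian_pair_ne (-(∑ i, toScalars F y i * c (j.succAbove i)) / c j)]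
      with ξ hξ h0
    apply hξ
    rw [weight, Fin.sum_univ_succAbove _ j] at h0
    simp only [toScalars, Fin.insertNth_apply_same, Fin.insertNth_apply_succAbove] at h0
    rw [eq_div_iff hj, eq_neg_iff_add_eq_zero]
    exact h0

theorem weight_comp_castLE (hR : m ≤ R) (f : Fin R → F) (c : Fin m → F) :
    weight (f ∘ Fin.castLE hR) c =
      weight f fun i => if h : (i : ℕ) < m then c ⟨i, h⟩ else 0 := by
  obtain ⟨j, rfl⟩ := Nat.exists_eq_add_of_le hR
  rw [weight, weight, Fin.sum_univ_add]
  simp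
  rfl

theorem ae_weight_comp_castLE_ne_zero (hR : m ≤ R) {c : Fin m → F} (hc : c ≠ 0) :
    ∀ᵐ ξ ∂(gaussianTape R), weight (toScalars F ξ ∘ Fin.castLE hR) c ≠ 0 := by
  simp only [weight_comp_castLE hR]
  refine ae_weight_ne_zero ?_
  obtain ⟨j, hj⟩ := Function.ne_iff.1 hc
  refine Function.ne_iff.2 ⟨Fin.castLE hR j, ?_⟩
  simpa using hj

theorem continuous_weight_comp_castLE (hR : m ≤ R) (c : Fin m → F) :
    Continuous fun ξ : Fin R → ℝ × ℝ => weight (toScalars F ξ ∘ Fin.castLE hR) c := by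
  simp only [weight_comp_castLE hR]
  exact continuous_weight_toScalars _

theorem weight_sub_smul (f : Fin m → F) (a b : F) (c d : Fin m → F) :
    weight f (a • c - b • d) = a * weight f c - b * weight f d := by
  simp only [weight, Finset.mul_sum, ← Finset.sum_sub_distrib]
  refine Finset.sum_congr rfl fun i _ => ?_
  simp only [Pi.sub_apply, Pi.smul_apply, smul_eq_mul]
  ring

theorem ae_weight_ratio_ne (hR : m ≤ R) {c d : Fin m → F} (h : LinearIndependent F ![c, d]) :
    ∀ᵐ ω ∂((gaussianTape R).prod (gaussianTape R)),
      weight (toScalars F ω.1 ∘ Fin.castLE hR) c * weight (toScalars F ω.2 ∘ Fin.castLE hR) d ≠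
        weight (toScalars F ω.1 ∘ Fin.castLE hR) d *
          weight (toScalars F ω.2 ∘ Fin.castLE hR) c := by
  have hmeas : MeasurableSet {ω : (Fin R → ℝ × ℝ) × (Fin R → ℝ × ℝ) |
      weight (toScalars F ω.1 ∘ Fin.castLE hR) c * weight (toScalars F ω.2 ∘ Fin.castLE hR) d ≠
        weight (toScalars F ω.1 ∘ Fin.castLE hR) d *
          weight (toScalars F ω.2 ∘ Fin.castLE hR) c} := by
    refine (isClosed_eq ?_ ?_).measurableSet.compl
    · exact ((continuous_weight_comp_castLE hR c).comp continuous_fst).mul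
        ((continuous_weight_comp_castLE hR d).comp continuous_snd)
    · exact ((continuous_weight_comp_castLE hR d).comp continuous_fst).mul
        ((continuous_weight_comp_castLE hR c).comp continuous_snd)
  refine (Measure.ae_prod_iff_ae_ae hmeas).2 ?_
  have hc : c ≠ 0 := h.ne_zero 0
  filter_upwards [ae_weight_comp_castLE_ne_zero hR hc] with θ hθ
  -- For a fixed first functional the condition on the second is linear: it must not kill this
  -- combination, which is non-zero by independence.
  have h1 : weight (toScalars F θ ∘ Fin.castLE hR) c • d -
      weight (toScalars F θ ∘ Fin.castLE hR) d • c ≠ 0 := by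
    intro h0
    rw [LinearIndependent.pair_iff] at h
    refine hθ (h (-weight (toScalars F θ ∘ Fin.castLE hR) d)
      (weight (toScalars F θ ∘ Fin.castLE hR) c) ?_).2
    rw [neg_smul, neg_add_eq_sub, h0]
  filter_upwards [ae_weight_comp_castLE_ne_zero hR h1] with η hη h2
  apply hη
  rw [weight_sub_smul, h2, sub_self]

theorem ae_genericDecomposition {ι : Type*} (hR : m ≤ R) {P : Fin m → Tensor (k + 1) ι F}
    {z : Fin m → Fin m → F} {x : Fin m → ι → F} (hz : LinearIndependent F z)
    (hx : LinearIndependent F x) (hP : ∀ i q, P i q = ∑ t, z t i * tensorPower (k + 1) (x t) q) :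
    ∀ᵐ ω ∂((gaussianTape R).prod (gaussianTape R)),
      GenericDecomposition P (toScalars F ω.1 ∘ Fin.castLE hR) (toScalars F ω.2 ∘ Fin.castLE hR)
        z x := by
  have h1 : ∀ᵐ ω ∂((gaussianTape R).prod (gaussianTape R)), ∀ t,
      weight (toScalars F ω.1 ∘ Fin.castLE hR) (z t) ≠ 0 := ae_all_iff.2 fun t =>
    Measure.quasiMeasurePreserving_fst.ae (ae_weight_comp_castLE_ne_zero hR (hz.ne_zero t))
  have h2 : ∀ᵐ ω ∂((gaussianTape R).prod (gaussianTape R)), ∀ t,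
      weight (toScalars F ω.2 ∘ Fin.castLE hR) (z t) ≠ 0 := ae_all_iff.2 fun t =>
    Measure.quasiMeasurePreserving_snd.ae (ae_weight_comp_castLE_ne_zero hR (hz.ne_zero t))
  have h3 : ∀ᵐ ω ∂((gaussianTape R).prod (gaussianTape R)), ∀ t u, t ≠ u →
      weight (toScalars F ω.1 ∘ Fin.castLE hR) (z t) *
        weight (toScalars F ω.2 ∘ Fin.castLE hR) (z u) ≠
      weight (toScalars F ω.1 ∘ Fin.castLE hR) (z u) *
        weight (toScalars F ω.2 ∘ Fin.castLE hR) (z t) := by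
    refine ae_all_iff.2 fun t => ae_all_iff.2 fun u => ?_
    by_cases htu : t = u
    · exact ae_of_all _ fun _ h => absurd htu h
    · have : LinearIndependent F ![z t, z u] := by
        have := hz.comp ![t, u] (by
          intro a b
          fin_cases a <;> fin_cases b <;> simp [htu, Ne.symm htu])
        convert this using 1
        ext a
        fin_cases a <;> rfl
      filter_upwards [ae_weight_ratio_ne hR this] with ω hω _
      exact hω
  filter_upwards [h1, h2, h3] with ω h1 h2 h3
  refine ⟨hz, hx, hP, h1, h2, fun t u htu => ?_⟩
  by_contra hne
  rw [div_eq_div_iff (h2 t) (h2 u)] at htu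
  exact h3 t u hne htu

end Gaussian

/-! ### The algorithm on generic subspaces with planted elements -/

section GenericSubspaces

open MvPolynomial

variable {F : Type*} [RCLike F]

/-- The open set is the complement of two hypersurfaces, one for linear independence and one for the
absence of vanishing forms. On it the intersection computed by the algorithm has the planted powers
as a basis, and random functionals recover them. -/
theorem generic_subspaces_correct (r n₁ n₂ R s : ℕ) (hr : 1 ≤ r) (h₁ : r < n₁) (h₂ : r < n₂)
    (hR : (R : ℝ) ≤ dimBound n₁ n₂ r) (hs : s ≤ R) :
    ∃ G : Set (Fin R × (Fin n₁ × Fin n₂) → F),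
      IsZariskiOpenDenseIn G (plantedVariety F n₁ n₂ r R s) ∧
      ∀ x ∈ G, ∀ v : Fin R → Fin n₁ × Fin n₂ → F, (∀ i q, v i q = x (i, q)) →
        LinearIndependent F v ∧
        (∀ w, (w ∈ Submodule.span F (Set.range v) ∧ w ∈ rankVariety F n₁ n₂ r) ↔
          w = 0 ∨ ∃ (i : Fin s) (t : F), w = t • v (Fin.castLE hs i)) ∧
        ∀ (p m : ℕ) (e : Fin p ≃ (Fin (r + 1) ↪o Fin n₁) × (Fin (r + 1) ↪o Fin n₂))
          (u : Fin R → Fin n₁ × Fin n₂ → F), LinearIndependent F u →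
          Submodule.span F (Set.range u) = Submodule.span F (Set.range v) →
        ∀ P : Fin m → Tensor (r + 1) (Fin n₁ × Fin n₂) F,
        ∀ᵐ ω ∂((gaussianTape R).prod (gaussianTape R)), ∀ out : Output (Fin n₁ × Fin n₂) F,
          Algorithm1 (minors F e) u P (toScalars F ω.1) (toScalars F ω.2) out →
          (s = 0 → out = .trivial) ∧
          (0 < s → ∃ (xs : List (Fin n₁ × Fin n₂ → F)) (t : Fin s → F), out = .only xs ∧
            (∀ i, t i ≠ 0) ∧
            xs.Perm (List.ofFn fun i : Fin s => t i • v (Fin.castLE hs i))) := by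
  have hN : 0 < n₁ * n₂ := Nat.mul_pos (by omega) (by omega)
  have hle := mul_pow_le_of_le_dimBound hN hR
  obtain ⟨p₀, ⟨e₀⟩⟩ : ∃ p₀, Nonempty (Fin p₀ ≃ (Fin (r + 1) ↪o Fin n₁) × (Fin (r + 1) ↪o Fin n₂)) :=
    ⟨_, ⟨(Fintype.equivFin _).symm⟩⟩
  obtain ⟨x₀, hx₀, hnv₀⟩ := exists_noVanishingForm (F := F) (s := s) e₀ hN hle
  obtain ⟨h, hh0, hh⟩ := exists_polynomial_noVanishingForm e₀ hnv₀
  obtain ⟨h', hh0', hh'⟩ := exists_polynomial_linearIndependent (F := F) (s := s)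
    (Nat.one_le_iff_ne_zero.1 hr) (le_of_mul_pow_le hN hle)
  refine ⟨{x ∈ plantedVariety F n₁ n₂ r R s | eval x (h * h') ≠ 0},
    isZariskiOpenDenseIn_of_polyIrreducible polyIrreducible_plantedVariety
      (polyIrreducible_plantedVariety.2 h h' ⟨x₀, hx₀, hh0⟩ hh0'), ?_⟩
  rintro x ⟨hxY, hxh⟩ v hv
  rw [map_mul] at hxh
  obtain rfl : v = fun i q => x (i, q) := funext fun i => funext fun q => hv i q
  have hli := hh' x (right_ne_zero_of_mul hxh)
  have hnv := hh x (left_ne_zero_of_mul hxh)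
  have hspan₀ := symPower_inf_annihilator_eq_span hs e₀ hli hnv fun i hi => hxY i hi
  have hlis : LinearIndependent F fun (i : Fin s) q => x (Fin.castLE hs i, q) :=
    hli.comp _ (Fin.castLE_injective hs)
  refine ⟨hli, mem_inter_rankVariety_iff (Nat.one_le_iff_ne_zero.1 hr) e₀ hlis hspan₀, ?_⟩
  intro p m e u hu huv P
  by_cases hP : IsIntersectionBasis (r + 1) (minors F e) u P
  swap
  · exact ae_of_all _ fun _ _ h => absurd h.1 hP
  -- The open set was obtained with one enumeration and the basis `v`, but the intersection depends
  -- on neither.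
  have hann : symPower (r + 1) (Submodule.span F (Set.range u)) ⊓ annihilator (r + 1) (minors F e) =
      symPower (r + 1) (Submodule.span F (Set.range fun (i : Fin R) q => x (i, q))) ⊓
        annihilator (r + 1) (minors F e₀) := by
    rw [huv]
    ext T
    refine and_congr_right fun hT => ?_
    exact (mem_annihilator_minors_iff e hT.2).trans (mem_annihilator_minors_iff e₀ hT.2).symm
  have hspan := hP.2.trans (hann.trans hspan₀)
  have hlit := linearIndependent_tensorPower (d := r + 1) r.succ_ne_zero hlis
  obtain rfl : m = s := by
    have h1 := finrank_span_eq_card hP.1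
    rw [hspan, finrank_span_eq_card hlit, Fintype.card_fin, Fintype.card_fin] at h1
    exact h1.symm
  obtain ⟨z, hz, hPz⟩ := exists_coefficients_of_span_eq hP.1 hspan
  filter_upwards [ae_genericDecomposition hs hz hlis hPz] with ω hω out hout
  constructor
  · rintro rfl
    cases hout.2 with
    | trivial => rfl
    | tooMany h => omega
    | noDecomposition h => omega
    | notPowers h => omega
    | found h => omega
  · intro hm
    obtain ⟨σ, c, hc, rfl⟩ := hω.output_eq hm hs (Nat.one_le_iff_ne_zero.1 hr) hout.2
    -- The scalars are produced in the order of the output list, so they are moved back along the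
    -- permutation.
    refine ⟨_, fun i => c (σ.symm i), rfl, fun i => hc _, ?_⟩
    have := Equiv.Perm.ofFn_comp_perm σ
      fun (i : Fin m) => c (σ.symm i) • fun q => x (Fin.castLE hs i, q)
    simpa [Function.comp_def] using this

end GenericSubspaces

/-! ## The order of growth of the dimension bound -/

/-- Each factor of `n (n-1) ⋯ (n-k+1)` is at least `n - k + 1`, and `n ≤ k (n - k + 1)`. -/
theorem pow_le_pow_mul_factorial_mul_choose {n k : ℕ} (hk : 0 < k) (hkn : k ≤ n) :
    n ^ k ≤ k ^ k * k ! * n.choose k := by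
  obtain ⟨a, rfl⟩ := Nat.exists_eq_add_of_le hkn
  have h1 := Nat.pow_sub_le_descFactorial (k + a) k
  rw [Nat.descFactorial_eq_factorial_mul_choose, show k + a + 1 - k = a + 1 by omega] at h1
  calc (k + a) ^ k ≤ (k * (a + 1)) ^ k := Nat.pow_le_pow_left (by nlinarith) k
    _ = k ^ k * (a + 1) ^ k := mul_pow _ _ _
    _ ≤ k ^ k * (k ! * (k + a).choose k) := Nat.mul_le_mul_left _ h1
    _ = _ := (mul_assoc _ _ _).symm

theorem exists_mul_le_dimBound (r : ℕ) : ∃ κ : ℝ, 0 < κ ∧ ∀ n₁ n₂ : ℕ, r < n₁ → r < n₂ →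
    κ * ((n₁ : ℝ) * (n₂ : ℝ)) ≤ dimBound n₁ n₂ r := by
  -- The loss in each of the two binomial coefficients of the numerator; the further factor `(r + 1)
  -- ^ r` comes from `N + r - 1 ≤ (r + 1) N` in the denominator.
  set K : ℕ := (r + 1) ^ (r + 1) * (r + 1)! with hK
  have hKpos : 0 < K := Nat.mul_pos (pow_pos r.succ_pos _) (Nat.factorial_pos _)
  have hLpos : 0 < K * K * (r + 1) ^ r :=
    Nat.mul_pos (Nat.mul_pos hKpos hKpos) (pow_pos r.succ_pos _)
  refine ⟨1 / (K * K * (r + 1) ^ r : ℕ), by positivity, fun n₁ n₂ h₁ h₂ => ?_⟩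
  have hN : 0 < n₁ * n₂ := Nat.mul_pos (by omega) (by omega)
  have hD : 0 < (n₁ * n₂ + r - 1).descFactorial r := by
    rw [Nat.pos_iff_ne_zero, Ne, Nat.descFactorial_eq_zero_iff_lt]
    omega
  have h3 : (n₁ * n₂ + r - 1).descFactorial r ≤ (r + 1) ^ r * (n₁ * n₂) ^ r := by
    rw [← mul_pow]
    exact (Nat.descFactorial_le_pow _ _).trans
      (Nat.pow_le_pow_left (by nlinarith [Nat.sub_le (n₁ * n₂ + r) 1]) r)
  have h4 := pow_le_pow_mul_factorial_mul_choose r.succ_pos h₁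
  have h5 := pow_le_pow_mul_factorial_mul_choose r.succ_pos h₂
  rw [Nat.succ_eq_add_one, ← hK] at h4 h5
  rw [dimBound_eq hN, le_div_iff₀ (by exact_mod_cast hD), mul_assoc, one_div, ← div_eq_inv_mul,
    div_le_iff₀ (by exact_mod_cast hLpos)]
  have h6 : n₁ * n₂ * (n₁ * n₂ + r - 1).descFactorial r ≤
      n₁.choose (r + 1) * n₂.choose (r + 1) * (K * K * (r + 1) ^ r) :=
    calc _ ≤ n₁ * n₂ * ((r + 1) ^ r * (n₁ * n₂) ^ r) := Nat.mul_le_mul_left _ h3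
      _ = n₁ ^ (r + 1) * n₂ ^ (r + 1) * (r + 1) ^ r := by ring
      _ ≤ K * n₁.choose (r + 1) * (K * n₂.choose (r + 1)) * (r + 1) ^ r :=
        Nat.mul_le_mul_right _ (Nat.mul_le_mul h4 h5)
      _ = _ := by ring
  exact_mod_cast h6

/-! ## The cost of programs with bounded registers -/

namespace NExp

/-- The value of the expression does not exceed a common bound of the registers. -/
def Bounded (e : NExp) : Prop := ∀ (ρ : ℕ → ℕ) (B : ℕ), 4 ≤ B → (∀ i, ρ i ≤ B) → e.eval ρ ≤ B

theorem bounded_reg (i : ℕ) : (reg i).Bounded := fun _ _ _ h => h i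

theorem bounded_lit {c : ℕ} (hc : c ≤ 4) : (lit c).Bounded := fun _ _ hB _ => hc.trans hB

/-- Truncated subtraction turns this into the minimum of `e` and `e'`. A counter can so be increased
while a syntactic bound is kept. -/
theorem bounded_clamp {e : NExp} (he : e.Bounded) (e' : NExp) : (sub e (sub e e')).Bounded :=
  fun ρ B hB h => (Nat.sub_le _ _).trans (he ρ B hB h)

/-- Intermediate values may exceed the bound of the registers, but they remain polynomial in it,
with an exponent that depends on the expression only. -/
theorem exists_cost_le (e : NExp) : ∃ k, ∀ (ρ : ℕ → ℕ) (B : ℕ), 4 ≤ B → (∀ i, ρ i ≤ B) →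
    e.eval ρ ≤ B ^ k ∧ e.cost ρ ≤ B ^ k := by
  have key : ∀ {B x y u v w k l : ℕ}, 4 ≤ B → x ≤ B ^ k → y ≤ B ^ l → u ≤ B ^ k → v ≤ B ^ l →
      w ≤ B ^ (k + l) ∨ w ≤ x + y → w ≤ B ^ (k + l + 2) ∧ u + v + w + 1 ≤ B ^ (k + l + 2) := by
    intro B x y u v w k l hB hx hy hu hv hw
    have hk : B ^ k ≤ B ^ (k + l) := Nat.pow_le_pow_right (by omega) (by omega)
    have hl : B ^ l ≤ B ^ (k + l) := Nat.pow_le_pow_right (by omega) (by omega)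
    have h1 : 1 ≤ B ^ (k + l) := Nat.one_le_pow _ _ (by omega)
    have h2 : 16 * B ^ (k + l) ≤ B ^ (k + l + 2) := by
      rw [pow_add _ (k + l) 2, mul_comm]
      exact Nat.mul_le_mul_left _ (by nlinarith)
    omega
  induction e with
  | lit c =>
    refine ⟨c + 1, fun ρ B hB h => ?_⟩
    have h1 : c + 1 ≤ B ^ (c + 1) := (Nat.lt_pow_self (by omega)).le
    exact ⟨by simp only [eval]; omega, by simp only [cost]; omega⟩
  | reg i =>
    refine ⟨2, fun ρ B hB h => ?_⟩
    have h1 := h i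
    have h2 : 4 * B ≤ B ^ 2 := by nlinarith
    exact ⟨by simp only [eval]; omega, by simp only [cost]; omega⟩
  | add a b iha ihb =>
    obtain ⟨k, hk⟩ := iha
    obtain ⟨l, hl⟩ := ihb
    exact ⟨k + l + 2, fun ρ B hB h => key hB (hk ρ B hB h).1 (hl ρ B hB h).1 (hk ρ B hB h).2
      (hl ρ B hB h).2 (.inr le_rfl)⟩
  | sub a b iha ihb =>
    obtain ⟨k, hk⟩ := iha
    obtain ⟨l, hl⟩ := ihb
    exact ⟨k + l + 2, fun ρ B hB h => key hB (hk ρ B hB h).1 (hl ρ B hB h).1 (hk ρ B hB h).2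
      (hl ρ B hB h).2 (.inr ((Nat.sub_le _ _).trans (Nat.le_add_right _ _)))⟩
  | mul a b iha ihb =>
    obtain ⟨k, hk⟩ := iha
    obtain ⟨l, hl⟩ := ihb
    exact ⟨k + l + 2, fun ρ B hB h => key hB (hk ρ B hB h).1 (hl ρ B hB h).1 (hk ρ B hB h).2
      (hl ρ B hB h).2 (.inl (by
        rw [pow_add]; exact Nat.mul_le_mul (hk ρ B hB h).1 (hl ρ B hB h).1))⟩
  | div a b iha ihb =>
    obtain ⟨k, hk⟩ := iha
    obtain ⟨l, hl⟩ := ihb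
    exact ⟨k + l + 2, fun ρ B hB h => key hB (hk ρ B hB h).1 (hl ρ B hB h).1 (hk ρ B hB h).2
      (hl ρ B hB h).2 (.inr ((Nat.div_le_self _ _).trans (Nat.le_add_right _ _)))⟩
  | mod a b iha ihb =>
    obtain ⟨k, hk⟩ := iha
    obtain ⟨l, hl⟩ := ihb
    exact ⟨k + l + 2, fun ρ B hB h => key hB (hk ρ B hB h).1 (hl ρ B hB h).1 (hk ρ B hB h).2
      (hl ρ B hB h).2 (.inr ((Nat.mod_le _ _).trans (Nat.le_add_right _ _)))⟩

end NExp

theorem FExp.exists_cost_le (F : Type*) [RCLike F] (x : FExp) :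
    ∃ k, ∀ (σ : Store F) (B : ℕ), 4 ≤ B → (∀ i, σ.reg i ≤ B) → x.cost σ ≤ B ^ k := by
  have key : ∀ {B u v k l : ℕ}, 4 ≤ B → u ≤ B ^ k → v ≤ B ^ l → u + v + 1 ≤ B ^ (k + l + 1) := by
    intro B u v k l hB hu hv
    have hk : B ^ k ≤ B ^ (k + l) := Nat.pow_le_pow_right (by omega) (by omega)
    have hl : B ^ l ≤ B ^ (k + l) := Nat.pow_le_pow_right (by omega) (by omega)
    have h1 : 1 ≤ B ^ (k + l) := Nat.one_le_pow _ _ (by omega)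
    have h2 : 4 * B ^ (k + l) ≤ B ^ (k + l + 1) := by
      rw [pow_succ, mul_comm]
      exact Nat.mul_le_mul_left _ hB
    omega
  have key' : ∀ {B u k : ℕ}, 4 ≤ B → u ≤ B ^ k → u + 1 ≤ B ^ (k + 1) := by
    intro B u k hB hu
    have h1 : 1 ≤ B ^ k := Nat.one_le_pow _ _ (by omega)
    have h2 : 4 * B ^ k ≤ B ^ (k + 1) := by
      rw [pow_succ, mul_comm]
      exact Nat.mul_le_mul_left _ hB
    omega
  induction x with
  | zero => exact ⟨0, fun σ B hB h => le_rfl⟩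
  | one => exact ⟨0, fun σ B hB h => le_rfl⟩
  | cell a i j =>
    obtain ⟨k, hk⟩ := i.exists_cost_le
    obtain ⟨l, hl⟩ := j.exists_cost_le
    exact ⟨k + l + 1, fun σ B hB h => key hB (hk _ B hB h).2 (hl _ B hB h).2⟩
  | add x y ihx ihy | sub x y ihx ihy | mul x y ihx ihy =>
    obtain ⟨k, hk⟩ := ihx
    obtain ⟨l, hl⟩ := ihy
    exact ⟨k + l + 1, fun σ B hB h => key hB (hk σ B hB h) (hl σ B hB h)⟩
  | inv x ih | conj x ih =>
    obtain ⟨k, hk⟩ := ih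
    exact ⟨k + 1, fun σ B hB h => key' hB (hk σ B hB h)⟩

namespace Program

/-- Registers are only set to bounded values, and loops have bounded length and contain no call of
the oracle if `q` holds. -/
def Bounded : Prop → Program → Prop
  | _, skip => True
  | _, setReg _ e => e.Bounded
  | _, setCell _ _ _ _ => True
  | q, seq c₁ c₂ => Bounded q c₁ ∧ Bounded q c₂
  | q, ifZero _ c₁ c₂ => Bounded q c₁ ∧ Bounded q c₂
  | q, ifLt _ _ c₁ c₂ => Bounded q c₁ ∧ Bounded q c₂
  | _, loop _ e body => e.Bounded ∧ Bounded False body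
  | q, diag _ _ _ _ => q

/-- The exponent is fixed by the program: registers stay below `B`, so a loop has at most `B` rounds
and raises the exponent by a constant. Oracle calls stay outside loops, hence their number is a
constant; the clause `¬ q → l = 0` carries this through the induction. -/
theorem exists_cost_le (F : Type*) [RCLike F] {q : Prop} {c : Program} (hc : Bounded q c) :
    ∃ k l, (¬ q → l = 0) ∧ ∀ (O : DiagOracle F) (σ : Store F) (B : ℕ), 4 ≤ B → (∀ i, σ.reg i ≤ B) →
      (∀ i, (run O c σ).reg i ≤ B) ∧ (run O c σ).steps ≤ σ.steps + B ^ k ∧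
        (run O c σ).calls ≤ σ.calls + l := by
  have pow1 : ∀ {B k l : ℕ}, 4 ≤ B → k ≤ l → B ^ k ≤ B ^ l := fun hB h =>
    Nat.pow_le_pow_right (by omega) h
  have four : ∀ {B : ℕ} (k : ℕ), 4 ≤ B → 4 * B ^ k ≤ B ^ (k + 1) := fun k hB => by
    rw [pow_succ, mul_comm]
    exact Nat.mul_le_mul_left _ hB
  have one : ∀ {B : ℕ} (k : ℕ), 4 ≤ B → 1 ≤ B ^ k := fun k hB => Nat.one_le_pow _ _ (by omega)
  induction c generalizing q with
  | skip =>
    exact ⟨0, 0, fun _ => rfl, fun O σ B hB h => ⟨h, le_rfl, le_rfl⟩⟩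
  | setReg i e =>
    obtain ⟨k, hk⟩ := e.exists_cost_le
    refine ⟨k + 1, 0, fun _ => rfl, fun O σ B hB h => ⟨fun j => ?_, ?_, le_rfl⟩⟩
    · simp only [run, Store.tick, Store.setReg]
      split_ifs
      · exact hc _ B hB h
      · exact h j
    · have := (hk _ B hB h).2
      have := four k hB
      have := one k hB
      simp only [run, Store.tick, Store.setReg]
      omega
  | setCell a i j x =>
    obtain ⟨k, hk⟩ := i.exists_cost_le
    obtain ⟨l, hl⟩ := j.exists_cost_le
    obtain ⟨m, hm⟩ := x.exists_cost_le F
    refine ⟨k + l + m + 1, 0, fun _ => rfl, fun O σ B hB h => ⟨h, ?_, le_rfl⟩⟩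
    have := (hk _ B hB h).2
    have := (hl _ B hB h).2
    have := hm σ B hB h
    have := four (k + l + m) hB
    have := one (k + l + m) hB
    have := pow1 hB (show k ≤ k + l + m by omega)
    have := pow1 hB (show l ≤ k + l + m by omega)
    have := pow1 hB (show m ≤ k + l + m by omega)
    simp only [run, Store.tick, Store.setCell]
    omega
  | seq c₁ c₂ ih₁ ih₂ =>
    obtain ⟨k₁, l₁, hl₁, h₁⟩ := ih₁ hc.1
    obtain ⟨k₂, l₂, hl₂, h₂⟩ := ih₂ hc.2
    refine ⟨k₁ + k₂ + 1, l₁ + l₂, fun hq => by rw [hl₁ hq, hl₂ hq], fun O σ B hB h => ?_⟩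
    obtain ⟨h3, h4, h5⟩ := h₁ O σ B hB h
    obtain ⟨h6, h7, h8⟩ := h₂ O _ B hB h3
    have := four (k₁ + k₂) hB
    have := pow1 hB (show k₁ ≤ k₁ + k₂ by omega)
    have := pow1 hB (show k₂ ≤ k₁ + k₂ by omega)
    simp only [run]
    exact ⟨h6, by omega, by omega⟩
  | ifZero x c₁ c₂ ih₁ ih₂ =>
    obtain ⟨m, hm⟩ := x.exists_cost_le F
    obtain ⟨k₁, l₁, hl₁, h₁⟩ := ih₁ hc.1
    obtain ⟨k₂, l₂, hl₂, h₂⟩ := ih₂ hc.2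
    refine ⟨k₁ + k₂ + m + 1, l₁ + l₂, fun hq => by rw [hl₁ hq, hl₂ hq], fun O σ B hB h => ?_⟩
    obtain ⟨h3, h4, h5⟩ := h₁ O (σ.tick (x.cost σ + 1)) B hB h
    obtain ⟨h6, h7, h8⟩ := h₂ O (σ.tick (x.cost σ + 1)) B hB h
    have := hm σ B hB h
    have := four (k₁ + k₂ + m) hB
    have := one (k₁ + k₂ + m) hB
    have := pow1 hB (show k₁ ≤ k₁ + k₂ + m by omega)
    have := pow1 hB (show k₂ ≤ k₁ + k₂ + m by omega)
    have := pow1 hB (show m ≤ k₁ + k₂ + m by omega)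
    simp only [run]
    simp only [Store.tick] at h3 h4 h5 h6 h7 h8 ⊢
    split_ifs
    · exact ⟨h3, by omega, by omega⟩
    · exact ⟨h6, by omega, by omega⟩
  | ifLt e₁ e₂ c₁ c₂ ih₁ ih₂ =>
    obtain ⟨m, hm⟩ := e₁.exists_cost_le
    obtain ⟨n, hn⟩ := e₂.exists_cost_le
    obtain ⟨k₁, l₁, hl₁, h₁⟩ := ih₁ hc.1
    obtain ⟨k₂, l₂, hl₂, h₂⟩ := ih₂ hc.2
    refine ⟨k₁ + k₂ + m + n + 1, l₁ + l₂, fun hq => by rw [hl₁ hq, hl₂ hq], fun O σ B hB h => ?_⟩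
    obtain ⟨h3, h4, h5⟩ := h₁ O (σ.tick (e₁.cost σ.reg + e₂.cost σ.reg + 1)) B hB h
    obtain ⟨h6, h7, h8⟩ := h₂ O (σ.tick (e₁.cost σ.reg + e₂.cost σ.reg + 1)) B hB h
    have := (hm _ B hB h).2
    have := (hn _ B hB h).2
    have := four (k₁ + k₂ + m + n) hB
    have := one (k₁ + k₂ + m + n) hB
    have := pow1 hB (show k₁ ≤ k₁ + k₂ + m + n by omega)
    have := pow1 hB (show k₂ ≤ k₁ + k₂ + m + n by omega)
    have := pow1 hB (show m ≤ k₁ + k₂ + m + n by omega)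
    have := pow1 hB (show n ≤ k₁ + k₂ + m + n by omega)
    simp only [run]
    simp only [Store.tick] at h3 h4 h5 h6 h7 h8 ⊢
    split_ifs
    · exact ⟨h3, by omega, by omega⟩
    · exact ⟨h6, by omega, by omega⟩
  | loop i e body ih =>
    obtain ⟨he, hbody⟩ := hc
    obtain ⟨m, hm⟩ := e.exists_cost_le
    obtain ⟨k, l, hl, h₁⟩ := ih hbody
    obtain rfl := hl not_false
    refine ⟨k + m + 3, 0, fun _ => rfl, fun O σ B hB h => ?_⟩
    have hloop : ∀ N ≤ e.eval σ.reg, ∀ τ, τ = (List.range N).foldl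
        (fun τ t => run O body ((τ.setReg i t).tick (t + 1))) (σ.tick (e.cost σ.reg + 1)) →
        (∀ j, τ.reg j ≤ B) ∧ τ.steps ≤ σ.steps + (e.cost σ.reg + 1) + N * (B + B ^ k) ∧
        τ.calls ≤ σ.calls := by
      intro N
      induction N with
      | zero =>
        rintro - τ rfl
        exact ⟨h, by simp [Store.tick], le_rfl⟩
      | succ N ihN =>
        rintro hN τ rfl
        rw [List.range_succ, List.foldl_append]
        obtain ⟨h2, h3, h4⟩ := ihN (by omega) _ rfl
        generalize (List.range N).foldl _ _ = τ at h2 h3 h4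
        have hNB : N + 1 ≤ B := hN.trans (he _ B hB h)
        obtain ⟨h5, h6, h7⟩ := h₁ O ((τ.setReg i N).tick (N + 1)) B hB (fun j => by
          simp only [Store.tick, Store.setReg]
          split_ifs
          · omega
          · exact h2 j)
        simp only [Store.tick, Store.setReg] at h6 h7
        simp only [List.foldl_cons, List.foldl_nil]
        refine ⟨h5, ?_, h7.trans (by simpa using h4)⟩
        refine h6.trans ?_
        rw [Nat.add_mul, one_mul]
        omega
    obtain ⟨h2, h3, h4⟩ := hloop _ le_rfl _ rfl
    refine ⟨h2, h3.trans ?_, h4⟩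
    have h5 : e.eval σ.reg * (B + B ^ k) ≤ B * (B + B ^ k) := Nat.mul_le_mul_right _ (he _ B hB h)
    have h6 := (hm _ B hB h).2
    have h7 : B * (B + B ^ k) = B ^ 2 + B ^ (k + 1) := by ring
    have : 4 * B ^ (k + m + 2) ≤ B ^ (k + m + 3) := four _ hB
    have := one (k + m + 2) hB
    have := pow1 hB (show 2 ≤ k + m + 2 by omega)
    have := pow1 hB (show k + 1 ≤ k + m + 2 by omega)
    have := pow1 hB (show m ≤ k + m + 2 by omega)
    omega
  | diag e src dst ev =>
    obtain ⟨m, hm⟩ := e.exists_cost_le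
    refine ⟨2 * m + 1, 1, fun hq => absurd hc hq, fun O σ B hB h => ⟨h, ?_, le_rfl⟩⟩
    obtain ⟨h1, h2⟩ := hm _ B hB h
    have h3 : e.eval σ.reg * e.eval σ.reg ≤ B ^ (2 * m) := by
      rw [two_mul, pow_add]
      exact Nat.mul_le_mul h1 h1
    have := four (2 * m) hB
    have := one (2 * m) hB
    have := pow1 hB (show m ≤ 2 * m by omega)
    simp only [run, Store.setBlock]
    omega

end Program

/-! ## Building blocks of programs -/

namespace Program

section Agree

variable {F : Type*}

/-- The stores `σ` and `τ` agree except for the array `a` and the registers in `s`. -/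
def AgreeOff (a : ℕ → Prop) (s : ℕ → Prop) (σ τ : Store F) : Prop :=
  (∀ i, ¬ s i → τ.reg i = σ.reg i) ∧ ∀ b, ¬ a b → τ.cell b = σ.cell b

theorem AgreeOff.refl {a s : ℕ → Prop} (σ : Store F) : AgreeOff a s σ σ :=
  ⟨fun _ _ => rfl, fun _ _ => rfl⟩

theorem AgreeOff.trans {a s : ℕ → Prop} {σ τ υ : Store F} (h : AgreeOff a s σ τ)
    (h' : AgreeOff a s τ υ) : AgreeOff a s σ υ :=
  ⟨fun i hi => (h'.1 i hi).trans (h.1 i hi), fun b hb => (h'.2 b hb).trans (h.2 b hb)⟩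

theorem AgreeOff.mono {a s a' s' : ℕ → Prop} {σ τ : Store F} (h : AgreeOff a s σ τ)
    (ha : ∀ b, a b → a' b) (hs : ∀ i, s i → s' i) : AgreeOff a' s' σ τ :=
  ⟨fun i hi => h.1 i fun h => hi (hs i h), fun b hb => h.2 b fun h => hb (ha b h)⟩

theorem AgreeOff.setReg {a s : ℕ → Prop} {σ τ : Store F} (h : AgreeOff a s σ τ) {i : ℕ}
    (hi : s i) (t k : ℕ) : AgreeOff a s σ ((τ.setReg i t).tick k) :=
  ⟨fun j hj => by
    simp only [Store.tick, Store.setReg]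
    rw [if_neg (by rintro rfl; exact hj hi)]
    exact h.1 j hj, h.2⟩

end Agree

variable {F : Type*} [RCLike F]

theorem run_setCell_cell (O : DiagOracle F) (a : ℕ) (i j : NExp) (x : FExp) (σ : Store F)
    (b i' j' : ℕ) : (run O (setCell a i j x) σ).cell b i' j' =
      if b = a ∧ i' = i.eval σ.reg ∧ j' = j.eval σ.reg then x.eval σ else σ.cell b i' j' := rfl

theorem AgreeOff.run_setCell (O : DiagOracle F) {a s : ℕ → Prop} {σ τ : Store F}
    (h : AgreeOff a s σ τ) {b : ℕ} (hb : a b) (i j : NExp) (x : FExp) :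
    AgreeOff a s σ (run O (setCell b i j x) τ) := by
  refine ⟨h.1, fun b' hb' => ?_⟩
  funext i' j'
  rw [run_setCell_cell, if_neg (by rintro ⟨rfl, -⟩; exact hb' hb), h.2 b' hb']

/-- Keeps the exact cost of evaluating the loop length, which is needed where steps are counted by
hand. -/
theorem run_loop_induct_of_cost (O : DiagOracle F) {i : ℕ} {e : NExp} {body : Program}
    {σ : Store F} {N : ℕ} (hN : e.eval σ.reg = N) (I : ℕ → Store F → Prop)
    (h0 : I 0 (σ.tick (e.cost σ.reg + 1)))
    (hstep : ∀ t < N, ∀ τ, I t τ → I (t + 1) (run O body ((τ.setReg i t).tick (t + 1)))) :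
    I N (run O (loop i e body) σ) := by
  subst hN
  rw [run]
  suffices h : ∀ M ≤ e.eval σ.reg, I M ((List.range M).foldl
      (fun τ t => run O body ((τ.setReg i t).tick (t + 1))) (σ.tick (e.cost σ.reg + 1))) from
    h _ le_rfl
  intro M
  induction M with
  | zero => exact fun _ => h0
  | succ M ih =>
    intro hM
    rw [List.range_succ, List.foldl_append]
    exact hstep M (by omega) _ (ih (by omega))

theorem run_loop_induct (O : DiagOracle F) {i : ℕ} {e : NExp} {body : Program} {σ : Store F}
    {N : ℕ} (hN : e.eval σ.reg = N) (I : ℕ → Store F → Prop)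
    (h0 : ∀ k, I 0 (σ.tick k))
    (hstep : ∀ t < N, ∀ τ, I t τ → I (t + 1) (run O body ((τ.setReg i t).tick (t + 1)))) :
    I N (run O (loop i e body) σ) :=
  run_loop_induct_of_cost O hN I (h0 _) hstep

/-- The registers used by the building blocks as loop counters. -/
def Counter (i : ℕ) : Prop := 10 ≤ i ∧ i ≤ 12

/-- Write `x₀ + ∑ k < e₃, x` to the entry `(i, j)` of the array `a`, for `i < e₁`, `j < e₂`. The
indices are found in the registers 10, 11, 12. -/
def sumInto (a : ℕ) (e₁ e₂ e₃ : NExp) (x₀ x : FExp) : Program :=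
  loop 10 e₁ (loop 11 e₂ (seq (setCell a (.reg 10) (.reg 11) x₀)
    (loop 12 e₃ (setCell a (.reg 10) (.reg 11) (.add (.cell a (.reg 10) (.reg 11)) x)))))

theorem bounded_sumInto {q : Prop} {a : ℕ} {e₁ e₂ e₃ : NExp} {x₀ x : FExp} (h₁ : e₁.Bounded)
    (h₂ : e₂.Bounded) (h₃ : e₃.Bounded) : Bounded q (sumInto a e₁ e₂ e₃ x₀ x) :=
  ⟨h₁, h₂, trivial, h₃, trivial⟩

/-- Bounds and summands are evaluated while the target array and the counters change, so the
hypotheses ask for their values in every store that agrees with the initial one elsewhere. The entry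
under construction serves as its own accumulator. -/
theorem run_sumInto (O : DiagOracle F) (σ : Store F) {a : ℕ} {e₁ e₂ e₃ : NExp} {x₀ x : FExp}
    {E₁ E₂ E₃ : ℕ} {f₀ : ℕ → ℕ → F} {f : ℕ → ℕ → ℕ → F}
    (h₁ : ∀ ρ : ℕ → ℕ, (∀ i, ¬ Counter i → ρ i = σ.reg i) → e₁.eval ρ = E₁)
    (h₂ : ∀ ρ : ℕ → ℕ, (∀ i, ¬ Counter i → ρ i = σ.reg i) → e₂.eval ρ = E₂)
    (h₃ : ∀ ρ : ℕ → ℕ, (∀ i, ¬ Counter i → ρ i = σ.reg i) → e₃.eval ρ = E₃)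
    (hx₀ : ∀ i j, i < E₁ → j < E₂ → ∀ τ, AgreeOff (· = a) Counter σ τ → τ.reg 10 = i →
      τ.reg 11 = j → x₀.eval τ = f₀ i j)
    (hx : ∀ i j k, i < E₁ → j < E₂ → k < E₃ → ∀ τ, AgreeOff (· = a) Counter σ τ →
      τ.reg 10 = i → τ.reg 11 = j → τ.reg 12 = k → x.eval τ = f i j k) :
    AgreeOff (· = a) Counter σ (run O (sumInto a e₁ e₂ e₃ x₀ x) σ) ∧
      ∀ i j, i < E₁ → j < E₂ → (run O (sumInto a e₁ e₂ e₃ x₀ x) σ).cell a i j =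
        f₀ i j + ∑ k ∈ Finset.range E₃, f i j k := by
  set v : ℕ → ℕ → F := fun i j => f₀ i j + ∑ k ∈ Finset.range E₃, f i j k with hv
  have c10 : Counter 10 := ⟨by norm_num, by norm_num⟩
  have c11 : Counter 11 := ⟨by norm_num, by norm_num⟩
  have c12 : Counter 12 := ⟨by norm_num, by norm_num⟩
  have inner : ∀ i j, i < E₁ → j < E₂ → ∀ τ, AgreeOff (· = a) Counter σ τ → τ.reg 10 = i →
      τ.reg 11 = j →
      AgreeOff (· = a) Counter σ (run O (seq (setCell a (.reg 10) (.reg 11) x₀) (loop 12 e₃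
        (setCell a (.reg 10) (.reg 11) (.add (.cell a (.reg 10) (.reg 11)) x)))) τ) ∧
      (run O (seq (setCell a (.reg 10) (.reg 11) x₀) (loop 12 e₃
        (setCell a (.reg 10) (.reg 11) (.add (.cell a (.reg 10) (.reg 11)) x)))) τ).reg 10 = i ∧
      ∀ i' j', (run O (seq (setCell a (.reg 10) (.reg 11) x₀) (loop 12 e₃
        (setCell a (.reg 10) (.reg 11) (.add (.cell a (.reg 10) (.reg 11)) x)))) τ).cell a i' j' =
          if i' = i ∧ j' = j then v i j else τ.cell a i' j' := by
    intro i j hi hj τ hτ h10 h11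
    have hset : ∀ y, (run O (setCell a (.reg 10) (.reg 11) y) τ).reg = τ.reg := fun y => rfl
    rw [run]
    have := run_loop_induct O (i := 12) (e := e₃)
      (body := setCell a (.reg 10) (.reg 11) (.add (.cell a (.reg 10) (.reg 11)) x))
      (σ := run O (setCell a (.reg 10) (.reg 11) x₀) τ) (N := E₃)
      (h₃ _ fun i hi => (hτ.1 i hi))
      (fun K υ => AgreeOff (· = a) Counter σ υ ∧ υ.reg 10 = i ∧ υ.reg 11 = j ∧
        ∀ i' j', υ.cell a i' j' = if i' = i ∧ j' = j then f₀ i j + ∑ k ∈ Finset.range K, f i j k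
          else τ.cell a i' j')
      (fun k => by
        refine ⟨hτ.run_setCell O rfl _ _ _, h10, h11, fun i' j' => ?_⟩
        rw [Finset.range_zero, Finset.sum_empty, add_zero, ← hx₀ i j hi hj τ hτ h10 h11,
          ← h10, ← h11]
        refine (run_setCell_cell O a _ _ _ τ a i' j').trans (if_congr ?_ rfl rfl)
        simp [NExp.eval])
      (fun t ht υ hυ => by
        obtain ⟨h1, h2, h3, h4⟩ := hυ
        have h5 := hx i j t hi hj ht ((υ.setReg 12 t).tick (t + 1)) (h1.setReg c12 t _)
          (by simpa [Store.tick, Store.setReg] using h2)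
          (by simpa [Store.tick, Store.setReg] using h3) (by simp [Store.tick, Store.setReg])
        have h6 := h1.setReg c12 t (t + 1)
        refine ⟨h6.run_setCell O rfl _ _ _, ?_, ?_, fun i' j' => ?_⟩
        · simpa [run, Store.tick, Store.setReg, Store.setCell] using h2
        · simpa [run, Store.tick, Store.setReg, Store.setCell] using h3
        · have h7 : ((υ.setReg 12 t).tick (t + 1)).reg 10 = i := by
            simpa [Store.tick, Store.setReg] using h2
          have h8 : ((υ.setReg 12 t).tick (t + 1)).reg 11 = j := by
            simpa [Store.tick, Store.setReg] using h3
          have h9 : ((υ.setReg 12 t).tick (t + 1)).cell = υ.cell := rfl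
          have h10 : (run O (setCell a (.reg 10) (.reg 11) (.add (.cell a (.reg 10) (.reg 11)) x))
              ((υ.setReg 12 t).tick (t + 1))).cell a i' j' =
              if i' = i ∧ j' = j then υ.cell a i j + f i j t else υ.cell a i' j' := by
            rw [run_setCell_cell]
            simp only [FExp.eval, h5, NExp.eval, true_and, h7, h8, h9]
          rw [h10]
          by_cases h : i' = i ∧ j' = j
          · rw [if_pos h, if_pos h, h4, if_pos ⟨rfl, rfl⟩, Finset.sum_range_succ, add_assoc]
          · rw [if_neg h, if_neg h, h4, if_neg h])
    exact ⟨this.1, this.2.1, this.2.2.2⟩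
  have middle : ∀ i, i < E₁ → ∀ τ, AgreeOff (· = a) Counter σ τ → τ.reg 10 = i →
      AgreeOff (· = a) Counter σ (run O (loop 11 e₂ (seq (setCell a (.reg 10) (.reg 11) x₀)
        (loop 12 e₃ (setCell a (.reg 10) (.reg 11) (.add (.cell a (.reg 10) (.reg 11)) x))))) τ) ∧
      ∀ i' j', (run O (loop 11 e₂ (seq (setCell a (.reg 10) (.reg 11) x₀)
        (loop 12 e₃ (setCell a (.reg 10) (.reg 11) (.add (.cell a (.reg 10) (.reg 11)) x)))))
          τ).cell a i' j' = if i' = i ∧ j' < E₂ then v i j' else τ.cell a i' j' := by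
    intro i hi τ hτ h10
    have := run_loop_induct O (i := 11) (e := e₂) (σ := τ) (N := E₂) (body := (seq
      (setCell a (.reg 10) (.reg 11) x₀)
        (loop 12 e₃ (setCell a (.reg 10) (.reg 11) (.add (.cell a (.reg 10) (.reg 11)) x)))))
      (h₂ _ fun i hi => (hτ.1 i hi))
      (fun K υ => AgreeOff (· = a) Counter σ υ ∧ υ.reg 10 = i ∧
        ∀ i' j', υ.cell a i' j' = if i' = i ∧ j' < K then v i j' else τ.cell a i' j')
      (fun k => ⟨hτ, h10, fun i' j' => by simp [Store.tick]⟩)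
      (fun t ht υ hυ => by
        obtain ⟨h1, h2, h3⟩ := hυ
        obtain ⟨h4, h5, h6⟩ := inner i t hi ht ((υ.setReg 11 t).tick (t + 1)) (h1.setReg c11 t _)
          (by simpa [Store.tick, Store.setReg] using h2) (by simp [Store.tick, Store.setReg])
        refine ⟨h4, h5, fun i' j' => ?_⟩
        rw [h6]
        have h7 : ((υ.setReg 11 t).tick (t + 1)).cell = υ.cell := rfl
        rw [h7, h3]
        by_cases hi' : i' = i
        · rcases lt_trichotomy j' t with h | h | h
          · simp [hi', h, h.ne, Nat.lt_succ_of_lt h]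
          · simp [hi', h]
          · simp [hi', h.ne', not_lt.2 h.le, not_lt.2 (Nat.succ_le_of_lt h)]
        · simp [hi'])
    exact ⟨this.1, this.2.2⟩
  have outer := run_loop_induct O (i := 10) (e := e₁) (σ := σ) (N := E₁) (body := loop 11 e₂ (seq
      (setCell a (.reg 10) (.reg 11) x₀)
        (loop 12 e₃ (setCell a (.reg 10) (.reg 11) (.add (.cell a (.reg 10) (.reg 11)) x)))))
      (h₁ _ fun i hi => rfl)
      (fun K υ => AgreeOff (· = a) Counter σ υ ∧
        ∀ i' j', i' < K → j' < E₂ → υ.cell a i' j' = v i' j')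
      (fun k => ⟨AgreeOff.refl σ, fun i' j' h => absurd h (Nat.not_lt_zero _)⟩)
      (fun t ht υ hυ => by
        obtain ⟨h1, h3⟩ := hυ
        obtain ⟨h4, h6⟩ := middle t ht ((υ.setReg 10 t).tick (t + 1)) (h1.setReg c10 t _)
          (by simp [Store.tick, Store.setReg])
        refine ⟨h4, fun i' j' hi' hj' => ?_⟩
        rw [h6]
        have h7 : ((υ.setReg 10 t).tick (t + 1)).cell = υ.cell := rfl
        rw [h7]
        rcases (Nat.lt_succ_iff_lt_or_eq.1 hi') with h | h
        · rw [if_neg (by omega), h3 i' j' h hj']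
        · rw [if_pos ⟨h, hj'⟩, h])
  exact outer

/-- Write `∑ |x|²`, over `i < e₁` in register 10 and `k < e₂` in register 12, to the entry `(0, 0)`
of the array `b`, with auxiliary array `a`. -/
def sumSquares (a b : ℕ) (e₁ e₂ : NExp) (x : FExp) : Program :=
  seq (sumInto a e₁ (.lit 1) e₂ .zero (.mul x (.conj x)))
    (sumInto b (.lit 1) (.lit 1) e₁ .zero (.cell a (.reg 12) (.lit 0)))

theorem bounded_sumSquares {q : Prop} {a b : ℕ} {e₁ e₂ : NExp} {x : FExp} (h₁ : e₁.Bounded)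
    (h₂ : e₂.Bounded) : Bounded q (sumSquares a b e₁ e₂ x) :=
  ⟨bounded_sumInto h₁ (NExp.bounded_lit (by norm_num)) h₂,
    bounded_sumInto (NExp.bounded_lit (by norm_num)) (NExp.bounded_lit (by norm_num)) h₁⟩

/-- Positivity combines any number of equations into a single zero test. -/
theorem sum_mul_star_eq_zero_iff {κ : Type*} (s : Finset κ) (f : κ → F) :
    ∑ k ∈ s, f k * star (f k) = 0 ↔ ∀ k ∈ s, f k = 0 := by
  have h1 : ∑ k ∈ s, f k * star (f k) = ((∑ k ∈ s, ‖f k‖ ^ 2 : ℝ) : F) := by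
    push_cast
    exact Finset.sum_congr rfl fun k _ => RCLike.mul_conj (f k)
  rw [h1, RCLike.ofReal_eq_zero, Finset.sum_eq_zero_iff_of_nonneg fun k _ => sq_nonneg _]
  simp

theorem run_sumSquares (O : DiagOracle F) (σ : Store F) {a b : ℕ} (hab : a ≠ b) {e₁ e₂ : NExp}
    {x : FExp} {E₁ E₂ : ℕ} {f : ℕ → ℕ → F}
    (h₁ : ∀ ρ : ℕ → ℕ, (∀ i, ¬ Counter i → ρ i = σ.reg i) → e₁.eval ρ = E₁)
    (h₂ : ∀ ρ : ℕ → ℕ, (∀ i, ¬ Counter i → ρ i = σ.reg i) → e₂.eval ρ = E₂)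
    (hx : ∀ i k, i < E₁ → k < E₂ → ∀ τ, AgreeOff (· = a) Counter σ τ →
      τ.reg 10 = i → τ.reg 12 = k → x.eval τ = f i k) :
    AgreeOff (fun c => c = a ∨ c = b) Counter σ (run O (sumSquares a b e₁ e₂ x) σ) ∧
      ((run O (sumSquares a b e₁ e₂ x) σ).cell b 0 0 = 0 ↔
        ∀ i k, i < E₁ → k < E₂ → f i k = 0) := by
  obtain ⟨hA, hv⟩ := run_sumInto O σ (a := a) (e₁ := e₁) (e₂ := .lit 1) (e₃ := e₂) (x₀ := .zero)
    (x := .mul x (.conj x)) (E₂ := 1) (f₀ := fun _ _ => 0)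
    (f := fun i _ k => f i k * star (f i k)) h₁ (fun _ _ => rfl) h₂ (fun _ _ _ _ _ _ _ _ => rfl)
    (fun i j k hi _ hk τ hτ h10 _ h12 => by simp only [FExp.eval, hx i k hi hk τ hτ h10 h12])
  rw [sumSquares, run]
  generalize run O (sumInto a e₁ (.lit 1) e₂ .zero (.mul x (.conj x))) σ = τ at hA hv
  obtain ⟨hA', hv'⟩ := run_sumInto O τ (a := b) (e₁ := .lit 1) (e₂ := .lit 1) (e₃ := e₁)
    (x₀ := .zero) (x := .cell a (.reg 12) (.lit 0)) (E₁ := 1) (E₂ := 1) (E₃ := E₁)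
    (f₀ := fun _ _ => 0) (f := fun _ _ k => τ.cell a k 0) (fun _ _ => rfl) (fun _ _ => rfl)
    (fun ρ hρ => h₁ ρ fun i hi => (hρ i hi).trans (hA.1 i hi)) (fun _ _ _ _ _ _ _ _ => rfl)
    (fun i j k _ _ _ υ hυ _ _ h12 => by simp only [FExp.eval, NExp.eval, h12, hυ.2 a hab])
  refine ⟨(hA.mono (fun _ => .inl) fun _ => id).trans (hA'.mono (fun _ => .inr) fun _ => id), ?_⟩
  rw [hv' 0 0 one_pos one_pos, zero_add, Finset.sum_congr rfl fun k hk =>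
    (hv k 0 (Finset.mem_range.1 hk) one_pos).trans (zero_add _), Finset.sum_sigma',
    sum_mul_star_eq_zero_iff]
  simp only [Finset.mem_sigma, Finset.mem_range, Sigma.forall, and_imp]

open Classical in
/-- The numbers `k < n` with `w k = 0`, in increasing order. -/
noncomputable def zeroIndices (n : ℕ) (w : ℕ → F) : List ℕ :=
  (List.range n).filter fun k => w k = 0

theorem mem_zeroIndices {n : ℕ} {w : ℕ → F} {k : ℕ} :
    k ∈ zeroIndices n w ↔ k < n ∧ w k = 0 := by
  simp [zeroIndices]

theorem nodup_zeroIndices (n : ℕ) (w : ℕ → F) : (zeroIndices n w).Nodup :=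
  List.nodup_range.filter _

theorem zeroIndices_succ (n : ℕ) (w : ℕ → F) [Decidable (w n = 0)] :
    zeroIndices (n + 1) w = zeroIndices n w ++ if w n = 0 then [n] else [] := by
  rw [zeroIndices, List.range_succ, List.filter_append, ← zeroIndices]
  congr 1
  split_ifs with h <;> simp [h]

theorem length_zeroIndices_le (n : ℕ) (w : ℕ → F) : (zeroIndices n w).length ≤ n :=
  (List.length_filter_le _ _).trans List.length_range.le

/-- The registers used by `compress`. -/
def CompressCounter (c i : ℕ) : Prop := i = c ∨ Counter i ∨ i = 13

/-- For the numbers `k < e` in register 13 with `w = 0`, one after the other, write the row with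
the entries `x`, `i < e₂` in register 10, to the array `a`. Count the rows in register `c`. -/
def compress (c a : ℕ) (e e₂ : NExp) (w x : FExp) : Program :=
  seq (setReg c (.lit 0)) (loop 13 e (ifZero w
    (seq (loop 10 e₂ (setCell a (.reg c) (.reg 10) x))
      (setReg c (.sub e (.sub e (.add (.reg c) (.lit 1)))))) skip))

theorem bounded_compress {q : Prop} {c a : ℕ} {e e₂ : NExp} {w x : FExp} (h : e.Bounded)
    (h₂ : e₂.Bounded) : Bounded q (compress c a e e₂ w x) :=
  ⟨NExp.bounded_lit (by norm_num), h, ⟨⟨h₂, trivial⟩, NExp.bounded_clamp h _⟩, trivial⟩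

theorem run_compress (O : DiagOracle F) (σ : Store F) {c a : ℕ} {e e₂ : NExp} {w x : FExp}
    (hc : ¬ (Counter c ∨ c = 13)) {E E₂ : ℕ} {W : ℕ → F} {X : ℕ → ℕ → F}
    (h₁ : ∀ ρ : ℕ → ℕ, (∀ i, ¬ CompressCounter c i → ρ i = σ.reg i) → e.eval ρ = E)
    (h₂ : ∀ ρ : ℕ → ℕ, (∀ i, ¬ CompressCounter c i → ρ i = σ.reg i) → e₂.eval ρ = E₂)
    (hw : ∀ k, k < E → ∀ τ, AgreeOff (· = a) (CompressCounter c) σ τ → τ.reg 13 = k →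
      w.eval τ = W k)
    (hx : ∀ k i, k < E → i < E₂ → ∀ τ, AgreeOff (· = a) (CompressCounter c) σ τ → τ.reg 13 = k →
      τ.reg 10 = i → x.eval τ = X k i) :
    AgreeOff (· = a) (CompressCounter c) σ (run O (compress c a e e₂ w x) σ) ∧
      (run O (compress c a e e₂ w x) σ).reg c = (zeroIndices E W).length ∧
      ∀ (t : ℕ) (ht : t < (zeroIndices E W).length) (i : ℕ), i < E₂ →
        (run O (compress c a e e₂ w x) σ).cell a t i = X (zeroIndices E W)[t] i := by
  classical
  have cc : CompressCounter c c := .inl rfl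
  have c10 : CompressCounter c 10 := .inr (.inl ⟨by norm_num, by norm_num⟩)
  have c13 : CompressCounter c 13 := .inr (.inr rfl)
  have hc10 : c ≠ 10 := by
    rintro rfl
    exact hc (.inl ⟨by norm_num, by norm_num⟩)
  have hc13 : c ≠ 13 := fun h => hc (.inr h)
  rw [compress, run]
  have hA0 : AgreeOff (· = a) (CompressCounter c) σ (run O (setReg c (.lit 0)) σ) :=
    (AgreeOff.refl σ).setReg cc _ _
  have h00 : (run O (setReg c (.lit 0)) σ).reg c = 0 := by
    simp [run, Store.tick, Store.setReg, NExp.eval]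
  generalize run O (setReg c (.lit 0)) σ = σ' at hA0 h00
  refine run_loop_induct O (N := E) (h₁ _ hA0.1)
    (fun K υ => AgreeOff (· = a) (CompressCounter c) σ υ ∧
      υ.reg c = (zeroIndices K W).length ∧ ∀ (t : ℕ) (ht : t < (zeroIndices K W).length) (i : ℕ),
        i < E₂ → υ.cell a t i = X (zeroIndices K W)[t] i)
    (fun k => ⟨hA0, h00, fun t ht => absurd ht (Nat.not_lt_zero _)⟩) ?_
  rintro K hK υ ⟨hA, hreg, hcell⟩
  have hA1 := hA.setReg c13 K (K + 1)
  have hr13 : ((υ.setReg 13 K).tick (K + 1)).reg 13 = K := by simp [Store.tick, Store.setReg]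
  have hrc : ((υ.setReg 13 K).tick (K + 1)).reg c = (zeroIndices K W).length := by
    simp [Store.tick, Store.setReg, hreg, hc13]
  have hcell1 : ((υ.setReg 13 K).tick (K + 1)).cell = υ.cell := rfl
  rw [← hcell1] at hcell
  generalize (υ.setReg 13 K).tick (K + 1) = τ at hA1 hr13 hrc hcell
  rw [run, hw K hK τ hA1 hr13, zeroIndices_succ]
  have hτ' : AgreeOff (· = a) (CompressCounter c) σ (τ.tick (FExp.cost τ w + 1)) := hA1
  have hr13' : (τ.tick (FExp.cost τ w + 1)).reg 13 = K := hr13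
  have hrc' : (τ.tick (FExp.cost τ w + 1)).reg c = (zeroIndices K W).length := hrc
  change ∀ (t : ℕ) (ht : t < (zeroIndices K W).length) (i : ℕ),
        i < E₂ → (τ.tick (FExp.cost τ w + 1)).cell a t i = X (zeroIndices K W)[t] i at hcell
  generalize τ.tick (FExp.cost τ w + 1) = υ at *
  by_cases h0 : W K = 0
  · simp only [h0, if_true]
    rw [run]
    have hrow := run_loop_induct O (i := 10) (e := e₂) (σ := υ)
      (body := setCell a (.reg c) (.reg 10) x) (h₂ _ hτ'.1)
      (fun M υ' => AgreeOff (· = a) (CompressCounter c) σ υ' ∧ υ'.reg 13 = K ∧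
        υ'.reg c = (zeroIndices K W).length ∧
        ∀ t i, υ'.cell a t i = if t = (zeroIndices K W).length ∧ i < M then X K i
          else υ.cell a t i)
      (fun k => ⟨hτ', hr13', hrc', fun t i => by simp [Store.tick]⟩)
      (fun t ht υ' hυ' => by
        obtain ⟨g1, g2, g3, g4⟩ := hυ'
        have k1 := g1.setReg c10 t (t + 1)
        have k2 : ((υ'.setReg 10 t).tick (t + 1)).reg 13 = K := by
          simpa [Store.tick, Store.setReg] using g2
        have k3 : ((υ'.setReg 10 t).tick (t + 1)).reg c = (zeroIndices K W).length := by
          simpa [Store.tick, Store.setReg, hc10] using g3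
        have k4 : ((υ'.setReg 10 t).tick (t + 1)).reg 10 = t := by
          simp [Store.tick, Store.setReg]
        have k5 : ((υ'.setReg 10 t).tick (t + 1)).cell = υ'.cell := rfl
        refine ⟨k1.run_setCell O rfl _ _ _, k2, k3, fun t' i' => ?_⟩
        rw [run_setCell_cell, hx K t hK ht _ k1 k2 k4, k5, g4]
        simp only [NExp.eval, k3, k4, true_and]
        by_cases ht' : t' = (zeroIndices K W).length
        · rcases lt_trichotomy i' t with h | h | h
          · simp [ht', h, h.ne, Nat.lt_succ_of_lt h]
          · simp [ht', h]
          · simp [ht', h.ne', not_lt.2 h.le, not_lt.2 (Nat.succ_le_of_lt h)]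
        · simp [ht'])
    obtain ⟨g1, g2, g3, g4⟩ := hrow
    generalize run O (loop 10 e₂ (setCell a (.reg c) (.reg 10) x)) υ = υ' at g1 g2 g3 g4
    refine ⟨g1.setReg cc _ _, ?_, fun t ht i hi => ?_⟩
    · have hlen := length_zeroIndices_le K W
      simp only [run, Store.tick, Store.setReg, if_true, NExp.eval, g3, h₁ _ g1.1,
        List.length_append, List.length_singleton]
      omega
    · have hcell' : ∀ i, (run O (setReg c (.sub e (.sub e (.add (.reg c) (.lit 1))))) υ').cell a t i
          = υ'.cell a t i := fun _ => rfl
      rw [hcell', g4]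
      rw [List.length_append, List.length_singleton] at ht
      rcases Nat.lt_succ_iff_lt_or_eq.1 ht with h | h
      · rw [if_neg (by omega), hcell t h i hi, List.getElem_append_left h]
      · subst h
        simp [hi]
  · simp only [h0, if_false, List.append_nil]
    exact ⟨hτ', hrc', hcell⟩

theorem run_diag (O : DiagOracle F) (σ : Store F) {e : NExp} {k src dst ev : ℕ}
    (he : e.eval σ.reg = k) (h : dst ≠ ev) {A : Matrix (Fin k) (Fin k) F}
    (hA : ∀ i j : Fin k, σ.cell src i j = A i j) :
    AgreeOff (fun c => c = dst ∨ c = ev) (fun _ => False) σ (run O (diag e src dst ev) σ) ∧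
      (∀ i j : Fin k, (run O (diag e src dst ev) σ).cell dst i j = O.vecs k A i j) ∧
      ∀ j : Fin k, (run O (diag e src dst ev) σ).cell ev 0 j = O.vals k A j := by
  subst he
  obtain rfl : A = Matrix.of fun (i j : Fin _) => σ.cell src i j := by
    ext i j
    exact (hA i j).symm
  refine ⟨⟨fun _ _ => rfl, fun b hb => ?_⟩, fun i j => ?_, fun j => ?_⟩
  · funext i j
    simp only [run, Store.setBlock]
    rw [dif_neg (by rintro ⟨rfl, -⟩; exact hb (.inr rfl)),
      dif_neg (by rintro ⟨rfl, -⟩; exact hb (.inl rfl))]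
  · simp only [run, Store.setBlock]
    rw [dif_neg (by rintro ⟨h', -⟩; exact h h'), dif_pos ⟨trivial, i.2, j.2⟩]
  · simp only [run, Store.setBlock]
    rw [dif_pos ⟨trivial, one_pos, j.2⟩]
    rfl

end Program

/-! ## Positions of tensor entries in arrays -/

section Code

variable {ι : Type*} {n d k : ℕ} (ν : ι ≃ Fin n)

/-- The number with the base-`n` digits `a`, least significant digit first. -/
def code (a : Fin d → ι) : ℕ := finFunctionFinEquiv fun t => ν (a t)

theorem code_lt (a : Fin d → ι) : code ν a < n ^ d := (finFunctionFinEquiv fun t => ν (a t)).2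

theorem code_eq_sum (a : Fin d → ι) : code ν a = ∑ t, (ν (a t) : ℕ) * n ^ (t : ℕ) :=
  finFunctionFinEquiv_apply _

theorem code_succ (a : Fin (k + 1) → ι) : code ν a = ν (a 0) + n * code ν (Fin.tail a) := by
  rw [code_eq_sum, code_eq_sum, Fin.sum_univ_succ, Finset.mul_sum]
  simp only [Fin.val_zero, pow_zero, mul_one, Fin.val_succ, Fin.tail]
  congr 1
  exact Finset.sum_congr rfl fun t _ => by ring

theorem code_cons (y : ι) (b : Fin k → ι) :
    code ν (Fin.cons y b : Fin (k + 1) → ι) = ν y + n * code ν b := by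
  rw [code_succ]
  simp

theorem code_mod (a : Fin (k + 1) → ι) : code ν a % n = ν (a 0) := by
  rw [code_succ, Nat.add_mul_mod_self_left, Nat.mod_eq_of_lt (ν (a 0)).2]

theorem code_div (a : Fin (k + 1) → ι) : code ν a / n = code ν (Fin.tail a) := by
  have hn : 0 < n := (ν (a 0)).pos
  rw [code_succ, Nat.add_mul_div_left _ _ hn, Nat.div_eq_of_lt (ν (a 0)).2, zero_add]

theorem code_div_pow_mod (a : Fin d → ι) (t : Fin d) :
    code ν a / n ^ (t : ℕ) % n = ν (a t) := by
  have h : finFunctionFinEquiv.symm (finFunctionFinEquiv fun t => ν (a t)) t = ν (a t) := by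
    rw [Equiv.symm_apply_apply]
  exact congrArg Fin.val h

theorem code_injective : Function.Injective (code ν : (Fin d → ι) → ℕ) := by
  intro a b h
  have := finFunctionFinEquiv.injective (Fin.ext h)
  exact funext fun t => ν.injective (congrFun this t)

theorem exists_code_eq {x : ℕ} (hx : x < n ^ d) : ∃ a : Fin d → ι, code ν a = x := by
  refine ⟨fun t => ν.symm (finFunctionFinEquiv.symm (⟨x, hx⟩ : Fin (n ^ d)) t), ?_⟩
  rw [code]
  simp

theorem sum_range_code {M : Type*} [AddCommMonoid M] [Fintype ι] (g : ℕ → M) :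
    ∑ x ∈ Finset.range (n ^ d), g x = ∑ a : Fin d → ι, g (code ν a) := by
  symm
  refine Finset.sum_bij (fun a _ => code ν a) (fun a _ => Finset.mem_range.2 (code_lt ν a))
    (fun a _ b _ h => code_injective ν h) (fun x hx => ?_) fun _ _ => rfl
  obtain ⟨a, ha⟩ := exists_code_eq ν (Finset.mem_range.1 hx)
  exact ⟨a, Finset.mem_univ _, ha⟩

/-- Moving the least significant digit to the top is a cyclic rotation of the indices, computable
with one division. -/
theorem code_rotate (a : Fin (k + 1) → ι) :
    code ν a / n + code ν a % n * n ^ k = code ν (a ∘ finRotate (k + 1)) := by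
  have h1 : a ∘ finRotate (k + 1) = Fin.snoc (α := fun _ => ι) (Fin.tail a) (a 0) := by
    rw [Fin.snoc_eq_cons_rotate]
    funext i
    rw [Fin.cons_self_tail]
    rfl
  rw [h1, code_mod, code_div, code_eq_sum, code_eq_sum, Fin.sum_univ_castSucc]
  simp

theorem code_swap (a : Fin (k + 2) → ι) :
    code ν a % n * n + code ν a / n % n + code ν a / n ^ 2 * n ^ 2 =
      code ν (a ∘ Equiv.swap 0 1) := by
  have h2 : Fin.tail (Fin.tail (a ∘ Equiv.swap 0 1)) = Fin.tail (Fin.tail a) := by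
    funext t
    simp only [Fin.tail, Function.comp_apply]
    rw [Equiv.swap_apply_of_ne_of_ne (by simp) (by
      rw [Ne, ← Fin.succ_zero_eq_one, Fin.succ_inj]
      simp)]
  rw [code_succ ν (a ∘ _), code_succ ν (Fin.tail (a ∘ _)), h2, pow_two, ← Nat.div_div_eq_div_mul,
    code_mod, code_div, code_mod, code_div]
  simp [Fin.tail]
  ring

/-- The full cycle and one adjacent transposition generate the symmetric group, so two families of
equations replace one family for every permutation. -/
theorem mem_symTensors_iff_generators {F : Type*} [Field F] {T : Tensor (k + 2) ι F} :
    T ∈ symTensors (k + 2) ι F ↔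
      (∀ a, T (a ∘ finRotate (k + 2)) = T a) ∧ ∀ a, T (a ∘ Equiv.swap 0 1) = T a := by
  refine ⟨fun h => ⟨h _, h _⟩, fun ⟨h1, h2⟩ π => ?_⟩
  have hπ : π ∈ Subgroup.closure ({finRotate (k + 2), Equiv.swap 0 (finRotate (k + 2) 0)} :
      Set (Equiv.Perm (Fin (k + 2)))) := by
    rw [Equiv.Perm.closure_cycle_adjacent_swap isCycle_finRotate support_finRotate]
    trivial
  have h01 : finRotate (k + 2) 0 = 1 := by simp
  rw [h01] at hπ
  induction hπ using Subgroup.closure_induction with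
  | mem π hπ =>
    rcases hπ with rfl | rfl
    · exact h1
    · exact h2
  | one => exact fun a => rfl
  | mul π ρ _ _ hπ hρ => exact fun a => (hρ (a ∘ π)).trans (hπ a)
  | inv π _ hπ =>
    intro a
    have := hπ (a ∘ ⇑π⁻¹)
    rw [← this]
    congr 1
    funext t
    simp

end Code

/-! ## Diagonalization -/

section Diagonalization

variable {F : Type*} [Field F] {n : ℕ}

/-- The kernel of a diagonalized matrix is spanned by the eigenvectors for the eigenvalue zero. -/
theorem mem_span_of_mulVec_eq_zero {H Q : Matrix (Fin n) (Fin n) F} {D : Fin n → F}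
    (hQ : IsUnit Q.det) (h : H * Q = Q * Matrix.diagonal D) {c : Fin n → F} :
    H *ᵥ c = 0 ↔ ∃ y : Fin n → F, c = Q *ᵥ y ∧ ∀ l, D l ≠ 0 → y l = 0 := by
  have hQ' : IsUnit Q := (Matrix.isUnit_iff_isUnit_det Q).2 hQ
  have hinj := Matrix.mulVec_injective_iff_isUnit.2 hQ'
  have key : ∀ y, H *ᵥ (Q *ᵥ y) = 0 ↔ ∀ l, D l ≠ 0 → y l = 0 := fun y => by
    rw [Matrix.mulVec_mulVec, h, ← Matrix.mulVec_mulVec, ← Matrix.mulVec_zero Q, hinj.eq_iff,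
      funext_iff]
    refine forall_congr' fun l => ?_
    rw [Matrix.mulVec_diagonal, Pi.zero_apply, mul_eq_zero]
    tauto
  constructor
  · intro hc
    obtain ⟨y, rfl⟩ := (Matrix.mulVec_surjective_iff_isUnit.2 hQ') c
    exact ⟨y, rfl, (key y).1 hc⟩
  · rintro ⟨y, rfl, hy⟩
    exact (key y).2 hy

/-- A basis can be chosen inside the set of eigenvectors, which spans. This is the form in which the
precondition of the oracle is verified. -/
theorem exists_diagonalization_of_span {M : Matrix (Fin n) (Fin n) F}
    (h : ∀ v : Fin n → F, v ∈ Submodule.span F {v | ∃ l : F, M *ᵥ v = l • v}) :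
    ∃ (Q : Matrix (Fin n) (Fin n) F) (D : Fin n → F),
      IsUnit Q.det ∧ M * Q = Q * Matrix.diagonal D := by
  obtain ⟨b, hb, hspan, hli⟩ := exists_linearIndependent F {v : Fin n → F | ∃ l : F, M *ᵥ v = l • v}
  have htop : ⊤ ≤ Submodule.span F (Set.range ((↑) : b → Fin n → F)) := by
    rw [Subtype.range_coe, hspan]
    exact fun v _ => h v
  let B := Module.Basis.mk hli htop
  have : Finite b := hli.finite
  have : Fintype b := Fintype.ofFinite b
  have hcard : Fintype.card b = Fintype.card (Fin n) := by
    rw [← Module.finrank_eq_card_basis B]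
    simp
  let e := Fintype.equivOfCardEq hcard
  have heig : ∀ t : Fin n, ∃ l : F, M *ᵥ (e.symm t : Fin n → F) = l • (e.symm t : Fin n → F) :=
    fun t => hb (e.symm t).2
  choose D hD using heig
  have hcols : LinearIndependent F fun t => ((e.symm t : b) : Fin n → F) :=
    hli.comp _ e.symm.injective
  refine ⟨Matrix.of fun y t => (e.symm t : Fin n → F) y, D, ?_, ?_⟩
  · rw [← Matrix.isUnit_iff_isUnit_det]
    exact Matrix.linearIndependent_cols_iff_isUnit.1 hcols
  · ext y t
    rw [Matrix.mul_diagonal, Matrix.mul_apply]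
    have := congrFun (hD t) y
    rw [Pi.smul_apply, smul_eq_mul, mul_comm] at this
    exact this

end Diagonalization

theorem Matrix.IsHermitian.exists_diagonalization {F : Type*} [RCLike F] {n : ℕ}
    {H : Matrix (Fin n) (Fin n) F} (hH : H.IsHermitian) :
    ∃ (Q : Matrix (Fin n) (Fin n) F) (D : Fin n → F),
      IsUnit Q.det ∧ H * Q = Q * Matrix.diagonal D := by
  refine exists_diagonalization_of_span fun v => ?_
  have h1 : ∀ j, (hH.eigenvectorBasis j).ofLp ∈
      Submodule.span F {v : Fin n → F | ∃ l : F, H *ᵥ v = l • v} := fun j =>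
    Submodule.subset_span ⟨(hH.eigenvalues j : F), by
      rw [hH.mulVec_eigenvectorBasis j]
      ext i
      simp [RCLike.real_smul_eq_coe_mul]⟩
  have h2 := hH.eigenvectorBasis.sum_repr (WithLp.toLp 2 v)
  have h3 : v =
      ∑ j, hH.eigenvectorBasis.repr (WithLp.toLp 2 v) j • (hH.eigenvectorBasis j).ofLp := by
    have := congrArg WithLp.ofLp h2
    rw [WithLp.ofLp_sum] at this
    simpa using this.symm
  rw [h3]
  exact Submodule.sum_mem _ fun j _ => Submodule.smul_mem _ _ (h1 j)

/-! ## Computing the intersection with the symmetric power -/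

section Intersection

variable {ι F : Type*} {n k R : ℕ} (ν : ι ≃ Fin n)

section Field

variable [Field F]

/-- The entry at `a` of the `l`-th element `u i ⊗ e_b` of a basis of `U ⊗ V^{⊗ k}`,
`l = i + R b`. -/
def slotEntry (u : Fin R → ι → F) (a : Fin (k + 1) → ι) (l : Fin (n ^ k * R)) : F :=
  if (l.divNat : ℕ) = code ν (Fin.tail a) then u l.modNat (a 0) else 0

/-- The tensor with the coordinates `c` in this basis. -/
def slotTensor (u : Fin R → ι → F) : (Fin (n ^ k * R) → F) →ₗ[F] Tensor (k + 1) ι F where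
  toFun c a := ∑ l, slotEntry ν u a l * c l
  map_add' c c' := by
    ext a
    simp [mul_add, Finset.sum_add_distrib]
  map_smul' t c := by
    ext a
    simp [Finset.mul_sum, mul_left_comm]

theorem slotTensor_apply (u : Fin R → ι → F) (c : Fin (n ^ k * R) → F) (a : Fin (k + 1) → ι) :
    slotTensor ν u c a = ∑ l, slotEntry ν u a l * c l := rfl

theorem slotTensor_cons (u : Fin R → ι → F) (c : Fin (n ^ k * R) → F) (y : ι) (b : Fin k → ι) :
    slotTensor ν u c (Fin.cons y b) =
      ∑ i, c (finProdFinEquiv (finFunctionFinEquiv fun t => ν (b t), i)) * u i y := by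
  rw [slotTensor_apply, ← finProdFinEquiv.sum_comp, Fintype.sum_prod_type,
    Finset.sum_eq_single (finFunctionFinEquiv fun t => ν (b t))]
  · refine Finset.sum_congr rfl fun i _ => ?_
    have h1 := finProdFinEquiv.symm_apply_apply (finFunctionFinEquiv (fun t => ν (b t)), i)
    have h2 : (finProdFinEquiv (finFunctionFinEquiv (fun t => ν (b t)), i)).divNat =
        finFunctionFinEquiv (fun t => ν (b t)) := congrArg Prod.fst h1
    have h3 : (finProdFinEquiv (finFunctionFinEquiv (fun t => ν (b t)), i)).modNat = i :=
      congrArg Prod.snd h1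
    rw [slotEntry, h2, h3, Fin.tail_cons, code, if_pos rfl, Fin.cons_zero, mul_comm]
  · intro b' _ hb'
    refine Finset.sum_eq_zero fun i _ => ?_
    have h1 := finProdFinEquiv.symm_apply_apply (b', i)
    have h2 : (finProdFinEquiv (b', i)).divNat = b' := congrArg Prod.fst h1
    rw [slotEntry, h2, Fin.tail_cons, code, if_neg fun h => hb' (Fin.ext h), zero_mul]
  · simp

theorem slotTensor_injective {u : Fin R → ι → F} (hu : LinearIndependent F u) :
    Function.Injective (slotTensor (k := k) ν u) := by
  refine (injective_iff_map_eq_zero _).2 fun c hc => ?_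
  funext l
  obtain ⟨⟨b, i⟩, rfl⟩ := finProdFinEquiv.surjective l
  obtain ⟨b, rfl⟩ := finFunctionFinEquiv.surjective b
  rw [Fintype.linearIndependent_iff] at hu
  have h1 := hu (fun i => c (finProdFinEquiv (finFunctionFinEquiv b, i))) (by
    funext y
    have h2 := congrFun hc (Fin.cons y fun t => ν.symm (b t))
    rw [slotTensor_cons] at h2
    simpa using h2) i
  exact h1

/-- Imposes membership in `U` on one slot by parametrization; symmetry will provide the other slots.
-/
theorem exists_slotTensor_eq_iff {u : Fin R → ι → F} {T : Tensor (k + 1) ι F} :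
    (∃ c, slotTensor ν u c = T) ↔
      ∀ q : Fin k → ι, (fun y => T (Fin.cons y q)) ∈ Submodule.span F (Set.range u) := by
  constructor
  · rintro ⟨c, rfl⟩ q
    rw [Submodule.mem_span_range_iff_exists_fun]
    refine ⟨fun i => c (finProdFinEquiv (finFunctionFinEquiv fun t => ν (q t), i)), ?_⟩
    funext y
    rw [slotTensor_cons]
    simp
  · intro h
    simp only [Submodule.mem_span_range_iff_exists_fun] at h
    choose g hg using h
    refine ⟨fun l => g (fun t => ν.symm (finFunctionFinEquiv.symm l.divNat t)) l.modNat, ?_⟩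
    funext a
    have h1 := congrFun (hg (Fin.tail a)) (a 0)
    rw [Fin.cons_self_tail] at h1
    rw [← h1, ← Fin.cons_self_tail a, slotTensor_cons, Fin.cons_zero, Fin.tail_cons,
      Finset.sum_apply]
    refine Finset.sum_congr rfl fun i _ => ?_
    have h1 := finProdFinEquiv.symm_apply_apply (finFunctionFinEquiv (fun t => ν (Fin.tail a t)), i)
    have h2 : (finProdFinEquiv (finFunctionFinEquiv (fun t => ν (Fin.tail a t)), i)).divNat =
        finFunctionFinEquiv (fun t => ν (Fin.tail a t)) := congrArg Prod.fst h1
    have h3 : (finProdFinEquiv (finFunctionFinEquiv (fun t => ν (Fin.tail a t)), i)).modNat = i :=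
      congrArg Prod.snd h1
    simp only [h2, h3, Equiv.symm_apply_apply]
    rfl

end Field

variable [Fintype ι] [RCLike F] {p : ℕ}

/-- The linear equations, in coordinates, for membership in the intersection: invariance under
permutations, and orthogonality to the polynomials with coefficients `w j`. -/
def intersectionEquations (u : Fin R → ι → F) (w : (Fin (k + 2) → ι) → (Fin (k + 2) → ι) → F) :
    Matrix ((Fin (k + 2) → ι) × Fin 3) (Fin (n ^ (k + 1) * R)) F := Matrix.of fun as l =>
  if as.2 = 0 then slotEntry ν u as.1 l - slotEntry ν u (as.1 ∘ finRotate (k + 2)) l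
  else if as.2 = 1 then slotEntry ν u as.1 l - slotEntry ν u (as.1 ∘ Equiv.swap 0 1) l
  else ∑ a, w as.1 a * slotEntry ν u a l

theorem intersectionEquations_mulVec_eq_zero_iff (u : Fin R → ι → F)
    (w : (Fin (k + 2) → ι) → (Fin (k + 2) → ι) → F) (c : Fin (n ^ (k + 1) * R) → F) :
    intersectionEquations ν u w *ᵥ c = 0 ↔
      slotTensor ν u c ∈ symTensors (k + 2) ι F ∧ ∀ j, ∑ a, w j a * slotTensor ν u c a = 0 := by
  have h0 : ∀ a, (intersectionEquations ν u w *ᵥ c) (a, 0) =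
      slotTensor ν u c a - slotTensor ν u c (a ∘ finRotate (k + 2)) := fun a => by
    simp only [intersectionEquations, Matrix.mulVec, dotProduct, Matrix.of_apply, if_true, sub_mul,
      Finset.sum_sub_distrib, slotTensor_apply]
  have h1 : ∀ a, (intersectionEquations ν u w *ᵥ c) (a, 1) =
      slotTensor ν u c a - slotTensor ν u c (a ∘ Equiv.swap 0 1) := fun a => by
    simp [intersectionEquations, Matrix.mulVec, dotProduct, Matrix.of_apply, sub_mul,
      Finset.sum_sub_distrib, slotTensor_apply]
  have h2 : ∀ a, (intersectionEquations ν u w *ᵥ c) (a, 2) =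
      ∑ a', w a a' * slotTensor ν u c a' := fun a => by
    simp only [intersectionEquations, Matrix.mulVec, dotProduct, Matrix.of_apply, Fin.reduceEq,
      if_false, slotTensor_apply, Finset.sum_mul, Finset.mul_sum, mul_assoc]
    exact Finset.sum_comm
  rw [mem_symTensors_iff_generators, funext_iff]
  constructor
  · intro h
    refine ⟨⟨fun a => ?_, fun a => ?_⟩, fun a => ?_⟩
    · have := h (a, 0)
      rw [h0] at this
      exact (sub_eq_zero.1 this).symm
    · have := h (a, 1)
      rw [h1] at this
      exact (sub_eq_zero.1 this).symm
    · have := h (a, 2)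
      rwa [h2] at this
  · rintro ⟨⟨g0, g1⟩, g2⟩ ⟨a, s⟩
    fin_cases s
    · exact (h0 a).trans (sub_eq_zero.2 (g0 a).symm)
    · exact (h1 a).trans (sub_eq_zero.2 (g1 a).symm)
    · exact (h2 a).trans (g2 a)

/-- The tensors computed from the eigenvectors for the eigenvalue zero. -/
noncomputable def kernelTensor (u : Fin R → ι → F)
    (Q : Matrix (Fin (n ^ (k + 1) * R)) (Fin (n ^ (k + 1) * R)) F) {m : ℕ}
    (idx : Fin m → Fin (n ^ (k + 1) * R)) (t : Fin m) : Tensor (k + 2) ι F :=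
  slotTensor ν u (Q.col (idx t))

open scoped ComplexOrder in
-- A matrix and its Gram matrix have the same kernel, and the Gram matrix is Hermitian, so the
-- oracle applies. The eigenvectors for the eigenvalue zero form a basis of the kernel, carried
-- injectively to tensors.
theorem isIntersectionBasis_kernelTensor {u : Fin R → ι → F} (hu : LinearIndependent F u)
    {w : (Fin (k + 2) → ι) → (Fin (k + 2) → ι) → F} {f : Fin p → MvPolynomial ι F}
    (hw : ∀ T ∈ symTensors (k + 2) ι F,
      T ∈ annihilator (k + 2) f ↔ ∀ j, ∑ a, w j a * T a = 0)
    {Q : Matrix (Fin (n ^ (k + 1) * R)) (Fin (n ^ (k + 1) * R)) F} {D : Fin (n ^ (k + 1) * R) → F}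
    (hQ : IsUnit Q.det)
    (h : ((intersectionEquations ν u w)ᴴ * intersectionEquations ν u w) * Q =
      Q * Matrix.diagonal D)
    {m : ℕ} {idx : Fin m → Fin (n ^ (k + 1) * R)} (hidx : Function.Injective idx)
    (hzero : ∀ l, D l = 0 ↔ ∃ t, idx t = l) :
    IsIntersectionBasis (k + 2) f u (kernelTensor ν u Q idx) := by
  classical
  have hinj := slotTensor_injective (k := k + 1) ν hu
  have hQ' : IsUnit Q := (Matrix.isUnit_iff_isUnit_det Q).2 hQ
  have hcol : LinearIndependent F fun t => Q.col (idx t) :=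
    (Matrix.linearIndependent_cols_iff_isUnit.2 hQ').comp idx hidx
  refine ⟨hcol.map' _ (LinearMap.ker_eq_bot.2 hinj), ?_⟩
  have hmem : ∀ c, slotTensor ν u c ∈ symPower (k + 2) (Submodule.span F (Set.range u)) ⊓
      annihilator (k + 2) f ↔
      ((intersectionEquations ν u w)ᴴ * intersectionEquations ν u w) *ᵥ c = 0 := fun c => by
    rw [Matrix.conjTranspose_mul_self_mulVec_eq_zero, intersectionEquations_mulVec_eq_zero_iff,
      Submodule.mem_inf, mem_symPower_succ_iff]
    constructor
    · rintro ⟨⟨h1, -⟩, h2⟩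
      exact ⟨h1, (hw _ h1).1 h2⟩
    · rintro ⟨h1, h2⟩
      exact ⟨⟨h1, (exists_slotTensor_eq_iff ν).1 ⟨c, rfl⟩⟩, (hw _ h1).2 h2⟩
  apply le_antisymm
  · rw [Submodule.span_le]
    rintro _ ⟨t, rfl⟩
    refine (hmem _).2 ((mem_span_of_mulVec_eq_zero hQ h).2 ⟨Pi.single (idx t) 1, ?_, ?_⟩)
    · rw [Matrix.mulVec_single_one]
    · intro l hl
      exact Pi.single_eq_of_ne (fun hlt => hl ((hzero l).2 ⟨t, hlt.symm⟩)) _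
  · intro T hT
    obtain ⟨c, rfl⟩ := (exists_slotTensor_eq_iff ν).2 (mem_symPower_succ_iff.1 hT.1).2
    obtain ⟨y, rfl, hy⟩ := (mem_span_of_mulVec_eq_zero hQ h).1 ((hmem c).1 hT)
    have h1 : Q *ᵥ y = ∑ t, y (idx t) • Q.col (idx t) := by
      rw [Matrix.mulVec_eq_sum]
      have h2 : ∀ l, (MulOpposite.op (y l) • Qᵀ l : Fin _ → F) = y l • Q.col l := fun l => by
        ext i
        simp [Matrix.col, mul_comm]
      simp only [h2]
      symm
      refine Finset.sum_of_injOn idx hidx.injOn (fun _ _ => Finset.mem_coe.2 (Finset.mem_univ _))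
        (fun l _ hl => ?_) fun _ _ => rfl
      rw [hy l, zero_smul]
      intro h0
      obtain ⟨t, ht⟩ := (hzero l).1 h0
      exact hl ⟨t, by simp, ht⟩
    rw [h1, map_sum]
    refine Submodule.sum_mem _ fun t _ => ?_
    rw [map_smul]
    exact Submodule.smul_mem _ _ (Submodule.subset_span ⟨t, rfl⟩)

end Intersection

/-! ## Computing the decomposition -/

section GeneralizedInverse

variable {β γ F : Type*} [Fintype β] [Fintype γ] [RCLike F]

/-- The adjoint form of `mul_generalized_inverse_gram`: it uses `A Aᴴ`, whose size is that of the
matrix space `V` and not that of its tensor power. -/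
theorem mul_gram_generalized_inverse_mul (A : Matrix β γ F) {G : Matrix β β F}
    (hG : A * Aᴴ * G * (A * Aᴴ) = A * Aᴴ) : A * (Aᴴ * G) * A = A := by
  obtain ⟨h1, h2⟩ := mul_generalized_inverse_gram Aᴴ (G := G)
    (by rwa [Matrix.conjTranspose_conjTranspose])
  rw [Matrix.conjTranspose_conjTranspose] at h1 h2
  have h3 := congrArg Matrix.conjTranspose h1
  rw [Matrix.conjTranspose_mul, h2.eq, Matrix.conjTranspose_conjTranspose] at h3
  simpa only [Matrix.mul_assoc] using h3

variable {n : ℕ}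

/-- Approximations to a generalized inverse of the matrix `S` with the eigenvalues `lam`. -/
noncomputable def approxInverse (S : Matrix (Fin n) (Fin n) F) (lam : ℕ → F) :
    ℕ → Matrix (Fin n) (Fin n) F
  | 0 => 0
  | j + 1 => approxInverse S lam j + (lam j)⁻¹ • (1 - S * approxInverse S lam j)

/-- Each step multiplies the residual `1 - S G` by `1 - λ⁻¹ S`, which kills the eigenspace of `λ`.
For `λ = 0` the convention `0⁻¹ = 0` makes the step harmless, and the final factor `S` kills that
eigenspace. No inverse of `Q` has to be computed. -/
theorem mul_approxInverse_mul {S Q : Matrix (Fin n) (Fin n) F} {D : Fin n → F}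
    (hQ : IsUnit Q.det) (h : S * Q = Q * Matrix.diagonal D) {lam : ℕ → F}
    (hlam : ∀ j : Fin n, lam j = D j) : S * approxInverse S lam n * S = S := by
  have h1 : ∀ j, (1 - S * approxInverse S lam j) * Q =
      Q * Matrix.diagonal fun l => ∏ i ∈ Finset.range j, (1 - (lam i)⁻¹ * D l) := by
    intro j
    induction j with
    | zero => simp [approxInverse]
    | succ j ih =>
      have h2 : 1 - S * approxInverse S lam (j + 1) = (1 - S * approxInverse S lam j) -
          (lam j)⁻¹ • (S * (1 - S * approxInverse S lam j)) := by
        rw [approxInverse, Matrix.mul_add, Matrix.mul_smul]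
        abel
      rw [h2, Matrix.sub_mul, Matrix.smul_mul, Matrix.mul_assoc S, ih, ← Matrix.mul_assoc, h,
        Matrix.mul_assoc, Matrix.diagonal_mul_diagonal, ← Matrix.mul_smul, ← Matrix.mul_sub]
      congr 1
      ext a b
      by_cases hab : a = b
      · subst hab
        simp [Finset.prod_range_succ]
        ring
      · simp [hab]
  have hQ' : IsUnit Q := (Matrix.isUnit_iff_isUnit_det Q).2 hQ
  have h3 : (1 - S * approxInverse S lam n) * S * Q = 0 := by
    rw [Matrix.mul_assoc, h, ← Matrix.mul_assoc, h1, Matrix.mul_assoc,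
      Matrix.diagonal_mul_diagonal]
    have : (fun l => (∏ i ∈ Finset.range n, (1 - (lam i)⁻¹ * D l)) * D l) = 0 := by
      funext l
      by_cases hl : D l = 0
      · simp [hl]
      · rw [Finset.prod_eq_zero (Finset.mem_range.2 l.2), zero_mul, Pi.zero_apply]
        rw [hlam, inv_mul_cancel₀ hl, sub_self]
    rw [this]
    simp
  have h4 : (1 - S * approxInverse S lam n) * S = 0 :=
    (IsUnit.mul_left_eq_zero hQ').1 h3
  rw [Matrix.sub_mul, Matrix.one_mul, sub_eq_zero] at h4
  exact h4.symm

end GeneralizedInverse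

/-! ### Eigenvectors of `T(f) G` and decompositions in general position -/

section Decomposition

variable {ι F : Type*} [Fintype ι] [RCLike F] {k m n p R : ℕ} {P : Fin m → Tensor (k + 1) ι F}
  {f g : Fin m → F} {G : Matrix (Fin k → ι) ι F}

/-- Soundness of the tests. Eigenvectors for non-zero eigenvalues lie in the column space of `T(f)`,
hence in `U`; so the powers of the `x t` are `m` independent elements of the intersection, whose
dimension is `m`, and span it. The ranks force non-zero weights, and the eigenvalues must be the
ratios. -/
theorem genericDecomposition_of_eigenvectors (hk : k ≠ 0) {w : Fin p → MvPolynomial ι F}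
    {u : Fin R → ι → F} (hP : IsIntersectionBasis (k + 1) w u P)
    (hG : contract (stack P) g * G * contract (stack P) g = contract (stack P) g)
    (hrank : G.rank ≤ (contract (stack P) g).rank) {x : Fin m → ι → F} {D : Fin m → F}
    (hD : ∀ t, D t ≠ 0) (hinj : Function.Injective D) (hx : ∀ t, x t ≠ 0)
    (heig : ∀ t, (contract (stack P) f * G) *ᵥ x t = D t • x t)
    (hann : ∀ t, tensorPower (k + 1) (x t) ∈ annihilator (k + 1) w) :
    ∃ z, GenericDecomposition P f g z x := by
  classical
  have hli : LinearIndependent F x := by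
    refine Module.End.eigenvectors_linearIndependent' (Matrix.toLin' (contract (stack P) f * G)) D
      hinj x fun a => ⟨?_, hx a⟩
    rw [Module.End.mem_eigenspace_iff, Matrix.toLin'_apply]
    exact heig a
  have hPU : ∀ i, P i ∈ symPower (k + 1) (Submodule.span F (Set.range u)) := fun i =>
    (hP.2 ▸ Submodule.subset_span ⟨i, rfl⟩ :
      P i ∈ symPower (k + 1) (Submodule.span F (Set.range u)) ⊓ annihilator (k + 1) w).1
  have hxU : ∀ t, x t ∈ Submodule.span F (Set.range u) := fun t => by
    have h1 : x t = (D t)⁻¹ • (contract (stack P) f *ᵥ (G *ᵥ x t)) := by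
      rw [Matrix.mulVec_mulVec, heig, smul_smul, inv_mul_cancel₀ (hD t), one_smul]
    rw [h1]
    refine Submodule.smul_mem _ _ ?_
    have h2 : contract (stack P) f *ᵥ (G *ᵥ x t) =
        ∑ q, ∑ i, ((G *ᵥ x t) q * f i) • fun y => P i (Fin.cons y q) := by
      funext y
      generalize G *ᵥ x t = v
      simp only [Matrix.mulVec, dotProduct, contract, stack, Matrix.of_apply, Finset.sum_apply,
        Pi.smul_apply, smul_eq_mul, Finset.sum_mul]
      exact Finset.sum_congr rfl fun q _ => Finset.sum_congr rfl fun i _ => by ring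
    rw [h2]
    exact Submodule.sum_mem _ fun q _ => Submodule.sum_mem _ fun i _ =>
      Submodule.smul_mem _ _ (slice_mem_of_mem_symPower (hPU i) q)
  have hlit := linearIndependent_tensorPower (d := k + 1) k.succ_ne_zero hli
  have hspan : Submodule.span F (Set.range P) =
      Submodule.span F (Set.range fun t => tensorPower (k + 1) (x t)) := by
    symm
    have : FiniteDimensional F (Submodule.span F (Set.range P)) :=
      FiniteDimensional.span_of_finite F (Set.finite_range P)
    refine Submodule.eq_of_le_of_finrank_eq ?_ ?_
    · rw [Submodule.span_le, hP.2]
      rintro _ ⟨t, rfl⟩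
      exact ⟨tensorPower_mem_symPower (hxU t), hann t⟩
    · rw [finrank_span_eq_card hlit, finrank_span_eq_card hP.1]
  obtain ⟨z, hz, hPz⟩ := exists_coefficients_of_span_eq hP.1 hspan
  obtain ⟨A', hA⟩ := exists_colMatrix_left_inverse hli
  have hMX : contract (stack P) f * G * colMatrix x = colMatrix x * Matrix.diagonal D := by
    ext y t
    have := congrFun (heig t) y
    rw [Matrix.mul_diagonal, Matrix.mul_apply]
    simpa [Matrix.mulVec, dotProduct, colMatrix, mul_comm] using this
  have hM : m ≤ (contract (stack P) f * G).rank := by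
    have h1 : (Matrix.diagonal D).rank = m := by
      rw [Matrix.rank_diagonal]
      simp [hD]
    refine h1.symm.le.trans ?_
    have h2 : Matrix.diagonal D = A' * (contract (stack P) f * G * colMatrix x) := by
      rw [hMX, ← Matrix.mul_assoc, hA, Matrix.one_mul]
    exact h2 ▸ (Matrix.rank_mul_le_right _ _).trans (Matrix.rank_mul_le_left _ _)
  have hcontract : ∀ h : Fin m → F, (contract (stack P) h).rank ≤
      (Matrix.diagonal fun t => weight h (z t)).rank := fun h => by
    rw [contract_stack_eq hPz h]
    exact (Matrix.rank_mul_le_left _ _).trans (Matrix.rank_mul_le_right _ _)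
  have hf := ne_zero_of_card_le_rank_diagonal
    (hM.trans ((Matrix.rank_mul_le_left _ _).trans (hcontract f)))
  have hg := ne_zero_of_card_le_rank_diagonal
    (hM.trans ((Matrix.rank_mul_le_right _ _).trans (hrank.trans (hcontract g))))
  refine ⟨z, hz, hli, hPz, hf, hg, ?_⟩
  obtain ⟨B', hB⟩ := exists_colMatrix_left_inverse (linearIndependent_tensorPower hk hli)
  have hB' := congrArg Matrix.transpose hB
  rw [Matrix.transpose_mul, Matrix.transpose_one] at hB'
  rw [contract_stack_eq hPz g] at hG
  have h1 := factored_mul_generalized_inverse_mul (f := fun t => weight f (z t)) hA hB' hg hG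
  rw [← contract_stack_eq hPz f, hMX] at h1
  have h2 := congrArg (A' * ·) h1
  simp only [← Matrix.mul_assoc, hA, Matrix.one_mul] at h2
  rw [← Matrix.diagonal_injective h2]
  exact hinj

variable {z : Fin m → Fin m → F} {x : Fin m → ι → F}

/-- The independent `x t` are eigenvectors for non-zero eigenvalues, and every vector differs from a
combination of them by an element of the kernel. So the oracle receives a legitimate query whenever
a decomposition in general position exists. -/
theorem GenericDecomposition.exists_diagonalization (ν : ι ≃ Fin n)
    (H : GenericDecomposition P f g z x) (hk : k ≠ 0)
    (hG : contract (stack P) g * G * contract (stack P) g = contract (stack P) g) :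
    ∃ (Q : Matrix (Fin n) (Fin n) F) (D : Fin n → F), IsUnit Q.det ∧
      (contract (stack P) f * G).submatrix ν.symm ν.symm * Q = Q * Matrix.diagonal D := by
  classical
  obtain ⟨A', hA⟩ := exists_colMatrix_left_inverse H.right_li
  have hMX := H.first_mul hk hG
  set M := contract (stack P) f * G with hM
  set ρ : Fin m → F := fun t => weight f (z t) / weight g (z t) with hρ
  have hρ0 : ∀ t, ρ t ≠ 0 := fun t => div_ne_zero (H.left_ne t) (H.right_ne t)
  let N : Matrix (Fin m) ι F := Matrix.diagonal (fun t => weight f (z t)) *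
    (colMatrix fun t => tensorPower k (x t))ᵀ * G
  have hMN : M = colMatrix x * N := by
    rw [hM, contract_stack_eq H.eq f]
    simp only [N, Matrix.mul_assoc]
  have key : ∀ v : ι → F, v ∈ Submodule.span F {v | ∃ l : F, M *ᵥ v = l • v} := by
    intro v
    set y : Fin m → F := Matrix.diagonal (fun t => (ρ t)⁻¹) *ᵥ (N *ᵥ v) with hy
    have h1 : M *ᵥ (v - colMatrix x *ᵥ y) = 0 := by
      have e1 : Matrix.diagonal ρ *ᵥ y = N *ᵥ v := by
        rw [hy, Matrix.mulVec_mulVec, Matrix.diagonal_mul_diagonal,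
          show (fun t => ρ t * (ρ t)⁻¹) = fun _ => 1 from funext fun t => mul_inv_cancel₀ (hρ0 t),
          Matrix.diagonal_one, Matrix.one_mulVec]
      have e2 : M *ᵥ (colMatrix x *ᵥ y) = M *ᵥ v := by
        rw [Matrix.mulVec_mulVec, hMX, ← Matrix.mulVec_mulVec, e1, Matrix.mulVec_mulVec, ← hMN]
      rw [Matrix.mulVec_sub, e2, sub_self]
    have h2 : colMatrix x *ᵥ y = ∑ t, y t • x t := by
      funext i
      simp [Matrix.mulVec, dotProduct, colMatrix, mul_comm]
    rw [← sub_add_cancel v (colMatrix x *ᵥ y)]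
    refine Submodule.add_mem _ (Submodule.subset_span ⟨0, by rw [h1, zero_smul]⟩) ?_
    rw [h2]
    refine Submodule.sum_mem _ fun t _ => Submodule.smul_mem _ _ (Submodule.subset_span ⟨ρ t, ?_⟩)
    funext i
    have := congrFun (congrFun hMX i) t
    rw [Matrix.mul_diagonal, Matrix.mul_apply] at this
    simpa [Matrix.mulVec, dotProduct, colMatrix, mul_comm] using this
  refine exists_diagonalization_of_span fun v => ?_
  have h3 := Submodule.mem_map_of_mem (f := (LinearEquiv.funCongrLeft F F ν.symm).toLinearMap)
    (key (v ∘ ν))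
  rw [Submodule.map_span] at h3
  have h4 : (LinearEquiv.funCongrLeft F F ν.symm).toLinearMap (v ∘ ν) = v := by
    funext i
    simp [LinearEquiv.funCongrLeft]
  rw [h4] at h3
  refine Submodule.span_mono ?_ h3
  rintro _ ⟨v, ⟨l, hl⟩, rfl⟩
  refine ⟨l, ?_⟩
  funext i
  have h5 := congrFun hl (ν.symm i)
  simp only [Matrix.mulVec, dotProduct] at h5 ⊢
  rw [← ν.sum_comp]
  simpa [LinearEquiv.funCongrLeft] using h5

/-- Completeness of the tests: whichever diagonalization the oracle returns, its columns for
non-zero eigenvalues are multiples of different `x t`, and their number is the rank `m`. -/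
theorem GenericDecomposition.eigenvectors (ν : ι ≃ Fin n)
    (H : GenericDecomposition P f g z x) (hk : k ≠ 0) {w : Fin p → MvPolynomial ι F}
    {u : Fin R → ι → F} (hP : IsIntersectionBasis (k + 1) w u P)
    (hG : contract (stack P) g * G * contract (stack P) g = contract (stack P) g)
    {Q : Matrix (Fin n) (Fin n) F} {D : Fin n → F} (hQ : IsUnit Q.det)
    (hMQ : (contract (stack P) f * G).submatrix ν.symm ν.symm * Q = Q * Matrix.diagonal D) :
    (∀ j, (fun y => Q (ν y) j) ≠ 0) ∧ (∀ i j, D i ≠ 0 → D j ≠ 0 → D i = D j → i = j) ∧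
      (∀ j, D j ≠ 0 → tensorPower (k + 1) (fun y => Q (ν y) j) ∈ annihilator (k + 1) w) ∧
      Nat.card {j // D j ≠ 0} = m := by
  classical
  obtain ⟨A', hA⟩ := exists_colMatrix_left_inverse H.right_li
  have hMX := H.first_mul hk hG
  set M := contract (stack P) f * G with hM
  set ρ : Fin m → F := fun t => weight f (z t) / weight g (z t) with hρ
  have hρ0 : ∀ t, ρ t ≠ 0 := fun t => div_ne_zero (H.left_ne t) (H.right_ne t)
  let N : Matrix (Fin m) ι F := Matrix.diagonal (fun t => weight f (z t)) *
    (colMatrix fun t => tensorPower k (x t))ᵀ * G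
  have hMN : M = colMatrix x * N := by
    rw [hM, contract_stack_eq H.eq f]
    simp only [N, Matrix.mul_assoc]
  have hQ' : IsUnit Q := (Matrix.isUnit_iff_isUnit_det Q).2 hQ
  have hcols : LinearIndependent F fun j => Q.col j :=
    Matrix.linearIndependent_cols_iff_isUnit.2 hQ'
  have hne : ∀ j, (fun y => Q (ν y) j) ≠ 0 := fun j h0 => hcols.ne_zero j (by
    funext i
    simpa [Matrix.col] using congrFun h0 (ν.symm i))
  have heig : ∀ j, M *ᵥ (fun y => Q (ν y) j) = D j • fun y => Q (ν y) j := fun j => by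
    funext y
    have h1 := congrFun (congrFun hMQ (ν y)) j
    rw [Matrix.mul_diagonal, Matrix.mul_apply, ← ν.sum_comp] at h1
    simpa [Matrix.mulVec, dotProduct, mul_comm] using h1
  have hvec : ∀ j, D j ≠ 0 → ∃ t, D j = ρ t ∧ ∃ c : F, c ≠ 0 ∧ (fun y => Q (ν y) j) = c • x t :=
    fun j hj => eigenvector_eq_smul_col hMN hA hMX H.ratio_injective (hne j) hj (heig j)
  refine ⟨hne, fun i j hi hj hij => ?_, fun j hj => ?_, ?_⟩
  · by_contra hne'
    obtain ⟨t, ht, c, hc, hct⟩ := hvec i hi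
    obtain ⟨s, hs, c', hc', hcs⟩ := hvec j hj
    have hts : t = s := H.ratio_injective (ht.symm.trans (hij.trans hs))
    subst hts
    have h1 : c' • Q.col i - c • Q.col j = 0 := by
      funext y
      have e1 := congrFun hct (ν.symm y)
      have e2 := congrFun hcs (ν.symm y)
      simp only [Equiv.apply_symm_apply, Pi.smul_apply, smul_eq_mul] at e1 e2
      simp only [Pi.sub_apply, Pi.smul_apply, Matrix.col_apply, smul_eq_mul, Pi.zero_apply, e1, e2]
      ring
    have h3 : LinearIndependent F ![Q.col i, Q.col j] := by
      have h4 := hcols.comp ![i, j] (fun a b hab => by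
        fin_cases a <;> fin_cases b <;> simp_all [eq_comm])
      convert h4 using 1
      funext a
      fin_cases a <;> rfl
    have h2 := (LinearIndependent.pair_iff.1 h3) c' (-c) (by
      rw [neg_smul, ← sub_eq_add_neg]
      exact h1)
    exact hc' h2.1
  · obtain ⟨t, ht, c, hc, hct⟩ := hvec j hj
    rw [hct, tensorPower_smul]
    refine Submodule.smul_mem _ _ ?_
    have h1 : tensorPower (k + 1) (x t) ∈ Submodule.span F (Set.range P) := by
      rw [span_eq_span_of_decomposition (X := fun t => tensorPower (k + 1) (x t)) H.left_li H.eq]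
      exact Submodule.subset_span ⟨t, rfl⟩
    rw [hP.2] at h1
    exact h1.2
  · have h1 : M.rank = m := by
      rw [rank_eq_card_of_factored hMN hA hMX hρ0, Fintype.card_fin]
    have h2 : (M.submatrix ν.symm ν.symm).rank = M.rank := Matrix.rank_submatrix M ν.symm ν.symm
    have h3 : (M.submatrix ν.symm ν.symm).rank = (Matrix.diagonal D).rank := by
      rw [← Matrix.rank_mul_eq_left_of_isUnit_det Q _ hQ, hMQ,
        Matrix.rank_mul_eq_right_of_isUnit_det Q _ hQ]
    rw [Nat.card_eq_fintype_card, ← Matrix.rank_diagonal, ← h3, h2, h1]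

end Decomposition

/-! ## The program: preparations and the basis of the intersection -/

namespace Program

section Frames

variable {F : Type*} {σ τ : Store F}

theorem AgreeOff.cell_eq {a : ℕ} {s : ℕ → Prop} (h : AgreeOff (· = a) s σ τ) {b : ℕ}
    (hb : b ≠ a) : τ.cell b = σ.cell b := h.2 b hb

theorem AgreeOff.reg_eq {a : ℕ → Prop} (h : AgreeOff a Counter σ τ) {i : ℕ} (hi : i < 10) :
    τ.reg i = σ.reg i := h.1 i fun hc => absurd hc.1 (by omega)

theorem AgreeOff.reg_eq_of_compress {a : ℕ → Prop} {c : ℕ} (h : AgreeOff a (CompressCounter c) σ τ)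
    {i : ℕ} (hi : i < 10) (hc : i ≠ c) : τ.reg i = σ.reg i :=
  h.1 i (by rintro (h | ⟨h, -⟩ | h) <;> omega)

theorem eval_reg_of_agree {i E : ℕ} (h : σ.reg i = E) (hi : i < 10) (ρ : ℕ → ℕ)
    (hρ : ∀ i, ¬ Counter i → ρ i = σ.reg i) : (NExp.reg i).eval ρ = E :=
  (hρ i fun hc => absurd hc.1 (by omega)).trans h

theorem eval_reg_of_compress {i E c : ℕ} (h : σ.reg i = E) (hi : i < 10) (hc : i ≠ c)
    (ρ : ℕ → ℕ) (hρ : ∀ i, ¬ CompressCounter c i → ρ i = σ.reg i) : (NExp.reg i).eval ρ = E :=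
  (hρ i (by rintro (h | ⟨h, -⟩ | h) <;> omega)).trans h

/-- The parts of the memory that are fixed after the preparations: the numbers
`n, d, R, n ^ d, n ^ (d - 1), n ^ (d - 1) * R` for `d = k + 2`, and an array from which the
Kronecker symbol is read. -/
structure Ready [Zero F] [One F] (n k R : ℕ) (σ : Store F) : Prop where
  reg0 : σ.reg 0 = n
  reg1 : σ.reg 1 = k + 2
  reg2 : σ.reg 2 = R
  reg4 : σ.reg 4 = n ^ (k + 2)
  reg5 : σ.reg 5 = n ^ (k + 1)
  reg6 : σ.reg 6 = n ^ (k + 1) * R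
  cell3 : ∀ i j, σ.cell 3 i j = if i = 0 ∧ j = 0 then 1 else 0

theorem Ready.of_frame [Zero F] [One F] {n k R : ℕ} (hσ : Ready n k R σ) {a s : ℕ → Prop}
    (h : AgreeOff a s σ τ) (ha : ¬ a 3) (hs : ∀ i ≤ 6, ¬ s i) : Ready n k R τ where
  reg0 := (h.1 0 (hs 0 (by norm_num))).trans hσ.reg0
  reg1 := (h.1 1 (hs 1 (by norm_num))).trans hσ.reg1
  reg2 := (h.1 2 (hs 2 (by norm_num))).trans hσ.reg2
  reg4 := (h.1 4 (hs 4 (by norm_num))).trans hσ.reg4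
  reg5 := (h.1 5 (hs 5 (by norm_num))).trans hσ.reg5
  reg6 := (h.1 6 (hs 6 (by norm_num))).trans hσ.reg6
  cell3 i j := by rw [h.2 3 ha]; exact hσ.cell3 i j

theorem Ready.of_agreeOff [Zero F] [One F] {n k R : ℕ} (hσ : Ready n k R σ)
    (h : AgreeOff (3 < ·) (6 < ·) σ τ) : Ready n k R τ :=
  hσ.of_frame h (lt_irrefl 3) fun _ hi => not_lt.2 hi

theorem AgreeOff.of_sumInto {a : ℕ} (h : AgreeOff (· = a) Counter σ τ) (ha : 3 < a) {l : ℕ}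
    (hl : l < 10) : AgreeOff (3 < ·) (l < ·) σ τ :=
  h.mono (fun _ hb => hb ▸ ha) fun _ hi => lt_of_lt_of_le hl hi.1

end Frames

/-- The Kronecker symbol. -/
def delta (e₁ e₂ : NExp) : FExp := .cell 3 (.sub e₁ e₂) (.sub e₂ e₁)

/-- Both truncated differences vanish only for equal numbers, and the array is non-zero only at `(0,
0)`. -/
theorem eval_delta {F : Type*} [RCLike F] {σ : Store F}
    (h : ∀ i j, σ.cell 3 i j = if i = 0 ∧ j = 0 then 1 else 0) (e₁ e₂ : NExp) :
    (delta e₁ e₂).eval σ = if e₁.eval σ.reg = e₂.eval σ.reg then 1 else 0 := by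
  simp only [delta, FExp.eval, NExp.eval, h]
  exact if_congr (by omega) rfl rfl

variable {F : Type*} [RCLike F]

theorem run_seq (O : DiagOracle F) (c₁ c₂ : Program) (σ : Store F) :
    run O (seq c₁ c₂) σ = run O c₂ (run O c₁ σ) := rfl

/-- Compute `n ^ (d - 1)`, `n ^ d` and `n ^ (d - 1) * R`. -/
def preparations : Program :=
  seq (setReg 5 (.lit 1))
    (seq (loop 13 (.sub (.reg 1) (.lit 1)) (setReg 5 (.mul (.reg 5) (.reg 0))))
    (seq (setReg 4 (.mul (.reg 5) (.reg 0))) (seq (setReg 6 (.mul (.reg 5) (.reg 2)))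
      (setCell 3 (.lit 0) (.lit 0) .one))))

/-- Computing powers of `n` enlarges registers, so the general cost bound does not apply and the
steps are counted directly. Afterwards all registers are at most `n ^ (k + 2)`, the bound for the
rest of the program. -/
theorem run_preparations (O : DiagOracle F) (σ : Store F) {n k R : ℕ} (hn : 2 ≤ n) (hR : R ≤ n)
    (h0 : σ.reg 0 = n) (h1 : σ.reg 1 = k + 2) (h2 : σ.reg 2 = R)
    (hreg : ∀ i, σ.reg i ≤ n ^ (k + 2)) (h3 : ∀ i j, σ.cell 3 i j = 0) :
    Ready n k R (run O preparations σ) ∧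
      (∀ b, b ≠ 3 → (run O preparations σ).cell b = σ.cell b) ∧
      (∀ i, (run O preparations σ).reg i ≤ n ^ (k + 2)) ∧
      (run O preparations σ).steps ≤ σ.steps + (n ^ (k + 2)) ^ 5 ∧
      (run O preparations σ).calls = σ.calls := by
  set D := n ^ (k + 2) with hD
  have hkD : k + 2 < D := Nat.lt_pow_self (by omega)
  have hD4 : 4 ≤ D := by
    rw [hD, pow_add]
    nlinarith [Nat.one_le_pow k n (by omega)]
  have hq : n ^ (k + 1) * n = D := by rw [hD, pow_succ _ (k + 1)]
  have hqR : n ^ (k + 1) * R ≤ D := hq ▸ Nat.mul_le_mul_left _ hR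
  have hpow : ∀ t, t ≤ k + 2 → n ^ t ≤ D := fun t ht => Nat.pow_le_pow_right (by omega) ht
  have hnD : n ≤ D := by simpa using hpow 1 (by omega)
  have hloop := run_loop_induct_of_cost O (i := 13) (e := .sub (.reg 1) (.lit 1))
    (body := setReg 5 (.mul (.reg 5) (.reg 0))) (σ := run O (setReg 5 (.lit 1)) σ) (N := k + 1)
    (by simp [run, NExp.eval, Store.tick, Store.setReg, h1])
    (fun t τ => τ.reg 5 = n ^ t ∧ (∀ i, i ≠ 5 → i ≠ 13 → τ.reg i = σ.reg i) ∧
      τ.reg 13 ≤ D ∧ τ.cell = σ.cell ∧ τ.calls = σ.calls ∧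
      τ.steps ≤ σ.steps + 20 * D + t * (10 * D))
    ⟨by simp [run, NExp.eval, Store.tick, Store.setReg],
      fun i hi _ => by simp [run, Store.tick, Store.setReg, hi],
      by simpa [run, Store.tick, Store.setReg] using hreg 13, rfl, rfl, by
        simp only [run, NExp.cost, NExp.eval, Store.tick, Store.setReg, Nat.reduceEqDiff, if_false,
          h1]
        omega⟩
    (fun t ht τ ⟨g1, g2, g3, g4, g5, g6⟩ => by
      have g0 := (g2 0 (by norm_num) (by norm_num)).trans h0
      refine ⟨?_, fun i hi hi' => ?_, ?_, g4, g5, ?_⟩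
      · simp [run, NExp.eval, Store.tick, Store.setReg, g1, g0, pow_succ]
      · simp [run, Store.tick, Store.setReg, hi, hi', g2]
      · simp only [run, Store.tick, Store.setReg, Nat.reduceEqDiff, if_false, if_true]
        omega
      · have p1 := hpow t (by omega)
        have p2 := hpow (t + 1) (by omega)
        rw [pow_succ] at p2
        simp only [run, NExp.cost, NExp.eval, Store.tick, Store.setReg, Nat.reduceEqDiff, if_false,
          g1, g0]
        rw [Nat.add_mul]
        omega)
  have hpow5 : 40 * (D * D) ≤ D ^ 5 := by
    have h : 4 ^ 3 ≤ D ^ 3 := Nat.pow_le_pow_left hD4 3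
    have : D ^ 5 = D ^ 3 * (D * D) := by ring
    rw [this]
    exact Nat.mul_le_mul_right _ (by omega)
  rw [preparations, run_seq, run_seq]
  generalize run O (loop 13 (.sub (.reg 1) (.lit 1)) (setReg 5 (.mul (.reg 5) (.reg 0))))
    (run O (setReg 5 (.lit 1)) σ) = τ at hloop
  simp only [run]
  obtain ⟨g1, g2, g3, g4, g5, g6⟩ := hloop
  have e0 : τ.reg 0 = n := (g2 0 (by norm_num) (by norm_num)).trans h0
  have e1 : τ.reg 1 = k + 2 := (g2 1 (by norm_num) (by norm_num)).trans h1
  have e2 : τ.reg 2 = R := (g2 2 (by norm_num) (by norm_num)).trans h2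
  have hq' : n ^ (k + 1) ≤ D := hpow _ (by omega)
  refine ⟨⟨?_, ?_, ?_, ?_, ?_, ?_, fun i j => ?_⟩, fun b hb => ?_, fun i => ?_, ?_, g5⟩
  · simpa [Store.tick, Store.setReg, Store.setCell] using e0
  · simpa [Store.tick, Store.setReg, Store.setCell] using e1
  · simpa [Store.tick, Store.setReg, Store.setCell] using e2
  · simp [Store.tick, Store.setReg, Store.setCell, NExp.eval, g1, e0, hq, hD]
  · simpa [Store.tick, Store.setReg, Store.setCell] using g1
  · simp [Store.tick, Store.setReg, Store.setCell, NExp.eval, g1, e2]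
  · simp [Store.tick, Store.setReg, Store.setCell, NExp.eval, FExp.eval, g4, h3]
  · funext i j
    simp [Store.tick, Store.setReg, Store.setCell, g4, hb]
  · simp only [Store.tick, Store.setReg, Store.setCell, NExp.eval, Nat.reduceEqDiff, if_false,
      g1, e0, e2]
    by_cases h13 : i = 13
    · subst h13
      simpa using g3
    by_cases h5 : i = 5
    · subst h5
      simpa [g1] using hq'
    rw [g2 i h5 h13]
    split_ifs
    · exact hqR
    · exact hq.le
    · exact hreg i
  · simp only [Store.tick, Store.setReg, Store.setCell, NExp.eval, NExp.cost, FExp.cost,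
      Nat.reduceEqDiff, if_false, g1, e0, e2, hq]
    have p1 : (k + 1) * (10 * D) ≤ D * (10 * D) := Nat.mul_le_mul_right _ (by omega)
    have p2 : D * (10 * D) = 10 * (D * D) := by ring
    have p3 : 4 * D ≤ D * D := Nat.mul_le_mul_right _ hD4
    omega

section Basis

variable {ι : Type*} {n k R : ℕ} (ν : ι ≃ Fin n)

/-- Compute the coordinates of the tensors `u i ⊗ e_b`. -/
def slotProgram : Program :=
  sumInto 4 (.reg 4) (.reg 6) (.lit 0)
    (.mul (.cell 0 (.mod (.reg 11) (.reg 2)) (.mod (.reg 10) (.reg 0)))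
      (delta (.div (.reg 11) (.reg 2)) (.div (.reg 10) (.reg 0)))) .zero

theorem run_slotProgram (O : DiagOracle F) (σ : Store F) (hσ : Ready n k R σ) {u : Fin R → ι → F}
    (hu : ∀ (i : Fin R) y, σ.cell 0 i (ν y) = u i y) :
    AgreeOff (· = 4) Counter σ (run O slotProgram σ) ∧
      ∀ (a : Fin (k + 2) → ι) (l : Fin (n ^ (k + 1) * R)),
        (run O slotProgram σ).cell 4 (code ν a) l = slotEntry ν u a l := by
  obtain ⟨hA, hv⟩ := run_sumInto O σ (a := 4) (e₁ := .reg 4) (e₂ := .reg 6) (e₃ := .lit 0)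
    (x₀ := (.mul (.cell 0 (.mod (.reg 11) (.reg 2)) (.mod (.reg 10) (.reg 0)))
      (delta (.div (.reg 11) (.reg 2)) (.div (.reg 10) (.reg 0))))) (x := .zero)
    (f₀ := fun a c => σ.cell 0 (c % R) (a % n) * if c / R = a / n then 1 else 0)
    (f := fun _ _ _ => 0) (eval_reg_of_agree hσ.reg4 (by norm_num))
    (eval_reg_of_agree hσ.reg6 (by norm_num)) (fun _ _ => rfl)
    (fun i j hi hj τ hτ h10 h11 => by
      simp only [FExp.eval, eval_delta (fun i j => by rw [hτ.cell_eq (by norm_num), hσ.cell3]),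
        NExp.eval, h10, h11, hτ.reg_eq (show 2 < 10 by norm_num),
        hτ.reg_eq (show 0 < 10 by norm_num), hσ.reg0, hσ.reg2,
        hτ.cell_eq (show 0 ≠ 4 by norm_num)])
    (fun _ _ _ _ _ _ _ _ _ _ _ => rfl)
  refine ⟨hA, fun a l => (hv _ _ (code_lt ν a) l.2).trans ?_⟩
  rw [Finset.sum_const_zero, add_zero, code_mod, code_div, slotEntry]
  have := hu l.modNat (a 0)
  simp only [Fin.coe_modNat] at this
  rw [this, Fin.coe_divNat, mul_ite, mul_one, mul_zero]

variable [Fintype ι]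

/-- The numbers of the eigenvectors in the kernel of the system of equations. -/
noncomputable def kernelIndices (O : DiagOracle F) (u : Fin R → ι → F)
    (w : (Fin (k + 2) → ι) → (Fin (k + 2) → ι) → F) : List ℕ :=
  zeroIndices (n ^ (k + 1) * R) fun l => if h : l < n ^ (k + 1) * R then
    O.vals _ ((intersectionEquations ν u w)ᴴ * intersectionEquations ν u w) ⟨l, h⟩ else 0

theorem lt_of_mem_kernelIndices (O : DiagOracle F) {u : Fin R → ι → F}
    {w : (Fin (k + 2) → ι) → (Fin (k + 2) → ι) → F} {l : ℕ} (h : l ∈ kernelIndices ν O u w) :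
    l < n ^ (k + 1) * R := (mem_zeroIndices.1 h).1

/-- The basis of the intersection that the program computes. -/
noncomputable def computedBasis (O : DiagOracle F) (u : Fin R → ι → F)
    (w : (Fin (k + 2) → ι) → (Fin (k + 2) → ι) → F) :
    Fin (kernelIndices ν O u w).length → Tensor (k + 2) ι F :=
  kernelTensor ν u
    (O.vecs _ ((intersectionEquations ν u w)ᴴ * intersectionEquations ν u w))
    fun t => ⟨(kernelIndices ν O u w)[t], lt_of_mem_kernelIndices ν O (List.getElem_mem _)⟩

/-- The basis is a function of the oracle, the vectors and the coefficients only, and so does not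
depend on the random tape. -/
theorem isIntersectionBasis_computedBasis (O : DiagOracle F) {p : ℕ} {u : Fin R → ι → F}
    (hu : LinearIndependent F u) {w : (Fin (k + 2) → ι) → (Fin (k + 2) → ι) → F}
    {f : Fin p → MvPolynomial ι F} (hw : ∀ T ∈ symTensors (k + 2) ι F,
      T ∈ annihilator (k + 2) f ↔ ∀ j, ∑ a, w j a * T a = 0) :
    IsIntersectionBasis (k + 2) f u (computedBasis ν O u w) := by
  obtain ⟨hQ, h⟩ := O.spec _ _ (Matrix.isHermitian_conjTranspose_mul_self
    (intersectionEquations ν u w)).exists_diagonalization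
  refine isIntersectionBasis_kernelTensor ν hu hw hQ h (fun s t hst => ?_) fun l => ?_
  · exact Fin.ext ((nodup_zeroIndices _ _).getElem_inj_iff.1 (congrArg Fin.val hst))
  · have : (l : ℕ) ∈ kernelIndices ν O u w ↔
        O.vals _ ((intersectionEquations ν u w)ᴴ * intersectionEquations ν u w) l = 0 := by
      rw [kernelIndices, mem_zeroIndices, dif_pos l.2]
      simp
    rw [← this, List.mem_iff_getElem]
    exact ⟨fun ⟨i, hi, h⟩ => ⟨⟨i, hi⟩, Fin.ext h⟩, fun ⟨t, ht⟩ => ⟨t, t.2, congrArg Fin.val ht⟩⟩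

/-- The position after rotation of the base-`n` digits of `e`. -/
def rotated (e : NExp) : NExp := .add (.div e (.reg 0)) (.mul (.mod e (.reg 0)) (.reg 5))

/-- The position after exchange of the last two base-`n` digits of `e`. -/
def swapped (e : NExp) : NExp :=
  .add (.add (.mul (.mod e (.reg 0)) (.reg 0)) (.mod (.div e (.reg 0)) (.reg 0)))
    (.mul (.div e (.mul (.reg 0) (.reg 0))) (.mul (.reg 0) (.reg 0)))

/-- Compute the values of the polynomials on the tensors `u i ⊗ e_b`. -/
def valuesProgram : Program :=
  sumInto 5 (.reg 4) (.reg 6) (.reg 4) .zero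
    (.mul (.cell 1 (.reg 10) (.reg 12)) (.cell 4 (.reg 12) (.reg 11)))

theorem run_valuesProgram (O : DiagOracle F) (σ : Store F) (hσ : Ready n k R σ)
    {u : Fin R → ι → F} {w : (Fin (k + 2) → ι) → (Fin (k + 2) → ι) → F}
    (hw : ∀ j a, σ.cell 1 (code ν j) (code ν a) = w j a)
    (h4 : ∀ (a : Fin (k + 2) → ι) (l : Fin (n ^ (k + 1) * R)),
      σ.cell 4 (code ν a) l = slotEntry ν u a l) :
    AgreeOff (· = 5) Counter σ (run O valuesProgram σ) ∧
      ∀ (j : Fin (k + 2) → ι) (l : Fin (n ^ (k + 1) * R)),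
        (run O valuesProgram σ).cell 5 (code ν j) l = ∑ a, w j a * slotEntry ν u a l := by
  obtain ⟨hA, hv⟩ := run_sumInto O σ (a := 5) (e₁ := .reg 4) (e₂ := .reg 6) (e₃ := .reg 4)
    (x₀ := .zero) (x := .mul (.cell 1 (.reg 10) (.reg 12)) (.cell 4 (.reg 12) (.reg 11)))
    (f₀ := fun _ _ => 0) (f := fun j c a => σ.cell 1 j a * σ.cell 4 a c)
    (eval_reg_of_agree hσ.reg4 (by norm_num)) (eval_reg_of_agree hσ.reg6 (by norm_num))
    (eval_reg_of_agree hσ.reg4 (by norm_num)) (fun _ _ _ _ _ _ _ _ => rfl)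
    (fun i j k hi hj hk τ hτ h10 h11 h12 => by
      simp only [FExp.eval, NExp.eval, h10, h11, h12, hτ.cell_eq (show 1 ≠ 5 by norm_num),
        hτ.cell_eq (show 4 ≠ 5 by norm_num)])
  refine ⟨hA, fun j l => (hv _ _ (code_lt ν j) l.2).trans ?_⟩
  rw [zero_add, sum_range_code ν]
  exact Finset.sum_congr rfl fun a _ => by rw [hw, h4]

/-- Compute the Gram matrix of the system of equations. -/
def gramProgram : Program :=
  sumInto 6 (.reg 6) (.reg 6) (.reg 4) .zero
    (.add (.add
      (.mul (.conj (.sub (.cell 4 (.reg 12) (.reg 10)) (.cell 4 (rotated (.reg 12)) (.reg 10))))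
        (.sub (.cell 4 (.reg 12) (.reg 11)) (.cell 4 (rotated (.reg 12)) (.reg 11))))
      (.mul (.conj (.sub (.cell 4 (.reg 12) (.reg 10)) (.cell 4 (swapped (.reg 12)) (.reg 10))))
        (.sub (.cell 4 (.reg 12) (.reg 11)) (.cell 4 (swapped (.reg 12)) (.reg 11)))))
      (.mul (.conj (.cell 5 (.reg 12) (.reg 10))) (.cell 5 (.reg 12) (.reg 11))))

theorem run_gramProgram (O : DiagOracle F) (σ : Store F) (hσ : Ready n k R σ)
    {u : Fin R → ι → F} {w : (Fin (k + 2) → ι) → (Fin (k + 2) → ι) → F}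
    (h4 : ∀ (a : Fin (k + 2) → ι) (l : Fin (n ^ (k + 1) * R)),
      σ.cell 4 (code ν a) l = slotEntry ν u a l)
    (h5 : ∀ (j : Fin (k + 2) → ι) (l : Fin (n ^ (k + 1) * R)),
      σ.cell 5 (code ν j) l = ∑ a, w j a * slotEntry ν u a l) :
    AgreeOff (· = 6) Counter σ (run O gramProgram σ) ∧
      ∀ l l' : Fin (n ^ (k + 1) * R), (run O gramProgram σ).cell 6 l l' =
        ((intersectionEquations ν u w)ᴴ * intersectionEquations ν u w) l l' := by
  obtain ⟨hA, hv⟩ := run_sumInto O σ (a := 6) (e₁ := .reg 6) (e₂ := .reg 6) (e₃ := .reg 4)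
    (x₀ := .zero) (x := (.add (.add
      (.mul (.conj (.sub (.cell 4 (.reg 12) (.reg 10)) (.cell 4 (rotated (.reg 12)) (.reg 10))))
        (.sub (.cell 4 (.reg 12) (.reg 11)) (.cell 4 (rotated (.reg 12)) (.reg 11))))
      (.mul (.conj (.sub (.cell 4 (.reg 12) (.reg 10)) (.cell 4 (swapped (.reg 12)) (.reg 10))))
        (.sub (.cell 4 (.reg 12) (.reg 11)) (.cell 4 (swapped (.reg 12)) (.reg 11)))))
      (.mul (.conj (.cell 5 (.reg 12) (.reg 10))) (.cell 5 (.reg 12) (.reg 11)))))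
    (f₀ := fun _ _ => 0) (f := fun c c' a =>
      star (σ.cell 4 a c - σ.cell 4 (a / n + a % n * n ^ (k + 1)) c) *
          (σ.cell 4 a c' - σ.cell 4 (a / n + a % n * n ^ (k + 1)) c') +
        star (σ.cell 4 a c - σ.cell 4 (a % n * n + a / n % n + a / (n * n) * (n * n)) c) *
          (σ.cell 4 a c' - σ.cell 4 (a % n * n + a / n % n + a / (n * n) * (n * n)) c') +
        star (σ.cell 5 a c) * σ.cell 5 a c')
    (eval_reg_of_agree hσ.reg6 (by norm_num)) (eval_reg_of_agree hσ.reg6 (by norm_num))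
    (eval_reg_of_agree hσ.reg4 (by norm_num)) (fun _ _ _ _ _ _ _ _ => rfl)
    (fun i j k hi hj hk τ hτ h10 h11 h12 => by
      simp only [FExp.eval, NExp.eval, rotated, swapped, h10, h11, h12,
        hτ.cell_eq (show 5 ≠ 6 by norm_num), hτ.cell_eq (show 4 ≠ 6 by norm_num),
        hτ.reg_eq (show 0 < 10 by norm_num), hτ.reg_eq (show 5 < 10 by norm_num), hσ.reg0,
        hσ.reg5])
  refine ⟨hA, fun l l' => (hv _ _ l.2 l'.2).trans ?_⟩
  rw [zero_add, sum_range_code ν, Matrix.mul_apply, Fintype.sum_prod_type]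
  refine Finset.sum_congr rfl fun a _ => ?_
  rw [Fin.sum_univ_three, code_rotate, ← pow_two, code_swap, h4, h4, h4, h4, h4, h4, h5, h5]
  simp [intersectionEquations, Matrix.conjTranspose_apply]

/-- Compute the basis of the intersection. -/
def basisProgram : Program :=
  seq slotProgram (seq valuesProgram (seq gramProgram (seq (diag (.reg 6) 6 7 8)
  (seq (compress 7 9 (.reg 6) (.reg 6) (.cell 8 (.lit 0) (.reg 13)) (.cell 7 (.reg 10) (.reg 13)))
    (sumInto 10 (.reg 7) (.reg 4) (.reg 6) .zero
      (.mul (.cell 9 (.reg 10) (.reg 12)) (.cell 4 (.reg 11) (.reg 12))))))))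

theorem bounded_basisProgram : Bounded True basisProgram := by
  simp only [basisProgram, Bounded]
  have hr := NExp.bounded_reg
  exact ⟨bounded_sumInto (hr _) (hr _) (NExp.bounded_lit (by norm_num)),
    bounded_sumInto (hr _) (hr _) (hr _), bounded_sumInto (hr _) (hr _) (hr _), trivial,
    bounded_compress (hr _) (hr _), bounded_sumInto (hr _) (hr _) (hr _)⟩

theorem run_basisProgram (O : DiagOracle F) (σ : Store F) (hσ : Ready n k R σ)
    {u : Fin R → ι → F} {w : (Fin (k + 2) → ι) → (Fin (k + 2) → ι) → F}
    (hu : ∀ (i : Fin R) y, σ.cell 0 i (ν y) = u i y)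
    (hw : ∀ j a, σ.cell 1 (code ν j) (code ν a) = w j a) :
    AgreeOff (3 < ·) (6 < ·) σ (run O basisProgram σ) ∧
      (run O basisProgram σ).reg 7 = (kernelIndices ν O u w).length ∧
      ∀ (t : Fin (kernelIndices ν O u w).length) a,
        (run O basisProgram σ).cell 10 t (code ν a) = computedBasis ν O u w t a := by
  simp only [basisProgram, run_seq]
  obtain ⟨hA, h4⟩ := run_slotProgram ν O σ hσ hu
  generalize run O slotProgram σ = σ₁ at *
  have hA₁ : AgreeOff (3 < ·) (6 < ·) σ σ₁ := hA.of_sumInto (by norm_num) (by norm_num)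
  obtain ⟨hA, h5⟩ := run_valuesProgram ν O σ₁ (hσ.of_agreeOff hA₁)
    (fun j a => by rw [hA.cell_eq (by norm_num), hw]) h4
  generalize run O valuesProgram σ₁ = σ₂ at *
  have hA₂ := hA₁.trans (hA.of_sumInto (by norm_num) (by norm_num))
  have h4₂ : ∀ (a : Fin (k + 2) → ι) (l : Fin (n ^ (k + 1) * R)),
      σ₂.cell 4 (code ν a) l = slotEntry ν u a l := fun a l => by
    rw [hA.cell_eq (by norm_num), h4]
  obtain ⟨hA, h6⟩ := run_gramProgram ν O σ₂ (hσ.of_agreeOff hA₂) h4₂ h5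
  generalize run O gramProgram σ₂ = σ₃ at *
  have hA₃ := hA₂.trans (hA.of_sumInto (by norm_num) (by norm_num))
  have c4 : σ₃.cell 4 = σ₂.cell 4 := hA.cell_eq (by norm_num)
  obtain ⟨hA, h7, h8⟩ := run_diag O σ₃ (e := .reg 6) (src := 6) (dst := 7) (ev := 8)
    (hσ.of_agreeOff hA₃).reg6 (by norm_num) h6
  generalize run O (diag (.reg 6) 6 7 8) σ₃ = σ₄ at *
  have hA₄ := hA₃.trans (hA.mono (a' := (3 < ·)) (s' := (6 < ·))
    (by rintro b (rfl | rfl) <;> norm_num) fun _ => False.elim)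
  replace c4 : σ₄.cell 4 = σ₂.cell 4 := (hA.2 4 (by norm_num)).trans c4
  have hσ₄ := hσ.of_agreeOff hA₄
  obtain ⟨hA, hr7, h9⟩ := run_compress O σ₄ (c := 7) (a := 9) (e := .reg 6) (e₂ := .reg 6)
    (w := .cell 8 (.lit 0) (.reg 13)) (x := .cell 7 (.reg 10) (.reg 13))
    (by simp [Counter]) (E := n ^ (k + 1) * R) (E₂ := n ^ (k + 1) * R)
    (W := fun l => if h : l < n ^ (k + 1) * R then
      O.vals _ ((intersectionEquations ν u w)ᴴ * intersectionEquations ν u w) ⟨l, h⟩ else 0)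
    (X := fun l i => σ₄.cell 7 i l)
    (eval_reg_of_compress hσ₄.reg6 (by norm_num) (by norm_num))
    (eval_reg_of_compress hσ₄.reg6 (by norm_num) (by norm_num))
    (fun l hl τ hτ h13 => by
      simp only [FExp.eval, NExp.eval, h13, hτ.cell_eq (show 8 ≠ 9 by norm_num), dif_pos hl]
      exact h8 ⟨l, hl⟩)
    (fun l i hl hi τ hτ h13 h10 => by
      simp only [FExp.eval, NExp.eval, h13, h10, hτ.cell_eq (show 7 ≠ 9 by norm_num)])
  generalize run O (compress 7 9 (.reg 6) (.reg 6) _ _) σ₄ = σ₅ at *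
  have hA₅ := hA₄.trans (hA.mono (a' := (3 < ·)) (s' := (6 < ·))
    (by rintro b rfl; norm_num) (by rintro i (rfl | ⟨h, -⟩ | rfl) <;> omega))
  replace c4 : σ₅.cell 4 = σ₂.cell 4 := (hA.2 4 (by norm_num)).trans c4
  have hσ₅ := hσ.of_agreeOff hA₅
  change σ₅.reg 7 = (kernelIndices ν O u w).length at hr7
  change ∀ (t : ℕ) (ht : t < (kernelIndices ν O u w).length) (i : ℕ), i < n ^ (k + 1) * R →
    σ₅.cell 9 t i = σ₄.cell 7 i (kernelIndices ν O u w)[t] at h9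
  obtain ⟨hA, hv⟩ := run_sumInto O σ₅ (a := 10) (e₁ := .reg 7) (e₂ := .reg 4) (e₃ := .reg 6)
    (x₀ := .zero) (x := .mul (.cell 9 (.reg 10) (.reg 12)) (.cell 4 (.reg 11) (.reg 12)))
    (f₀ := fun _ _ => 0) (f := fun t a l => σ₅.cell 9 t l * σ₅.cell 4 a l)
    (eval_reg_of_agree hr7 (by norm_num)) (eval_reg_of_agree hσ₅.reg4 (by norm_num))
    (eval_reg_of_agree hσ₅.reg6 (by norm_num)) (fun _ _ _ _ _ _ _ _ => rfl)
    (fun i j k hi hj hk τ hτ h10 h11 h12 => by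
      simp only [FExp.eval, NExp.eval, h10, h11, h12, hτ.cell_eq (show 9 ≠ 10 by norm_num),
        hτ.cell_eq (show 4 ≠ 10 by norm_num)])
  refine ⟨hA₅.trans (hA.of_sumInto (by norm_num) (by norm_num)),
    (hA.reg_eq (by norm_num)).trans hr7, fun t a => (hv _ _ t.2 (code_lt ν a)).trans ?_⟩
  rw [zero_add, Finset.sum_range, computedBasis, kernelTensor, slotTensor_apply]
  refine Finset.sum_congr rfl fun l _ => ?_
  rw [c4, h4₂, h9 t t.2 l l.2, mul_comm]
  exact congrArg _ (h7 l ⟨_, lt_of_mem_kernelIndices ν O (List.getElem_mem t.2)⟩)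

end Basis

end Program

/-! ## The program: the matrix to be diagonalized -/

namespace Program

variable {F : Type*}

/-- The leading `n × n` block of the array `a`. -/
def block (n : ℕ) (σ : Store F) (a : ℕ) : Matrix (Fin n) (Fin n) F :=
  Matrix.of fun i j => σ.cell a i j

theorem block_congr {n a : ℕ} {σ τ : Store F} (h : τ.cell a = σ.cell a) :
    block n τ a = block n σ a := by
  simp only [block, h]

theorem AgreeOff.reg13 {a : ℕ → Prop} {σ τ : Store F} (h : AgreeOff a Counter σ τ) :
    τ.reg 13 = σ.reg 13 := h.1 13 fun hc => absurd hc.2 (by norm_num)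

theorem AgreeOff.of_counter {a : ℕ} {σ τ : Store F} (h : AgreeOff (· = a) Counter σ τ) {l l' : ℕ}
    (ha : l < a) (hl : l' < 10) : AgreeOff (l < ·) (l' < ·) σ τ :=
  h.mono (fun _ hb => hb ▸ ha) fun _ hi => lt_of_lt_of_le hl hi.1

variable [RCLike F]

section Square

variable {n : ℕ}

/-- Multiply the `n × n` matrices in the arrays `b` and `c`. -/
def matMul (a b c : ℕ) : Program :=
  sumInto a (.reg 0) (.reg 0) (.reg 0) .zero
    (.mul (.cell b (.reg 10) (.reg 12)) (.cell c (.reg 12) (.reg 11)))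

theorem bounded_matMul {q : Prop} {a b c : ℕ} : Bounded q (matMul a b c) :=
  bounded_sumInto (NExp.bounded_reg _) (NExp.bounded_reg _) (NExp.bounded_reg _)

theorem run_matMul (O : DiagOracle F) (σ : Store F) (h0 : σ.reg 0 = n) {a b c : ℕ} (hb : b ≠ a)
    (hc : c ≠ a) : AgreeOff (· = a) Counter σ (run O (matMul a b c) σ) ∧
      block n (run O (matMul a b c) σ) a = block n σ b * block n σ c := by
  obtain ⟨hA, hv⟩ := run_sumInto O σ (a := a) (e₁ := .reg 0) (e₂ := .reg 0) (e₃ := .reg 0)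
    (x₀ := .zero) (x := .mul (.cell b (.reg 10) (.reg 12)) (.cell c (.reg 12) (.reg 11)))
    (f₀ := fun _ _ => 0) (f := fun i j l => σ.cell b i l * σ.cell c l j)
    (eval_reg_of_agree h0 (by norm_num)) (eval_reg_of_agree h0 (by norm_num))
    (eval_reg_of_agree h0 (by norm_num)) (fun _ _ _ _ _ _ _ _ => rfl)
    (fun i j k hi hj hk τ hτ h10 h11 h12 => by
      simp only [FExp.eval, NExp.eval, h10, h11, h12, hτ.cell_eq hb, hτ.cell_eq hc])
  refine ⟨hA, ?_⟩
  ext i j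
  rw [Matrix.mul_apply]
  refine (hv _ _ i.2 j.2).trans ?_
  rw [zero_add, Finset.sum_range]
  rfl

/-- Fill the leading `n × n` block of the array `a` with the values of `x`. -/
def matFill (a : ℕ) (x : FExp) : Program := sumInto a (.reg 0) (.reg 0) (.lit 0) x .zero

theorem bounded_matFill {q : Prop} {a : ℕ} {x : FExp} : Bounded q (matFill a x) :=
  bounded_sumInto (NExp.bounded_reg _) (NExp.bounded_reg _) (NExp.bounded_lit (by norm_num))

theorem run_matFill (O : DiagOracle F) (σ : Store F) (h0 : σ.reg 0 = n) {a : ℕ} {x : FExp}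
    {X : Matrix (Fin n) (Fin n) F} (hx : ∀ (i j : Fin n) τ, AgreeOff (· = a) Counter σ τ →
      τ.reg 10 = i → τ.reg 11 = j → x.eval τ = X i j) :
    AgreeOff (· = a) Counter σ (run O (matFill a x) σ) ∧ block n (run O (matFill a x) σ) a = X := by
  obtain ⟨hA, hv⟩ := run_sumInto O σ (a := a) (e₁ := .reg 0) (e₂ := .reg 0) (e₃ := .lit 0)
    (x₀ := x) (x := .zero)
    (f₀ := fun i j => if h : i < n ∧ j < n then X ⟨i, h.1⟩ ⟨j, h.2⟩ else 0) (f := fun _ _ _ => 0)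
    (eval_reg_of_agree h0 (by norm_num)) (eval_reg_of_agree h0 (by norm_num))
    (fun _ _ => rfl) (fun i j hi hj τ hτ h10 h11 => by
      rw [dif_pos ⟨hi, hj⟩]
      exact hx ⟨i, hi⟩ ⟨j, hj⟩ τ hτ h10 h11)
    (fun _ _ _ _ _ _ _ _ _ _ _ => rfl)
  refine ⟨hA, ?_⟩
  ext i j
  refine (hv _ _ i.2 j.2).trans ?_
  rw [Finset.sum_const_zero, add_zero, dif_pos ⟨i.2, j.2⟩]

/-- Compute a generalized inverse, in array 17, of the matrix in array 12 with the eigenvalues in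
array 15. -/
def inverseProgram : Program :=
  seq (matFill 17 .zero) (loop 13 (.reg 0) (seq (matMul 16 12 17)
    (seq (matFill 18 (.add (.cell 17 (.reg 10) (.reg 11)) (.mul (.inv (.cell 15 (.lit 0) (.reg 13)))
      (.sub (delta (.reg 10) (.reg 11)) (.cell 16 (.reg 10) (.reg 11))))))
      (matFill 17 (.cell 18 (.reg 10) (.reg 11))))))

theorem bounded_inverseProgram {q : Prop} : Bounded q inverseProgram :=
  ⟨bounded_matFill, NExp.bounded_reg _, bounded_matMul, bounded_matFill, bounded_matFill⟩

theorem run_inverseProgram (O : DiagOracle F) (σ : Store F) (h0 : σ.reg 0 = n)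
    (h3 : ∀ i j, σ.cell 3 i j = if i = 0 ∧ j = 0 then 1 else 0) :
    AgreeOff (15 < ·) (9 < ·) σ (run O inverseProgram σ) ∧
      block n (run O inverseProgram σ) 17 = approxInverse (block n σ 12) (σ.cell 15 0) n := by
  rw [inverseProgram, run_seq]
  obtain ⟨hA, hv⟩ := run_matFill O σ h0 (a := 17) (x := .zero) (X := 0) (fun _ _ _ _ _ _ => rfl)
  generalize run O (matFill 17 .zero) σ = σ₁ at *
  have hA₁ : AgreeOff (15 < ·) (9 < ·) σ σ₁ := hA.of_counter (by norm_num) (by norm_num)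
  refine run_loop_induct O (e := .reg 0) (σ := σ₁) (N := n) ((hA.reg_eq (by norm_num)).trans h0)
    (fun t τ => AgreeOff (15 < ·) (9 < ·) σ τ ∧
      block n τ 17 = approxInverse (block n σ 12) (σ.cell 15 0) t)
    (fun _ => ⟨hA₁, hv⟩) ?_
  rintro t ht τ ⟨hτ, h17⟩
  have hτ' := hτ.setReg (i := 13) (by norm_num) t (t + 1)
  have h13 : ((τ.setReg 13 t).tick (t + 1)).reg 13 = t := by simp [Store.tick, Store.setReg]
  have h17' : block n ((τ.setReg 13 t).tick (t + 1)) 17 =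
    approxInverse (block n σ 12) (σ.cell 15 0) t := h17
  generalize (τ.setReg 13 t).tick (t + 1) = υ at *
  have hυ0 : υ.reg 0 = n := (hτ'.1 0 (by norm_num)).trans h0
  simp only [run_seq]
  obtain ⟨hB, h16⟩ := run_matMul O υ hυ0 (a := 16) (b := 12) (c := 17) (by norm_num) (by norm_num)
  generalize run O (matMul 16 12 17) υ = υ₁ at *
  have hυ₁ := hτ'.trans (hB.of_counter (by norm_num) (by norm_num))
  have h17₁ : block n υ₁ 17 = _ := (block_congr (hB.cell_eq (by norm_num))).trans h17'
  have h13₁ : υ₁.reg 13 = t := hB.reg13.trans h13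
  rw [h17', block_congr (hτ'.2 12 (by norm_num))] at h16
  obtain ⟨hB, h18⟩ := run_matFill O υ₁ ((hυ₁.1 0 (by norm_num)).trans h0) (a := 18)
    (x := .add (.cell 17 (.reg 10) (.reg 11)) (.mul (.inv (.cell 15 (.lit 0) (.reg 13)))
      (.sub (delta (.reg 10) (.reg 11)) (.cell 16 (.reg 10) (.reg 11)))))
    (X := block n υ₁ 17 + (σ.cell 15 0 t)⁻¹ • (1 - block n υ₁ 16))
    (fun i j ω hω h10 h11 => by
      simp only [FExp.eval, eval_delta (fun i j => by
        rw [hω.cell_eq (by norm_num), hυ₁.2 3 (by norm_num), h3]), NExp.eval, h10, h11,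
        hω.cell_eq (show 17 ≠ 18 by norm_num), hω.cell_eq (show 16 ≠ 18 by norm_num),
        hω.cell_eq (show 15 ≠ 18 by norm_num), hω.reg13, h13₁, hυ₁.2 15 (by norm_num)]
      simp [block, Matrix.one_apply, Fin.ext_iff])
  generalize run O (matFill 18 _) υ₁ = υ₂ at *
  have hυ₂ := hυ₁.trans (hB.of_counter (by norm_num) (by norm_num))
  rw [h17₁, h16] at h18
  obtain ⟨hB, hv⟩ := run_matFill O υ₂ ((hυ₂.1 0 (by norm_num)).trans h0) (a := 17)
    (x := .cell 18 (.reg 10) (.reg 11)) (X := block n υ₂ 18)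
    (fun i j ω hω h10 h11 => by
      simp only [FExp.eval, NExp.eval, h10, h11, hω.cell_eq (show 18 ≠ 17 by norm_num)]
      rfl)
  exact ⟨hυ₂.trans (hB.of_counter (by norm_num) (by norm_num)), hv.trans h18⟩

end Square

section Contraction

variable {ι : Type*} {n k R m : ℕ} (ν : ι ≃ Fin n)

/-- Contract the tensors in array 10 with the two functionals on the tape. -/
def contractProgram : Program :=
  sumInto 11 (.lit 2) (.reg 4) (.reg 7) .zero
    (.mul (.cell 2 (.reg 10) (.reg 12)) (.cell 10 (.reg 12) (.reg 11)))

theorem run_contractProgram (O : DiagOracle F) (σ : Store F) (hσ : Ready n k R σ)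
    (h7 : σ.reg 7 = m) {P : Fin m → Tensor (k + 2) ι F}
    (hP : ∀ t a, σ.cell 10 (t : Fin m) (code ν a) = P t a) :
    AgreeOff (· = 11) Counter σ (run O contractProgram σ) ∧
      ∀ s < 2, ∀ y q, (run O contractProgram σ).cell 11 s (ν y + n * code ν q) =
        contract (stack P) (fun t => σ.cell 2 s t) y q := by
  obtain ⟨hA, hv⟩ := run_sumInto O σ (a := 11) (e₁ := .lit 2) (e₂ := .reg 4) (e₃ := .reg 7)
    (x₀ := .zero) (x := .mul (.cell 2 (.reg 10) (.reg 12)) (.cell 10 (.reg 12) (.reg 11)))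
    (E₁ := 2) (f₀ := fun _ _ => 0) (f := fun s a t => σ.cell 2 s t * σ.cell 10 t a)
    (fun _ _ => rfl) (eval_reg_of_agree hσ.reg4 (by norm_num))
    (eval_reg_of_agree h7 (by norm_num)) (fun _ _ _ _ _ _ _ _ => rfl)
    (fun i j k hi hj hk τ hτ h10 h11 h12 => by
      simp only [FExp.eval, NExp.eval, h10, h11, h12, hτ.cell_eq (show 2 ≠ 11 by norm_num),
        hτ.cell_eq (show 10 ≠ 11 by norm_num)])
  refine ⟨hA, fun s hs y q => ?_⟩
  rw [← code_cons]
  refine (hv _ _ hs (code_lt ν _)).trans ?_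
  rw [zero_add, Finset.sum_range]
  exact Finset.sum_congr rfl fun t _ => by rw [hP]; rfl

variable [Fintype ι]

/-- Compute the product of the contraction number `s` with the adjoint of the contraction
number 1. -/
def productProgram (b s : ℕ) : Program :=
  sumInto b (.reg 0) (.reg 0) (.reg 5) .zero
    (.mul (.cell 11 (.lit s) (.add (.reg 10) (.mul (.reg 0) (.reg 12))))
      (.conj (.cell 11 (.lit 1) (.add (.reg 11) (.mul (.reg 0) (.reg 12))))))

theorem run_productProgram (O : DiagOracle F) (σ : Store F) (hσ : Ready n k R σ)
    {A : ℕ → Matrix ι (Fin (k + 1) → ι) F}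
    (hA : ∀ s < 2, ∀ y q, σ.cell 11 s (ν y + n * code ν q) = A s y q) {b s : ℕ} (hs : s < 2)
    (hb : 11 ≠ b) :
    AgreeOff (· = b) Counter σ (run O (productProgram b s) σ) ∧
      block n (run O (productProgram b s) σ) b = (A s * (A 1)ᴴ).submatrix ν.symm ν.symm := by
  obtain ⟨hB, hv⟩ := run_sumInto O σ (a := b) (e₁ := .reg 0) (e₂ := .reg 0) (e₃ := .reg 5)
    (x₀ := .zero) (x := (.mul (.cell 11 (.lit s) (.add (.reg 10) (.mul (.reg 0) (.reg 12))))
      (.conj (.cell 11 (.lit 1) (.add (.reg 11) (.mul (.reg 0) (.reg 12)))))))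
    (f₀ := fun _ _ => 0)
    (f := fun i j c => σ.cell 11 s (i + n * c) * star (σ.cell 11 1 (j + n * c)))
    (eval_reg_of_agree hσ.reg0 (by norm_num)) (eval_reg_of_agree hσ.reg0 (by norm_num))
    (eval_reg_of_agree hσ.reg5 (by norm_num)) (fun _ _ _ _ _ _ _ _ => rfl)
    (fun i j k hi hj hk τ hτ h10 h11 h12 => by
      simp only [FExp.eval, NExp.eval, h10, h11, h12, hτ.cell_eq hb,
        hτ.reg_eq (show 0 < 10 by norm_num), hσ.reg0])
  refine ⟨hB, ?_⟩
  ext i j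
  refine (hv _ _ i.2 j.2).trans ?_
  rw [zero_add, sum_range_code ν, Matrix.submatrix_apply, Matrix.mul_apply]
  refine Finset.sum_congr rfl fun q _ => ?_
  have h1 := hA s hs (ν.symm i) q
  have h2 := hA 1 (by norm_num) (ν.symm j) q
  rw [Equiv.apply_symm_apply] at h1 h2
  rw [h1, h2, Matrix.conjTranspose_apply]

open scoped ComplexOrder in
theorem rank_conjTranspose_le {β γ : Type*} [Fintype β] [Fintype γ] (A : Matrix β γ F) :
    Aᴴ.rank ≤ A.rank := (Matrix.rank_conjTranspose A).le

/-- Compute the matrix `T(f) G` for a generalized inverse `G` of `T(g)`. -/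
def matrixProgram : Program :=
  seq contractProgram (seq (productProgram 12 1) (seq (productProgram 13 0)
    (seq (diag (.reg 0) 12 14 15) (seq inverseProgram (matMul 18 13 17)))))

theorem bounded_matrixProgram : Bounded True matrixProgram := by
  have hr := NExp.bounded_reg
  exact ⟨bounded_sumInto (NExp.bounded_lit (by norm_num)) (hr _) (hr _),
    bounded_sumInto (hr _) (hr _) (hr _), bounded_sumInto (hr _) (hr _) (hr _), trivial,
    bounded_inverseProgram, bounded_matMul⟩

theorem run_matrixProgram (O : DiagOracle F) (σ : Store F) (hσ : Ready n k R σ)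
    (h7 : σ.reg 7 = m) {P : Fin m → Tensor (k + 2) ι F}
    (hP : ∀ t a, σ.cell 10 (t : Fin m) (code ν a) = P t a) {f g : Fin m → F}
    (hf : ∀ t : Fin m, σ.cell 2 0 t = f t) (hg : ∀ t : Fin m, σ.cell 2 1 t = g t) :
    AgreeOff (10 < ·) (9 < ·) σ (run O matrixProgram σ) ∧
      ∃ G : Matrix (Fin (k + 1) → ι) ι F,
        contract (stack P) g * G * contract (stack P) g = contract (stack P) g ∧
        G.rank ≤ (contract (stack P) g).rank ∧
        block n (run O matrixProgram σ) 18 =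
          (contract (stack P) f * G).submatrix ν.symm ν.symm := by
  obtain rfl : f = fun t : Fin m => σ.cell 2 0 t := funext fun t => (hf t).symm
  obtain rfl : g = fun t : Fin m => σ.cell 2 1 t := funext fun t => (hg t).symm
  set A : ℕ → Matrix ι (Fin (k + 1) → ι) F :=
    fun s => contract (stack P) fun t => σ.cell 2 s t with hAdef
  simp only [matrixProgram, run_seq]
  obtain ⟨hA, h11⟩ := run_contractProgram ν O σ hσ h7 hP
  generalize run O contractProgram σ = σ₁ at *
  have hA₁ : AgreeOff (10 < ·) (9 < ·) σ σ₁ := hA.of_counter (by norm_num) (by norm_num)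
  have frame : ∀ {τ}, AgreeOff (10 < ·) (9 < ·) σ τ → Ready n k R τ := fun h =>
    hσ.of_agreeOff (h.mono (fun _ h => by omega) fun _ h => by omega)
  obtain ⟨hA, h12⟩ := run_productProgram ν O σ₁ (frame hA₁) (A := A) h11 (b := 12) (s := 1)
    (by norm_num) (by norm_num)
  generalize run O (productProgram 12 1) σ₁ = σ₂ at *
  have hA₂ := hA₁.trans (hA.of_counter (by norm_num) (by norm_num))
  obtain ⟨hA, h13⟩ := run_productProgram ν O σ₂ (frame hA₂) (A := A)
    (fun s hs y q => by rw [hA.cell_eq (by norm_num), h11 s hs]) (b := 13) (s := 0)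
    (by norm_num) (by norm_num)
  generalize run O (productProgram 13 0) σ₂ = σ₃ at *
  have hA₃ := hA₂.trans (hA.of_counter (by norm_num) (by norm_num))
  have h12₃ := (block_congr (n := n) (hA.cell_eq (show 12 ≠ 13 by norm_num))).trans h12
  obtain ⟨hA, -, h15⟩ := run_diag O σ₃ (e := .reg 0) (src := 12) (dst := 14) (ev := 15)
    (frame hA₃).reg0 (by norm_num) (A := block n σ₃ 12) (fun _ _ => rfl)
  generalize run O (diag (.reg 0) 12 14 15) σ₃ = σ₄ at *
  have hA₄ := hA₃.trans (hA.mono (a' := (10 < ·)) (s' := (9 < ·))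
    (by rintro b (rfl | rfl) <;> norm_num) fun _ => False.elim)
  have h12₄ := (block_congr (n := n) (hA.2 12 (by norm_num))).trans h12₃
  have h13₄ := (block_congr (n := n) (hA.2 13 (by norm_num))).trans h13
  obtain ⟨hA, h17⟩ := run_inverseProgram O σ₄ (frame hA₄).reg0 (frame hA₄).cell3
  generalize run O inverseProgram σ₄ = σ₅ at *
  have hA₅ := hA₄.trans (hA.mono (fun _ h => by omega) fun _ h => h)
  have h13₅ := (block_congr (n := n) (hA.2 13 (by norm_num))).trans h13₄
  obtain ⟨hA, h18⟩ := run_matMul O σ₅ (frame hA₅).reg0 (a := 18) (b := 13) (c := 17) (by norm_num)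
    (by norm_num)
  refine ⟨hA₅.trans (hA.of_counter (by norm_num) (by norm_num)), ?_⟩
  have hS : (block n σ₃ 12).IsHermitian := by
    rw [h12₃]
    exact (Matrix.isHermitian_mul_conjTranspose_self (A 1)).submatrix _
  obtain ⟨hQ, hD⟩ := O.spec _ _ hS.exists_diagonalization
  have hG := mul_approxInverse_mul hQ hD (lam := σ₄.cell 15 0) h15
  rw [← h12₃.trans h12₄.symm] at h17
  rw [← h17, h12₃] at hG
  -- The generalized inverse itself is never stored: array 13 holds `T(f) T(g)ᴴ`, and its product
  -- with the generalized inverse of `T(g) T(g)ᴴ` is already `T(f) G`. The factor `T(g)ᴴ` bounds the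
  -- rank of `G`.
  refine ⟨(A 1)ᴴ * (block n σ₅ 17).submatrix ν ν, mul_gram_generalized_inverse_mul (A 1) ?_, ?_, ?_⟩
  · have h1 := congrArg (fun X => X.submatrix ν ν) hG
    simpa only [← Matrix.submatrix_mul_equiv _ _ _ ν, Matrix.submatrix_submatrix,
      Equiv.symm_comp_self, Matrix.submatrix_id_id] using h1
  · exact (Matrix.rank_mul_le_left _ _).trans (rank_conjTranspose_le _)
  · rw [h18, h13₅, ← Matrix.mul_assoc, ← Matrix.submatrix_mul_equiv _ _ _ ν.symm,
      Matrix.submatrix_submatrix, Equiv.self_comp_symm, Matrix.submatrix_id_id]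

end Contraction

end Program

/-! ## The program: eigenvectors and tests -/

namespace Program

/-- Because `0⁻¹ = 0`, this expression makes being non-zero an equation, which sums of squares can
test. -/
theorem one_sub_mul_inv_eq_zero_iff {F : Type*} [Field F] {x : F} : 1 - x * x⁻¹ = 0 ↔ x ≠ 0 := by
  by_cases h : x = 0 <;> simp [h]

variable {F : Type*} [RCLike F]

theorem exists_zeroIndices_eq (n : ℕ) (W : ℕ → F) :
    ∃ s : Fin (zeroIndices n W).length → Fin n, Function.Injective s ∧
      (∀ l : Fin n, W l = 0 ↔ ∃ t, s t = l) ∧ ∀ t, (s t : ℕ) = (zeroIndices n W)[t] := by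
  refine ⟨fun t => ⟨(zeroIndices n W)[t], (mem_zeroIndices.1 (List.getElem_mem _)).1⟩,
    fun s t hst => Fin.ext ((nodup_zeroIndices _ _).getElem_inj_iff.1 (congrArg Fin.val hst)),
    fun l => ?_, fun _ => rfl⟩
  have : (l : ℕ) ∈ zeroIndices n W ↔ W l = 0 := by simp [mem_zeroIndices]
  rw [← this, List.mem_iff_getElem]
  exact ⟨fun ⟨i, hi, h⟩ => ⟨⟨i, hi⟩, Fin.ext h⟩, fun ⟨t, ht⟩ => ⟨t, t.2, congrArg Fin.val ht⟩⟩

section Tests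

variable {ι : Type*} {n k R : ℕ} (ν : ι ≃ Fin n)

/-- Compute the tensor powers of the columns of the matrix in array 19. -/
def powersProgram : Program :=
  seq (sumInto 21 (.reg 4) (.reg 0) (.lit 0) .one .zero)
    (loop 13 (.reg 1) (seq (sumInto 22 (.reg 4) (.reg 0) (.lit 0)
      (.mul (.cell 19 (.mod (.reg 10) (.reg 0)) (.reg 11))
        (.cell 21 (.div (.reg 10) (.reg 0)) (.reg 11))) .zero)
      (sumInto 21 (.reg 4) (.reg 0) (.lit 0) (.cell 22 (.reg 10) (.reg 11)) .zero)))

theorem run_powersProgram (O : DiagOracle F) (σ : Store F) (hσ : Ready n k R σ) :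
    AgreeOff (20 < ·) (9 < ·) σ (run O powersProgram σ) ∧
      ∀ (a : Fin (k + 2) → ι) (j : Fin n), (run O powersProgram σ).cell 21 (code ν a) j =
        tensorPower (k + 2) (fun y => block n σ 19 (ν y) j) a := by
  rw [powersProgram, run_seq]
  -- Splits off the lowest digit of the position: one round multiplies its entry into the product
  -- already found for the remaining digits.
  have hprod : ∀ a t j, (∏ s ∈ Finset.range (t + 1), σ.cell 19 (a / n ^ s % n) j) =
      σ.cell 19 (a % n) j * ∏ s ∈ Finset.range t, σ.cell 19 (a / n / n ^ s % n) j := by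
    intro a t j
    rw [Finset.prod_range_succ', mul_comm]
    simp only [pow_zero, Nat.div_one, Nat.div_div_eq_div_mul, pow_succ']
  obtain ⟨hA, hv⟩ := run_sumInto O σ (a := 21) (e₁ := .reg 4) (e₂ := .reg 0) (e₃ := .lit 0)
    (x₀ := .one) (x := .zero) (f₀ := fun _ _ => 1) (f := fun _ _ _ => 0)
    (eval_reg_of_agree hσ.reg4 (by norm_num)) (eval_reg_of_agree hσ.reg0 (by norm_num))
    (fun _ _ => rfl) (fun _ _ _ _ _ _ _ _ => rfl) (fun _ _ _ _ _ _ _ _ _ _ _ => rfl)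
  generalize run O (sumInto 21 _ _ _ _ _) σ = σ₁ at *
  have hA₁ : AgreeOff (20 < ·) (9 < ·) σ σ₁ := hA.of_counter (by norm_num) (by norm_num)
  have frame : ∀ {τ}, AgreeOff (20 < ·) (9 < ·) σ τ → Ready n k R τ := fun h =>
    hσ.of_frame h (by norm_num) fun _ _ => by omega
  have key := run_loop_induct O (i := 13) (e := .reg 1) (σ := σ₁) (N := k + 2)
    (body := seq (sumInto 22 (.reg 4) (.reg 0) (.lit 0)
      (.mul (.cell 19 (.mod (.reg 10) (.reg 0)) (.reg 11))
        (.cell 21 (.div (.reg 10) (.reg 0)) (.reg 11))) .zero)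
      (sumInto 21 (.reg 4) (.reg 0) (.lit 0) (.cell 22 (.reg 10) (.reg 11)) .zero))
    (frame hA₁).reg1
    (fun t τ => AgreeOff (20 < ·) (9 < ·) σ τ ∧ ∀ a j, a < n ^ (k + 2) → j < n →
      τ.cell 21 a j = ∏ s ∈ Finset.range t, σ.cell 19 (a / n ^ s % n) j)
    (fun _ => ⟨hA₁, fun a j ha hj => (hv a j ha hj).trans (by simp)⟩) (by
      rintro t ht τ ⟨hτ, h21⟩
      have hτ' := hτ.setReg (i := 13) (by norm_num) t (t + 1)
      have h21' : ∀ a j, a < n ^ (k + 2) → j < n → ((τ.setReg 13 t).tick (t + 1)).cell 21 a j =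
          ∏ s ∈ Finset.range t, σ.cell 19 (a / n ^ s % n) j := h21
      generalize (τ.setReg 13 t).tick (t + 1) = υ at *
      have hυ := frame hτ'
      rw [run_seq]
      -- Array 22 is a buffer: the old products must stay intact while the new ones are formed.
      obtain ⟨hB, h22⟩ := run_sumInto O υ (a := 22) (e₁ := .reg 4) (e₂ := .reg 0) (e₃ := .lit 0)
        (x₀ := (.mul (.cell 19 (.mod (.reg 10) (.reg 0)) (.reg 11))
        (.cell 21 (.div (.reg 10) (.reg 0)) (.reg 11)))) (x := .zero)
        (f₀ := fun a j => υ.cell 19 (a % n) j * υ.cell 21 (a / n) j) (f := fun _ _ _ => 0)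
        (eval_reg_of_agree hυ.reg4 (by norm_num)) (eval_reg_of_agree hυ.reg0 (by norm_num))
        (fun _ _ => rfl) (fun i j hi hj ω hω h10 h11 => by
          simp only [FExp.eval, NExp.eval, h10, h11, hω.cell_eq (show 19 ≠ 22 by norm_num),
            hω.cell_eq (show 21 ≠ 22 by norm_num), hω.reg_eq (show 0 < 10 by norm_num), hυ.reg0])
        (fun _ _ _ _ _ _ _ _ _ _ _ => rfl)
      generalize run O (sumInto 22 _ _ _ _ _) υ = υ₁ at *
      have hυ₁ := hτ'.trans (hB.of_counter (by norm_num) (by norm_num))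
      have hυ₁' := frame hυ₁
      obtain ⟨hB, hv'⟩ := run_sumInto O υ₁ (a := 21) (e₁ := .reg 4) (e₂ := .reg 0) (e₃ := .lit 0)
        (x₀ := .cell 22 (.reg 10) (.reg 11)) (x := .zero)
        (f₀ := fun a j => υ₁.cell 22 a j) (f := fun _ _ _ => 0)
        (eval_reg_of_agree hυ₁'.reg4 (by norm_num)) (eval_reg_of_agree hυ₁'.reg0 (by norm_num))
        (fun _ _ => rfl) (fun i j hi hj ω hω h10 h11 => by
          simp only [FExp.eval, NExp.eval, h10, h11, hω.cell_eq (show 22 ≠ 21 by norm_num)])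
        (fun _ _ _ _ _ _ _ _ _ _ _ => rfl)
      refine ⟨hυ₁.trans (hB.of_counter (by norm_num) (by norm_num)), fun a j ha hj => ?_⟩
      rw [hv' a j ha hj, h22 a j ha hj, h21' _ j ((Nat.div_le_self _ _).trans_lt ha) hj, hprod,
        hτ'.2 19 (by norm_num)]
      simp)
  refine ⟨key.1, fun a j => (key.2 _ _ (code_lt ν a) j.2).trans ?_⟩
  rw [Finset.prod_range, tensorPower]
  exact Finset.prod_congr rfl fun t _ => by rw [code_div_pow_mod]; rfl

/-- Test the equation `M * Q = Q * diagonal D`. -/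
def eigenTest : Program :=
  seq (matMul 22 18 19) (sumSquares 23 24 (.reg 0) (.reg 0)
    (.sub (.cell 22 (.reg 10) (.reg 12))
      (.mul (.cell 19 (.reg 10) (.reg 12)) (.cell 20 (.lit 0) (.reg 12)))))

/-- Needed because the oracle answers arbitrarily when the matrix is not diagonalizable. -/
theorem run_eigenTest (O : DiagOracle F) (σ : Store F) (h0 : σ.reg 0 = n) :
    AgreeOff (fun c => c = 22 ∨ c = 23 ∨ c = 24) Counter σ (run O eigenTest σ) ∧
      ((run O eigenTest σ).cell 24 0 0 = 0 ↔ block n σ 18 * block n σ 19 =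
        block n σ 19 * Matrix.diagonal fun j : Fin n => σ.cell 20 0 j) := by
  rw [eigenTest, run_seq]
  obtain ⟨hA, h22⟩ := run_matMul O σ h0 (a := 22) (b := 18) (c := 19) (by norm_num) (by norm_num)
  generalize run O (matMul 22 18 19) σ = σ₁ at *
  have h0₁ : σ₁.reg 0 = n := (hA.reg_eq (by norm_num)).trans h0
  obtain ⟨hB, hv⟩ := run_sumSquares O σ₁ (a := 23) (b := 24) (by norm_num) (e₁ := .reg 0)
    (e₂ := .reg 0) (x := (.sub (.cell 22 (.reg 10) (.reg 12))
      (.mul (.cell 19 (.reg 10) (.reg 12)) (.cell 20 (.lit 0) (.reg 12)))))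
    (f := fun i j => σ₁.cell 22 i j - σ.cell 19 i j * σ.cell 20 0 j)
    (eval_reg_of_agree h0₁ (by norm_num)) (eval_reg_of_agree h0₁ (by norm_num))
    (fun i j hi hj τ hτ h10 h12 => by
      simp only [FExp.eval, NExp.eval, h10, h12, hτ.cell_eq (show 22 ≠ 23 by norm_num),
        hτ.cell_eq (show 19 ≠ 23 by norm_num), hτ.cell_eq (show 20 ≠ 23 by norm_num),
        hA.cell_eq (show 19 ≠ 22 by norm_num), hA.cell_eq (show 20 ≠ 22 by norm_num)])
  refine ⟨(hA.mono (fun _ => .inl) fun _ => id).trans (hB.mono (fun _ => .inr) fun _ => id),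
    hv.trans ?_⟩
  rw [← h22, ← Matrix.ext_iff]
  simp only [Matrix.mul_diagonal, block, Matrix.of_apply, sub_eq_zero]
  exact ⟨fun h i j => h i j i.2 j.2, fun h i j hi hj => h ⟨i, hi⟩ ⟨j, hj⟩⟩

/-- Test that the eigenvectors are not zero. -/
def columnTest : Program :=
  seq (sumInto 25 (.reg 0) (.lit 1) (.reg 0) .zero
    (.mul (.cell 19 (.reg 12) (.reg 10)) (.conj (.cell 19 (.reg 12) (.reg 10)))))
    (sumSquares 23 26 (.reg 0) (.lit 1)
      (.sub .one (.mul (.cell 25 (.reg 10) (.lit 0)) (.inv (.cell 25 (.reg 10) (.lit 0))))))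

/-- Invertibility of the matrix of eigenvectors is not tested; non-zero columns suffice, since
eigenvectors for distinct eigenvalues are independent. -/
theorem run_columnTest (O : DiagOracle F) (σ : Store F) (h0 : σ.reg 0 = n) :
    AgreeOff (fun c => c = 25 ∨ c = 23 ∨ c = 26) Counter σ (run O columnTest σ) ∧
      ((run O columnTest σ).cell 26 0 0 = 0 ↔ ∀ j : Fin n, (block n σ 19).col j ≠ 0) := by
  rw [columnTest, run_seq]
  obtain ⟨hA, h25⟩ := run_sumInto O σ (a := 25) (e₁ := .reg 0) (e₂ := .lit 1) (e₃ := .reg 0)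
    (x₀ := .zero) (x := .mul (.cell 19 (.reg 12) (.reg 10)) (.conj (.cell 19 (.reg 12) (.reg 10))))
    (E₂ := 1) (f₀ := fun _ _ => 0) (f := fun j _ i => σ.cell 19 i j * star (σ.cell 19 i j))
    (eval_reg_of_agree h0 (by norm_num)) (fun _ _ => rfl) (eval_reg_of_agree h0 (by norm_num))
    (fun _ _ _ _ _ _ _ _ => rfl) (fun i j l hi hj hl τ hτ h10 h11 h12 => by
      simp only [FExp.eval, NExp.eval, h10, h12, hτ.cell_eq (show 19 ≠ 25 by norm_num)])
  generalize run O (sumInto 25 _ _ _ _ _) σ = σ₁ at *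
  have h0₁ : σ₁.reg 0 = n := (hA.reg_eq (by norm_num)).trans h0
  obtain ⟨hB, hv⟩ := run_sumSquares O σ₁ (a := 23) (b := 26) (by norm_num) (e₁ := .reg 0)
    (e₂ := .lit 1) (x := .sub .one
      (.mul (.cell 25 (.reg 10) (.lit 0)) (.inv (.cell 25 (.reg 10) (.lit 0)))))
    (E₂ := 1) (f := fun j _ => 1 - σ₁.cell 25 j 0 * (σ₁.cell 25 j 0)⁻¹)
    (eval_reg_of_agree h0₁ (by norm_num)) (fun _ _ => rfl)
    (fun i j hi hj τ hτ h10 h12 => by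
      simp only [FExp.eval, NExp.eval, h10, hτ.cell_eq (show 25 ≠ 23 by norm_num)])
  refine ⟨(hA.mono (fun _ => .inl) fun _ => id).trans (hB.mono (fun _ => .inr) fun _ => id),
    hv.trans ?_⟩
  have h1 : ∀ j : Fin n, σ₁.cell 25 j 0 ≠ 0 ↔ (block n σ 19).col j ≠ 0 := fun j => by
    rw [h25 j 0 j.2 one_pos, zero_add, Ne, sum_mul_star_eq_zero_iff, Ne, funext_iff]
    simp only [Finset.mem_range]
    exact not_congr ⟨fun h i => h i i.2, fun h i hi => h ⟨i, hi⟩⟩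
  simp only [one_sub_mul_inv_eq_zero_iff]
  exact ⟨fun h j => (h1 j).1 (h j 0 j.2 one_pos), fun h j _ hj _ => (h1 ⟨j, hj⟩).2 (h ⟨j, hj⟩)⟩

/-- Test that the non-zero eigenvalues are distinct. -/
def distinctTest : Program :=
  sumSquares 23 27 (.reg 0) (.reg 0)
    (.mul (.mul (.cell 20 (.lit 0) (.reg 10)) (.cell 20 (.lit 0) (.reg 12)))
      (.mul (.sub .one (.mul (.sub (.cell 20 (.lit 0) (.reg 10)) (.cell 20 (.lit 0) (.reg 12)))
        (.inv (.sub (.cell 20 (.lit 0) (.reg 10)) (.cell 20 (.lit 0) (.reg 12))))))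
        (.sub .one (delta (.reg 10) (.reg 12)))))

theorem run_distinctTest (O : DiagOracle F) (σ : Store F) (hσ : Ready n k R σ) :
    AgreeOff (fun c => c = 23 ∨ c = 27) Counter σ (run O distinctTest σ) ∧
      ((run O distinctTest σ).cell 27 0 0 = 0 ↔ ∀ i j : Fin n, σ.cell 20 0 i ≠ 0 →
        σ.cell 20 0 j ≠ 0 → σ.cell 20 0 i = σ.cell 20 0 j → i = j) := by
  obtain ⟨hB, hv⟩ := run_sumSquares O σ (a := 23) (b := 27) (by norm_num) (e₁ := .reg 0)
    (e₂ := .reg 0)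
    (x := (.mul (.mul (.cell 20 (.lit 0) (.reg 10)) (.cell 20 (.lit 0) (.reg 12)))
      (.mul (.sub .one (.mul (.sub (.cell 20 (.lit 0) (.reg 10)) (.cell 20 (.lit 0) (.reg 12)))
        (.inv (.sub (.cell 20 (.lit 0) (.reg 10)) (.cell 20 (.lit 0) (.reg 12))))))
        (.sub .one (delta (.reg 10) (.reg 12))))))
    (f := fun i j => σ.cell 20 0 i * σ.cell 20 0 j *
      ((1 - (σ.cell 20 0 i - σ.cell 20 0 j) * (σ.cell 20 0 i - σ.cell 20 0 j)⁻¹) *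
        (1 - if i = j then 1 else 0)))
    (eval_reg_of_agree hσ.reg0 (by norm_num)) (eval_reg_of_agree hσ.reg0 (by norm_num))
    (fun i j hi hj τ hτ h10 h12 => by
      simp only [FExp.eval, eval_delta (fun i j => by rw [hτ.cell_eq (by norm_num), hσ.cell3]),
        NExp.eval, h10, h12, hτ.cell_eq (show 20 ≠ 23 by norm_num)])
  refine ⟨hB, hv.trans ?_⟩
  have h1 : ∀ i j : ℕ, (1 - if i = j then 1 else 0 : F) = 0 ↔ i = j := fun i j => by
    split_ifs with h <;> simp [h]
  simp only [mul_eq_zero, one_sub_mul_inv_eq_zero_iff, sub_ne_zero, h1]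
  constructor
  · intro h i j hi hj hij
    rcases h i j i.2 j.2 with (h | h) | h | h
    · exact absurd h hi
    · exact absurd h hj
    · exact absurd hij h
    · exact Fin.ext h
  · intro h i j hi hj
    by_cases h2 : σ.cell 20 0 i = 0
    · exact .inl (.inl h2)
    by_cases h3 : σ.cell 20 0 j = 0
    · exact .inl (.inr h3)
    by_cases h4 : σ.cell 20 0 i = σ.cell 20 0 j
    · exact .inr (.inr (congrArg Fin.val (h ⟨i, hi⟩ ⟨j, hj⟩ h2 h3 h4)))
    · exact .inr (.inl h4)

variable [Fintype ι]

/-- Test that the polynomials vanish at the eigenvectors for the non-zero eigenvalues. -/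
def polynomialTest : Program :=
  seq (sumInto 28 (.reg 4) (.reg 0) (.reg 4) .zero
    (.mul (.cell 1 (.reg 10) (.reg 12)) (.cell 21 (.reg 12) (.reg 11))))
    (sumSquares 23 29 (.reg 4) (.reg 0)
      (.mul (.cell 20 (.lit 0) (.reg 12)) (.cell 28 (.reg 10) (.reg 12))))

theorem run_polynomialTest (O : DiagOracle F) (σ : Store F) (hσ : Ready n k R σ)
    {w : (Fin (k + 2) → ι) → (Fin (k + 2) → ι) → F} {T : Fin n → Tensor (k + 2) ι F}
    (hw : ∀ j a, σ.cell 1 (code ν j) (code ν a) = w j a)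
    (hT : ∀ a (l : Fin n), σ.cell 21 (code ν a) l = T l a) :
    AgreeOff (fun c => c = 28 ∨ c = 23 ∨ c = 29) Counter σ (run O polynomialTest σ) ∧
      ((run O polynomialTest σ).cell 29 0 0 = 0 ↔
        ∀ l : Fin n, σ.cell 20 0 l ≠ 0 → ∀ j, ∑ a, w j a * T l a = 0) := by
  rw [polynomialTest, run_seq]
  obtain ⟨hA, h28⟩ := run_sumInto O σ (a := 28) (e₁ := .reg 4) (e₂ := .reg 0) (e₃ := .reg 4)
    (x₀ := .zero) (x := .mul (.cell 1 (.reg 10) (.reg 12)) (.cell 21 (.reg 12) (.reg 11)))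
    (f₀ := fun _ _ => 0) (f := fun j l a => σ.cell 1 j a * σ.cell 21 a l)
    (eval_reg_of_agree hσ.reg4 (by norm_num)) (eval_reg_of_agree hσ.reg0 (by norm_num))
    (eval_reg_of_agree hσ.reg4 (by norm_num))
    (fun _ _ _ _ _ _ _ _ => rfl) (fun i j l hi hj hl τ hτ h10 h11 h12 => by
      simp only [FExp.eval, NExp.eval, h10, h11, h12, hτ.cell_eq (show 1 ≠ 28 by norm_num),
        hτ.cell_eq (show 21 ≠ 28 by norm_num)])
  generalize run O (sumInto 28 _ _ _ _ _) σ = σ₁ at *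
  have h0₁ : σ₁.reg 0 = n := (hA.reg_eq (by norm_num)).trans hσ.reg0
  have h4₁ : σ₁.reg 4 = n ^ (k + 2) := (hA.reg_eq (by norm_num)).trans hσ.reg4
  obtain ⟨hB, hv⟩ := run_sumSquares O σ₁ (a := 23) (b := 29) (by norm_num) (e₁ := .reg 4)
    (e₂ := .reg 0) (x := .mul (.cell 20 (.lit 0) (.reg 12)) (.cell 28 (.reg 10) (.reg 12)))
    (f := fun j l => σ.cell 20 0 l * σ₁.cell 28 j l)
    (eval_reg_of_agree h4₁ (by norm_num)) (eval_reg_of_agree h0₁ (by norm_num))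
    (fun i j hi hj τ hτ h10 h12 => by
      simp only [FExp.eval, NExp.eval, h10, h12, hτ.cell_eq (show 28 ≠ 23 by norm_num),
        hτ.cell_eq (show 20 ≠ 23 by norm_num), hA.cell_eq (show 20 ≠ 28 by norm_num)])
  refine ⟨(hA.mono (fun _ => .inl) fun _ => id).trans (hB.mono (fun _ => .inr) fun _ => id),
    hv.trans ?_⟩
  have h1 : ∀ (j : Fin (k + 2) → ι) (l : Fin n), σ₁.cell 28 (code ν j) l = ∑ a, w j a * T l a :=
    fun j l => by
      rw [h28 _ _ (code_lt ν j) l.2, zero_add, sum_range_code ν]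
      exact Finset.sum_congr rfl fun a _ => by rw [hw, hT]
  simp only [mul_eq_zero]
  constructor
  · intro h l hl j
    rw [← h1]
    exact (h _ _ (code_lt ν j) l.2).resolve_left hl
  · intro h j l hj hl
    obtain ⟨a, rfl⟩ := exists_code_eq ν hj
    by_cases h2 : σ.cell 20 0 l = 0
    · exact .inl h2
    · exact .inr ((h1 a ⟨l, hl⟩).trans (h ⟨l, hl⟩ h2 a))

end Tests

end Program

/-! ## The program: its output -/

namespace Program

theorem readOutput_eq_only {ι F : Type*} {n m : ℕ} (ν : ι ≃ Fin n) {σ : Store F} {x : Fin m → ι → F}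
    (h0 : σ.reg 0 = 1) (h1 : σ.reg 1 = m) (hx : ∀ t y, σ.cell 0 (t : Fin m) (ν y) = x t y) :
    readOutput ν σ = .only (List.ofFn x) := by
  subst h1
  rw [readOutput, if_neg (by omega), if_pos h0]
  congr 2
  funext t y
  exact hx t y

variable {F : Type*} [RCLike F]

/-- Report failure unless all the tests were passed and the numbers in the registers 7 and 8
agree. -/
def reportProgram : Program :=
  ifZero (.cell 24 (.lit 0) (.lit 0)) (ifZero (.cell 26 (.lit 0) (.lit 0))
    (ifZero (.cell 27 (.lit 0) (.lit 0)) (ifZero (.cell 29 (.lit 0) (.lit 0))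
      (ifLt (.reg 7) (.reg 8) (setReg 0 (.lit 2)) (ifLt (.reg 8) (.reg 7) (setReg 0 (.lit 2))
        (seq (setReg 1 (.reg 8)) (setReg 0 (.lit 1)))))
      (setReg 0 (.lit 2))) (setReg 0 (.lit 2))) (setReg 0 (.lit 2))) (setReg 0 (.lit 2))

theorem run_reportProgram (O : DiagOracle F) (σ : Store F) :
    (run O reportProgram σ).cell = σ.cell ∧
      ((σ.cell 24 0 0 = 0 ∧ σ.cell 26 0 0 = 0 ∧ σ.cell 27 0 0 = 0 ∧ σ.cell 29 0 0 = 0 ∧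
          σ.reg 8 = σ.reg 7) →
        (run O reportProgram σ).reg 0 = 1 ∧ (run O reportProgram σ).reg 1 = σ.reg 7) ∧
      (¬ (σ.cell 24 0 0 = 0 ∧ σ.cell 26 0 0 = 0 ∧ σ.cell 27 0 0 = 0 ∧ σ.cell 29 0 0 = 0 ∧
          σ.reg 8 = σ.reg 7) → (run O reportProgram σ).reg 0 = 2) := by
  have key : ∀ τ : Store F, τ.reg = σ.reg → (run O (ifLt (.reg 7) (.reg 8) (setReg 0 (.lit 2))
      (ifLt (.reg 8) (.reg 7) (setReg 0 (.lit 2)) (seq (setReg 1 (.reg 8)) (setReg 0 (.lit 1)))))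
      τ).cell = τ.cell ∧ (σ.reg 8 = σ.reg 7 → (run O (ifLt (.reg 7) (.reg 8) (setReg 0 (.lit 2))
      (ifLt (.reg 8) (.reg 7) (setReg 0 (.lit 2)) (seq (setReg 1 (.reg 8)) (setReg 0 (.lit 1)))))
      τ).reg 0 = 1 ∧ (run O (ifLt (.reg 7) (.reg 8) (setReg 0 (.lit 2))
      (ifLt (.reg 8) (.reg 7) (setReg 0 (.lit 2)) (seq (setReg 1 (.reg 8)) (setReg 0 (.lit 1)))))
      τ).reg 1 = σ.reg 7) ∧ (σ.reg 8 ≠ σ.reg 7 →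
      (run O (ifLt (.reg 7) (.reg 8) (setReg 0 (.lit 2))
      (ifLt (.reg 8) (.reg 7) (setReg 0 (.lit 2)) (seq (setReg 1 (.reg 8)) (setReg 0 (.lit 1)))))
      τ).reg 0 = 2) := fun τ hτ => by
    rcases lt_trichotomy (σ.reg 7) (σ.reg 8) with h | h | h
    · simp [run, NExp.eval, Store.tick, Store.setReg, hτ, h, h.ne']
    · simp [run, NExp.eval, Store.tick, Store.setReg, hτ, h]
    · simp [run, NExp.eval, Store.tick, Store.setReg, hτ, h, h.ne, h.not_gt]
  have fail : ∀ τ : Store F, (run O (setReg 0 (.lit 2)) τ).reg 0 = 2 := fun τ => by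
    simp [run, NExp.eval, Store.tick, Store.setReg]
  have fail' : ∀ τ : Store F, (run O (setReg 0 (.lit 2)) τ).cell = τ.cell := fun τ => rfl
  have hcell : ∀ (τ : Store F) t, (τ.tick t).cell = τ.cell := fun _ _ => rfl
  have hreg : ∀ (τ : Store F) t, (τ.tick t).reg = τ.reg := fun _ _ => rfl
  rw [reportProgram]
  generalize ifLt _ _ _ _ = c at key
  simp only [run, FExp.eval, NExp.eval]
  simp only [hcell]
  split_ifs with h1 h2 h3 h4
  · obtain ⟨k1, k2, k3⟩ := key (((((σ.tick _).tick _).tick _).tick _)) rfl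
    exact ⟨k1, fun h => k2 h.2.2.2.2, fun h => k3 fun h' => h ⟨h1, h2, h3, h4, h'⟩⟩
  · exact ⟨fail' _, fun h => absurd h.2.2.2.1 h4, fun _ => fail _⟩
  · exact ⟨fail' _, fun h => absurd h.2.2.1 h3, fun _ => fail _⟩
  · exact ⟨fail' _, fun h => absurd h.2.1 h2, fun _ => fail _⟩
  · exact ⟨fail' _, fun h => absurd h.1 h1, fun _ => fail _⟩

section Output

variable {ι : Type*} [Fintype ι] {n k R m : ℕ} (ν : ι ≃ Fin n)

/-- Find the decomposition, if the functionals are generic for it. -/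
def decomposeProgram : Program :=
  seq (diag (.reg 0) 18 19 20)
  (seq (compress 8 0 (.reg 0) (.reg 0)
    (.sub .one (.mul (.cell 20 (.lit 0) (.reg 13)) (.inv (.cell 20 (.lit 0) (.reg 13)))))
    (.cell 19 (.reg 10) (.reg 13)))
  (seq powersProgram (seq eigenTest (seq columnTest (seq distinctTest (seq polynomialTest
    reportProgram))))))

theorem bounded_decomposeProgram : Bounded True decomposeProgram := by
  have hr := NExp.bounded_reg
  have hl : ∀ {c}, c ≤ 4 → (NExp.lit c).Bounded := fun h => NExp.bounded_lit h
  exact ⟨trivial, bounded_compress (hr _) (hr _),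
    ⟨bounded_sumInto (hr _) (hr _) (hl (by norm_num)), hr _,
      bounded_sumInto (hr _) (hr _) (hl (by norm_num)),
      bounded_sumInto (hr _) (hr _) (hl (by norm_num))⟩,
    ⟨bounded_matMul, bounded_sumSquares (hr _) (hr _)⟩,
    ⟨bounded_sumInto (hr _) (hl (by norm_num)) (hr _),
      bounded_sumSquares (hr _) (hl (by norm_num))⟩,
    bounded_sumSquares (hr _) (hr _),
    ⟨bounded_sumInto (hr _) (hr _) (hr _), bounded_sumSquares (hr _) (hr _)⟩,
    ⟨⟨⟨⟨hl (by norm_num), hl (by norm_num), hr _, hl (by norm_num)⟩, hl (by norm_num)⟩,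
      hl (by norm_num)⟩, hl (by norm_num)⟩, hl (by norm_num)⟩

/-- The eigenvectors `Q` and eigenvalues `D` pass all the tests. -/
def Passes (M Q : Matrix (Fin n) (Fin n) F) (D : Fin n → F)
    (w : (Fin (k + 2) → ι) → (Fin (k + 2) → ι) → F) (m : ℕ) : Prop :=
  M * Q = Q * Matrix.diagonal D ∧ (∀ j, Q.col j ≠ 0) ∧
    (∀ i j, D i ≠ 0 → D j ≠ 0 → D i = D j → i = j) ∧
    (∀ l, D l ≠ 0 → ∀ j, ∑ a, w j a * tensorPower (k + 2) (fun y => Q (ν y) l) a = 0) ∧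
    Nat.card {l // D l ≠ 0} = m

/-- The candidates are copied to the output array before the tests, and the tests only decide which
message is reported. The number of candidates must equal `m`, the dimension of the intersection. -/
theorem run_decomposeProgram (O : DiagOracle F) (σ : Store F) (hσ : Ready n k R σ)
    (h7 : σ.reg 7 = m) {w : (Fin (k + 2) → ι) → (Fin (k + 2) → ι) → F}
    (hw : ∀ j a, σ.cell 1 (code ν j) (code ν a) = w j a)
    {M : Matrix (Fin n) (Fin n) F} (hM : block n σ 18 = M) :
    (Passes ν M (O.vecs n M) (O.vals n M) w m →
      (run O decomposeProgram σ).reg 0 = 1 ∧ (run O decomposeProgram σ).reg 1 = m ∧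
      ∃ s : Fin m → Fin n, Function.Injective s ∧ (∀ t, O.vals n M (s t) ≠ 0) ∧
        ∀ t i, (run O decomposeProgram σ).cell 0 (t : Fin m) (i : Fin n) = O.vecs n M i (s t)) ∧
    (¬ Passes ν M (O.vecs n M) (O.vals n M) w m → (run O decomposeProgram σ).reg 0 = 2) := by
  simp only [decomposeProgram, run_seq]
  obtain ⟨hA, h19, h20⟩ := run_diag O σ (e := .reg 0) (src := 18) (dst := 19) (ev := 20)
    hσ.reg0 (by norm_num) (A := M) (fun i j => by rw [← hM]; rfl)
  generalize run O (diag (.reg 0) 18 19 20) σ = σ₁ at *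
  have hσ₁ : Ready n k R σ₁ := hσ.of_frame hA (by norm_num) fun _ _ => id
  have hM₁ : block n σ₁ 18 = M := (block_congr (hA.2 18 (by norm_num))).trans hM
  have hQ₁ : block n σ₁ 19 = O.vecs n M := by
    ext i j
    exact h19 i j
  have h7₁ : σ₁.reg 7 = m := (hA.1 7 id).trans h7
  have hw₁ : ∀ j a, σ₁.cell 1 (code ν j) (code ν a) = w j a := fun j a => by
    rw [hA.2 1 (by norm_num), hw]
  obtain ⟨hA, h8, hc⟩ := run_compress O σ₁ (c := 8) (a := 0) (e := .reg 0) (e₂ := .reg 0)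
    (w := .sub .one (.mul (.cell 20 (.lit 0) (.reg 13)) (.inv (.cell 20 (.lit 0) (.reg 13)))))
    (x := .cell 19 (.reg 10) (.reg 13)) (by simp [Counter])
    (W := fun l => 1 - σ₁.cell 20 0 l * (σ₁.cell 20 0 l)⁻¹) (X := fun l i => σ₁.cell 19 i l)
    (eval_reg_of_compress hσ₁.reg0 (by norm_num) (by norm_num))
    (eval_reg_of_compress hσ₁.reg0 (by norm_num) (by norm_num))
    (fun l hl τ hτ h13 => by
      simp only [FExp.eval, NExp.eval, h13, hτ.cell_eq (show 20 ≠ 0 by norm_num)])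
    (fun l i hl hi τ hτ h13 h10 => by
      simp only [FExp.eval, NExp.eval, h13, h10, hτ.cell_eq (show 19 ≠ 0 by norm_num)])
  generalize run O (compress 8 0 _ _ _ _) σ₁ = σ₂ at *
  have hσ₂ : Ready n k R σ₂ := hσ₁.of_frame hA (by norm_num)
    fun i hi => by rintro (h | ⟨h, -⟩ | h) <;> omega
  have hM₂ := (block_congr (hA.cell_eq (show 18 ≠ 0 by norm_num))).trans hM₁
  have hQ₂ := (block_congr (hA.cell_eq (show 19 ≠ 0 by norm_num))).trans hQ₁
  have hD₂ : ∀ j : Fin n, σ₂.cell 20 0 j = O.vals n M j := fun j => by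
    rw [hA.cell_eq (by norm_num), h20]
  have h7₂ : σ₂.reg 7 = m := (hA.reg_eq_of_compress (by norm_num) (by norm_num)).trans h7₁
  have hw₂ : ∀ j a, σ₂.cell 1 (code ν j) (code ν a) = w j a := fun j a => by
    rw [hA.cell_eq (by norm_num), hw₁]
  obtain ⟨s, hs, hs', hst⟩ := exists_zeroIndices_eq n
    fun l => 1 - σ₁.cell 20 0 l * (σ₁.cell 20 0 l)⁻¹
  have hc₂ : ∀ (t : Fin (zeroIndices n fun l => 1 - σ₁.cell 20 0 l * (σ₁.cell 20 0 l)⁻¹).length)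
      (i : Fin n), σ₂.cell 0 t i = O.vecs n M i (s t) := fun t i => by
    rw [hc t t.2 i i.2, ← h19, hst]
    rfl
  simp only [one_sub_mul_inv_eq_zero_iff, h20] at hs'
  have hcard : Nat.card {l // O.vals n M l ≠ 0} = σ₂.reg 8 := by
    rw [h8, ← Nat.card_fin (zeroIndices n _).length]
    refine (Nat.card_congr (Equiv.ofBijective
      (fun t => (⟨s t, (hs' _).2 ⟨t, rfl⟩⟩ : {l // O.vals n M l ≠ 0}))
      ⟨fun t t' h => hs (congrArg Subtype.val h), fun ⟨l, hl⟩ => ?_⟩)).symm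
    obtain ⟨t, ht⟩ := (hs' l).1 hl
    exact ⟨t, Subtype.ext ht⟩
  obtain ⟨hA, h21⟩ := run_powersProgram ν O σ₂ hσ₂
  generalize run O powersProgram σ₂ = σ₃ at *
  rw [hQ₂] at h21
  have hσ₃ : Ready n k R σ₃ := hσ₂.of_frame hA (by norm_num) fun _ _ => by omega
  obtain ⟨hB, h24⟩ := run_eigenTest O σ₃ hσ₃.reg0
  rw [block_congr (hA.2 18 (by norm_num)), block_congr (hA.2 19 (by norm_num)), hM₂, hQ₂,
    hA.2 20 (by norm_num), show (fun j : Fin n => σ₂.cell 20 0 j) = O.vals n M from funext hD₂]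
    at h24
  generalize run O eigenTest σ₃ = σ₄ at *
  have hA₄ := (hA.mono (a' := (17 < ·)) (s' := (9 < ·)) (fun _ _ => by omega) fun _ => id).trans
    (hB.mono (by rintro b (rfl | rfl | rfl) <;> norm_num) fun _ hi => hi.1)
  have hσ₄ : Ready n k R σ₄ := hσ₂.of_frame hA₄ (by norm_num) fun _ _ => by omega
  have hQ₄ : block n σ₄ 19 = O.vecs n M := by
    rw [block_congr (hB.2 19 (by norm_num)), block_congr (hA.2 19 (by norm_num)), hQ₂]
  have hD₄ : ∀ j : Fin n, σ₄.cell 20 0 j = O.vals n M j := fun j => by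
    rw [hB.2 20 (by norm_num), hA.2 20 (by norm_num), hD₂]
  have h21₄ : σ₄.cell 21 = σ₃.cell 21 := hB.2 21 (by norm_num)
  obtain ⟨hB, h26⟩ := run_columnTest O σ₄ hσ₄.reg0
  rw [hQ₄] at h26
  generalize run O columnTest σ₄ = σ₅ at *
  have hA₅ := hA₄.trans (hB.mono (by rintro b (rfl | rfl | rfl) <;> norm_num) fun _ hi => hi.1)
  have hσ₅ : Ready n k R σ₅ := hσ₂.of_frame hA₅ (by norm_num) fun _ _ => by omega
  have hD₅ : ∀ j : Fin n, σ₅.cell 20 0 j = O.vals n M j := fun j => by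
    rw [hB.2 20 (by norm_num), hD₄]
  have h21₅ : σ₅.cell 21 = σ₃.cell 21 := (hB.2 21 (by norm_num)).trans h21₄
  have h24₅ : σ₅.cell 24 = σ₄.cell 24 := hB.2 24 (by norm_num)
  obtain ⟨hB, h27⟩ := run_distinctTest O σ₅ hσ₅
  simp only [hD₅] at h27
  generalize run O distinctTest σ₅ = σ₆ at *
  have hA₆ := hA₅.trans (hB.mono (by rintro b (rfl | rfl) <;> norm_num) fun _ hi => hi.1)
  have hσ₆ : Ready n k R σ₆ := hσ₂.of_frame hA₆ (by norm_num) fun _ _ => by omega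
  have hD₆ : ∀ j : Fin n, σ₆.cell 20 0 j = O.vals n M j := fun j => by
    rw [hB.2 20 (by norm_num), hD₅]
  have h21₆ : σ₆.cell 21 = σ₃.cell 21 := (hB.2 21 (by norm_num)).trans h21₅
  have h24₆ : σ₆.cell 24 = σ₄.cell 24 := (hB.2 24 (by norm_num)).trans h24₅
  have h26₆ : σ₆.cell 26 = σ₅.cell 26 := hB.2 26 (by norm_num)
  obtain ⟨hB, h29⟩ := run_polynomialTest ν O σ₆ hσ₆ (w := w)
    (T := fun l => tensorPower (k + 2) fun y => O.vecs n M (ν y) l)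
    (fun j a => by rw [hA₆.2 1 (by norm_num), hw₂]) (fun a l => by rw [h21₆, h21])
  simp only [hD₆] at h29
  generalize run O polynomialTest σ₆ = σ₇ at *
  have hA₇ := hA₆.trans (hB.mono (by rintro b (rfl | rfl | rfl) <;> norm_num) fun _ hi => hi.1)
  obtain ⟨hcell, hpass, hfail⟩ := run_reportProgram O σ₇
  have h7₇ : σ₇.reg 7 = m := (hA₇.1 7 (by norm_num)).trans h7₂
  have h8₇ : σ₇.reg 8 = Nat.card {l // O.vals n M l ≠ 0} :=
    (hA₇.1 8 (by norm_num)).trans hcard.symm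
  have hiff : (σ₇.cell 24 0 0 = 0 ∧ σ₇.cell 26 0 0 = 0 ∧ σ₇.cell 27 0 0 = 0 ∧
      σ₇.cell 29 0 0 = 0 ∧ σ₇.reg 8 = σ₇.reg 7) ↔ Passes ν M (O.vecs n M) (O.vals n M) w m := by
    rw [hB.2 24 (by norm_num), hB.2 26 (by norm_num), hB.2 27 (by norm_num), h24₆, h26₆, h24, h26,
      h27, h29, h7₇, h8₇]
    rfl
  rw [hiff] at hpass hfail
  refine ⟨fun h => ?_, hfail⟩
  obtain ⟨p0, p1⟩ := hpass h
  obtain rfl : (zeroIndices n fun l => 1 - σ₁.cell 20 0 l * (σ₁.cell 20 0 l)⁻¹).length = m := by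
    rw [← h8, ← hcard]
    exact h.2.2.2.2
  refine ⟨p0, p1.trans h7₇, s, hs, fun t => (hs' _).2 ⟨t, rfl⟩, fun t i => ?_⟩
  rw [hcell, hA₇.2 0 (by norm_num), hc₂]

/-- Passing the tests is equivalent to the existence of a decomposition in general position. One
direction makes the listed vectors a legal output; in the other, failure of the tests shows that no
such decomposition exists, so "Fail" is legal although the program does not follow the literal
subroutine. -/
theorem algorithm1Run_decomposeProgram (O : DiagOracle F) (σ : Store F) (hσ : Ready n k R σ)
    (h7 : σ.reg 7 = m) {p : ℕ} {f : Fin p → MvPolynomial ι F} {u : Fin R → ι → F}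
    {w : (Fin (k + 2) → ι) → (Fin (k + 2) → ι) → F} (hw : ∀ T ∈ symTensors (k + 2) ι F,
      T ∈ annihilator (k + 2) f ↔ ∀ j, ∑ a, w j a * T a = 0)
    (h1 : ∀ j a, σ.cell 1 (code ν j) (code ν a) = w j a)
    {P : Fin m → Tensor (k + 2) ι F} (hP : IsIntersectionBasis (k + 2) f u P) {θ η : Fin R → F}
    (hm : 0 < m) (hR : m ≤ R) {G : Matrix (Fin (k + 1) → ι) ι F}
    (hG : contract (stack P) (η ∘ Fin.castLE hR) * G * contract (stack P) (η ∘ Fin.castLE hR) =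
      contract (stack P) (η ∘ Fin.castLE hR))
    (hrank : G.rank ≤ (contract (stack P) (η ∘ Fin.castLE hR)).rank)
    (h18 : block n σ 18 =
      (contract (stack P) (θ ∘ Fin.castLE hR) * G).submatrix ν.symm ν.symm) :
    Algorithm1Run P θ η (readOutput ν (run O decomposeProgram σ)) := by
  obtain ⟨hpass, hfail⟩ := run_decomposeProgram ν O σ hσ h7 h1 h18
  set M := (contract (stack P) (θ ∘ Fin.castLE hR) * G).submatrix ν.symm ν.symm with hM
  by_cases h : Passes ν M (O.vecs n M) (O.vals n M) w m
  · obtain ⟨p0, p1, s, hs, hs0, hc⟩ := hpass h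
    obtain ⟨q1, q2, q3, q4, -⟩ := h
    obtain ⟨z, H⟩ := genericDecomposition_of_eigenvectors (f := θ ∘ Fin.castLE hR) k.succ_ne_zero hP
      hG hrank (x := fun t y => O.vecs n M (ν y) (s t)) (D := fun t => O.vals n M (s t)) hs0
      (fun t t' htt => hs (q3 _ _ (hs0 t) (hs0 t') htt))
      (fun t h0 => q2 (s t) (funext fun i => by simpa using congrFun h0 (ν.symm i)))
      (fun t => by
        funext y
        have e1 := congrFun (congrFun q1 (ν y)) (s t)
        rw [Matrix.mul_diagonal, Matrix.mul_apply, ← ν.sum_comp] at e1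
        simpa [hM, Matrix.mulVec, dotProduct, mul_comm] using e1)
      (fun t => (hw _ (tensorPower_mem_symTensors _ _)).2 (q4 (s t) (hs0 t)))
    rw [readOutput_eq_only ν p0 p1 fun t y => hc t (ν y)]
    exact H.algorithm1Run hm hR k.succ_ne_zero
  · have : readOutput ν (run O decomposeProgram σ) = .fail := by
      rw [readOutput, hfail h]
      simp
    rw [this]
    refine algorithm1Run_fail hm hR k.succ_ne_zero fun ⟨z, x, H⟩ => h ?_
    obtain ⟨hQ, hMQ⟩ := O.spec n M (H.exists_diagonalization ν k.succ_ne_zero hG)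
    obtain ⟨e1, e2, e3, e4⟩ := H.eigenvectors ν k.succ_ne_zero hP hG hQ hMQ
    exact ⟨hMQ, fun j h0 => e1 j (funext fun y => congrFun h0 (ν y)), e2,
      fun l hl => (hw _ (tensorPower_mem_symTensors _ _)).1 (e3 l hl), e4⟩

end Output

end Program

/-! ## The whole program -/

namespace Program

/-- Algorithm 1, after the preparations. -/
def mainProgram : Program :=
  seq basisProgram (ifLt (.lit 0) (.reg 7) (ifLt (.reg 2) (.reg 7) (setReg 0 (.lit 2))
    (seq matrixProgram decomposeProgram)) (setReg 0 (.lit 0)))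

theorem bounded_mainProgram : Bounded True mainProgram :=
  ⟨bounded_basisProgram, ⟨NExp.bounded_lit (by norm_num), bounded_matrixProgram,
    bounded_decomposeProgram⟩, NExp.bounded_lit (by norm_num)⟩

theorem exists_run_ifLt_pos {F : Type*} [RCLike F] (O : DiagOracle F) {σ : Store F} {e₁ e₂ : NExp}
    (c₁ c₂ : Program) (h : e₁.eval σ.reg < e₂.eval σ.reg) :
    ∃ t, run O (ifLt e₁ e₂ c₁ c₂) σ = run O c₁ (σ.tick t) :=
  ⟨_, if_pos h⟩

theorem exists_run_ifLt_neg {F : Type*} [RCLike F] (O : DiagOracle F) {σ : Store F} {e₁ e₂ : NExp}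
    (c₁ c₂ : Program) (h : ¬ e₁.eval σ.reg < e₂.eval σ.reg) :
    ∃ t, run O (ifLt e₁ e₂ c₁ c₂) σ = run O c₂ (σ.tick t) :=
  ⟨_, if_neg h⟩

section Correct

variable {ι F : Type*} [Fintype ι] [RCLike F] {n k R p : ℕ} (ν : ι ≃ Fin n)

theorem algorithm1_mainProgram (O : DiagOracle F) (σ : Store F) (hσ : Ready n k R σ)
    {f : Fin p → MvPolynomial ι F} {u : Fin R → ι → F} (hu : LinearIndependent F u)
    {w : (Fin (k + 2) → ι) → (Fin (k + 2) → ι) → F} (hw : ∀ T ∈ symTensors (k + 2) ι F,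
      T ∈ annihilator (k + 2) f ↔ ∀ j, ∑ a, w j a * T a = 0)
    (h0 : ∀ (i : Fin R) y, σ.cell 0 i (ν y) = u i y)
    (h1 : ∀ j a, σ.cell 1 (code ν j) (code ν a) = w j a) {θ η : Fin R → F}
    (hθ : ∀ t : Fin R, σ.cell 2 0 t = θ t) (hη : ∀ t : Fin R, σ.cell 2 1 t = η t) :
    Algorithm1 f u (computedBasis ν O u w) θ η (readOutput ν (run O mainProgram σ)) := by
  have hP := isIntersectionBasis_computedBasis ν O hu hw
  refine ⟨hP, ?_⟩
  rw [mainProgram, run_seq]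
  obtain ⟨hA, h7, h10⟩ := run_basisProgram ν O σ hσ h0 h1
  generalize run O basisProgram σ = σ₁ at *
  by_cases hm : 0 < (kernelIndices ν O u w).length
  · obtain ⟨t, ht⟩ := exists_run_ifLt_pos O (σ := σ₁) (e₁ := .lit 0) (e₂ := .reg 7)
      (ifLt (.reg 2) (.reg 7) (setReg 0 (.lit 2)) (seq matrixProgram decomposeProgram))
      (setReg 0 (.lit 0)) (by simpa only [NExp.eval, h7] using hm)
    rw [ht]
    have hA₂ : AgreeOff (3 < ·) (6 < ·) σ (σ₁.tick t) := hA
    have h7₂ : (σ₁.tick t).reg 7 = (kernelIndices ν O u w).length := h7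
    have h10₂ : ∀ (t' : Fin (kernelIndices ν O u w).length) a,
        (σ₁.tick t).cell 10 t' (code ν a) = computedBasis ν O u w t' a := h10
    generalize σ₁.tick t = σ₂ at *
    have hσ₂ := hσ.of_agreeOff hA₂
    by_cases hR : R < (kernelIndices ν O u w).length
    · obtain ⟨t, ht⟩ := exists_run_ifLt_pos O (σ := σ₂) (e₁ := .reg 2) (e₂ := .reg 7)
        (setReg 0 (.lit 2)) (seq matrixProgram decomposeProgram) (by
          simpa only [NExp.eval, h7₂, hσ₂.reg2] using hR)
      have : readOutput ν (run O (setReg 0 (.lit 2)) (σ₂.tick t)) = (.fail : Output ι F) := by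
        simp [readOutput, run, NExp.eval, Store.tick, Store.setReg]
      rw [ht, this]
      exact .tooMany hR
    · obtain ⟨t, ht⟩ := exists_run_ifLt_neg O (σ := σ₂) (e₁ := .reg 2) (e₂ := .reg 7)
        (setReg 0 (.lit 2)) (seq matrixProgram decomposeProgram) (by
          simpa only [NExp.eval, h7₂, hσ₂.reg2] using hR)
      rw [ht, run_seq]
      have hA₃ : AgreeOff (3 < ·) (6 < ·) σ (σ₂.tick t) := hA₂
      have h7₃ : (σ₂.tick t).reg 7 = (kernelIndices ν O u w).length := h7₂
      have h10₃ : ∀ (t' : Fin (kernelIndices ν O u w).length) a,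
          (σ₂.tick t).cell 10 t' (code ν a) = computedBasis ν O u w t' a := h10₂
      generalize σ₂.tick t = σ₃ at *
      have hσ₃ := hσ.of_agreeOff hA₃
      have hR' := not_lt.1 hR
      obtain ⟨hB, G, hG, hrank, h18⟩ := run_matrixProgram ν O σ₃ hσ₃ h7₃ h10₃
        (f := θ ∘ Fin.castLE hR') (g := η ∘ Fin.castLE hR')
        (fun t => by rw [hA₃.2 2 (by norm_num)]; exact hθ (Fin.castLE hR' t))
        (fun t => by rw [hA₃.2 2 (by norm_num)]; exact hη (Fin.castLE hR' t))
      exact algorithm1Run_decomposeProgram ν O _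
        (hσ₃.of_frame hB (by norm_num) fun _ _ => by omega) ((hB.1 7 (by norm_num)).trans h7₃) hw
        (fun j a => by rw [hB.2 1 (by norm_num), hA₃.2 1 (by norm_num), h1]) hP hm hR' hG hrank h18
  · obtain ⟨t, ht⟩ := exists_run_ifLt_neg O (σ := σ₁) (e₁ := .lit 0) (e₂ := .reg 7)
      (ifLt (.reg 2) (.reg 7) (setReg 0 (.lit 2)) (seq matrixProgram decomposeProgram))
      (setReg 0 (.lit 0)) (by simpa only [NExp.eval, h7] using hm)
    have : readOutput ν (run O (setReg 0 (.lit 0)) (σ₁.tick t)) = (.trivial : Output ι F) := by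
      simp [readOutput, run, NExp.eval, Store.tick, Store.setReg]
    rw [ht, this]
    exact .trivial (by omega)

end Correct

/-! ### The minors as input of the program -/

section Minors

variable {F : Type*} [RCLike F] {n₁ n₂ r p : ℕ}

/-- The coefficients of the minor whose number has the given digits. -/
noncomputable def minorCoefficients (F : Type*) [RCLike F]
    (e : Fin p ≃ (Fin (r + 1) ↪o Fin n₁) × (Fin (r + 1) ↪o Fin n₂))
    (j a : Fin (r + 1) → Fin n₁ × Fin n₂) : F :=
  if h : code finProdFinEquiv j < p then
    MvPolynomial.coeff (content a) (minors F e ⟨code finProdFinEquiv j, h⟩) else 0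

theorem card_minors_le_pow (e : Fin p ≃ (Fin (r + 1) ↪o Fin n₁) × (Fin (r + 1) ↪o Fin n₂)) :
    p ≤ (n₁ * n₂) ^ (r + 1) := by
  rw [card_minors e, mul_pow]
  exact Nat.mul_le_mul (Nat.choose_le_pow _ _) (Nat.choose_le_pow _ _)

/-- The program runs over all `(n₁ n₂)^(r+1)` rows of the coefficient array. There are at most that
many minors and the other rows are zero; the common factor `1 / (r+1)!` of the polarizations is
irrelevant. -/
theorem mem_annihilator_iff_minorCoefficients
    (e : Fin p ≃ (Fin (r + 1) ↪o Fin n₁) × (Fin (r + 1) ↪o Fin n₂))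
    (T : Tensor (r + 1) (Fin n₁ × Fin n₂) F) : T ∈ annihilator (r + 1) (minors F e) ↔
      ∀ j, ∑ a, minorCoefficients F e j a * T a = 0 := by
  have h1 : T ∈ annihilator (r + 1) (minors F e) ↔
      ∀ j, ∑ a, polarization (r + 1) (minors F e j) a * T a = 0 := Iff.rfl
  have hf : ((r + 1)! : F)⁻¹ ≠ 0 :=
    inv_ne_zero (by exact_mod_cast Nat.factorial_ne_zero _)
  have h2 : ∀ j, ∑ a, polarization (r + 1) (minors F e j) a * T a =
      ((r + 1)! : F)⁻¹ * ∑ a, MvPolynomial.coeff (content a) (minors F e j) * T a := fun j => by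
    rw [Finset.mul_sum]
    exact Finset.sum_congr rfl fun a _ => by rw [polarization_minors]; ring
  simp only [h1, h2, mul_eq_zero, hf, false_or]
  constructor
  · intro h j
    by_cases hj : code finProdFinEquiv j < p
    · simpa only [minorCoefficients, dif_pos hj] using h ⟨_, hj⟩
    · simp [minorCoefficients, hj]
  · intro h j
    obtain ⟨b, hb⟩ := exists_code_eq (d := r + 1) finProdFinEquiv
      (j.2.trans_le (card_minors_le_pow e))
    have h3 := h b
    simp only [minorCoefficients, hb, j.2, dif_pos] at h3
    exact h3

end Minors

theorem exists_program (F : Type*) [RCLike F] :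
    ∃ (A : Program) (C c : ℕ), ∀ (O : DiagOracle F) (r n₁ n₂ R p : ℕ), 1 ≤ r → r < n₁ → r < n₂ →
      ∀ (e : Fin p ≃ (Fin (r + 1) ↪o Fin n₁) × (Fin (r + 1) ↪o Fin n₂))
        (u : Fin R → Fin n₁ × Fin n₂ → F), LinearIndependent F u →
      ∃ (m : ℕ) (P : Fin m → Tensor (r + 1) (Fin n₁ × Fin n₂) F), ∀ θ η : Fin R → F,
        let σ := A.run O (initialStore (r + 1) finProdFinEquiv (minors F e) u θ η)
        Algorithm1 (minors F e) u P θ η (readOutput finProdFinEquiv σ) ∧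
          σ.steps ≤ (n₁ * n₂) ^ (C * r) ∧ σ.calls ≤ c := by
  obtain ⟨K, l, -, hcost⟩ := exists_cost_le F bounded_mainProgram
  -- With `B = (n₁ n₂)^(r+1)` the total is at most `B^5 + B^K ≤ B^(K+6)`, and `r + 1 ≤ 2 r` brings
  -- the exponent to the form `C r`.
  refine ⟨seq preparations mainProgram, 2 * (K + 6), l, fun O r n₁ n₂ R p hr h₁ h₂ e u hu => ?_⟩
  obtain ⟨k, rfl⟩ : ∃ k, r = k + 1 := ⟨r - 1, by omega⟩
  set n := n₁ * n₂ with hn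
  have hn4 : 4 ≤ n := by nlinarith
  have hR : R ≤ n := by
    have := hu.fintype_card_le_finrank
    simpa using this
  have hp : p ≤ n ^ (k + 2) := card_minors_le_pow e
  have hD : n ≤ n ^ (k + 2) := Nat.le_self_pow (by omega) n
  have hd : k + 2 < n ^ (k + 2) := Nat.lt_pow_self (by omega)
  refine ⟨_, computedBasis finProdFinEquiv O u (minorCoefficients F e), fun θ η => ?_⟩
  obtain ⟨hσ, hcell, hreg, hsteps, hcalls⟩ := run_preparations O
    (initialStore (k + 2) finProdFinEquiv (minors F e) u θ η) (n := n) (k := k) (R := R) (by omega)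
    hR rfl rfl rfl (fun i => by
      simp only [initialStore]
      split_ifs <;> omega) (fun i j => by simp [initialStore])
  obtain ⟨-, hsteps', hcalls'⟩ := hcost O
    (run O preparations (initialStore (k + 2) finProdFinEquiv (minors F e) u θ η)) (n ^ (k + 2))
    (hn4.trans hD) hreg
  refine ⟨algorithm1_mainProgram finProdFinEquiv O _ hσ hu
    (fun T _ => mem_annihilator_iff_minorCoefficients e T) (fun i y => ?_) (fun j a => ?_)
    (fun t => ?_) fun t => ?_, ?_, ?_⟩
  · rw [hcell 0 (by norm_num)]
    exact (dif_pos ⟨i.2, (finProdFinEquiv y).2⟩).trans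
      (congrArg (u i) (Equiv.symm_apply_apply finProdFinEquiv y))
  · rw [hcell 1 (by norm_num)]
    have ha : (fun t => finProdFinEquiv.symm (finFunctionFinEquiv.symm
        (⟨code finProdFinEquiv a, code_lt _ a⟩ : Fin (n ^ (k + 2))) t)) = a := by
      funext t
      have := finFunctionFinEquiv.symm_apply_apply fun t => finProdFinEquiv (a t)
      exact (congrArg finProdFinEquiv.symm (congrFun this t)).trans (Equiv.symm_apply_apply _ _)
    by_cases hj : code finProdFinEquiv j < p
    · rw [minorCoefficients, dif_pos hj]
      refine (dif_pos ⟨hj, code_lt _ a⟩).trans ?_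
      exact congrArg (fun b => MvPolynomial.coeff (content b) _) ha
    · rw [minorCoefficients, dif_neg hj]
      exact dif_neg fun h => hj h.1
  · rw [hcell 2 (by norm_num)]
    simp [initialStore]
  · rw [hcell 2 (by norm_num)]
    simp [initialStore]
  · refine hsteps'.trans ((Nat.add_le_add_right hsteps _).trans ?_)
    have h1 : (n ^ (k + 2)) ^ 5 ≤ (n ^ (k + 2)) ^ (K + 5) :=
      Nat.pow_le_pow_right (by omega) (by omega)
    have h2 : (n ^ (k + 2)) ^ K ≤ (n ^ (k + 2)) ^ (K + 5) :=
      Nat.pow_le_pow_right (by omega) (by omega)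
    have h3 : 2 * (n ^ (k + 2)) ^ (K + 5) ≤ n ^ (k + 2) * (n ^ (k + 2)) ^ (K + 5) :=
      Nat.mul_le_mul_right _ (by omega)
    have h4 : n ^ (k + 2) * (n ^ (k + 2)) ^ (K + 5) ≤ (n₁ * n₂) ^ (2 * (K + 6) * (k + 1)) := by
      rw [← hn, ← pow_succ', ← pow_mul]
      exact Nat.pow_le_pow_right (by omega) (by nlinarith)
    have h5 : (initialStore (k + 2) finProdFinEquiv (minors F e) u θ η).steps = 0 := rfl
    omega
  · exact hcalls'.trans (by rw [hcalls]; simp [initialStore])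

end Program

/-! ### The main theorem -/

theorem corollary1p3 (F : Type*) [RCLike F] :
    -- One program runs Algorithm 1 on the minors and any basis of any subspace,
    -- in time `(n₁ n₂)^{O(r)}` with `O(1)` calls to the diagonalization oracle.
    (∃ (A : Program) (C c : ℕ), ∀ (O : DiagOracle F) (r n₁ n₂ R p : ℕ), 1 ≤ r → r < n₁ → r < n₂ →
      ∀ (e : Fin p ≃ (Fin (r + 1) ↪o Fin n₁) × (Fin (r + 1) ↪o Fin n₂))
        (u : Fin R → Fin n₁ × Fin n₂ → F), LinearIndependent F u →
      ∃ (m : ℕ) (P : Fin m → Tensor (r + 1) (Fin n₁ × Fin n₂) F), ∀ θ η : Fin R → F,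
        let σ := A.run O (initialStore (r + 1) finProdFinEquiv (minors F e) u θ η)
        Algorithm1 (minors F e) u P θ η (readOutput finProdFinEquiv σ) ∧
          σ.steps ≤ (n₁ * n₂) ^ (C * r) ∧ σ.calls ≤ c) ∧
    -- The messages of Algorithm 1, if not "Fail", are always correct.
    (∀ (r n₁ n₂ R p m : ℕ), 1 ≤ r → r < n₁ → r < n₂ →
      ∀ (e : Fin p ≃ (Fin (r + 1) ↪o Fin n₁) × (Fin (r + 1) ↪o Fin n₂))
        (u : Fin R → Fin n₁ × Fin n₂ → F), LinearIndependent F u →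
      ∀ (P : Fin m → Tensor (r + 1) (Fin n₁ × Fin n₂) F) (θ η : Fin R → F),
        (Algorithm1 (minors F e) u P θ η .trivial →
          ∀ w ∈ Submodule.span F (Set.range u), w ∈ rankVariety F n₁ n₂ r → w = 0) ∧
        ∀ xs, Algorithm1 (minors F e) u P θ η (.only xs) →
          ∀ w, (w ∈ Submodule.span F (Set.range u) ∧ w ∈ rankVariety F n₁ n₂ r) ↔
            w = 0 ∨ ∃ x ∈ xs, ∃ t : F, w = t • x) ∧
    -- Generic subspaces, with `s` planted elements.
    (∀ (r n₁ n₂ R s : ℕ), 1 ≤ r → r < n₁ → r < n₂ → (R : ℝ) ≤ dimBound n₁ n₂ r →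
      ∀ hs : s ≤ R, ∃ G : Set (Fin R × (Fin n₁ × Fin n₂) → F),
        IsZariskiOpenDenseIn G (plantedVariety F n₁ n₂ r R s) ∧
        ∀ x ∈ G, ∀ v : Fin R → Fin n₁ × Fin n₂ → F, (∀ i q, v i q = x (i, q)) →
          LinearIndependent F v ∧
          (∀ w, (w ∈ Submodule.span F (Set.range v) ∧ w ∈ rankVariety F n₁ n₂ r) ↔
            w = 0 ∨ ∃ (i : Fin s) (t : F), w = t • v (Fin.castLE hs i)) ∧
          ∀ (p m : ℕ) (e : Fin p ≃ (Fin (r + 1) ↪o Fin n₁) × (Fin (r + 1) ↪o Fin n₂))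
            (u : Fin R → Fin n₁ × Fin n₂ → F), LinearIndependent F u →
            Submodule.span F (Set.range u) = Submodule.span F (Set.range v) →
          ∀ P : Fin m → Tensor (r + 1) (Fin n₁ × Fin n₂) F,
          ∀ᵐ ω ∂((gaussianTape R).prod (gaussianTape R)), ∀ out : Output (Fin n₁ × Fin n₂) F,
            Algorithm1 (minors F e) u P (toScalars F ω.1) (toScalars F ω.2) out →
            (s = 0 → out = .trivial) ∧
            (0 < s → ∃ (xs : List (Fin n₁ × Fin n₂ → F)) (t : Fin s → F), out = .only xs ∧
              (∀ i, t i ≠ 0) ∧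
              xs.Perm (List.ofFn fun i : Fin s => t i • v (Fin.castLE hs i)))) ∧
    -- The dimension bound is `Ω_r(n₁ n₂)`.
    (∀ r : ℕ, 1 ≤ r → ∃ κ : ℝ, 0 < κ ∧ ∀ n₁ n₂ : ℕ, r < n₁ → r < n₂ →
      κ * ((n₁ : ℝ) * (n₂ : ℝ)) ≤ dimBound n₁ n₂ r) := by
  refine ⟨Program.exists_program F, fun r n₁ n₂ R p m hr h₁ h₂ e u hu P θ η =>
    ⟨fun h w hw hwr => algorithm1_trivial_correct e h hw hwr, fun xs h w =>
    algorithm1_only_correct (Nat.one_le_iff_ne_zero.1 hr) e h w⟩,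
    generic_subspaces_correct, fun r _ => exists_mul_le_dimBound r⟩
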